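/- **Setting.** Let $X$ be a complex variety (reduced, separated, of finite type over $\mathbf C$) with an algebraic $\mathbf C^\times$-action and a Poisson structure which is homogeneous of some degree $d\in\mathbf Z$ (functions $f$ with $f(c\cdot x)=c^a f(x)$ have degree $a$, and brackets of functions of degrees $a,b$ have degree $a+b+d$). Let $Y\subseteq X$ be a $\mathbf C^\times$-stable symplectic leaf, i.e. a locally closed subvariety with $T_zY$ equal to the span of the Hamiltonian vector fields at $z$ for all closed points $z\in Y$. Let $y\in Y$ be a closed point whose stabilizer in $\mathbf C^\times$ is finite, of order $\ell\ge 1$, and minimal among the stabilizers of closed points of $Y$. Let $U\subseteq X$ be an affine open subset containing the orbit $\mathbf C^\times\cdot y$ as a closed subset; let $\hat{\mathcal O}(X)$ be the completion of $\mathcal O(U)$ along the ideal of the orbit, with the induced continuous Poisson bracket and weights, $\hat X=\operatorname{Spf}\hat{\mathcal O}(X)$ the formal neighborhood of the orbit in $X$, and $\hat Y\subseteq\hat X$ the formal neighborhood of the orbit in $Y$. Write $\Delta^r=\operatorname{Spf}\mathbf C[\![x_1,\dots,x_r]\!]$. For $n\ge1$ and $k\in\mathbf Z$, the *standard structure* on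 $\mathbf C^\times\hat\times\Delta^{2n-1}=\operatorname{Spf}\mathbf C[t,t^{-1}][\![u,z_1,\dots,z_{2n-2}]\!]$, with $t$ of degree $\ell$ and $u,z_i$ of degree $0$, is the symplectic structure of degree $k\ell$ with Poisson bivector $$\pi_{2n,-k}=t^{1-k}\partial_u\wedge\partial_t+\sum_{i=1}^{n-1}\partial_{z'_{2i-1}}\wedge\partial_{z_{2i}},\qquad z'_{2i-1}=t^kz_{2i-1},$$ where the partial derivatives are those of the coordinates $t,u,z'_{2i-1},z_{2i}$, and $\partial_a\wedge\partial_b$ means $\{a,b\}=1$. **Theorem.** There are $k\in\mathbf Z$ and $n\ge 1$ with $d=-k\ell$ and $\dim_y Y=2n$, the bracket of $\hat{\mathcal O}(X)$ induces one on $\mathcal O(\hat Y)$, and: (i) There is a $\mathbf C^\times$-equivariant isomorphism $\hat Y\cong\mathbf C^\times\hat\times\Delta^{\dim Y-1}$ carrying the Poisson structure of $\hat Y$ to the standard one, with $t(y)=1$. Moreover, for all coordinates $t,u,z_1,\dots,z_{2n-2}$ on $\hat Y$ given by a $\mathbf C^\times$-equivariant isomorphism with $\mathbf C^\times\hat\times\Delta^{2n-1}$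 carrying the Poisson structure to the standard one, there is a $\mathbf C^\times$-equivariant Poisson projection $\hat X\to\hat Y$ restricting to the identity on $\hat Y$, such that, denoting the pullbacks of $t,u,z_i$ to $\hat X$ by the same letters: (ii) If $\ell=1$, let $\mathcal O(S)\subseteq\hat{\mathcal O}(X)$ be the subalgebra of degree-zero elements Poisson commuting with $t,z_1,\dots,z_{2n-2}$. Then $\mathcal O(S)$ is a complete noetherian local algebra with residue field $\mathbf C$, and, together with the projection to $\hat Y$, the inclusion of $\mathcal O(S)$ gives a $\mathbf C^\times$-equivariant isomorphism of formal schemes $\hat X\cong\hat Y\hat\times S$, where $\mathbf C^\times$ acts trivially on $S$. The formula $\{f,g\}_S=t^k\{f,g\}$ defines a Poisson bracket on $\mathcal O(S)$. (iii) If $\ell=1$, then moreover the Poisson bivector of $\hat X\cong\hat Y\hat\times S$ is $$\pi_{2n,-k}+t^{-k}\partial_u\wedge\xi+t^{-k}\pi_S,\qquad(*)$$ with $\pi_S$ the Poisson bivector of $S$ and $\xi$ a vector field on $S$ with $[\xi,\pi_S]=k\pi_S$. (iv) For arbitrary $\ell\ge1$, let $\tilde Y\to\hat Y$ and $\tilde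 X\to\hat X$ be the $\ell$-fold étale covers obtained by adjoining $t^{1/\ell}$ (of degree $1$), with the action of the group $\mu_\ell\cong\mathbf Z/\ell$ of $\ell$-th roots of unity by $t^{1/\ell}\mapsto\zeta t^{1/\ell}$ and, on $\tilde X$, the Poisson structure extending that of $\hat X$. Let $\mathcal O(S)\subseteq\mathcal O(\tilde X)$ be the $\mu_\ell$-stable subalgebra of degree-zero elements Poisson commuting with $t,z_1,\dots,z_{2n-2}$. It is complete noetherian local with residue field $\mathbf C$; there is a $\mathbf C^\times$- and $\mu_\ell$-equivariant isomorphism $\tilde X\cong\tilde Y\hat\times S$ under which the Poisson bivector has the form $(*)$, with $\{f,g\}_S=t^k\{f,g\}$ and $[\xi,\pi_S]=k\pi_S$; and it induces a $\mathbf C^\times$-equivariant Poisson isomorphism $\hat X\cong(\tilde Y\hat\times S)/(\mathbf Z/\ell)$. Alternatively, let $\mathcal O(T)\subseteq\hat{\mathcal O}(X)$ be the centralizer of $t,z_1,\dots,z_{2n-2}$. Then $T=\operatorname{Spf}\mathcal O(T)$ is a noetherian formal scheme with $\mathbf C^\times$-action and Poisson structure (restricted from $\hat X$), with Poisson central subalgebra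 $\mathbf C[t,t^{-1}]$; there is a $\mathbf C^\times$-equivariant isomorphism $\hat X\cong\hat Y\hat\times_{\mathbf C^\times}T$; and the Poisson bivector of $\hat X$ is $\pi_{\hat Y}+\pi_T+t^{-k}\partial_u\wedge\xi$, with $\xi$ a degree-zero Poisson vector field on $T$. Here the last term is the whole bracket of $u$ with functions on $T$ (including $t$), i.e. $\{u,f\}=t^{-k}\xi(f)$ for $f\in\mathcal O(T)$; $\pi_{\hat Y}$ and $\pi_T$ give the brackets among functions of $\hat Y$ and among functions of $T$. -/

import Mathlib

open AlgebraicGeometry CategoryTheory CategoryTheory.Limits TensorProduct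
open scoped LaurentPolynomial Polynomial

/-! ### Poisson brackets and their completions -/

/-- A Poisson bracket on a commutative `ℂ`-algebra: a `ℂ`-bilinear Lie bracket which is a
derivation in each argument. -/
structure PoissonBracket (A : Type) [CommRing A] [Algebra ℂ A] where
  bracket : A →ₗ[ℂ] A →ₗ[ℂ] A
  bracket_self : ∀ f, bracket f f = 0
  leibniz : ∀ f g h, bracket f (g * h) = bracket f g * h + g * bracket f h
  jacobi : ∀ f g h, bracket f (bracket g h) = bracket (bracket f g) h + bracket g (bracket f h)

namespace PoissonBracket

section Representatives

variable {A : Type} [CommRing A] {I : Ideal A}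

/-- A representative in `A` of an element of the completion modulo `I ^ n`. -/
noncomputable def rep (n : ℕ) (f : AdicCompletion I A) : A :=
  (Ideal.Quotient.mk_surjective (AdicCompletion.evalₐ I n f)).choose

theorem mk_rep (n : ℕ) (f : AdicCompletion I A) :
    Ideal.Quotient.mk (I ^ n) (rep n f) = AdicCompletion.evalₐ I n f :=
  (Ideal.Quotient.mk_surjective (AdicCompletion.evalₐ I n f)).choose_spec

theorem mk_of_le {m n : ℕ} (h : m ≤ n) {f : AdicCompletion I A} {a : A}
    (ha : Ideal.Quotient.mk (I ^ n) a = AdicCompletion.evalₐ I n f) :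
    Ideal.Quotient.mk (I ^ m) a = AdicCompletion.evalₐ I m f := by
  obtain ⟨s, rfl⟩ := AdicCompletion.mk_surjective I A f
  rw [AdicCompletion.evalₐ_mk] at ha ⊢
  rw [← AdicCompletion.Ideal.mk_eq_mk I h s]
  rw [Ideal.Quotient.eq] at ha ⊢
  exact Ideal.pow_le_pow_right h ha

theorem sub_mem_of_mk {n : ℕ} {f : AdicCompletion I A} {a a' : A}
    (ha : Ideal.Quotient.mk (I ^ n) a = AdicCompletion.evalₐ I n f)
    (ha' : Ideal.Quotient.mk (I ^ n) a' = AdicCompletion.evalₐ I n f) : a - a' ∈ I ^ n :=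
  (Ideal.Quotient.eq).1 (ha.trans ha'.symm)

end Representatives

variable {A : Type} [CommRing A] [Algebra ℂ A] (b : PoissonBracket A) (I : Ideal A)

theorem skew (f g : A) : b.bracket f g = - b.bracket g f := by
  have h := b.bracket_self (f + g)
  simp only [map_add, LinearMap.add_apply, b.bracket_self, zero_add, add_zero] at h
  exact eq_neg_of_add_eq_zero_right h

theorem bracket_mem_pow (f : A) (n : ℕ) {g : A} (hg : g ∈ I ^ (n + 1)) :
    b.bracket f g ∈ I ^ n := by
  induction n generalizing g with
  | zero => simp
  | succ n ih =>
    rw [pow_succ] at hg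
    refine Submodule.mul_induction_on hg (fun x hx y hy => ?_) (fun x y hx hy => ?_)
    · rw [b.leibniz]
      refine Ideal.add_mem _ ?_ (Ideal.mul_mem_right _ _ hx)
      rw [pow_succ]
      exact Ideal.mul_mem_mul (ih hx) hy
    · rw [map_add]; exact Ideal.add_mem _ hx hy

theorem bracket_sub_mem (n : ℕ) {f f' g g' : A} (hf : f - f' ∈ I ^ (n + 1))
    (hg : g - g' ∈ I ^ (n + 1)) : b.bracket f g - b.bracket f' g' ∈ I ^ n := by
  have h1 := b.bracket_mem_pow I f n hg
  have h2 := b.bracket_mem_pow I g' n hf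
  rw [map_sub] at h1 h2
  have : b.bracket f g - b.bracket f' g' =
      (b.bracket f g - b.bracket f g') - (b.bracket g' f - b.bracket g' f') := by
    rw [b.skew g' f, b.skew g' f']; ring
  rw [this]
  exact Ideal.sub_mem _ h1 h2

variable {I}

/-- The bracket of two elements of the completion, computed on representatives: modulo `I ^ n` it
is the bracket of representatives modulo `I ^ (n + 1)`. -/
noncomputable def completionFun (f g : AdicCompletion I A) : AdicCompletion I A :=
  AdicCompletion.mk I A (AdicCompletion.AdicCauchySequence.mk I A
    (fun n => b.bracket (rep (n + 1) f) (rep (n + 1) g)) (fun n => by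
      rw [SModEq.sub_mem, smul_eq_mul, Ideal.mul_top]
      exact b.bracket_sub_mem I n
        (sub_mem_of_mk (mk_rep _ f) (mk_of_le (Nat.le_succ _) (mk_rep _ f)))
        (sub_mem_of_mk (mk_rep _ g) (mk_of_le (Nat.le_succ _) (mk_rep _ g)))))

theorem evalₐ_completionFun (n : ℕ) {f g : AdicCompletion I A} {a c : A}
    (ha : Ideal.Quotient.mk (I ^ (n + 1)) a = AdicCompletion.evalₐ I (n + 1) f)
    (hc : Ideal.Quotient.mk (I ^ (n + 1)) c = AdicCompletion.evalₐ I (n + 1) g) :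
    AdicCompletion.evalₐ I n (b.completionFun f g) =
      Ideal.Quotient.mk (I ^ n) (b.bracket a c) := by
  rw [completionFun, AdicCompletion.evalₐ_mk, Ideal.Quotient.eq]
  exact b.bracket_sub_mem I n (sub_mem_of_mk (mk_rep _ f) ha) (sub_mem_of_mk (mk_rep _ g) hc)

theorem evalₐ_smul (n : ℕ) (c : ℂ) (f : AdicCompletion I A) :
    AdicCompletion.evalₐ I n (c • f) = c • AdicCompletion.evalₐ I n f := by
  rw [← algebraMap_smul A c f, map_smul, algebraMap_smul]

variable (I)

/-- The continuous extension of a Poisson bracket on `A` to the `I`-adic completion of `A`. -/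
noncomputable def completion : PoissonBracket (AdicCompletion I A) where
  bracket := LinearMap.mk₂ ℂ b.completionFun
    (fun f f' g => AdicCompletion.ext_evalₐ fun n => by
      rw [map_add, b.evalₐ_completionFun n (mk_rep _ f) (mk_rep _ g),
        b.evalₐ_completionFun n (mk_rep _ f') (mk_rep _ g),
        b.evalₐ_completionFun n (a := rep (n + 1) f + rep (n + 1) f')
          (by rw [map_add, map_add, mk_rep, mk_rep]) (mk_rep _ g)]
      simp)
    (fun c f g => AdicCompletion.ext_evalₐ fun n => by
      rw [evalₐ_smul, b.evalₐ_completionFun n (mk_rep _ f) (mk_rep _ g),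
        b.evalₐ_completionFun n (a := c • rep (n + 1) f)
          (by rw [evalₐ_smul, ← mk_rep]; rfl) (mk_rep _ g)]
      simp; rfl)
    (fun f g g' => AdicCompletion.ext_evalₐ fun n => by
      rw [map_add, b.evalₐ_completionFun n (mk_rep _ f) (mk_rep _ g),
        b.evalₐ_completionFun n (mk_rep _ f) (mk_rep _ g'),
        b.evalₐ_completionFun n (c := rep (n + 1) g + rep (n + 1) g') (mk_rep _ f)
          (by rw [map_add, map_add, mk_rep, mk_rep])]
      simp)
    (fun c f g => AdicCompletion.ext_evalₐ fun n => by
      rw [evalₐ_smul, b.evalₐ_completionFun n (mk_rep _ f) (mk_rep _ g),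
        b.evalₐ_completionFun n (c := c • rep (n + 1) g) (mk_rep _ f)
          (by rw [evalₐ_smul, ← mk_rep]; rfl)]
      simp; rfl)
  bracket_self f := AdicCompletion.ext_evalₐ fun n => by
    simp only [LinearMap.mk₂_apply]
    rw [b.evalₐ_completionFun n (mk_rep _ f) (mk_rep _ f), b.bracket_self]
    simp
  leibniz f g h := AdicCompletion.ext_evalₐ fun n => by
    simp only [LinearMap.mk₂_apply]
    rw [map_add, map_mul, map_mul, b.evalₐ_completionFun n (mk_rep _ f) (mk_rep _ g),
      b.evalₐ_completionFun n (mk_rep _ f) (mk_rep _ h),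
      b.evalₐ_completionFun n (c := rep (n + 1) g * rep (n + 1) h) (mk_rep _ f)
        (by rw [map_mul, map_mul, mk_rep, mk_rep]), b.leibniz,
      ← mk_of_le (Nat.le_succ n) (mk_rep (n + 1) g), ← mk_of_le (Nat.le_succ n) (mk_rep (n + 1) h)]
    simp
  jacobi f g h := AdicCompletion.ext_evalₐ fun n => by
    simp only [LinearMap.mk₂_apply]
    have e : ∀ x y : AdicCompletion I A, Ideal.Quotient.mk (I ^ (n + 1))
        (b.bracket (rep (n + 2) x) (rep (n + 2) y)) =
          AdicCompletion.evalₐ I (n + 1) (b.completionFun x y) := fun x y =>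
      (b.evalₐ_completionFun (n + 1) (mk_rep _ x) (mk_rep _ y)).symm
    have r : ∀ x : AdicCompletion I A, Ideal.Quotient.mk (I ^ (n + 1)) (rep (n + 2) x) =
        AdicCompletion.evalₐ I (n + 1) x := fun x => mk_of_le (Nat.le_succ _) (mk_rep _ x)
    rw [map_add, b.evalₐ_completionFun n (r f) (e g h), b.evalₐ_completionFun n (e f g) (r h),
      b.evalₐ_completionFun n (r g) (e f h), b.jacobi]
    simp

/-- The extended bracket restricts to the given one on `A`. -/
theorem completion_of (f g : A) :
    (b.completion I).bracket (AdicCompletion.of I A f) (AdicCompletion.of I A g) =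
      AdicCompletion.of I A (b.bracket f g) :=
  AdicCompletion.ext_evalₐ fun n => by
    rw [AdicCompletion.evalₐ_of]
    exact b.evalₐ_completionFun n (AdicCompletion.evalₐ_of I _ f).symm
      (AdicCompletion.evalₐ_of I _ g).symm

end PoissonBracket

/-! ### Varieties with a Poisson structure and a `ℂˣ`-action -/

section Geometry

variable {X : Scheme.{0}}

/-- The ring `Γ(X, U)` of functions on an open subset of a scheme `p : X ⟶ Spec ℂ` over `ℂ`,
regarded as a `ℂ`-algebra. -/
def Fun (_p : X ⟶ Spec (CommRingCat.of ℂ)) (U : X.Opens) : Type := Γ(X, U)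

noncomputable instance (p : X ⟶ Spec (CommRingCat.of ℂ)) (U : X.Opens) : CommRing (Fun p U) :=
  inferInstanceAs (CommRing Γ(X, U))

noncomputable instance (p : X ⟶ Spec (CommRingCat.of ℂ)) (U : X.Opens) : Algebra ℂ (Fun p U) :=
  RingHom.toAlgebra (R := ℂ) (S := Γ(X, U))
    ((X.presheaf.map (homOfLE (le_top : U ≤ ⊤)).op).hom.comp
      (p.appTop.hom.comp (Scheme.ΓSpecIso (CommRingCat.of ℂ)).inv.hom))

/-- Restriction of functions. -/
noncomputable def Fun.res (p : X ⟶ Spec (CommRingCat.of ℂ)) {U V : X.Opens} (h : V ≤ U) :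
    Fun p U →+* Fun p V :=
  (X.presheaf.map (homOfLE h).op).hom

/-- The prime ideal of functions on `U` vanishing at the point `x ∈ U`. -/
noncomputable def pointIdeal (p : X ⟶ Spec (CommRingCat.of ℂ)) (U : X.Opens) (x : X)
    (hx : x ∈ U) : Ideal (Fun p U) :=
  Ideal.comap (X.presheaf.germ U x hx).hom (IsLocalRing.maximalIdeal (X.presheaf.stalk x))

/-- The ideal of functions on `U` vanishing at all points of `V ∩ U`. -/
noncomputable def vanishingIdeal (p : X ⟶ Spec (CommRingCat.of ℂ)) (U : X.Opens) (V : Set X) :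
    Ideal (Fun p U) :=
  ⨅ (x : X) (_ : x ∈ V) (hx : x ∈ U), pointIdeal p U x hx

/-- An algebraic action of the multiplicative group `ℂˣ` on `X` over `ℂ`: an action of the group
`ℂˣ` by automorphisms of `X` over `ℂ` which are the restrictions to the points `c ∈ ℂˣ` of a
morphism `𝔾ₘ × X ⟶ X`. -/
structure GmAction (p : X ⟶ Spec (CommRingCat.of ℂ)) where
  act : ℂˣ →* Aut X
  act_comp : ∀ c, (act c).hom ≫ p = p
  algebraic : ∃ a : pullback (Spec.map (CommRingCat.ofHom (algebraMap ℂ ℂ[T;T⁻¹]))) p ⟶ X,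
    a ≫ p = pullback.snd _ _ ≫ p ∧
    ∀ c : ℂˣ, pullback.lift
      (p ≫ Spec.map (CommRingCat.ofHom (LaurentPolynomial.eval₂ (RingHom.id ℂ) c))) (𝟙 X)
      (by
        rw [Category.assoc, ← Spec.map_comp, ← CommRingCat.ofHom_comp, Category.id_comp]
        have : (LaurentPolynomial.eval₂ (RingHom.id ℂ) c).comp (algebraMap ℂ ℂ[T;T⁻¹]) =
            RingHom.id ℂ :=
          RingHom.ext fun r => LaurentPolynomial.eval₂_C (RingHom.id ℂ) c r
        rw [this]
        exact (congrArg (p ≫ ·) (Spec.map_id (CommRingCat.of ℂ))).trans (Category.comp_id p)) ≫ a = (act c).hom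

namespace GmAction

variable {p : X ⟶ Spec (CommRingCat.of ℂ)} (G : GmAction p)

/-- The point `c · x`. -/
noncomputable def smul (c : ℂˣ) (x : X) : X := (G.act c).hom x

/-- The orbit `ℂˣ · x`. -/
def orbit (x : X) : Set X := Set.range fun c => G.smul c x

theorem mem_orbit (x : X) : x ∈ G.orbit x := ⟨1, by
  change (G.act 1).hom x = x
  rw [map_one]
  rfl⟩

/-- The stabilizer of `x` in `ℂˣ`, as a set. -/
def stab (x : X) : Set ℂˣ := {c | G.smul c x = x}

/-- Pull-back of functions along `x ↦ c · x`. -/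
noncomputable def pull (c : ℂˣ) (U : X.Opens) : Fun p U →+* Fun p ((G.act c).hom ⁻¹ᵁ U) :=
  ((G.act c).hom.app U).hom

end GmAction

/-- A Poisson structure on a scheme over `ℂ`: compatible Poisson brackets on the functions on all
open subsets. -/
structure PoissonScheme (p : X ⟶ Spec (CommRingCat.of ℂ)) where
  br : ∀ U : X.Opens, PoissonBracket (Fun p U)
  res_br : ∀ {U V : X.Opens} (h : V ≤ U) (f g : Fun p U),
    Fun.res p h ((br U).bracket f g) = (br V).bracket (Fun.res p h f) (Fun.res p h g)

namespace PoissonScheme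

variable {p : X ⟶ Spec (CommRingCat.of ℂ)} (P : PoissonScheme p)

/-- The Poisson bracket (equivalently, the Poisson bivector) is homogeneous of degree `d`: the
bracket of functions of weights `i` and `j` has weight `i + j + d`. -/
def IsHomogeneous (G : GmAction p) (d : ℤ) : Prop :=
  ∀ (c : ℂˣ) (U : X.Opens) (f g : Fun p U),
    G.pull c U ((P.br U).bracket f g) =
      ((c ^ d : ℂˣ) : ℂ) • (P.br _).bracket (G.pull c U f) (G.pull c U g)

/-- `Y` is a symplectic leaf: it is locally closed, and at each closed point `z` of `Y` the tangent
space of `Y` (the point derivations at `z` of functions on an affine neighborhood `V` that kill the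
functions vanishing on `Y`) is the span of the Hamiltonian vector fields at `z`. -/
def IsSymplecticLeaf (Y : Set X) : Prop :=
  IsLocallyClosed Y ∧
    ∀ z ∈ Y, IsClosed {z} → ∀ (V : X.Opens), IsAffineOpen V → ∀ hz : z ∈ V,
      ∀ D : Derivation ℂ (Fun p V) (Fun p V ⧸ pointIdeal p V z hz),
        (∀ g ∈ vanishingIdeal p V Y, D g = 0) ↔
          D ∈ Submodule.span ℂ {H : Derivation ℂ (Fun p V) (Fun p V ⧸ pointIdeal p V z hz) |
            ∃ f, ∀ g, H g = Ideal.Quotient.mk _ ((P.br V).bracket f g)}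

end PoissonScheme

/-! ### Formal neighborhoods of an orbit -/

/-- The functions `𝒪(X̂)` on the formal neighborhood of a subset `Z` in `X`: the completion of
`𝒪(U)` along the ideal of `Z`, where `U` is an affine open subset in which `Z` is closed. -/
abbrev FormalNhd (p : X ⟶ Spec (CommRingCat.of ℂ)) (U : X.Opens) (Z : Set X) : Type :=
  AdicCompletion (vanishingIdeal p U Z) (Fun p U)

/-- The ideal of definition of `𝒪(X̂)`. -/
noncomputable def FormalNhd.ideal (p : X ⟶ Spec (CommRingCat.of ℂ)) (U : X.Opens) (Z : Set X) :
    Ideal (FormalNhd p U Z) :=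
  (vanishingIdeal p U Z).map (algebraMap (Fun p U) (FormalNhd p U Z))

/-- The ideal of a locally closed `Y ⊇ Z` in `𝒪(X̂)`. -/
noncomputable def FormalNhd.subIdeal (p : X ⟶ Spec (CommRingCat.of ℂ)) (U : X.Opens)
    (Z Y : Set X) : Ideal (FormalNhd p U Z) :=
  (vanishingIdeal p U Y).map (algebraMap (Fun p U) (FormalNhd p U Z))

/-- The functions `𝒪(Ŷ)` on the formal neighborhood of `Z` in a locally closed subvariety
`Y ⊇ Z` of `X`, as the closed formal subscheme of `X̂` defined by the ideal of `Y`: as `𝒪(U)` is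
noetherian, this is the completion along `Z` of the functions on the closure of `Y ∩ U` in `U`, in
which `Y ∩ U` is an open neighborhood of `Z`. -/
abbrev SubFormalNhd (p : X ⟶ Spec (CommRingCat.of ℂ)) (U : X.Opens) (Z Y : Set X) : Type :=
  FormalNhd p U Z ⧸ FormalNhd.subIdeal p U Z Y

/-- The ideal of definition of `𝒪(Ŷ)`. -/
noncomputable def SubFormalNhd.ideal (p : X ⟶ Spec (CommRingCat.of ℂ)) (U : X.Opens)
    (Z Y : Set X) : Ideal (SubFormalNhd p U Z Y) :=
  (FormalNhd.ideal p U Z).map (Ideal.Quotient.mk _)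

/-- `f ∈ 𝒪(X̂)` has weight `d` for the action of `ℂˣ`, that is, `f (c · x) = c ^ d • f x`. As `U`
need not be stable, for each `c` this is tested on `U ∩ c⁻¹ U`, which contains the stable set `Z`,
modulo all powers of the ideal of `Z`. -/
def IsWeight {p : X ⟶ Spec (CommRingCat.of ℂ)} (G : GmAction p) (U : X.Opens) (Z : Set X)
    (d : ℤ) (f : FormalNhd p U Z) : Prop :=
  ∀ (c : ℂˣ) (n : ℕ) (a : Fun p U),
    AdicCompletion.evalₐ (vanishingIdeal p U Z) n f = Ideal.Quotient.mk _ a →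
      Fun.res p (inf_le_right : U ⊓ (G.act c).hom ⁻¹ᵁ U ≤ _) (G.pull c U a) -
        ((c ^ d : ℂˣ) : ℂ) • Fun.res p (inf_le_left : U ⊓ (G.act c).hom ⁻¹ᵁ U ≤ _) a ∈
      vanishingIdeal p (U ⊓ (G.act c).hom ⁻¹ᵁ U) Z ^ n

/-- `f ∈ 𝒪(Ŷ)` has weight `d`: it is the restriction of a function of weight `d` on `X̂`. -/
def IsSubWeight {p : X ⟶ Spec (CommRingCat.of ℂ)} (G : GmAction p) (U : X.Opens) (Z Y : Set X)
    (d : ℤ) (f : SubFormalNhd p U Z Y) : Prop :=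
  ∃ g : FormalNhd p U Z, IsWeight G U Z d g ∧ Ideal.Quotient.mk _ g = f

end Geometry

/-! ### Formal charts, completed products, and slices -/

/-- Indices of the coordinates of the formal disk `Δ^(2m+1)`: `none` stands for `u`,
`some (inl i)` for `z_(2i-1)`, and `some (inr i)` for `z_(2i)`. -/
abbrev DiskIdx (m : ℕ) : Type := Option (Fin m ⊕ Fin m)

/-- `ℂ[t, t⁻¹][[u, z_1, …, z_(2m)]]`, the functions on `ℂˣ ×̂ Δ^(2m+1)`. -/
abbrev DiskFun (m : ℕ) : Type := MvPowerSeries (DiskIdx m) ℂ[T;T⁻¹]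

/-- A `ℂˣ`-equivariant isomorphism of an affine formal scheme (with functions `A`, ideal of
definition `I`, and weight spaces given by `wt`) with `ℂˣ ×̂ Δ^(2m+1)`, where `t` has weight `ℓ` and
`u, z_1, …, z_(2m)` have weight zero. -/
structure FormalChart {A : Type} [CommRing A] [Algebra ℂ A] (I : Ideal A) (wt : ℤ → A → Prop)
    (ℓ : ℕ) (m : ℕ) where
  equiv : A ≃ₐ[ℂ] DiskFun m
  map_ideal : I.map (equiv : A →+* DiskFun m) = Ideal.span (Set.range MvPowerSeries.X)
  weight : ∀ (d : ℤ) (f : A), wt d f ↔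
    ∀ (α : DiskIdx m →₀ ℕ) (j : ℤ), (MvPowerSeries.coeff α (equiv f)).coeff j ≠ 0 → j * ℓ = d

namespace FormalChart

variable {A : Type} [CommRing A] [Algebra ℂ A] {I : Ideal A} {wt : ℤ → A → Prop} {ℓ m : ℕ}
  (Φ : FormalChart I wt ℓ m)

/-- The inclusion `ℂ[t, t⁻¹] → A` given by the chart. -/
noncomputable def base : ℂ[T;T⁻¹] →+* A :=
  (Φ.equiv.symm : DiskFun m →+* A).comp (MvPowerSeries.C (σ := DiskIdx m) (R := ℂ[T;T⁻¹]))

/-- The coordinate `t`. -/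
noncomputable def t : Aˣ where
  val := Φ.base (LaurentPolynomial.T 1)
  inv := Φ.base (LaurentPolynomial.T (-1))
  val_inv := by rw [← map_mul, ← LaurentPolynomial.T_add]; simp
  inv_val := by rw [← map_mul, ← LaurentPolynomial.T_add]; simp

/-- The coordinate `u`. -/
noncomputable def u : A := Φ.equiv.symm (MvPowerSeries.X none)

/-- The coordinates `z_(2i-1)`. -/
noncomputable def zo (i : Fin m) : A := Φ.equiv.symm (MvPowerSeries.X (some (Sum.inl i)))

/-- The coordinates `z_(2i)`. -/
noncomputable def ze (i : Fin m) : A := Φ.equiv.symm (MvPowerSeries.X (some (Sum.inr i)))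

end FormalChart

/-- In terms of `t`, `u`, `z'_(2i-1) = t ^ k * z_(2i-1)` and `z_(2i)`, the Poisson bivector is the
standard one, `t ^ (1 - k) ∂_u ∧ ∂_t + ∑ ∂_{z'_(2i-1)} ∧ ∂_{z_(2i)}`. -/
structure IsStandard {A : Type} [CommRing A] [Algebra ℂ A] (b : PoissonBracket A) (k : ℤ)
    {m : ℕ} (t : Aˣ) (u : A) (zo ze : Fin m → A) : Prop where
  u_t : b.bracket u t = ((t ^ (1 - k) : Aˣ) : A)
  u_zo : ∀ i, b.bracket u (((t ^ k : Aˣ) : A) * zo i) = 0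
  u_ze : ∀ i, b.bracket u (ze i) = 0
  t_zo : ∀ i, b.bracket t (((t ^ k : Aˣ) : A) * zo i) = 0
  t_ze : ∀ i, b.bracket t (ze i) = 0
  zo_zo : ∀ i j, b.bracket (((t ^ k : Aˣ) : A) * zo i) (((t ^ k : Aˣ) : A) * zo j) = 0
  ze_ze : ∀ i j, b.bracket (ze i) (ze j) = 0
  zo_ze : ∀ i j, b.bracket (((t ^ k : Aˣ) : A) * zo i) (ze j) = if i = j then 1 else 0

/-- `K`, with its `𝔨`-adic topology, is the completed tensor product over `B` of `A` and `R` with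
their `𝔞`-adic and `𝔯`-adic topologies, via `σ` and `τ`; that is, `Spf K = Spf A ×̂_B Spf R`. This
says that `K` is complete and that `σ` and `τ` induce isomorphisms
`(A ⊗ R) / (𝔞 ⊗ 1 + 1 ⊗ 𝔯) ^ n ≃ K / 𝔨 ^ n` for all `n`. -/
structure IsCompletedTensor (B : Type) [CommRing B] {A R K : Type} [CommRing A] [CommRing R]
    [CommRing K] [Algebra B A] [Algebra B R] [Algebra B K] (𝔞 : Ideal A) (𝔯 : Ideal R)
    (𝔨 : Ideal K) (σ : A →ₐ[B] K) (τ : R →ₐ[B] K) : Prop where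
  complete : IsAdicComplete 𝔨 K
  mem_iff : ∀ (n : ℕ) (w : A ⊗[B] R), Algebra.TensorProduct.productMap σ τ w ∈ 𝔨 ^ n ↔
    w ∈ (𝔞.map (Algebra.TensorProduct.includeLeft : A →ₐ[B] A ⊗[B] R) ⊔
      𝔯.map (Algebra.TensorProduct.includeRight : R →ₐ[B] A ⊗[B] R)) ^ n
  dense : ∀ (n : ℕ) (x : K), ∃ w : A ⊗[B] R,
    x - Algebra.TensorProduct.productMap σ τ w ∈ 𝔨 ^ n

/-- The same notion, when the structure of `A`, `R` and `K` as algebras over `B` is given by ring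
homomorphisms `β` and `γ`. -/
def IsCompletedFiberProduct {B A R K : Type} [CommRing B] [CommRing A] [CommRing R] [CommRing K]
    (β : B →+* A) (γ : B →+* R) (𝔞 : Ideal A) (𝔯 : Ideal R) (𝔨 : Ideal K)
    (σ : A →+* K) (τ : R →+* K) (h : ∀ c, τ (γ c) = σ (β c)) : Prop :=
  letI := β.toAlgebra
  letI := γ.toAlgebra
  letI := (σ.comp β).toAlgebra
  IsCompletedTensor B 𝔞 𝔯 𝔨 (⟨σ, fun _ => rfl⟩ : A →ₐ[B] K) (⟨τ, h⟩ : R →ₐ[B] K)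

/-- `R = 𝒪(S)` is an equivariant slice in a formal Poisson scheme `Spf K` with weight spaces `wt`,
with respect to a formal scheme `Spf A` and a projection `Spf K → Spf A` given by `σ`, on which
`t, u, z` are (the pull-backs of) standard coordinates: `R` consists of the elements of weight zero
commuting with `t` and all `z_i`; `Spf K = Spf A ×̂ S`; and the Poisson bivector has the form
`π + t ^ (-k) ∂_u ∧ ξ + t ^ (-k) π_S` with `[ξ, π_S] = k π_S`. -/
structure IsEquivariantSlice {K A : Type} [CommRing K] [Algebra ℂ K] [CommRing A] [Algebra ℂ A]
    (b : PoissonBracket K) (wt : ℤ → K → Prop) (𝔨 : Ideal K) (𝔞 : Ideal A) (σ : A →ₐ[ℂ] K)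
    (k : ℤ) {m : ℕ} (t : Kˣ) (u : K) (zo ze : Fin m → K) (R : Subalgebra ℂ K) : Prop where
  /-- `R` is the algebra of weight-zero elements of the centralizer of `t` and the `z_i`. -/
  mem_iff : ∀ f, f ∈ R ↔ wt 0 f ∧ b.bracket f t = 0 ∧
    ∀ i, b.bracket f (zo i) = 0 ∧ b.bracket f (ze i) = 0
  /-- `S = Spf R` is a formal scheme with one closed point, with residue field `ℂ`. -/
  noetherian : IsNoetherianRing R
  complete : IsAdicComplete (𝔨.comap R.val) R
  residue : Function.Bijective (algebraMap ℂ (R ⧸ 𝔨.comap R.val))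
  /-- `Spf K` is the product of `Spf A` and `S`. -/
  product : IsCompletedTensor ℂ 𝔞 (𝔨.comap R.val) 𝔨 σ R.val
  /-- The brackets of elements of `R` with each other, and with `u`. -/
  bivector : ∃ (bS : PoissonBracket R) (ξ : Derivation ℂ R R),
    (∀ f g : R, b.bracket (f : K) (g : K) = ((t ^ (-k) : Kˣ) : K) * (bS.bracket f g : R)) ∧
    (∀ f : R, b.bracket u (f : K) = ((t ^ (-k) : Kˣ) : K) * (ξ f : R)) ∧
    (∀ f g : R, ξ (bS.bracket f g) =
      bS.bracket (ξ f) g + bS.bracket f (ξ g) + (k : ℂ) • bS.bracket f g)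

/-- `Q = 𝒪(T)` is the centralizer of `t` and the `z_i` in `K`; `T` is a formal scheme with
`ℂˣ`-action, with Poisson bracket restricted from `K`, over `ℂˣ = Spec ℂ[t, t⁻¹]`, where
`ℂ[t, t⁻¹]` is Poisson central; `Spf K` is the fibered product of `Spf A` and `T` over `ℂˣ`; and the
Poisson bivector has the form `π + π_T + t ^ (-k) ∂_u ∧ ξ`, with `ξ` a Poisson vector field of
degree zero on `T`. Here the last term accounts for all brackets of `u` with functions on `T`,
including the function `t`. -/
structure IsFiberedSlice {K A : Type} [CommRing K] [Algebra ℂ K] [CommRing A] [Algebra ℂ A]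
    (b : PoissonBracket K) (wt : ℤ → K → Prop) (𝔨 : Ideal K) (𝔞 : Ideal A)
    (β : ℂ[T;T⁻¹] →+* A) (σ : A →ₐ[ℂ] K)
    (k : ℤ) {m : ℕ} (t : Kˣ) (u : K) (zo ze : Fin m → K) (Q : Subalgebra ℂ K) : Prop where
  mem_iff : ∀ f, f ∈ Q ↔ b.bracket f t = 0 ∧
    ∀ i, b.bracket f (zo i) = 0 ∧ b.bracket f (ze i) = 0
  noetherian : IsNoetherianRing Q
  complete : IsAdicComplete (𝔨.comap Q.val) Q
  /-- `Q` is topologically spanned by its homogeneous elements. -/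
  graded : ∀ (n : ℕ) (f : Q), ∃ (s : Finset ℤ) (g : ℤ → Q),
    (∀ e ∈ s, wt e (g e : K)) ∧ f - ∑ e ∈ s, g e ∈ (𝔨.comap Q.val) ^ n
  product : ∃ (γ : ℂ[T;T⁻¹] →+* Q) (h : ∀ c, Q.val (γ c) = σ (β c)),
    IsCompletedFiberProduct β γ 𝔞 (𝔨.comap Q.val) 𝔨 (σ : A →+* K) (Q.val : Q →+* K) h
  bivector : ∃ (bT : PoissonBracket Q) (ξ : Derivation ℂ Q Q),
    (∀ f g : Q, b.bracket (f : K) (g : K) = (bT.bracket f g : Q)) ∧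
    (∀ (f : Q) (c : ℂ[T;T⁻¹]), b.bracket (f : K) (σ (β c)) = 0) ∧
    (∀ f : Q, b.bracket u (f : K) = ((t ^ (-k) : Kˣ) : K) * (ξ f : Q)) ∧
    (∀ (e : ℤ) (f : Q), wt e (f : K) → wt e (ξ f : K)) ∧
    (∀ f g : Q, ξ (bT.bracket f g) = bT.bracket (ξ f) g + bT.bracket f (ξ g))

/-! ### The cyclic étale cover obtained by adjoining a root of a unit -/

/-- `A[s] / (s ^ ℓ - t)`, the functions on the `ℓ`-fold cover of `Spf A` adjoining
`s = t ^ (1 / ℓ)`. -/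
abbrev RootCover {A : Type} [CommRing A] (t : A) (ℓ : ℕ) : Type :=
  AdjoinRoot (Polynomial.X ^ ℓ - Polynomial.C t : A[X])

namespace RootCover

/-- The map of covers induced by an algebra homomorphism; it sends `s` to `s`. -/
noncomputable def map {A K : Type} [CommRing A] [Algebra ℂ A] [CommRing K] [Algebra ℂ K]
    (σ : A →ₐ[ℂ] K) (t : A) (ℓ : ℕ) : RootCover t ℓ →ₐ[ℂ] RootCover (σ t) ℓ :=
  AdjoinRoot.mapAlgHom σ _ _ (by simp)

variable {A : Type} [CommRing A] [Algebra ℂ A] (t : A) (ℓ : ℕ)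

/-- The action of `ℓ`-th roots of unity on the cover: `s ↦ ζ s`. -/
noncomputable def twist (ζ : rootsOfUnity ℓ ℂ) : RootCover t ℓ →ₐ[ℂ] RootCover t ℓ :=
  AdjoinRoot.liftAlgHom _ (IsScalarTower.toAlgHom ℂ A (RootCover t ℓ))
    (((ζ : ℂˣ) : ℂ) • AdjoinRoot.root _) (by
      have h : (((ζ : ℂˣ) : ℂ)) ^ ℓ = 1 := by
        have h1 := congrArg Units.val ((mem_rootsOfUnity ℓ (ζ : ℂˣ)).1 ζ.2)
        simpa using h1
      have h2 := AdjoinRoot.eval₂_root (Polynomial.X ^ ℓ - Polynomial.C t : A[X])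
      simp only [Polynomial.eval₂_sub, Polynomial.eval₂_X_pow, Polynomial.eval₂_C] at h2 ⊢
      rw [smul_pow, h, one_smul]
      exact h2)

/-- An element `∑ f_i s ^ i` of the cover has weight `d` if `f_i` has weight `d - i`; thus `s` has
weight one. -/
def IsWeight (wt : ℤ → A → Prop) (d : ℤ) (x : RootCover t ℓ) : Prop :=
  ∃ f : Fin ℓ → A, (∀ i : Fin ℓ, wt (d - (i : ℕ)) (f i)) ∧
    x = ∑ i : Fin ℓ, AdjoinRoot.of _ (f i) * AdjoinRoot.root _ ^ (i : ℕ)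

end RootCover

/-- The presentation of a formal Poisson scheme `Spf K` with `ℂˣ`-action as the quotient by the
group of `ℓ`-th roots of unity of the product of the `ℓ`-fold cover of `Spf A` and a slice
`S = Spf R`. Here `t : Aˣ`, the cover of `Spf A` adjoins `s = t ^ (1 / ℓ)`, and `σ : A → K` is a
projection `Spf K → Spf A`. The product is identified with the `ℓ`-fold cover of `Spf K`, so that
`S` is canonical: `R` consists of the elements of `K[t ^ (1 / ℓ)]` of weight zero commuting with `t`
and all `z_i`. -/
structure IsCoverSlice {K A : Type} [CommRing K] [Algebra ℂ K] [CommRing A] [Algebra ℂ A]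
    (b : PoissonBracket K) (wt : ℤ → K → Prop) (𝔨 : Ideal K) (𝔞 : Ideal A) (σ : A →ₐ[ℂ] K)
    (k : ℤ) (ℓ : ℕ) {m : ℕ} (t : Aˣ) (u : A) (zo ze : Fin m → A)
    (bK : PoissonBracket (RootCover (σ t) ℓ)) (R : Subalgebra ℂ (RootCover (σ t) ℓ)) : Prop where
  /-- `Spf K` is the quotient of the cover, as a formal scheme with `ℂˣ`-action. -/
  injective : Function.Injective (AdjoinRoot.of (Polynomial.X ^ ℓ - Polynomial.C (σ t) : K[X]))
  invariants : ∀ x : RootCover (σ t) ℓ,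
    (∀ ζ, RootCover.twist (σ t) ℓ ζ x = x) ↔ ∃ f, AdjoinRoot.of _ f = x
  weight : ∀ e f, wt e f ↔ RootCover.IsWeight (σ t) ℓ wt e (AdjoinRoot.of _ f)
  mem_pow : ∀ n f, f ∈ 𝔨 ^ n ↔ (AdjoinRoot.of _ f : RootCover (σ t) ℓ) ∈
    (𝔨.map (AdjoinRoot.of _)) ^ n
  /-- The quotient map is Poisson, for the bracket `bK` (unique with this property). -/
  bracket_of : ∀ f g, bK.bracket (AdjoinRoot.of _ f) (AdjoinRoot.of _ g) =
    AdjoinRoot.of _ (b.bracket f g)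
  /-- Roots of unity act by Poisson automorphisms, compatibly on the cover of `Spf A` and on `S`. -/
  bracket_twist : ∀ ζ x x', bK.bracket (RootCover.twist (σ t) ℓ ζ x)
    (RootCover.twist (σ t) ℓ ζ x') = RootCover.twist (σ t) ℓ ζ (bK.bracket x x')
  map_twist : ∀ ζ a, RootCover.map σ (t : A) ℓ (RootCover.twist (t : A) ℓ ζ a) =
    RootCover.twist (σ t) ℓ ζ (RootCover.map σ (t : A) ℓ a)
  twist_mem : ∀ ζ, ∀ x ∈ R, RootCover.twist (σ t) ℓ ζ x ∈ R
  /-- The cover of `Spf K` is the product of the cover of `Spf A` and `S`, and its bivector has the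
  standard form. -/
  slice : IsEquivariantSlice bK (RootCover.IsWeight (σ t) ℓ wt) (𝔨.map (AdjoinRoot.of _))
    (𝔞.map (AdjoinRoot.of _)) (RootCover.map σ (t : A) ℓ) k
    (Units.map (AdjoinRoot.of _).toMonoidHom (Units.map σ.toRingHom.toMonoidHom t))
    (AdjoinRoot.of _ (σ u)) (fun i => AdjoinRoot.of _ (σ (zo i)))
    (fun i => AdjoinRoot.of _ (σ (ze i))) R

/-! ### Adically complete rings -/

section Adic

variable {K : Type} [CommRing K] {𝔨 : Ideal K}

theorem eq_zero_of_forall_mem_pow [IsHausdorff 𝔨 K] {f : K} (h : ∀ n, f ∈ 𝔨 ^ n) : f = 0 :=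
  IsHausdorff.haus ‹_› f fun n => by
    rw [SModEq.zero, smul_eq_mul, Ideal.mul_top]
    exact h n

theorem exists_adic_limit [IsPrecomplete 𝔨 K] (s : ℕ → K) (h : ∀ n, s (n + 1) - s n ∈ 𝔨 ^ n) :
    ∃ L, ∀ n, L - s n ∈ 𝔨 ^ n := by
  have h' : ∀ {m n}, m ≤ n → s n - s m ∈ 𝔨 ^ m := by
    intro m n hmn
    induction n, hmn using Nat.le_induction with
    | base => simp
    | succ n hmn ih =>
      have := Ideal.add_mem _ (Ideal.pow_le_pow_right hmn (h n)) ih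
      simpa using this
  obtain ⟨L, hL⟩ := IsPrecomplete.prec (I := 𝔨) (M := K) ‹_› (f := s) (fun {m n} hmn => by
    rw [SModEq.sub_mem, smul_eq_mul, Ideal.mul_top, ← neg_sub]
    exact neg_mem (h' hmn))
  refine ⟨L, fun n => ?_⟩
  have := hL n
  rw [SModEq.sub_mem, smul_eq_mul, Ideal.mul_top, ← neg_sub] at this
  exact neg_mem_iff.1 this

theorem exists_adic_sum [IsPrecomplete 𝔨 K] (a : ℕ → K) (h : ∀ n, a n ∈ 𝔨 ^ n) :
    ∃ L, ∀ n, L - ∑ i ∈ Finset.range n, a i ∈ 𝔨 ^ n :=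
  exists_adic_limit _ fun n => by simpa [Finset.sum_range_succ] using h n

theorem isUnit_of_sub_mem [IsAdicComplete 𝔨 K] {f g : K} (hg : IsUnit g) (h : f - g ∈ 𝔨) :
    IsUnit f := by
  obtain ⟨g, rfl⟩ := hg
  have h1 : IsUnit ((f - g) * ↑g⁻¹ + 1) :=
    Ideal.mem_jacobson_bot.1 (IsAdicComplete.le_jacobson_bot 𝔨 h) _
  have h2 : f = ((f - g) * ↑g⁻¹ + 1) * g := by
    rw [add_mul, mul_assoc, Units.inv_mul]; ring
  rw [h2]
  exact h1.mul g.isUnit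

/-- A ring homomorphism whose image is dense modulo an ideal generated by images is adically
dense. -/
theorem exists_sub_mem_pow_of_map {S : Type} [CommRing S] (φ : S →+* K) (J : Ideal S)
    (hJ : J.map φ = 𝔨) (h : ∀ f, ∃ s, f - φ s ∈ 𝔨) (n : ℕ) (f : K) : ∃ s, f - φ s ∈ 𝔨 ^ n := by
  have key : ∀ n, ∀ f ∈ 𝔨 ^ n, ∃ s, f - φ s ∈ 𝔨 ^ (n + 1) := by
    intro n f hf
    rw [← hJ, ← Ideal.map_pow] at hf
    refine Submodule.span_induction ?_ ⟨0, by simp⟩ ?_ ?_ hf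
    · rintro _ ⟨s, -, rfl⟩
      exact ⟨s, by simp⟩
    · rintro f g - - ⟨s, hs⟩ ⟨s', hs'⟩
      refine ⟨s + s', ?_⟩
      rw [map_add, add_sub_add_comm]
      exact Ideal.add_mem _ hs hs'
    · rintro a f hf' ⟨s, hs⟩
      obtain ⟨r, hr⟩ := h a
      refine ⟨r * s, ?_⟩
      have e : a • f - φ (r * s) = (a - φ r) * f + φ r * (f - φ s) := by
        rw [map_mul, smul_eq_mul]; ring
      rw [e]
      refine Ideal.add_mem _ ?_ (Ideal.mul_mem_left _ _ hs)
      rw [pow_succ']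
      refine Ideal.mul_mem_mul hr ?_
      have : f ∈ (J ^ n).map φ := hf'
      rwa [Ideal.map_pow, hJ] at this
  induction n generalizing f with
  | zero => exact ⟨0, by simp⟩
  | succ n ih =>
    obtain ⟨s, hs⟩ := ih f
    obtain ⟨s', hs'⟩ := key n _ hs
    exact ⟨s + s', by rwa [map_add, ← sub_sub]⟩

variable (𝔨)

/-- Closedness for the `𝔨`-adic topology. -/
def IsAdicClosed (N : Set K) : Prop :=
  ∀ f, (∀ n, ∃ g ∈ N, f - g ∈ 𝔨 ^ n) → f ∈ N

theorem isAdicComplete_of (haus : ∀ f : K, (∀ n, f ∈ 𝔨 ^ n) → f = 0)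
    (prec : ∀ s : ℕ → K, (∀ n, s (n + 1) - s n ∈ 𝔨 ^ n) → ∃ L, ∀ n, L - s n ∈ 𝔨 ^ n) :
    IsAdicComplete 𝔨 K where
  haus' f hf := haus f fun n => by
    have := hf n
    rwa [SModEq.zero, smul_eq_mul, Ideal.mul_top] at this
  prec' s hs := by
    obtain ⟨L, hL⟩ := prec s fun n => by
      have := hs (Nat.le_succ n)
      rw [SModEq.sub_mem, smul_eq_mul, Ideal.mul_top, ← neg_sub] at this
      exact neg_mem_iff.1 this
    refine ⟨L, fun n => ?_⟩
    rw [SModEq.sub_mem, smul_eq_mul, Ideal.mul_top, ← neg_sub]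
    exact neg_mem (hL n)

theorem isAdicClosed_ideal [IsNoetherianRing K] [IsAdicComplete 𝔨 K] (P : Ideal K) :
    IsAdicClosed 𝔨 (P : Set K) := by
  intro f hf
  have := IsHausdorff.of_le_jacobson 𝔨 (K ⧸ P) (IsAdicComplete.le_jacobson_bot 𝔨)
  have h : Ideal.Quotient.mk P f = 0 := by
    refine IsHausdorff.haus this _ fun n => ?_
    rw [SModEq.zero]
    obtain ⟨g, hg, hfg⟩ := hf n
    have e : Ideal.Quotient.mk P f = (f - g) • (1 : K ⧸ P) := by
      rw [Algebra.smul_def, mul_one, Ideal.Quotient.algebraMap_eq, map_sub,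
        Ideal.Quotient.eq_zero_iff_mem.2 hg, sub_zero]
    rw [e]
    exact Submodule.smul_mem_smul hfg trivial
  exact Ideal.Quotient.eq_zero_iff_mem.1 h

theorem mem_map_quotient_pow_iff (P : Ideal K) (n : ℕ) (f : K) :
    Ideal.Quotient.mk P f ∈ (𝔨.map (Ideal.Quotient.mk P)) ^ n ↔ ∃ g ∈ P, f - g ∈ 𝔨 ^ n := by
  rw [← Ideal.map_pow, Ideal.mem_map_iff_of_surjective _ Ideal.Quotient.mk_surjective]
  constructor
  · rintro ⟨h, hh, e⟩
    exact ⟨f - h, (Ideal.Quotient.eq).1 e.symm, by simpa using hh⟩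
  · rintro ⟨g, hg, h⟩
    exact ⟨f - g, h, by rw [map_sub, Ideal.Quotient.eq_zero_iff_mem.2 hg, sub_zero]⟩

theorem isAdicComplete_quotient [IsAdicComplete 𝔨 K] (P : Ideal K)
    (hP : IsAdicClosed 𝔨 (P : Set K)) :
    IsAdicComplete (𝔨.map (Ideal.Quotient.mk P)) (K ⧸ P) := by
  refine isAdicComplete_of _ (fun f hf => ?_) (fun s hs => ?_)
  · obtain ⟨f, rfl⟩ := Ideal.Quotient.mk_surjective f
    rw [Ideal.Quotient.eq_zero_iff_mem]
    exact hP f fun n => (mem_map_quotient_pow_iff 𝔨 P n f).1 (hf n)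
  · have h : ∀ n, ∃ d ∈ 𝔨 ^ n, Ideal.Quotient.mk P d = s (n + 1) - s n := fun n => by
      have := hs n
      rwa [← Ideal.map_pow, Ideal.mem_map_iff_of_surjective _ Ideal.Quotient.mk_surjective] at this
    choose d hd e using h
    obtain ⟨s0, hs0⟩ := Ideal.Quotient.mk_surjective (s 0)
    obtain ⟨L, hL⟩ := exists_adic_sum d hd
    refine ⟨Ideal.Quotient.mk P (s0 + L), fun n => ?_⟩
    have : Ideal.Quotient.mk P (s0 + L) - s n =
        Ideal.Quotient.mk P (L - ∑ i ∈ Finset.range n, d i) := by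
      rw [map_add, map_sub, map_sum, hs0, Finset.sum_congr rfl fun i _ => e i,
        Finset.sum_range_sub]
      ring
    rw [this, ← Ideal.map_pow]
    exact Ideal.mem_map_of_mem _ (hL n)

end Adic

section EvalSeries

variable {K C ι : Type} [CommRing K] [CommRing C] (𝔨 : Ideal K)

theorem eval₂_mem_pow {φ : C →+* K} {x : ι → K} (hx : ∀ i, x i ∈ 𝔨) {n : ℕ}
    {p : MvPolynomial ι C} (hp : p ∈ MvPolynomial.idealOfVars ι C ^ n) :
    MvPolynomial.eval₂ φ x p ∈ 𝔨 ^ n := by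
  have h : (MvPolynomial.idealOfVars ι C).map (MvPolynomial.eval₂Hom φ x) ≤ 𝔨 := by
    rw [MvPolynomial.idealOfVars, Ideal.map_span, Ideal.span_le]
    rintro _ ⟨_, ⟨i, rfl⟩, rfl⟩
    simpa using hx i
  have h2 := Ideal.mem_map_of_mem (MvPolynomial.eval₂Hom φ x) hp
  rw [Ideal.map_pow] at h2
  exact Ideal.pow_right_mono h n h2

variable [Finite ι] [IsAdicComplete 𝔨 K]

/-- Evaluation of formal power series at topologically nilpotent elements. -/
theorem exists_evalSeries (φ : C →+* K) (x : ι → K) (hx : ∀ i, x i ∈ 𝔨) :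
    ∃ E : MvPowerSeries ι C →+* K,
      (∀ n f, E f - MvPolynomial.eval₂ φ x (f.truncTotal n) ∈ 𝔨 ^ n) ∧
      (∀ p : MvPolynomial ι C, E p = MvPolynomial.eval₂ φ x p) := by
  classical
  let e := MvPolynomial.eval₂Hom φ x
  have he : ∀ p, e p = MvPolynomial.eval₂ φ x p := fun _ => rfl
  let F : ∀ n, MvPowerSeries ι C →+* K ⧸ 𝔨 ^ n := fun n =>
    { toFun := fun f => Ideal.Quotient.mk _ (e (f.truncTotal n))
      map_zero' := by simp
      map_one' := by
        cases n with
        | zero => exact Subsingleton.elim (h := Ideal.Quotient.subsingleton_iff.2 (by simp)) _ _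
        | succ n => rw [MvPowerSeries.truncTotal_one n.succ_ne_zero]; simp
      map_add' := fun f g => by simp
      map_mul' := fun f g => by
        rw [← map_mul, ← map_mul, Ideal.Quotient.eq, ← map_sub]
        exact eval₂_mem_pow 𝔨 hx
          (MvPowerSeries.truncTotal_mul_sub_mul_truncTotal_mem_pow_idealOfVars f g) }
  have hF : ∀ {m n : ℕ} (hle : m ≤ n), (Ideal.Quotient.factorPow 𝔨 hle).comp (F n) = F m := by
    intro m n hle
    ext f
    change Ideal.Quotient.mk _ (e (f.truncTotal n)) = Ideal.Quotient.mk _ (e (f.truncTotal m))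
    rw [Ideal.Quotient.eq, ← map_sub]
    exact eval₂_mem_pow 𝔨 hx (MvPowerSeries.truncTotal_sub_truncTotal_mem_pow_idealOfVars hle
      le_rfl f)
  let E := IsAdicComplete.liftRingHom 𝔨 F hF
  have h1 : ∀ n f, E f - MvPolynomial.eval₂ φ x (f.truncTotal n) ∈ 𝔨 ^ n := fun n f => by
    rw [← Ideal.Quotient.eq, IsAdicComplete.mk_liftRingHom]
    rfl
  refine ⟨E, h1, fun p => ?_⟩
  rw [← sub_eq_zero]
  refine eq_zero_of_forall_mem_pow (𝔨 := 𝔨) fun n => ?_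
  have h2 : MvPolynomial.eval₂ φ x ((p : MvPowerSeries ι C).truncTotal n) -
      MvPolynomial.eval₂ φ x p ∈ 𝔨 ^ n := by
    rw [← he, ← he, ← map_sub]
    refine eval₂_mem_pow 𝔨 hx ?_
    rw [MvPolynomial.mem_pow_idealOfVars_iff']
    intro d hd
    rw [MvPolynomial.coeff_sub, MvPowerSeries.coeff_truncTotal _ hd, MvPolynomial.coeff_coe,
      sub_self]
  simpa using Ideal.add_mem _ (h1 n p) h2

theorem surjective_of_evalSeries {φ : C →+* K} {x : ι → K} {E : MvPowerSeries ι C →+* K}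
    (hE : ∀ p : MvPolynomial ι C, E p = MvPolynomial.eval₂ φ x p)
    (hx : 𝔨 = Ideal.span (Set.range x)) (hφ : ∀ f, ∃ c, f - φ c ∈ 𝔨) :
    Function.Surjective E := by
  have hX : ∀ i, E (MvPowerSeries.X i) = x i := fun i => by
    rw [← MvPolynomial.coe_X, hE, MvPolynomial.eval₂_X]
  have hm : (Ideal.span (Set.range MvPowerSeries.X)).map E = 𝔨 := by
    rw [Ideal.map_span, ← Set.range_comp, hx]
    congr 2
    ext i
    exact hX i
  have : IsHausdorff ((Ideal.span (Set.range MvPowerSeries.X)).map E) K := by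
    rw [hm]; infer_instance
  refine surjective_of_mk_map_comp_surjective (I := Ideal.span (Set.range MvPowerSeries.X)) E ?_
  intro f
  obtain ⟨f, rfl⟩ := Ideal.Quotient.mk_surjective f
  obtain ⟨c, hc⟩ := hφ f
  refine ⟨MvPowerSeries.C c, ?_⟩
  rw [← MvPolynomial.coe_C, RingHom.comp_apply, hE, MvPolynomial.eval₂_C, eq_comm,
    Ideal.Quotient.eq, hm]
  exact hc

/-- A ring which is complete for a finitely generated ideal and is noetherian modulo this ideal,
through a noetherian ring of representatives, is noetherian. -/
theorem isNoetherianRing_of_complete [IsNoetherianRing C] (φ : C →+* K) (h : 𝔨.FG)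
    (hφ : ∀ f, ∃ c, f - φ c ∈ 𝔨) : IsNoetherianRing K := by
  obtain ⟨s, hs⟩ := h
  obtain ⟨E, -, hE⟩ := exists_evalSeries 𝔨 φ (fun i : s => (i : K))
    (fun i => hs ▸ Ideal.subset_span i.2)
  refine isNoetherianRing_of_surjective _ _ E (surjective_of_evalSeries 𝔨 hE ?_ hφ)
  rw [← hs]
  simp [Ideal.span]

end EvalSeries

/-! ### Integration along a derivation -/

section Integration

variable {K : Type} [CommRing K] [Algebra ℂ K] {𝔨 : Ideal K}

theorem Derivation.map_mem_pow (D : Derivation ℂ K K) (n : ℕ) {f : K} (hf : f ∈ 𝔨 ^ (n + 1)) :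
    D f ∈ 𝔨 ^ n := by
  induction n generalizing f with
  | zero => simp
  | succ n ih =>
    rw [pow_succ] at hf
    refine Submodule.mul_induction_on hf (fun x hx y hy => ?_) (fun x y hx hy => ?_)
    · rw [D.leibniz, smul_eq_mul, smul_eq_mul]
      refine Ideal.add_mem _ (Ideal.mul_mem_right _ _ hx) ?_
      rw [pow_succ']
      exact Ideal.mul_mem_mul hy (ih hx)
    · rw [map_add]; exact Ideal.add_mem _ hx hy

theorem isAdicClosed_ker [IsHausdorff 𝔨 K] (D : Derivation ℂ K K) :
    IsAdicClosed 𝔨 {f | D f = 0} := by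
  intro f hf
  refine eq_zero_of_forall_mem_pow (𝔨 := 𝔨) fun n => ?_
  obtain ⟨g, hg, h⟩ := hf (n + 1)
  have := D.map_mem_pow n h
  rwa [map_sub, show D g = 0 from hg, sub_zero] at this

variable [IsAdicComplete 𝔨 K]

theorem exists_integral (D : Derivation ℂ K K) {x : K} (hx : x ∈ 𝔨) (hD : D x = 1) (h : K) :
    ∃ v, D (x * v) = h ∧ ∀ N : Submodule ℂ K, IsAdicClosed 𝔨 (N : Set K) →
      (∀ f ∈ N, D f ∈ N) → (∀ f ∈ N, x * f ∈ N) → h ∈ N → x * v ∈ N := by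
  let c : ℕ → ℂ := fun j => (-1) ^ j / ((j + 1).factorial : ℂ)
  let a : ℕ → K := fun j => c j • (x ^ j * D^[j] h)
  have ha : ∀ n, a n ∈ 𝔨 ^ n := fun n => by
    exact Submodule.smul_of_tower_mem _ _ (Ideal.mul_mem_right _ _ (Ideal.pow_mem_pow hx n))
  obtain ⟨v, hv⟩ := exists_adic_sum a ha
  have hS : ∀ n, D (x * ∑ i ∈ Finset.range n, a i) =
      h - ((-1) ^ n / (n.factorial : ℂ)) • (x ^ n * D^[n] h) := by
    intro n
    induction n with
    | zero => simp
    | succ n ih =>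
      have e1 : x * a n = c n • (x ^ (n + 1) * D^[n] h) := by
        simp only [a, mul_smul_comm, ← mul_assoc, pow_succ']
      have e2 : D (x ^ (n + 1)) = ((n + 1 : ℕ) : ℂ) • x ^ n := by
        rw [D.leibniz_pow, hD]
        simp only [Nat.add_sub_cancel, smul_eq_mul, mul_one, nsmul_eq_mul, Nat.cast_smul_eq_nsmul]
      have f1 : (n.factorial : ℂ) ≠ 0 := by exact_mod_cast n.factorial_ne_zero
      have f2 : ((n : ℂ) + 1) ≠ 0 := by exact_mod_cast n.succ_ne_zero
      have c1 : c n * ((n + 1 : ℕ) : ℂ) = (-1) ^ n / (n.factorial : ℂ) := by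
        simp only [c, Nat.factorial_succ]
        push_cast
        field_simp
      have c2 : c n = -((-1) ^ (n + 1) / ((n + 1).factorial : ℂ)) := by
        simp only [c, pow_succ]; ring
      rw [Finset.sum_range_succ, mul_add, map_add, ih, e1, D.map_smul, D.leibniz, e2,
        smul_eq_mul, smul_eq_mul, smul_add, mul_smul_comm, smul_smul, c1,
        Function.iterate_succ_apply', c2, neg_smul, mul_comm (D^[n] h)]
      abel
  refine ⟨v, ?_, fun N hN hND hNx hh => ?_⟩
  · rw [← sub_eq_zero]
    refine eq_zero_of_forall_mem_pow (𝔨 := 𝔨) fun n => ?_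
    have h1 : D (x * (v - ∑ i ∈ Finset.range n, a i)) ∈ 𝔨 ^ n := by
      refine D.map_mem_pow n ?_
      rw [pow_succ']
      exact Ideal.mul_mem_mul hx (hv n)
    have h2 : ((-1) ^ n / (n.factorial : ℂ)) • (x ^ n * D^[n] h) ∈ 𝔨 ^ n := by
      exact Submodule.smul_of_tower_mem _ _ (Ideal.mul_mem_right _ _ (Ideal.pow_mem_pow hx n))
    have e : D (x * v) - h = D (x * (v - ∑ i ∈ Finset.range n, a i)) -
        ((-1) ^ n / (n.factorial : ℂ)) • (x ^ n * D^[n] h) := by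
      rw [mul_sub, map_sub, hS n]; ring
    rw [e]
    exact Ideal.sub_mem _ h1 h2
  · refine hN _ fun n => ⟨x * ∑ i ∈ Finset.range n, a i, ?_, ?_⟩
    · rw [Finset.mul_sum]
      refine Submodule.sum_mem _ fun j _ => ?_
      have hj : ∀ j, D^[j] h ∈ N := fun j => by
        induction j with
        | zero => exact hh
        | succ j ih => rw [Function.iterate_succ_apply']; exact hND _ ih
      have hj' : ∀ i f, f ∈ N → x ^ i * f ∈ N := fun i f hf => by
        induction i with
        | zero => simpa using hf
        | succ i ih => rw [pow_succ', mul_assoc]; exact hNx _ ih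
      simp only [a, mul_smul_comm]
      exact Submodule.smul_mem _ _ (hNx _ (hj' _ _ (hj _)))
    · rw [← mul_sub]
      exact Ideal.mul_mem_left _ _ (hv n)

end Integration

/-! ### Coordinates with commuting dual derivations -/

/-- Topologically nilpotent elements `x i` together with commuting derivations `D i` dual to
them. -/
structure FlatFrame {K : Type} [CommRing K] [Algebra ℂ K] (𝔨 : Ideal K) (ι : Type) where
  x : ι → K
  D : ι → Derivation ℂ K K
  x_mem : ∀ i, x i ∈ 𝔨
  D_self : ∀ i, D i (x i) = 1
  D_ne : ∀ i j, i ≠ j → D i (x j) = 0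
  comm : ∀ i j f, D i (D j f) = D j (D i f)

namespace FlatFrame

variable {K : Type} [CommRing K] [Algebra ℂ K] {𝔨 : Ideal K} {ι : Type} (F : FlatFrame 𝔨 ι)

/-- The subalgebra of elements killed by all derivations of a frame. -/
def flat : Subalgebra ℂ K where
  carrier := {f | ∀ i, F.D i f = 0}
  mul_mem' {f g} hf hg i := by rw [Derivation.leibniz, hf i, hg i]; simp
  add_mem' {f g} hf hg i := by rw [map_add, hf i, hg i, add_zero]
  algebraMap_mem' c i := Derivation.map_algebraMap _ _

/-- The ideal generated by the coordinates. -/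
def ideal : Ideal K := Ideal.span (Set.range F.x)

theorem x_mem_ideal (i : ι) : F.x i ∈ F.ideal := Ideal.subset_span ⟨i, rfl⟩

theorem ideal_le : F.ideal ≤ 𝔨 := Ideal.span_le.2 (by rintro _ ⟨i, rfl⟩; exact F.x_mem i)

/-- A subspace along which one can integrate. -/
structure IsStable (N : Submodule ℂ K) : Prop where
  closed : IsAdicClosed 𝔨 (N : Set K)
  D_mem : ∀ i, ∀ f ∈ N, F.D i f ∈ N
  x_mul_mem : ∀ i, ∀ f ∈ N, F.x i * f ∈ N

variable [IsAdicComplete 𝔨 K]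

theorem exists_flat [Finite ι] (f : K) : ∃ q, q ∈ F.flat ∧ f - q ∈ F.ideal ∧
    ∀ N : Submodule ℂ K, F.IsStable N → (∀ i, F.D i f ∈ N) → f - q ∈ N := by
  classical
  have := Fintype.ofFinite ι
  suffices h : ∀ s : Finset ι, ∃ q, (∀ i ∈ s, F.D i q = 0) ∧ f - q ∈ F.ideal ∧
      ∀ N : Submodule ℂ K, F.IsStable N → (∀ i, F.D i f ∈ N) → f - q ∈ N by
    obtain ⟨q, h1, h2⟩ := h Finset.univ
    exact ⟨q, fun i => h1 i (Finset.mem_univ i), h2⟩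
  intro s
  induction s using Finset.induction_on with
  | empty => exact ⟨f, by simp, by simp, fun N _ _ => by simp⟩
  | insert j s hj ih =>
    obtain ⟨q, h1, h2, h3⟩ := ih
    obtain ⟨v, hv, hN⟩ := exists_integral (F.D j) (F.x_mem j) (F.D_self j) (F.D j q)
    refine ⟨q - F.x j * v, ?_, ?_, ?_⟩
    · intro i hi
      rcases Finset.mem_insert.1 hi with rfl | hi
      · rw [map_sub, hv, sub_self]
      · have hij : i ≠ j := fun h => hj (h ▸ hi)
        have : F.x j * v ∈ LinearMap.ker (F.D i : K →ₗ[ℂ] K) := by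
          refine hN _ (isAdicClosed_ker (F.D i)) (fun g hg => ?_) (fun g hg => ?_) ?_
          · change F.D i (F.D j g) = 0
            rw [F.comm, show F.D i g = 0 from hg, map_zero]
          · change F.D i (F.x j * g) = 0
            rw [Derivation.leibniz, show F.D i g = 0 from hg, F.D_ne i j hij]
            simp
          · change F.D i (F.D j q) = 0
            rw [F.comm, h1 i hi, map_zero]
        rw [map_sub, h1 i hi, show F.D i (F.x j * v) = 0 from this, sub_zero]
    · rw [← sub_add]
      exact Ideal.add_mem _ h2 (Ideal.mul_mem_right _ _ (F.x_mem_ideal j))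
    · intro N hS hf
      have hq := h3 N hS hf
      rw [← sub_add]
      refine N.add_mem hq (hN N hS.closed (hS.D_mem j) (hS.x_mul_mem j) ?_)
      have := N.sub_mem (hf j) (hS.D_mem j _ hq)
      rwa [map_sub, sub_sub_cancel] at this

omit [IsAdicComplete 𝔨 K] in
theorem euler_sub_mem [Fintype ι] (n : ℕ) {f : K} (hf : f ∈ F.ideal ^ n) :
    ∑ i, F.x i * F.D i f - n • f ∈ F.ideal ^ (n + 1) := by
  classical
  have h0 : ∀ f, ∑ i, F.x i * F.D i f ∈ F.ideal := fun f =>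
    Ideal.sum_mem _ fun i _ => Ideal.mul_mem_right _ _ (F.x_mem_ideal i)
  have hE : ∀ f g : K, ∑ i, F.x i * F.D i (f * g) =
      f * ∑ i, F.x i * F.D i g + g * ∑ i, F.x i * F.D i f := fun f g => by
    rw [Finset.mul_sum, Finset.mul_sum, ← Finset.sum_add_distrib]
    refine Finset.sum_congr rfl fun i _ => ?_
    rw [Derivation.leibniz, smul_eq_mul, smul_eq_mul]; ring
  have h1 : ∀ f ∈ F.ideal, ∑ i, F.x i * F.D i f - f ∈ F.ideal ^ 2 := by
    intro f hf
    refine Submodule.span_induction ?_ (by simp) ?_ ?_ hf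
    · rintro _ ⟨j, rfl⟩
      have : ∑ i, F.x i * F.D i (F.x j) = F.x j := by
        rw [Finset.sum_eq_single j, F.D_self, mul_one]
        · intro i _ hij
          rw [F.D_ne i j hij, mul_zero]
        · simp
      rw [this, sub_self]
      exact Ideal.zero_mem _
    · intro f g _ _ hf hg
      have e : ∑ i, F.x i * F.D i (f + g) - (f + g) = (∑ i, F.x i * F.D i f - f) +
          (∑ i, F.x i * F.D i g - g) := by
        simp only [map_add, mul_add, Finset.sum_add_distrib]; ring
      rw [e]
      exact Ideal.add_mem _ hf hg
    · intro a f hf' hf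
      have e : ∑ i, F.x i * F.D i (a • f) - a • f = a * (∑ i, F.x i * F.D i f - f) +
          f * ∑ i, F.x i * F.D i a := by
        rw [smul_eq_mul, hE]; ring
      rw [e]
      refine Ideal.add_mem _ (Ideal.mul_mem_left _ _ hf) ?_
      rw [pow_two]
      exact Ideal.mul_mem_mul hf' (h0 a)
  induction n generalizing f with
  | zero => simpa using h0 f
  | succ n ih =>
    rw [pow_succ'] at hf
    refine Submodule.mul_induction_on hf (fun a ha b hb => ?_) (fun f g hf hg => ?_)
    · have e : ∑ i, F.x i * F.D i (a * b) - (n + 1) • (a * b) =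
          a * (∑ i, F.x i * F.D i b - n • b) + (∑ i, F.x i * F.D i a - a) * b := by
        rw [hE]; simp only [nsmul_eq_mul]; push_cast; ring
      rw [e]
      refine Ideal.add_mem _ ?_ ?_
      · rw [pow_succ' _ (n + 1)]
        exact Ideal.mul_mem_mul ha (ih hb)
      · rw [show n + 1 + 1 = 2 + n by ring, pow_add]
        exact Ideal.mul_mem_mul (h1 a ha) hb
    · have e : ∑ i, F.x i * F.D i (f + g) - (n + 1) • (f + g) =
          (∑ i, F.x i * F.D i f - (n + 1) • f) + (∑ i, F.x i * F.D i g - (n + 1) • g) := by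
        simp only [map_add, mul_add, Finset.sum_add_distrib, smul_add]; ring
      rw [e]
      exact Ideal.add_mem _ hf hg

variable [Finite ι]

theorem eq_zero_of_mem_flat {q : K} (hq : q ∈ F.flat) (hJ : q ∈ F.ideal) : q = 0 := by
  have := Fintype.ofFinite ι
  have h : ∀ n, q ∈ F.ideal ^ (n + 1) := by
    intro n
    induction n with
    | zero => simpa using hJ
    | succ n ih =>
      have h := F.euler_sub_mem (n + 1) ih
      rw [Finset.sum_eq_zero fun i _ => by rw [hq i, mul_zero], zero_sub, neg_mem_iff] at h
      have h2 := Submodule.smul_of_tower_mem (F.ideal ^ (n + 1 + 1)) ((n + 1 : ℂ)⁻¹) h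
      rw [← Nat.cast_smul_eq_nsmul ℂ, smul_smul] at h2
      have h3 : ((n : ℂ) + 1)⁻¹ * ((n + 1 : ℕ) : ℂ) = 1 := by
        push_cast
        exact inv_mul_cancel₀ (by exact_mod_cast n.succ_ne_zero)
      rwa [h3, one_smul] at h2
  refine eq_zero_of_forall_mem_pow (𝔨 := 𝔨) fun n => ?_
  exact Ideal.pow_le_pow_right n.le_succ (Ideal.pow_right_mono F.ideal_le _ (h n))

theorem flat_unique {f q q' : K} (hq : q ∈ F.flat) (hq' : q' ∈ F.flat) (h : f - q ∈ F.ideal)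
    (h' : f - q' ∈ F.ideal) : q = q' := by
  rw [← sub_eq_zero]
  refine F.eq_zero_of_mem_flat (sub_mem hq hq') ?_
  have := Ideal.sub_mem _ h' h
  simpa using this

/-- The element `F.projFun f` of the flat subalgebra with `f - F.projFun f` in the ideal of the
coordinates. -/
noncomputable def projFun (f : K) : K := (F.exists_flat f).choose

theorem projFun_mem (f : K) : F.projFun f ∈ F.flat := (F.exists_flat f).choose_spec.1

theorem sub_projFun_mem (f : K) : f - F.projFun f ∈ F.ideal := (F.exists_flat f).choose_spec.2.1

theorem sub_projFun_mem_of_stable {N : Submodule ℂ K} (hN : F.IsStable N) {f : K}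
    (hf : ∀ i, F.D i f ∈ N) : f - F.projFun f ∈ N :=
  (F.exists_flat f).choose_spec.2.2 N hN hf

theorem projFun_eq {f q : K} (hq : q ∈ F.flat) (h : f - q ∈ F.ideal) : F.projFun f = q :=
  F.flat_unique (F.projFun_mem f) hq (F.sub_projFun_mem f) h

/-- The projection to the flat subalgebra along the ideal of the coordinates. -/
noncomputable def proj : K →ₐ[ℂ] F.flat where
  toFun f := ⟨F.projFun f, F.projFun_mem f⟩
  map_one' := Subtype.ext (F.projFun_eq (one_mem _) (by simp))
  map_zero' := Subtype.ext (F.projFun_eq (zero_mem _) (by simp))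
  map_add' f g := Subtype.ext (F.projFun_eq (add_mem (F.projFun_mem f) (F.projFun_mem g)) (by
    change f + g - (F.projFun f + F.projFun g) ∈ _
    rw [add_sub_add_comm]
    exact Ideal.add_mem _ (F.sub_projFun_mem f) (F.sub_projFun_mem g)))
  map_mul' f g := Subtype.ext (F.projFun_eq (mul_mem (F.projFun_mem f) (F.projFun_mem g)) (by
    change f * g - F.projFun f * F.projFun g ∈ _
    have e : f * g - F.projFun f * F.projFun g = (f - F.projFun f) * g +
      F.projFun f * (g - F.projFun g) := by ring
    rw [e]
    exact Ideal.add_mem _ (Ideal.mul_mem_right _ _ (F.sub_projFun_mem f))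
      (Ideal.mul_mem_left _ _ (F.sub_projFun_mem g))))
  commutes' c := Subtype.ext (F.projFun_eq (Subalgebra.algebraMap_mem _ c) (by simp))

theorem sub_proj_mem (f : K) : f - F.proj f ∈ F.ideal := F.sub_projFun_mem f

theorem proj_coe (q : F.flat) : F.proj q = q := Subtype.ext (F.projFun_eq q.2 (by simp))

theorem proj_surjective : Function.Surjective F.proj := fun q => ⟨q, F.proj_coe q⟩

theorem proj_x (i : ι) : F.proj (F.x i) = 0 :=
  Subtype.ext (F.projFun_eq (zero_mem _) (by simpa using F.x_mem_ideal i))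

/-- The ideal of definition of the flat subalgebra. -/
def flatIdeal : Ideal F.flat := 𝔨.comap F.flat.val

theorem proj_mem {f : K} (hf : f ∈ 𝔨) : F.proj f ∈ F.flatIdeal := by
  have := Ideal.sub_mem _ hf (F.ideal_le (F.sub_proj_mem f))
  rwa [sub_sub_cancel] at this

theorem proj_mem_pow {n : ℕ} {f : K} (hf : f ∈ 𝔨 ^ n) : F.proj f ∈ F.flatIdeal ^ n := by
  have h : 𝔨.map (F.proj : K →+* F.flat) ≤ F.flatIdeal := by
    rw [Ideal.map_le_iff_le_comap]
    intro f hf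
    exact F.proj_mem hf
  have := Ideal.mem_map_of_mem (F.proj : K →+* F.flat) hf
  rw [Ideal.map_pow] at this
  exact Ideal.pow_right_mono h n this

theorem mem_flatIdeal_pow {n : ℕ} {q : F.flat} : q ∈ F.flatIdeal ^ n ↔ (q : K) ∈ 𝔨 ^ n := by
  constructor
  · intro h
    have h2 : F.flatIdeal.map (F.flat.val : F.flat →+* K) ≤ 𝔨 := by
      rw [Ideal.map_le_iff_le_comap]; rfl
    have := Ideal.mem_map_of_mem (F.flat.val : F.flat →+* K) h
    rw [Ideal.map_pow] at this
    exact Ideal.pow_right_mono h2 n this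
  · intro h
    have := F.proj_mem_pow h
    rwa [F.proj_coe] at this

theorem isNoetherianRing_flat [IsNoetherianRing K] : IsNoetherianRing F.flat :=
  isNoetherianRing_of_surjective K F.flat (F.proj : K →+* F.flat) F.proj_surjective

theorem isAdicComplete_flat : IsAdicComplete F.flatIdeal F.flat := by
  refine isAdicComplete_of _ (fun q hq => ?_) (fun s hs => ?_)
  · exact Subtype.ext (eq_zero_of_forall_mem_pow (𝔨 := 𝔨) fun n => F.mem_flatIdeal_pow.1 (hq n))
  · obtain ⟨L, hL⟩ := exists_adic_limit (𝔨 := 𝔨) (fun n => (s n : K))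
      fun n => by simpa using F.mem_flatIdeal_pow.1 (hs n)
    refine ⟨F.proj L, fun n => ?_⟩
    have := F.proj_mem_pow (hL n)
    rwa [map_sub, F.proj_coe] at this

theorem le_sup : 𝔨 ≤ F.ideal ⊔ F.flatIdeal.map (F.flat.val : F.flat →+* K) := by
  intro f hf
  rw [← sub_add_cancel f (F.proj f : K)]
  exact Submodule.add_mem_sup (F.sub_proj_mem f)
    (Ideal.mem_map_of_mem (F.flat.val : F.flat →+* K) (F.proj_mem hf))

/-- Polynomials in the coordinates with flat coefficients, as elements of `K`. -/
noncomputable def evalPoly : MvPolynomial ι F.flat →+* K :=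
  MvPolynomial.eval₂Hom (F.flat.val : F.flat →+* K) F.x

omit [IsAdicComplete 𝔨 K] [Finite ι] in
theorem D_evalPoly (i : ι) (p : MvPolynomial ι F.flat) :
    F.D i (F.evalPoly p) = F.evalPoly (MvPolynomial.pderiv i p) := by
  classical
  induction p using MvPolynomial.induction_on with
  | C a =>
    simp only [evalPoly, MvPolynomial.eval₂Hom_C, MvPolynomial.pderiv_C, map_zero]
    exact a.2 i
  | add p q hp hq => simp only [map_add, hp, hq]
  | mul_X p j hp =>
    have hX : F.evalPoly (MvPolynomial.X j) = F.x j := by simp [evalPoly]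
    rw [map_mul, Derivation.leibniz, hp, MvPolynomial.pderiv_mul, map_add, map_mul, map_mul, hX,
      MvPolynomial.pderiv_X, smul_eq_mul, smul_eq_mul]
    by_cases h : i = j
    · subst h
      rw [F.D_self, Pi.single_eq_same, map_one]; ring
    · rw [F.D_ne i j h, Pi.single_eq_of_ne (Ne.symm h), map_zero]; ring

theorem coeff_mem_of_evalPoly_mem {n : ℕ} {p : MvPolynomial ι F.flat}
    (hp : F.evalPoly p ∈ 𝔨 ^ n) (α : ι →₀ ℕ) : p.coeff α ∈ F.flatIdeal ^ (n - α.degree) := by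
  classical
  induction n generalizing p α with
  | zero => simp
  | succ n ih =>
    by_cases hα : α = 0
    · subst hα
      have h := F.proj_mem_pow hp
      have e : F.proj (F.evalPoly p) = p.coeff 0 := by
        have : (F.proj : K →+* F.flat).comp F.evalPoly = MvPolynomial.constantCoeff := by
          ext i
          · simp [evalPoly, F.proj_coe]
          · simp [evalPoly, F.proj_x]
        exact congrArg (fun g => g p) this
      rw [e] at h
      simpa using h
    · obtain ⟨i, hi⟩ : ∃ i, α i ≠ 0 := by
        by_contra! h
        exact hα (Finsupp.ext h)
      obtain ⟨β, rfl⟩ : ∃ β, α = β + Finsupp.single i 1 := by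
        refine ⟨α - Finsupp.single i 1, (tsub_add_cancel_of_le ?_).symm⟩
        rw [Finsupp.single_le_iff]
        exact Nat.one_le_iff_ne_zero.2 hi
      have h1 : F.evalPoly (MvPolynomial.pderiv i p) ∈ 𝔨 ^ n := by
        rw [← F.D_evalPoly]
        exact Derivation.map_mem_pow _ n hp
      have h2 := ih h1 β
      rw [MvPolynomial.coeff_pderiv] at h2
      have h3 : n + 1 - (β + Finsupp.single i 1).degree = n - β.degree := by
        rw [map_add, Finsupp.degree_single]; omega
      rw [h3]
      have h4 : ((β i : ℂ) + 1) ≠ 0 := by exact_mod_cast (β i).succ_ne_zero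
      have h5 := Submodule.smul_of_tower_mem (F.flatIdeal ^ (n - β.degree)) ((β i + 1 : ℂ)⁻¹) h2
      have h6 : MvPolynomial.coeff (β + Finsupp.single i 1) p * ((β i : F.flat) + 1) =
          ((β i : ℂ) + 1) • MvPolynomial.coeff (β + Finsupp.single i 1) p := by
        rw [Algebra.smul_def, mul_comm]; simp
      rwa [h6, smul_smul, inv_mul_cancel₀ h4, one_smul] at h5

end FlatFrame

/-! ### Topological gradings -/

/-- Weight spaces `wt e` form a topological grading of a ring `K` with its `𝔨`-adic topology:
there are continuous projections to the weight spaces, and modulo each power of `𝔨` each element is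
the sum of finitely many of its components. -/
structure TopGrading {K : Type} [CommRing K] [Algebra ℂ K] (𝔨 : Ideal K)
    (wt : ℤ → K → Prop) where
  pr : ℤ → K →ₗ[ℂ] K
  wt_iff : ∀ {e f}, wt e f ↔ pr e f = f
  wt_pr : ∀ e f, wt e (pr e f)
  pr_ne : ∀ {e e' f}, wt e f → e ≠ e' → pr e' f = 0
  pr_mem : ∀ {e n f}, f ∈ 𝔨 ^ n → pr e f ∈ 𝔨 ^ n
  exists_sum : ∀ n f, ∃ s : Finset ℤ, f - ∑ e ∈ s, pr e f ∈ 𝔨 ^ n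
  one : wt 0 1
  mul : ∀ {i j f g}, wt i f → wt j g → wt (i + j) (f * g)

namespace TopGrading

variable {K : Type} [CommRing K] [Algebra ℂ K] {𝔨 : Ideal K} {wt : ℤ → K → Prop}
  (g : TopGrading 𝔨 wt)

/-- The weight spaces. -/
def space (e : ℤ) : Submodule ℂ K where
  carrier := {f | wt e f}
  add_mem' {a b} ha hb := by
    change wt e (a + b)
    rw [g.wt_iff, map_add, g.wt_iff.1 ha, g.wt_iff.1 hb]
  zero_mem' := by
    change wt e 0
    rw [g.wt_iff, map_zero]
  smul_mem' c a ha := by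
    change wt e (c • a)
    rw [g.wt_iff, map_smul, g.wt_iff.1 ha]

include g in
theorem wt_zero (e : ℤ) : wt e 0 := (g.space e).zero_mem

include g in
theorem wt_add {e : ℤ} {a b : K} (ha : wt e a) (hb : wt e b) : wt e (a + b) :=
  (g.space e).add_mem ha hb

include g in
theorem wt_sub {e : ℤ} {a b : K} (ha : wt e a) (hb : wt e b) : wt e (a - b) :=
  (g.space e).sub_mem ha hb

include g in
theorem wt_neg {e : ℤ} {a : K} (ha : wt e a) : wt e (-a) := (g.space e).neg_mem ha

include g in
theorem wt_smul {e : ℤ} (c : ℂ) {a : K} (ha : wt e a) : wt e (c • a) := (g.space e).smul_mem c ha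

include g in
theorem wt_algebraMap (c : ℂ) : wt 0 (algebraMap ℂ K c) := by
  rw [Algebra.algebraMap_eq_smul_one]
  exact g.wt_smul c g.one

include g in
theorem wt_pow {e : ℤ} {a : K} (ha : wt e a) (n : ℕ) : wt (n * e) (a ^ n) := by
  induction n with
  | zero => simpa using g.one
  | succ n ih =>
    rw [pow_succ]
    convert! g.mul ih ha using 1
    push_cast; ring

theorem pr_self {e : ℤ} {f : K} (h : wt e f) : g.pr e f = f := g.wt_iff.1 h

theorem pr_mem_of_notMem {n : ℕ} {f : K} {s : Finset ℤ} (hs : f - ∑ e ∈ s, g.pr e f ∈ 𝔨 ^ n)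
    {e : ℤ} (he : e ∉ s) : g.pr e f ∈ 𝔨 ^ n := by
  have h := g.pr_mem (e := e) hs
  rw [map_sub, map_sum, Finset.sum_eq_zero, sub_zero] at h
  · exact h
  · intro i hi
    exact g.pr_ne (g.wt_pr i f) (fun h => he (h ▸ hi))

theorem isAdicClosed_space [IsHausdorff 𝔨 K] (e : ℤ) : IsAdicClosed 𝔨 (g.space e : Set K) := by
  intro f hf
  change wt e f
  rw [g.wt_iff, ← sub_eq_zero]
  refine eq_zero_of_forall_mem_pow (𝔨 := 𝔨) fun n => ?_
  obtain ⟨h, hh, hfh⟩ := hf n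
  have h1 := Ideal.sub_mem _ (g.pr_mem (e := e) hfh) hfh
  rwa [map_sub, g.pr_self hh, sub_sub_sub_cancel_right] at h1

theorem pr_mul [IsHausdorff 𝔨 K] {i : ℤ} {a : K} (ha : wt i a) (j : ℤ) (f : K) :
    g.pr (i + j) (a * f) = a * g.pr j f := by
  rw [← sub_eq_zero]
  refine eq_zero_of_forall_mem_pow (𝔨 := 𝔨) fun n => ?_
  obtain ⟨s, hs⟩ := g.exists_sum n f
  have h1 : g.pr (i + j) (a * (f - ∑ e ∈ s, g.pr e f)) ∈ 𝔨 ^ n :=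
    g.pr_mem (Ideal.mul_mem_left _ _ hs)
  by_cases hj : j ∈ s
  · have e1 : g.pr (i + j) (a * ∑ e ∈ s, g.pr e f) = a * g.pr j f := by
      rw [Finset.mul_sum, map_sum, Finset.sum_eq_single_of_mem j hj]
      · exact g.pr_self (g.mul ha (g.wt_pr j f))
      · intro e _ he
        exact g.pr_ne (g.mul ha (g.wt_pr e f)) (fun h => he (by omega))
    rwa [mul_sub, map_sub, e1] at h1
  · have e1 : g.pr (i + j) (a * ∑ e ∈ s, g.pr e f) = 0 := by
      rw [Finset.mul_sum, map_sum]
      refine Finset.sum_eq_zero fun e he => ?_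
      exact g.pr_ne (g.mul ha (g.wt_pr e f)) (fun h => hj ((by omega : e = j) ▸ he))
    rw [mul_sub, map_sub, e1, sub_zero] at h1
    exact Ideal.sub_mem _ h1 (Ideal.mul_mem_left _ _ (g.pr_mem_of_notMem hs hj))

include g in
theorem wt_inv [IsHausdorff 𝔨 K] {i : ℤ} {t : Kˣ} (h : wt i (t : K)) : wt (-i) (↑t⁻¹ : K) := by
  have h1 := g.pr_mul h (-i) (↑t⁻¹ : K)
  rw [add_neg_cancel, Units.mul_inv, g.pr_self g.one] at h1
  rw [g.wt_iff, ← Units.mul_right_inj t, ← h1, Units.mul_inv]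

include g in
theorem wt_zpow [IsHausdorff 𝔨 K] {i : ℤ} {t : Kˣ} (h : wt i (t : K)) (n : ℤ) :
    wt (n * i) (↑(t ^ n) : K) := by
  cases n with
  | ofNat n => simpa using g.wt_pow h n
  | negSucc n =>
    rw [zpow_negSucc]
    have h1 := g.wt_pow h (n + 1)
    rw [← Units.val_pow_eq_pow_val] at h1
    convert! g.wt_inv h1 using 1
    rw [Int.negSucc_eq]; push_cast; ring

/-- Some component of an element outside an open subgroup is outside it. -/
theorem exists_pr_notMem {N : AddSubgroup K} {n : ℕ} (hN : ∀ f ∈ 𝔨 ^ n, f ∈ N) {f : K}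
    (hf : f ∉ N) : ∃ e, g.pr e f ∉ N := by
  by_contra! h
  obtain ⟨s, hs⟩ := g.exists_sum n f
  refine hf ?_
  rw [← sub_add_cancel f (∑ e ∈ s, g.pr e f)]
  exact N.add_mem (hN _ hs) (sum_mem fun e _ => h e)

include g in
theorem mem_pow_of_sum_mem {n : ℕ} {s : Finset ℤ} {a : ℤ → K} (ha : ∀ e, wt e (a e))
    (h : ∑ e ∈ s, a e ∈ 𝔨 ^ n) {e : ℤ} (he : e ∈ s) : a e ∈ 𝔨 ^ n := by
  have h1 := g.pr_mem (e := e) h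
  rw [map_sum, Finset.sum_eq_single_of_mem e he] at h1
  · rwa [g.pr_self (ha e)] at h1
  · intro i _ hi
    exact g.pr_ne (ha i) hi

end TopGrading

namespace FlatFrame

variable {K : Type} [CommRing K] [Algebra ℂ K] {𝔨 : Ideal K} {ι : Type} (F : FlatFrame 𝔨 ι)
  {wt : ℤ → K → Prop} (g : TopGrading 𝔨 wt)

/-- The coordinates and the derivations of the frame have weight zero. -/
structure IsGraded : Prop where
  wt_x : ∀ i, wt 0 (F.x i)
  wt_D : ∀ i e f, wt e f → wt e (F.D i f)

variable {F} [IsAdicComplete 𝔨 K]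

theorem IsGraded.isStable (hF : F.IsGraded (wt := wt)) (e : ℤ) : F.IsStable (g.space e) where
  closed := g.isAdicClosed_space e
  D_mem i f hf := hF.wt_D i e f hf
  x_mul_mem i f hf := by
    have := g.mul (hF.wt_x i) hf
    rwa [zero_add] at this

include g in
theorem IsGraded.wt_proj [Finite ι] (hF : F.IsGraded (wt := wt)) {e : ℤ} {f : K} (hf : wt e f) :
    wt e (F.proj f : K) := by
  have := F.sub_projFun_mem_of_stable (hF.isStable g e) (f := f) fun i => hF.wt_D i e f hf
  have h2 := g.wt_sub hf this
  rwa [sub_sub_cancel] at h2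

end FlatFrame

/-! ### Poisson brackets and standard systems of coordinates -/

namespace PoissonBracket

variable {K : Type} [CommRing K] [Algebra ℂ K] (b : PoissonBracket K)

/-- The Hamiltonian derivation `{f, ·}`. -/
def ham (f : K) : Derivation ℂ K K where
  toLinearMap := b.bracket f
  map_one_eq_zero' := by
    have := b.leibniz f 1 1
    simpa using this
  leibniz' g h := by
    rw [b.leibniz, smul_eq_mul, smul_eq_mul]; ring

theorem ham_apply (f g : K) : b.ham f g = b.bracket f g := rfl

theorem leibniz_left (f g h : K) :
    b.bracket (f * g) h = f * b.bracket g h + b.bracket f h * g := by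
  rw [b.skew, b.leibniz, b.skew h f, b.skew h g]; ring

theorem bracket_algebraMap (f : K) (c : ℂ) : b.bracket f (algebraMap ℂ K c) = 0 :=
  (b.ham f).map_algebraMap c

theorem algebraMap_bracket (f : K) (c : ℂ) : b.bracket (algebraMap ℂ K c) f = 0 := by
  rw [b.skew, bracket_algebraMap, neg_zero]

theorem bracket_one (f : K) : b.bracket f 1 = 0 := by
  simpa using b.bracket_algebraMap f 1

theorem bracket_inv (f : K) (t : Kˣ) :
    b.bracket f (↑t⁻¹ : K) = -(↑t⁻¹ * ↑t⁻¹ * b.bracket f t) := by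
  have h := b.leibniz f (t : K) (↑t⁻¹ : K)
  rw [Units.mul_inv, b.bracket_one] at h
  have h2 : (t : K) * b.bracket f (↑t⁻¹ : K) = -(b.bracket f t * ↑t⁻¹) := by linear_combination -h
  have h3 : (↑t⁻¹ : K) * (t : K) = 1 := Units.inv_mul t
  linear_combination (↑t⁻¹ : K) * h2 - b.bracket f (↑t⁻¹ : K) * h3

theorem bracket_zpow (f : K) (t : Kˣ) (n : ℤ) :
    b.bracket f (↑(t ^ n) : K) = (n : K) * ↑(t ^ (n - 1)) * b.bracket f t := by
  have hp : ∀ n : ℕ, b.bracket f (↑(t ^ n) : K) = (n : K) * ↑(t ^ ((n : ℤ) - 1)) * b.bracket f t := by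
    intro n
    have h := (b.ham f).leibniz_pow (t : K) n
    rw [ham_apply, ham_apply] at h
    rw [Units.val_pow_eq_pow_val, h]
    cases n with
    | zero => simp
    | succ n => simp [mul_assoc]
  cases n with
  | ofNat n => simpa using hp n
  | negSucc n =>
    rw [zpow_negSucc, bracket_inv, hp (n + 1), Int.negSucc_eq]
    have : (↑(t ^ (-((n : ℤ) + 1) - 1)) : K) = ↑(t ^ (n + 1))⁻¹ * ↑(t ^ (n + 1))⁻¹ *
        ↑(t ^ (((n + 1 : ℕ) : ℤ) - 1)) := by
      rw [← Units.val_mul, ← Units.val_mul, ← zpow_natCast, ← zpow_neg, ← zpow_add, ← zpow_add]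
      congr 2
      push_cast; ring
    rw [this]
    push_cast; ring

theorem bracket_zpow_eq_zero {f : K} {t : Kˣ} (h : b.bracket f t = 0) (n : ℤ) :
    b.bracket f (↑(t ^ n) : K) = 0 := by
  rw [bracket_zpow, h, mul_zero]

end PoissonBracket

/-- Standard coordinates on a graded formal Poisson scheme. -/
structure StdSystem {K : Type} [CommRing K] [Algebra ℂ K] (b : PoissonBracket K)
    (wt : ℤ → K → Prop) (𝔨 : Ideal K) (k : ℤ) (ℓ m : ℕ) where
  t : Kˣ
  u : K
  zo : Fin m → K
  ze : Fin m → K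
  std : IsStandard b k t u zo ze
  wt_t : wt ℓ (t : K)
  wt_u : wt 0 u
  wt_zo : ∀ i, wt 0 (zo i)
  wt_ze : ∀ i, wt 0 (ze i)
  u_mem : u ∈ 𝔨
  zo_mem : ∀ i, zo i ∈ 𝔨
  ze_mem : ∀ i, ze i ∈ 𝔨

namespace StdSystem

variable {K : Type} [CommRing K] [Algebra ℂ K] {b : PoissonBracket K}
    {wt : ℤ → K → Prop} {𝔨 : Ideal K} {k : ℤ} {ℓ m : ℕ} (S : StdSystem b wt 𝔨 k ℓ m)

/-- The coordinates. -/
def x : DiskIdx m → K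
  | none => S.u
  | some (Sum.inl i) => S.zo i
  | some (Sum.inr i) => S.ze i

/-- The conjugate coordinates. -/
def conj : DiskIdx m → K
  | none => S.t
  | some (Sum.inl i) => S.ze i
  | some (Sum.inr i) => ((S.t ^ k : Kˣ) : K) * S.zo i

/-- The factors normalizing the Hamiltonian derivations of the conjugate coordinates. -/
def factor : DiskIdx m → K
  | none => -((S.t ^ (k - 1) : Kˣ) : K)
  | some (Sum.inl _) => -((S.t ^ k : Kˣ) : K)
  | some (Sum.inr _) => 1

theorem conj_t (i : DiskIdx m) : b.bracket (S.conj i) S.t = 0 := by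
  rcases i with _ | i | i
  · exact b.bracket_self _
  · rw [b.skew]; simp [conj, S.std.t_ze]
  · rw [b.skew]; simp only [conj, S.std.t_zo, neg_zero]

theorem conj_factor (i j : DiskIdx m) : b.bracket (S.conj i) (S.factor j) = 0 := by
  have h := b.bracket_zpow_eq_zero (S.conj_t i)
  rcases j with _ | j | j
  · simp only [factor, map_neg, h, neg_zero]
  · simp only [factor, map_neg, h, neg_zero]
  · exact b.bracket_one _

theorem conj_conj (i j : DiskIdx m) : ∃ c : ℂ, b.bracket (S.conj i) (S.conj j) =
    algebraMap ℂ K c := by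
  rcases i with _ | i | i <;> rcases j with _ | j | j
  · exact ⟨0, by rw [map_zero]; exact b.bracket_self _⟩
  · exact ⟨0, by rw [map_zero]; exact S.std.t_ze j⟩
  · exact ⟨0, by rw [map_zero]; exact S.std.t_zo j⟩
  · exact ⟨0, by rw [map_zero]; exact S.conj_t (some (Sum.inl i))⟩
  · exact ⟨0, by rw [map_zero]; exact S.std.ze_ze i j⟩
  · refine ⟨if j = i then -1 else 0, ?_⟩
    have := S.std.zo_ze j i
    rw [b.skew]
    simp only [conj, this]
    split_ifs <;> simp
  · exact ⟨0, by rw [map_zero]; exact S.conj_t (some (Sum.inr i))⟩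
  · refine ⟨if i = j then 1 else 0, ?_⟩
    have := S.std.zo_ze i j
    simp only [conj, this]
    split_ifs <;> simp
  · exact ⟨0, by rw [map_zero]; exact S.std.zo_zo i j⟩

theorem bracket_conj_zo (i : DiskIdx m) (j : Fin m) : b.bracket (S.conj i) (S.zo j) =
    ((S.t ^ (-k) : Kˣ) : K) * b.bracket (S.conj i) (((S.t ^ k : Kˣ) : K) * S.zo j) := by
  rw [b.leibniz, b.bracket_zpow_eq_zero (S.conj_t i), zero_mul, zero_add, ← mul_assoc,
    ← Units.val_mul, ← zpow_add]
  simp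

/-- The frame given by standard coordinates. -/
@[simps]
def frame : FlatFrame 𝔨 (DiskIdx m) where
  x := S.x
  D i := S.factor i • b.ham (S.conj i)
  x_mem i := by
    rcases i with _ | i | i
    · exact S.u_mem
    · exact S.zo_mem i
    · exact S.ze_mem i
  D_self i := by
    rw [Derivation.smul_apply, b.ham_apply, smul_eq_mul]
    rcases i with _ | i | i
    · simp only [factor, conj, x]
      rw [b.skew, S.std.u_t, neg_mul_neg, ← Units.val_mul, ← zpow_add]
      simp
    · simp only [x]
      rw [S.bracket_conj_zo]
      simp only [factor, conj]
      rw [b.skew, S.std.zo_ze, if_pos rfl, mul_neg_one, neg_mul_neg, ← Units.val_mul, ← zpow_add]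
      simp
    · simp only [factor, conj, x]
      rw [S.std.zo_ze, if_pos rfl, mul_one]
  D_ne i j hij := by
    rw [Derivation.smul_apply, b.ham_apply, smul_eq_mul]
    refine mul_eq_zero_of_right _ ?_
    rcases j with _ | j | j
    · simp only [x]
      rcases i with _ | i | i
      · exact absurd rfl hij
      · simp only [conj]; rw [b.skew, S.std.u_ze, neg_zero]
      · simp only [conj]; rw [b.skew, S.std.u_zo, neg_zero]
    · simp only [x]
      rw [S.bracket_conj_zo]
      refine mul_eq_zero_of_right _ ?_
      rcases i with _ | i | i
      · exact S.std.t_zo j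
      · simp only [conj]
        rw [b.skew, S.std.zo_ze, if_neg, neg_zero]
        rintro rfl; exact hij rfl
      · exact S.std.zo_zo i j
    · simp only [x]
      rcases i with _ | i | i
      · exact S.std.t_ze j
      · exact S.std.ze_ze i j
      · simp only [conj]
        rw [S.std.zo_ze, if_neg]
        rintro rfl; exact hij rfl
  comm i j f := by
    simp only [Derivation.smul_apply, b.ham_apply, smul_eq_mul]
    rw [b.leibniz, b.leibniz, S.conj_factor, S.conj_factor, b.jacobi]
    obtain ⟨c, hc⟩ := S.conj_conj i j
    rw [hc, b.algebraMap_bracket]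
    ring

theorem mem_flat {f : K} : f ∈ S.frame.flat ↔ b.bracket f S.t = 0 ∧
    ∀ i, b.bracket f (S.zo i) = 0 ∧ b.bracket f (S.ze i) = 0 := by
  have h1 : f ∈ S.frame.flat ↔ ∀ i, b.bracket f (S.conj i) = 0 := by
    refine forall_congr' fun i => ?_
    have hu : IsUnit (S.factor i) := by
      rcases i with _ | i | i
      · exact (Units.isUnit _).neg
      · exact (Units.isUnit _).neg
      · exact isUnit_one
    change S.factor i * b.bracket (S.conj i) f = 0 ↔ _
    rw [hu.mul_right_eq_zero, b.skew, neg_eq_zero]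
  have h2 : ∀ i, b.bracket f S.t = 0 → (b.bracket f (((S.t ^ k : Kˣ) : K) * S.zo i) = 0 ↔
      b.bracket f (S.zo i) = 0) := fun i h => by
    rw [b.leibniz, b.bracket_zpow_eq_zero h, zero_mul, zero_add, Units.mul_right_eq_zero]
  rw [h1]
  constructor
  · intro h
    exact ⟨h none, fun i => ⟨(h2 i (h none)).1 (h (some (Sum.inr i))), h (some (Sum.inl i))⟩⟩
  · rintro ⟨h, h'⟩ (_ | i | i)
    · exact h
    · exact (h' i).2
    · exact (h2 i h).2 (h' i).1

variable (g : TopGrading 𝔨 wt) {d : ℤ} (hd : d = -(k * ℓ))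
  (hb : ∀ i j f h, wt i f → wt j h → wt (i + j + d) (b.bracket f h))

include g hd hb in
theorem isGraded [IsHausdorff 𝔨 K] : S.frame.IsGraded (wt := wt) where
  wt_x i := by
    rcases i with _ | i | i
    · exact S.wt_u
    · exact S.wt_zo i
    · exact S.wt_ze i
  wt_D i e f hf := by
    change wt e (S.factor i * b.bracket (S.conj i) f)
    rcases i with _ | i | i
    · convert! g.mul (g.wt_neg (g.wt_zpow S.wt_t (k - 1))) (hb _ _ _ _ S.wt_t hf) using 1
      rw [hd]; ring
    · convert! g.mul (g.wt_neg (g.wt_zpow S.wt_t k)) (hb _ _ _ _ (S.wt_ze i) hf) using 1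
      rw [hd]; ring
    · convert! g.mul g.one (hb _ _ _ _ (g.mul (g.wt_zpow S.wt_t k) (S.wt_zo i)) hf) using 1
      rw [hd]; ring

end StdSystem

theorem Ideal.mul_mem_pow_of_le {R : Type} [CommRing R] {I : Ideal R} {a b n : ℕ} {x y : R}
    (hx : x ∈ I ^ a) (hy : y ∈ I ^ b) (h : n ≤ a + b) : x * y ∈ I ^ n := by
  refine Ideal.pow_le_pow_right h ?_
  rw [pow_add]
  exact Ideal.mul_mem_mul hx hy

namespace LaurentPolynomial

variable {R S : Type} [CommRing R] [CommRing S]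

theorem eval₂_eq_sum (f : R →+* S) (x : Sˣ) (p : R[T;T⁻¹]) :
    eval₂ f x p = p.coeff.sum fun n r => f r * ↑(x ^ n) := by
  induction p using LaurentPolynomial.induction_on' with
  | add p q hp hq =>
    rw [map_add, hp, hq, AddMonoidAlgebra.coeff_add, Finsupp.sum_add_index']
    · simp
    · intro i a b; rw [map_add, add_mul]
  | C_mul_T n a =>
    rw [eval₂_C_mul_T, ← single_eq_C_mul_T, AddMonoidAlgebra.coeff_single, Finsupp.sum_single_index]
    simp

theorem ringHom_T {S : Type} [CommRing S] (β : ℂ[T;T⁻¹] →+* S) {s : Sˣ} (hs : β (T 1) = s)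
    (n : ℤ) : β (T n) = ↑(s ^ n) := by
  have h1 : ∀ n : ℕ, β (T n) = ↑(s ^ n) := fun n => by
    have := T_pow (R := ℂ) 1 n
    rw [mul_one] at this
    rw [← this, map_pow, hs, Units.val_pow_eq_pow_val]
  cases n with
  | ofNat n => simpa using h1 n
  | negSucc n =>
    have h2 := congrArg β (T_add (R := ℂ) (Int.negSucc n) ((n + 1 : ℕ) : ℤ))
    rw [map_mul, h1 (n + 1), Int.negSucc_eq] at h2
    have h3 : (-((n : ℤ) + 1) + ((n + 1 : ℕ) : ℤ)) = 0 := by push_cast; ring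
    rw [h3, T_zero, map_one] at h2
    rw [zpow_negSucc, Int.negSucc_eq]
    exact (Units.eq_inv_of_mul_eq_one_right h2.symm)

theorem ringHom_apply_eq_sum {S : Type} [CommRing S] [Algebra ℂ S] (β : ℂ[T;T⁻¹] →+* S)
    (hβ : ∀ c, β (C c) = algebraMap ℂ S c) {s : Sˣ} (hs : β (T 1) = s) (c : ℂ[T;T⁻¹]) :
    β c = c.coeff.sum fun n r => r • (↑(s ^ n) : S) := by
  induction c using LaurentPolynomial.induction_on' with
  | add p q hp hq =>
    rw [map_add, hp, hq, AddMonoidAlgebra.coeff_add, Finsupp.sum_add_index']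
    · simp
    · intro i a b; rw [add_smul]
  | C_mul_T n a =>
    rw [map_mul, hβ, ringHom_T β hs, ← single_eq_C_mul_T, AddMonoidAlgebra.coeff_single,
      Finsupp.sum_single_index, Algebra.smul_def]
    simp

end LaurentPolynomial

namespace FlatFrame

variable {K : Type} [CommRing K] [Algebra ℂ K] {𝔨 : Ideal K} [IsAdicComplete 𝔨 K] {ι : Type}
  [Finite ι] (F : FlatFrame 𝔨 ι)

/-- A criterion for `K` to be a completed tensor product of `A`, topologically generated by
coordinates `xA` over `B'`, and `R`, where `C` is a ring of coefficients which maps to the tensor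
product and to the flat subalgebra. -/
theorem isCompletedTensor_of_coeff {B B' C A R : Type} [CommRing B] [CommRing B'] [CommRing C]
    [CommRing A] [CommRing R] [Algebra B A] [Algebra B R] [Algebra B K] (σ : A →ₐ[B] K)
    (τ : R →ₐ[B] K) (xA : ι → A) (𝔞 : Ideal A) (h𝔞 : 𝔞 = Ideal.span (Set.range xA))
    (hσ : ∀ i, σ (xA i) = F.x i) (𝔯 : Ideal R) (φ : B' →+* A) (hA : ∀ a : A, ∃ c, a - φ c ∈ 𝔞)
    (hK : ∀ f : K, ∃ c, f - σ (φ c) ∈ 𝔨) (hτ : 𝔯.map (τ : R →+* K) ≤ 𝔨)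
    (hsup : 𝔨 ≤ F.ideal ⊔ 𝔯.map (τ : R →+* K)) (κ : C →+* A ⊗[B] R) (lam : C →+* F.flat)
    (hκ : ∀ c, Algebra.TensorProduct.productMap σ τ (κ c) = lam c)
    (hκφ : ∀ c, φ c ⊗ₜ 1 ∈ κ.range) (hκR : ∀ r, 1 ⊗ₜ r ∈ κ.range)
    (hcoeff : ∀ n c, lam c ∈ F.flatIdeal ^ n → κ c ∈
      (𝔞.map (Algebra.TensorProduct.includeLeft : A →ₐ[B] A ⊗[B] R) ⊔
        𝔯.map (Algebra.TensorProduct.includeRight : R →ₐ[B] A ⊗[B] R)) ^ n) :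
    IsCompletedTensor B 𝔞 𝔯 𝔨 σ τ := by
  let inl := (Algebra.TensorProduct.includeLeft : A →ₐ[B] A ⊗[B] R)
  let inr := (Algebra.TensorProduct.includeRight : R →ₐ[B] A ⊗[B] R)
  let N : Ideal (A ⊗[B] R) := 𝔞.map inl ⊔ 𝔯.map inr
  let pm := Algebra.TensorProduct.productMap σ τ
  have hNmap : N.map pm ≤ 𝔨 := by
    rw [Ideal.map_sup, sup_le_iff, Ideal.map_le_iff_le_comap, Ideal.map_le_iff_le_comap,
      Ideal.map_le_iff_le_comap, Ideal.map_le_iff_le_comap, h𝔞, Ideal.span_le]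
    constructor
    · rintro _ ⟨i, rfl⟩
      change pm (xA i ⊗ₜ 1) ∈ 𝔨
      simp only [pm, Algebra.TensorProduct.productMap_apply_tmul, hσ, map_one, mul_one]
      exact F.x_mem i
    · intro q hq
      change pm (1 ⊗ₜ q) ∈ 𝔨
      simp only [pm, Algebra.TensorProduct.productMap_apply_tmul, map_one, one_mul]
      exact hτ (Ideal.mem_map_of_mem (τ : R →+* K) hq)
  let ev : MvPolynomial ι C →+* A ⊗[B] R :=
    MvPolynomial.eval₂Hom κ (fun i => xA i ⊗ₜ 1)
  have hpm : ∀ p, pm (ev p) = F.evalPoly (MvPolynomial.map lam p) := by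
    intro p
    have : (pm : A ⊗[B] R →+* K).comp ev = F.evalPoly.comp (MvPolynomial.map lam) := by
      refine MvPolynomial.ringHom_ext (fun c => ?_) (fun i => ?_)
      · simp [pm, ev, evalPoly, hκ]
      · simp [pm, ev, evalPoly, hσ]
    exact congrArg (fun g => g p) this
  have hN1 : ∀ i, (xA i ⊗ₜ 1 : A ⊗[B] R) ∈ N := fun i =>
    Ideal.mem_sup_left (Ideal.mem_map_of_mem inl (h𝔞 ▸ Ideal.subset_span ⟨i, rfl⟩))
  have hrange : ∀ c, κ c ∈ ev.range := fun c => ⟨MvPolynomial.C c, by simp [ev]⟩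
  have happrox : ∀ n (w : A ⊗[B] R), ∃ p, w - ev p ∈ N ^ n := by
    intro n w
    induction w using TensorProduct.induction_on with
    | zero => exact ⟨0, by simp⟩
    | add w w' hw hw' =>
      obtain ⟨p, hp⟩ := hw
      obtain ⟨p', hp'⟩ := hw'
      refine ⟨p + p', ?_⟩
      rw [map_add, add_sub_add_comm]
      exact Ideal.add_mem _ hp hp'
    | tmul a q =>
      obtain ⟨pB, hB⟩ := exists_sub_mem_pow_of_map (𝔨 := 𝔞)
        (MvPolynomial.eval₂Hom φ xA) (Ideal.span (Set.range MvPolynomial.X))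
        (by
          rw [Ideal.map_span, ← Set.range_comp, h𝔞]
          congr 2; ext i; simp)
        (fun a => by
          obtain ⟨c, hc⟩ := hA a
          exact ⟨MvPolynomial.C c, by simpa using hc⟩) n a
      have h1 : ∀ pB, inl (MvPolynomial.eval₂Hom φ xA pB) ∈ ev.range := by
        intro pB
        induction pB using MvPolynomial.induction_on with
        | C c =>
          obtain ⟨c', hc'⟩ := hκφ c
          rw [MvPolynomial.eval₂Hom_C]
          change φ c ⊗ₜ 1 ∈ ev.range
          rw [← hc']
          exact hrange c'
        | add p p' h h' => rw [map_add, map_add]; exact add_mem h h'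
        | mul_X p i h =>
          rw [map_mul, map_mul]
          refine mul_mem h ⟨MvPolynomial.X i, ?_⟩
          simp [ev, inl]
      obtain ⟨p, hp⟩ := h1 pB
      obtain ⟨c', hc'⟩ := hκR q
      refine ⟨p * MvPolynomial.C c', ?_⟩
      have e : a ⊗ₜ[B] q - ev (p * MvPolynomial.C c') =
          inl (a - MvPolynomial.eval₂Hom φ xA pB) * inr q := by
        have : ev (MvPolynomial.C c') = 1 ⊗ₜ q := by simp [ev, hc']
        rw [map_mul, hp, map_sub, sub_mul, this]
        simp [inl, inr]
      rw [e]
      refine Ideal.mul_mem_right _ _ (Ideal.pow_right_mono (le_sup_left : 𝔞.map inl ≤ N) n ?_)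
      rw [← Ideal.map_pow]
      exact Ideal.mem_map_of_mem inl hB
  have hle : ∀ n w, w ∈ N ^ n → pm w ∈ 𝔨 ^ n := fun n w hw => by
    have := Ideal.mem_map_of_mem pm hw
    rw [Ideal.map_pow] at this
    exact Ideal.pow_right_mono hNmap n this
  refine ⟨‹_›, fun n w => ⟨fun hw => ?_, hle n w⟩, fun n f => ?_⟩
  · obtain ⟨p, hp⟩ := happrox n w
    have h1 : F.evalPoly (MvPolynomial.map lam p) ∈ 𝔨 ^ n := by
      have := Ideal.sub_mem _ hw (hle n _ hp)
      change pm w - pm (w - ev p) ∈ 𝔨 ^ n at this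
      rwa [← map_sub, sub_sub_cancel, hpm] at this
    have h2 : ev p ∈ N ^ n := by
      have e : ev p = MvPolynomial.eval₂ κ (fun i => (xA i ⊗ₜ 1 : A ⊗[B] R)) p := rfl
      rw [e, MvPolynomial.eval₂_eq]
      refine Ideal.sum_mem _ fun α _ => ?_
      have h3 := F.coeff_mem_of_evalPoly_mem h1 α
      rw [MvPolynomial.coeff_map] at h3
      have h5 : ∏ i ∈ α.support, (xA i ⊗ₜ 1 : A ⊗[B] R) ^ α i ∈ N ^ α.degree := by
        have := Ideal.prod_mem_prod (s := α.support) (I := fun i => N ^ α i)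
          fun i _ => Ideal.pow_mem_pow (hN1 i) (α i)
        rwa [Finset.prod_pow_eq_pow_sum] at this
      exact Ideal.mul_mem_pow_of_le (hcoeff _ _ h3) h5 (by omega)
    have := Ideal.add_mem _ hp h2
    rwa [sub_add_cancel] at this
  · refine exists_sub_mem_pow_of_map (pm : A ⊗[B] R →+* K) N (le_antisymm hNmap ?_) ?_ n f
    · refine hsup.trans (sup_le ?_ ?_)
      · refine Ideal.span_le.2 ?_
        rintro _ ⟨i, rfl⟩
        have := Ideal.mem_map_of_mem (pm : A ⊗[B] R →+* K) (hN1 i)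
        simpa [pm, hσ] using this
      · rw [Ideal.map_le_iff_le_comap]
        intro q hq
        have := Ideal.mem_map_of_mem (pm : A ⊗[B] R →+* K)
          (Ideal.mem_sup_right (Ideal.mem_map_of_mem inr hq) : inr q ∈ N)
        simpa [pm, inr] using this
    · intro f
      obtain ⟨c, hc⟩ := hK f
      refine ⟨φ c ⊗ₜ 1, ?_⟩
      change f - pm _ ∈ 𝔨
      simpa [pm] using hc

theorem isCompletedTensor {B A : Type} [CommRing B] [CommRing A] [Algebra B A] [Algebra B F.flat]
    [Algebra B K] (σ : A →ₐ[B] K) (τ : F.flat →ₐ[B] K) (hτ : ∀ q, τ q = q) (xA : ι → A)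
    (𝔞 : Ideal A) (h𝔞 : 𝔞 = Ideal.span (Set.range xA)) (hσ : ∀ i, σ (xA i) = F.x i)
    (hA : ∀ a : A, ∃ c, a - algebraMap B A c ∈ 𝔞)
    (hK : ∀ f : K, ∃ c, f - algebraMap B K c ∈ 𝔨) :
    IsCompletedTensor B 𝔞 F.flatIdeal 𝔨 σ τ := by
  have hτ' : (τ : F.flat →+* K) = (F.flat.val : F.flat →+* K) := RingHom.ext hτ
  refine F.isCompletedTensor_of_coeff σ τ xA 𝔞 h𝔞 hσ F.flatIdeal (algebraMap B A) hA
    (fun f => by simpa using hK f) ?_ ?_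
    (Algebra.TensorProduct.includeRight : F.flat →ₐ[B] A ⊗[B] F.flat) (RingHom.id _)
    (fun c => by simp [hτ]) (fun c => ⟨algebraMap B _ c, ?_⟩) (fun r => ⟨r, rfl⟩)
    (fun n c hc => ?_)
  · rw [hτ', Ideal.map_le_iff_le_comap]; rfl
  · rw [hτ']; exact F.le_sup
  · simp only [RingHom.coe_coe, AlgHom.commutes]
    rfl
  · refine Ideal.pow_right_mono le_sup_right n ?_
    rw [← Ideal.map_pow]
    exact Ideal.mem_map_of_mem _ hc

end FlatFrame

/-- A projection from a formal scheme with functions `K` to one with functions `A`, where `A` is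
topologically generated by a unit `s` and coordinates `x` pulling back to those of a frame. -/
structure IsChartProjection {K A : Type} [CommRing K] [Algebra ℂ K] [CommRing A] [Algebra ℂ A]
    {𝔨 : Ideal K} {ι : Type} (F : FlatFrame 𝔨 ι) (𝔞 : Ideal A) (β : ℂ[T;T⁻¹] →+* A) (s : Aˣ)
    (x : ι → A) (σ : A →ₐ[ℂ] K) : Prop where
  base_C : ∀ c, β (LaurentPolynomial.C c) = algebraMap ℂ A c
  base_T : β (LaurentPolynomial.T 1) = s
  span : 𝔞 = Ideal.span (Set.range x)
  map_x : ∀ i, σ (x i) = F.x i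
  dense : ∀ a, ∃ c, a - β c ∈ 𝔞
  dense' : ∀ f, ∃ c, f - σ (β c) ∈ 𝔨

namespace FlatFrame

variable {K : Type} [CommRing K] [Algebra ℂ K] {𝔨 : Ideal K} {ι : Type} (F : FlatFrame 𝔨 ι)
  {wt : ℤ → K → Prop} (g : TopGrading 𝔨 wt)

/-- The flat elements of weight zero. -/
def zeroPart : Subalgebra ℂ K where
  carrier := {f | f ∈ F.flat ∧ wt 0 f}
  mul_mem' {a b} ha hb := ⟨mul_mem ha.1 hb.1, by simpa using g.mul ha.2 hb.2⟩
  add_mem' {a b} ha hb := ⟨add_mem ha.1 hb.1, g.wt_add ha.2 hb.2⟩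
  algebraMap_mem' c := ⟨Subalgebra.algebraMap_mem _ c, g.wt_algebraMap c⟩

theorem mem_zeroPart {f : K} : f ∈ F.zeroPart g ↔ f ∈ F.flat ∧ wt 0 f := Iff.rfl

/-- The ideal of definition of the weight zero part. -/
def zeroIdeal : Ideal (F.zeroPart g) := 𝔨.comap (F.zeroPart g).val

variable {F} [IsAdicComplete 𝔨 K]

theorem IsGraded.D_pr (hF : F.IsGraded (wt := wt)) (i : ι) (e : ℤ) (f : K) :
    F.D i (g.pr e f) = g.pr e (F.D i f) := by
  rw [← sub_eq_zero]
  refine eq_zero_of_forall_mem_pow (𝔨 := 𝔨) fun n => ?_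
  obtain ⟨s, hs⟩ := g.exists_sum (n + 1) f
  have h1 : g.pr e (F.D i (f - ∑ e ∈ s, g.pr e f)) ∈ 𝔨 ^ n :=
    g.pr_mem (Derivation.map_mem_pow _ n hs)
  by_cases he : e ∈ s
  · have e1 : g.pr e (F.D i (∑ e ∈ s, g.pr e f)) = F.D i (g.pr e f) := by
      rw [map_sum, map_sum, Finset.sum_eq_single_of_mem e he]
      · exact g.pr_self (hF.wt_D i e _ (g.wt_pr e f))
      · intro j _ hj
        exact g.pr_ne (hF.wt_D i j _ (g.wt_pr j f)) hj
    rw [map_sub, map_sub, e1, ← neg_sub, neg_mem_iff] at h1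
    exact h1
  · have e1 : g.pr e (F.D i (∑ e ∈ s, g.pr e f)) = 0 := by
      rw [map_sum, map_sum]
      refine Finset.sum_eq_zero fun j hj => ?_
      exact g.pr_ne (hF.wt_D i j _ (g.wt_pr j f)) (fun h => he (h ▸ hj))
    rw [map_sub, map_sub, e1, sub_zero] at h1
    exact Ideal.sub_mem _ (Derivation.map_mem_pow _ n (g.pr_mem_of_notMem hs he)) h1

theorem IsGraded.pr_mem_flat (hF : F.IsGraded (wt := wt)) (e : ℤ) {q : K} (hq : q ∈ F.flat) :
    g.pr e q ∈ F.flat := fun i => by rw [hF.D_pr, hq i, map_zero]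

variable [Finite ι]

/-- The projection to the weight zero part of the flat subalgebra. -/
noncomputable def zeroProj (hF : F.IsGraded (wt := wt)) (f : K) : F.zeroPart g :=
  ⟨F.proj (g.pr 0 f), (F.proj (g.pr 0 f)).2, hF.wt_proj g (g.wt_pr 0 f)⟩

theorem zeroProj_add (hF : F.IsGraded (wt := wt)) (f f' : K) :
    zeroProj g hF (f + f') = zeroProj g hF f + zeroProj g hF f' :=
  Subtype.ext (by simp [zeroProj])

theorem zeroProj_mul (hF : F.IsGraded (wt := wt)) (r : F.zeroPart g) (f : K) :
    zeroProj g hF (r * f) = r * zeroProj g hF f := by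
  refine Subtype.ext ?_
  have h := g.pr_mul r.2.2 0 f
  have h2 : F.proj (r : K) = ⟨r, r.2.1⟩ := F.proj_coe ⟨r, r.2.1⟩
  simp only [zeroProj, zero_add] at h ⊢
  rw [h, map_mul, h2]
  rfl

theorem zeroProj_coe (hF : F.IsGraded (wt := wt)) (r : F.zeroPart g) : zeroProj g hF r = r := by
  refine Subtype.ext ?_
  have h2 : F.proj (r : K) = ⟨r, r.2.1⟩ := F.proj_coe ⟨r, r.2.1⟩
  simp only [zeroProj]
  rw [g.pr_self r.2.2, h2]

theorem mem_of_mem_map (hF : F.IsGraded (wt := wt)) (J : Ideal (F.zeroPart g)) {r : F.zeroPart g}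
    (h : (r : K) ∈ J.map ((F.zeroPart g).val : F.zeroPart g →+* K)) : r ∈ J := by
  have h1 : ∀ f ∈ J.map ((F.zeroPart g).val : F.zeroPart g →+* K),
      ∀ a, zeroProj g hF (a * f) ∈ J := by
    intro f hf
    refine Submodule.span_induction ?_ ?_ ?_ ?_ hf
    · rintro _ ⟨j, hj, rfl⟩ a
      change zeroProj g hF (a * (j : K)) ∈ J
      rw [mul_comm, zeroProj_mul]
      exact Ideal.mul_mem_right _ _ hj
    · intro a
      rw [mul_zero, ← zero_mul (0 : K), ← ZeroMemClass.coe_zero (F.zeroPart g), zeroProj_mul,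
        zero_mul]
      exact J.zero_mem
    · intro x y _ _ hx hy a
      rw [mul_add, zeroProj_add]
      exact J.add_mem (hx a) (hy a)
    · intro c x _ hx a
      rw [smul_eq_mul, ← mul_assoc]
      exact hx _
  have := h1 r h 1
  rwa [one_mul, zeroProj_coe] at this

theorem isNoetherianRing_zeroPart [IsNoetherianRing K] (hF : F.IsGraded (wt := wt)) :
    IsNoetherianRing (F.zeroPart g) := by
  let φ : F.zeroPart g →+* K := (F.zeroPart g).val
  have hmono : Monotone (fun J : Ideal (F.zeroPart g) => J.map φ) := fun _ _ h => Ideal.map_mono h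
  have hinj : Function.Injective (fun J : Ideal (F.zeroPart g) => J.map φ) := by
    intro J J' h
    refine le_antisymm (fun r hr => ?_) (fun r hr => ?_)
    · refine mem_of_mem_map g hF _ ?_
      have := Ideal.mem_map_of_mem φ hr
      rwa [show J.map φ = J'.map φ from h] at this
    · refine mem_of_mem_map g hF _ ?_
      have := Ideal.mem_map_of_mem φ hr
      rwa [show J'.map φ = J.map φ from h.symm] at this
  rw [isNoetherianRing_iff, isNoetherian_iff']
  exact (hmono.strictMono_of_injective hinj).wellFoundedGT

theorem flatIdeal_le_zeroIdeal [IsNoetherianRing K] (hF : F.IsGraded (wt := wt)) {s : Kˣ}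
    (hs : (s : K) ∈ F.flat) (hws : wt 1 (s : K)) :
    F.flatIdeal.map (F.flat.val : F.flat →+* K) ≤
      (F.zeroIdeal g).map ((F.zeroPart g).val : F.zeroPart g →+* K) := by
  let M := F.flatIdeal.map (F.flat.val : F.flat →+* K)
  refine Submodule.le_of_le_smul_of_le_jacobson_bot (I := 𝔨) (IsNoetherian.noetherian M)
    (IsAdicComplete.le_jacobson_bot 𝔨) ?_
  rw [Ideal.map_le_iff_le_comap]
  intro q hq
  change (q : K) ∈ (F.zeroIdeal g).map ((F.zeroPart g).val : F.zeroPart g →+* K) ⊔ 𝔨 • M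
  obtain ⟨S, hS⟩ := g.exists_sum 2 (q : K)
  rw [← sub_add_cancel (q : K) (∑ e ∈ S, g.pr e q), add_comm]
  have hmem : ∀ e, g.pr e q ∈ F.flat := fun e => hF.pr_mem_flat g e q.2
  refine Submodule.add_mem_sup (Ideal.sum_mem _ fun e _ => ?_) ?_
  · have hsz : ∀ n : ℤ, (↑(s ^ n) : K) ∈ F.flat := fun n i => by
      have hi := hs i
      have h1 : ∀ n : ℕ, F.D i (↑(s ^ n) : K) = 0 := fun n => by
        rw [Units.val_pow_eq_pow_val, Derivation.leibniz_pow, hi]; simp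
      cases n with
      | ofNat n => simpa using h1 n
      | negSucc n =>
        have h2 := (F.D i).leibniz (↑(s ^ (n + 1)) : K) (↑(s ^ Int.negSucc n) : K)
        rw [zpow_negSucc, Units.mul_inv, Derivation.map_one_eq_zero, h1, smul_zero, add_zero,
          smul_eq_mul, eq_comm, Units.mul_right_eq_zero] at h2
        rw [zpow_negSucc]
        exact h2
    have hr : (↑(s ^ (-e)) : K) * g.pr e q ∈ F.zeroPart g := by
      refine ⟨mul_mem (hsz _) (hmem e), ?_⟩
      have := g.mul (g.wt_zpow hws (-e)) (g.wt_pr e q)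
      convert! this using 1
      ring
    have e1 : g.pr e q = (↑(s ^ e) : K) * ((↑(s ^ (-e)) : K) * g.pr e q) := by
      rw [← mul_assoc, ← Units.val_mul, ← zpow_add]; simp
    rw [e1]
    refine Ideal.mul_mem_left _ _ (Ideal.mem_map_of_mem ((F.zeroPart g).val : F.zeroPart g →+* K)
      (x := ⟨_, hr⟩) ?_)
    change _ ∈ 𝔨
    refine Ideal.mul_mem_left _ _ ?_
    have hq' : (q : K) ∈ 𝔨 ^ 1 := by rw [pow_one]; exact hq
    simpa using g.pr_mem (e := e) hq'
  · have hq2 : (q : K) - ∑ e ∈ S, g.pr e q ∈ F.flat := sub_mem q.2 (sum_mem fun e _ => hmem e)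
    have h2 : (⟨_, hq2⟩ : F.flat) ∈ F.flatIdeal ^ 2 := F.mem_flatIdeal_pow.2 hS
    have h3 := Ideal.mem_map_of_mem (F.flat.val : F.flat →+* K) h2
    rw [Ideal.map_pow, pow_two] at h3
    refine Ideal.mul_mono_left ?_ h3
    rw [Ideal.map_le_iff_le_comap]
    exact fun _ h => h

theorem mem_zeroIdeal_pow [IsNoetherianRing K] (hF : F.IsGraded (wt := wt)) {s : Kˣ}
    (hs : (s : K) ∈ F.flat) (hws : wt 1 (s : K)) {n : ℕ} {r : F.zeroPart g} :
    r ∈ F.zeroIdeal g ^ n ↔ (r : K) ∈ 𝔨 ^ n := by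
  constructor
  · intro h
    have h2 : (F.zeroIdeal g).map ((F.zeroPart g).val : F.zeroPart g →+* K) ≤ 𝔨 := by
      rw [Ideal.map_le_iff_le_comap]; rfl
    have := Ideal.mem_map_of_mem ((F.zeroPart g).val : F.zeroPart g →+* K) h
    rw [Ideal.map_pow] at this
    exact Ideal.pow_right_mono h2 n this
  · intro h
    have h1 : (⟨r, r.2.1⟩ : F.flat) ∈ F.flatIdeal ^ n := F.mem_flatIdeal_pow.2 h
    have h2 := Ideal.mem_map_of_mem (F.flat.val : F.flat →+* K) h1
    rw [Ideal.map_pow] at h2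
    have h3 := Ideal.pow_right_mono (flatIdeal_le_zeroIdeal g hF hs hws) n h2
    rw [← Ideal.map_pow] at h3
    exact mem_of_mem_map g hF _ h3

theorem isAdicComplete_zeroPart [IsNoetherianRing K] (hF : F.IsGraded (wt := wt)) {s : Kˣ}
    (hs : (s : K) ∈ F.flat) (hws : wt 1 (s : K)) :
    IsAdicComplete (F.zeroIdeal g) (F.zeroPart g) := by
  refine isAdicComplete_of _ (fun r hr => ?_) (fun a ha => ?_)
  · exact Subtype.ext (eq_zero_of_forall_mem_pow (𝔨 := 𝔨) fun n =>
      (mem_zeroIdeal_pow g hF hs hws).1 (hr n))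
  · obtain ⟨L, hL⟩ := exists_adic_limit (𝔨 := 𝔨) (fun n => (a n : K))
      fun n => by simpa using (mem_zeroIdeal_pow g hF hs hws).1 (ha n)
    refine ⟨zeroProj g hF L, fun n => ?_⟩
    rw [mem_zeroIdeal_pow g hF hs hws]
    have h1 := F.mem_flatIdeal_pow.1 (F.proj_mem_pow (g.pr_mem (e := 0) (hL n)))
    rw [map_sub, map_sub, g.pr_self (a n).2.2] at h1
    have h2 : F.proj (a n : K) = ⟨a n, (a n).2.1⟩ := F.proj_coe ⟨a n, (a n).2.1⟩
    rw [h2] at h1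
    exact h1

end FlatFrame

namespace IsChartProjection

variable {K A : Type} [CommRing K] [Algebra ℂ K] [CommRing A] [Algebra ℂ A] {𝔨 : Ideal K}
  [IsAdicComplete 𝔨 K] {ι : Type} [Finite ι] {F : FlatFrame 𝔨 ι} {𝔞 : Ideal A}
  {β : ℂ[T;T⁻¹] →+* A} {s : Aˣ} {x : ι → A} {σ : A →ₐ[ℂ] K}
  (h : IsChartProjection F 𝔞 β s x σ) {wt : ℤ → K → Prop} (g : TopGrading 𝔨 wt)
  (hF : F.IsGraded (wt := wt)) (hs : σ s ∈ F.flat) (hs' : σ ↑s⁻¹ ∈ F.flat)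
  (hws : wt 1 (σ s))

include h hF hs hs' hws in
theorem isCompletedTensor_zeroPart [IsNoetherianRing K] :
    IsCompletedTensor ℂ 𝔞 (F.zeroIdeal g) 𝔨 σ (F.zeroPart g).val := by
  let R := F.zeroPart g
  let inl := (Algebra.TensorProduct.includeLeft : A →ₐ[ℂ] A ⊗[ℂ] R)
  let inr := (Algebra.TensorProduct.includeRight : R →ₐ[ℂ] A ⊗[ℂ] R)
  let sK : Kˣ := Units.map (σ : A →+* K).toMonoidHom s
  have hsK : (sK : K) = σ s := rfl
  let sF : F.flatˣ := ⟨⟨σ s, hs⟩, ⟨σ ↑s⁻¹, hs'⟩,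
    Subtype.ext (by simp [← map_mul]), Subtype.ext (by simp [← map_mul])⟩
  let sT : (A ⊗[ℂ] R)ˣ := Units.map (inl : A →+* A ⊗[ℂ] R).toMonoidHom s
  let inc : R →+* F.flat := (Subalgebra.inclusion (fun f hf => hf.1 : R ≤ F.flat) : R →+* F.flat)
  have hsF : ∀ n : ℤ, ((↑(sF ^ n) : F.flat) : K) = ↑(sK ^ n) := fun n => by
    have : Units.map (F.flat.val : F.flat →+* K).toMonoidHom sF = sK := Units.ext rfl
    rw [← this, ← map_zpow]; rfl
  have hsT : ∀ n : ℤ, (↑(sT ^ n) : A ⊗[ℂ] R) = (↑(s ^ n) : A) ⊗ₜ 1 := fun n => by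
    change (↑(Units.map (inl : A →+* A ⊗[ℂ] R).toMonoidHom s ^ n) : A ⊗[ℂ] R) = _
    rw [← map_zpow]; rfl
  have hσs : ∀ n : ℤ, σ ↑(s ^ n) = ↑(sK ^ n) := fun n => by
    change _ = ((Units.map (σ : A →+* K).toMonoidHom s ^ n : Kˣ) : K)
    rw [← map_zpow]; rfl
  have hwsK : ∀ n : ℤ, wt n (↑(sK ^ n) : K) := fun n => by
    simpa using g.wt_zpow (t := sK) hws n
  refine F.isCompletedTensor_of_coeff σ R.val x 𝔞 h.span h.map_x (F.zeroIdeal g) β h.dense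
    h.dense' ?_ ?_ (LaurentPolynomial.eval₂ (inr : R →+* A ⊗[ℂ] R) sT)
    (LaurentPolynomial.eval₂ inc sF) ?_ ?_ ?_ ?_
  · rw [Ideal.map_le_iff_le_comap]; rfl
  · exact F.le_sup.trans (sup_le_sup le_rfl (F.flatIdeal_le_zeroIdeal g hF (s := sK) hs hws))
  · intro c
    rw [LaurentPolynomial.eval₂_eq_sum, LaurentPolynomial.eval₂_eq_sum, Finsupp.sum, Finsupp.sum,
      map_sum, AddSubmonoidClass.coe_finsetSum]
    refine Finset.sum_congr rfl fun n _ => ?_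
    rw [map_mul, hsT, MulMemClass.coe_mul, hsF]
    simp only [inr, RingHom.coe_coe, Algebra.TensorProduct.includeRight_apply,
      Algebra.TensorProduct.productMap_apply_tmul, map_one, one_mul, mul_one, hσs]
    rfl
  · intro c
    induction c using LaurentPolynomial.induction_on' with
    | add p q hp hq => rw [map_add, TensorProduct.add_tmul]; exact add_mem hp hq
    | C_mul_T n a =>
      refine ⟨LaurentPolynomial.C (algebraMap ℂ R a) * LaurentPolynomial.T n, ?_⟩
      rw [LaurentPolynomial.eval₂_C_mul_T, hsT, map_mul, h.base_C,
        LaurentPolynomial.ringHom_T β h.base_T]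
      simp only [RingHom.coe_coe, AlgHom.commutes]
      rw [Algebra.TensorProduct.algebraMap_apply, Algebra.TensorProduct.tmul_mul_tmul, mul_one]
  · intro r
    exact ⟨LaurentPolynomial.C r, LaurentPolynomial.eval₂_C _ _ _⟩
  · intro n c hc
    rw [F.mem_flatIdeal_pow, LaurentPolynomial.eval₂_eq_sum, Finsupp.sum,
      AddSubmonoidClass.coe_finsetSum] at hc
    rw [LaurentPolynomial.eval₂_eq_sum]
    refine Ideal.sum_mem _ fun j hj => Ideal.mul_mem_right _ _ ?_
    have h1 := g.mem_pow_of_sum_mem (n := n) (s := c.coeff.support)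
      (a := fun j => (c.coeff j : K) * ↑(sK ^ j))
      (fun j => by simpa using g.mul (c.coeff j).2.2 (hwsK j))
      (by
        convert! hc using 2 with j _
        rw [MulMemClass.coe_mul, hsF]
        rfl) hj
    have h2 := Ideal.mul_mem_right (↑(sK ^ (-j)) : K) _ h1
    rw [mul_assoc, ← Units.val_mul, ← zpow_add, add_neg_cancel, zpow_zero, Units.val_one,
      mul_one] at h2
    have h3 := (F.mem_zeroIdeal_pow g hF (s := sK) hs hws).2 h2
    have h4 := Ideal.mem_map_of_mem (inr : R →+* A ⊗[ℂ] R) h3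
    rw [Ideal.map_pow] at h4
    exact Ideal.pow_right_mono le_sup_right n h4

include h hws in
omit [Finite ι] in
theorem residue_zeroPart (h𝔨 : 𝔨 ≠ ⊤) :
    Function.Bijective (algebraMap ℂ (F.zeroPart g ⧸ F.zeroIdeal g)) := by
  let sK : Kˣ := Units.map (σ : A →+* K).toMonoidHom s
  have hne : F.zeroIdeal g ≠ ⊤ := fun h => h𝔨 ((Ideal.eq_top_iff_one _).2
    ((Ideal.eq_top_iff_one (F.zeroIdeal g)).1 h : (1 : K) ∈ 𝔨))
  have := Ideal.Quotient.nontrivial_iff.2 hne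
  refine ⟨(algebraMap ℂ _).injective, fun q => ?_⟩
  obtain ⟨r, rfl⟩ := Ideal.Quotient.mk_surjective q
  obtain ⟨c, hc⟩ := h.dense' r
  refine ⟨c.coeff 0, ?_⟩
  have h1 : g.pr 0 (σ (β c)) = algebraMap ℂ K (c.coeff 0) := by
    rw [LaurentPolynomial.ringHom_apply_eq_sum β h.base_C h.base_T c, Finsupp.sum, map_sum, map_sum]
    have h2 : ∀ n : ℤ, wt n (σ (↑(s ^ n) : A)) := fun n => by
      have := g.wt_zpow (t := sK) hws n
      rw [mul_one, ← map_zpow] at this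
      exact this
    rw [Finset.sum_eq_single 0]
    · rw [map_smul, g.pr_self (g.wt_smul _ (h2 0)), Algebra.algebraMap_eq_smul_one]; simp
    · intro n _ hn
      rw [map_smul]
      exact g.pr_ne (g.wt_smul _ (h2 n)) hn
    · intro h0
      simp [Finsupp.notMem_support_iff.1 h0]
  change Ideal.Quotient.mk _ (algebraMap ℂ (F.zeroPart g) (c.coeff 0)) = _
  rw [eq_comm, Ideal.Quotient.eq]
  change (r : K) - algebraMap ℂ K (c.coeff 0) ∈ 𝔨
  have h3 : (r : K) - σ (β c) ∈ 𝔨 ^ 1 := by rwa [pow_one]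
  have h4 := g.pr_mem (e := 0) h3
  rwa [map_sub, h1, g.pr_self r.2.2, pow_one] at h4

end IsChartProjection

namespace StdSystem

variable {K A : Type} [CommRing K] [Algebra ℂ K] [CommRing A] [Algebra ℂ A] {b : PoissonBracket K}
  {wt : ℤ → K → Prop} {𝔨 : Ideal K} {k : ℤ} {ℓ m : ℕ} (S : StdSystem b wt 𝔨 k ℓ m)

theorem mem_flat_iff_conj {f : K} : f ∈ S.frame.flat ↔ ∀ i, b.bracket (S.conj i) f = 0 := by
  refine forall_congr' fun i => ?_
  have hu : IsUnit (S.factor i) := by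
    rcases i with _ | i | i
    · exact (Units.isUnit _).neg
    · exact (Units.isUnit _).neg
    · exact isUnit_one
  change S.factor i * b.bracket (S.conj i) f = 0 ↔ _
  rw [hu.mul_right_eq_zero]

theorem zpow_t_mem_flat (n : ℤ) : (↑(S.t ^ n) : K) ∈ S.frame.flat :=
  S.mem_flat_iff_conj.2 fun i => b.bracket_zpow_eq_zero (S.conj_t i) n

theorem bracket_mem_flat {f h : K} (hf : f ∈ S.frame.flat) (hh : h ∈ S.frame.flat) :
    b.bracket f h ∈ S.frame.flat := by
  rw [mem_flat_iff_conj] at *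
  intro i
  rw [b.jacobi, hf i, hh i]
  simp

theorem bracket_t {f : K} (hf : f ∈ S.frame.flat) (n : ℤ) : b.bracket f ↑(S.t ^ n) = 0 :=
  b.bracket_zpow_eq_zero (S.mem_flat.1 hf).1 n

theorem bracket_u_mem_flat {f : K} (hf : f ∈ S.frame.flat) : b.bracket S.u f ∈ S.frame.flat := by
  have h0 := S.mem_flat_iff_conj.1 hf
  rw [mem_flat_iff_conj]
  intro i
  rw [b.jacobi, h0 i, map_zero, add_zero]
  rcases i with _ | i | i
  · change b.bracket (b.bracket S.t S.u) f = 0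
    rw [b.skew S.t, S.std.u_t, b.skew, map_neg, neg_neg, S.bracket_t hf]
  · change b.bracket (b.bracket (S.ze i) S.u) f = 0
    rw [b.skew (S.ze i), S.std.u_ze]; simp
  · change b.bracket (b.bracket (((S.t ^ k : Kˣ) : K) * S.zo i) S.u) f = 0
    rw [b.skew (_ * S.zo i), S.std.u_zo]; simp

theorem bracket_u_zpow (n : ℤ) :
    b.bracket S.u ↑(S.t ^ n) = (n : K) * ↑(S.t ^ (n - k)) := by
  rw [b.bracket_zpow, S.std.u_t, mul_assoc, ← Units.val_mul, ← zpow_add]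
  congr 3
  rw [show n - 1 + (1 - k) = n - k by ring]

theorem zpow_cancel (f : K) : (↑(S.t ^ (-k)) : K) * (↑(S.t ^ k) * f) = f := by
  rw [← mul_assoc, ← Units.val_mul, ← zpow_add]; simp

/-- The Poisson bracket on the flat subalgebra. -/
def flatBracket : PoissonBracket S.frame.flat where
  bracket := LinearMap.mk₂ ℂ (fun f h => ⟨b.bracket f h, S.bracket_mem_flat f.2 h.2⟩)
    (fun _ _ _ => Subtype.ext (by simp)) (fun _ _ _ => Subtype.ext (by simp))
    (fun _ _ _ => Subtype.ext (by simp)) (fun _ _ _ => Subtype.ext (by simp))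
  bracket_self f := Subtype.ext (b.bracket_self _)
  leibniz f g h := Subtype.ext (b.leibniz _ _ _)
  jacobi f g h := Subtype.ext (b.jacobi _ _ _)

/-- The derivation `t ^ k * {u, ·}` of the flat subalgebra. -/
def flatXi : Derivation ℂ S.frame.flat S.frame.flat where
  toFun f := ⟨↑(S.t ^ k) * b.bracket S.u f,
    mul_mem (S.zpow_t_mem_flat k) (S.bracket_u_mem_flat f.2)⟩
  map_add' f h := Subtype.ext (by simp [mul_add])
  map_smul' c f := Subtype.ext (by simp)
  map_one_eq_zero' := Subtype.ext (by simp [b.bracket_one])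
  leibniz' f h := Subtype.ext (by
    simp only [MulMemClass.coe_mul, LinearMap.coe_mk, AddHom.coe_mk, smul_eq_mul,
      AddMemClass.coe_add, b.leibniz]
    ring)

theorem coe_flatBracket (f h : S.frame.flat) : (S.flatBracket.bracket f h : K) = b.bracket f h :=
  rfl

theorem coe_flatXi (f : S.frame.flat) : (S.flatXi f : K) = ↑(S.t ^ k) * b.bracket S.u f := rfl

variable (g : TopGrading 𝔨 wt) {d : ℤ} (hd : d = -(k * ℓ))
  (hb : ∀ i j f h, wt i f → wt j h → wt (i + j + d) (b.bracket f h)) [IsAdicComplete 𝔨 K]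

include g hd hb in
theorem wt_zpow_mul_bracket {i j : ℤ} {f h : K} (hf : wt i f) (hh : wt j h) :
    wt (i + j) (↑(S.t ^ k) * b.bracket f h) := by
  convert! g.mul (g.wt_zpow S.wt_t k) (hb i j f h hf hh) using 1
  rw [hd]; ring

/-- The Poisson bracket `t ^ k * {·, ·}` on the flat elements of weight zero. -/
def zeroBracket : PoissonBracket (S.frame.zeroPart g) where
  bracket := LinearMap.mk₂ ℂ (fun f h => ⟨↑(S.t ^ k) * b.bracket f h,
      mul_mem (S.zpow_t_mem_flat k) (S.bracket_mem_flat f.2.1 h.2.1),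
      by simpa using S.wt_zpow_mul_bracket g hd hb f.2.2 h.2.2⟩)
    (fun _ _ _ => Subtype.ext (by simp [mul_add])) (fun _ _ _ => Subtype.ext (by simp))
    (fun _ _ _ => Subtype.ext (by simp [mul_add])) (fun _ _ _ => Subtype.ext (by simp))
  bracket_self f := Subtype.ext (by simp [b.bracket_self])
  leibniz f g h := Subtype.ext (by simp [b.leibniz]; ring)
  jacobi f f' h := Subtype.ext (by
    have h1 := S.bracket_t f.2.1 k
    have h2 := S.bracket_t h.2.1 k
    rw [b.skew, neg_eq_zero] at h2
    have h3 := S.bracket_t f'.2.1 k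
    simp only [LinearMap.mk₂_apply, AddMemClass.coe_add, b.leibniz, b.leibniz_left, h1, h2, h3,
      b.jacobi (f : K) f' h]
    ring)

/-- The derivation `t ^ k * {u, ·}` of the algebra of flat elements of weight zero. -/
def zeroXi : Derivation ℂ (S.frame.zeroPart g) (S.frame.zeroPart g) where
  toFun f := ⟨↑(S.t ^ k) * b.bracket S.u f,
    mul_mem (S.zpow_t_mem_flat k) (S.bracket_u_mem_flat f.2.1),
    by simpa using S.wt_zpow_mul_bracket g hd hb S.wt_u f.2.2⟩
  map_add' f h := Subtype.ext (by simp [mul_add])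
  map_smul' c f := Subtype.ext (by simp)
  map_one_eq_zero' := Subtype.ext (by simp [b.bracket_one])
  leibniz' f h := Subtype.ext (by
    simp only [MulMemClass.coe_mul, LinearMap.coe_mk, AddHom.coe_mk, smul_eq_mul,
      AddMemClass.coe_add, b.leibniz]
    ring)

theorem coe_zeroBracket (f h : S.frame.zeroPart g) :
    ((S.zeroBracket g hd hb).bracket f h : K) = ↑(S.t ^ k) * b.bracket f h := rfl

theorem coe_zeroXi (f : S.frame.zeroPart g) :
    (S.zeroXi g hd hb f : K) = ↑(S.t ^ k) * b.bracket S.u f := rfl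

variable [IsNoetherianRing K] {𝔞 : Ideal A} {β : ℂ[T;T⁻¹] →+* A} {s : Aˣ} {x : DiskIdx m → A}
  {σ : A →ₐ[ℂ] K} (h : IsChartProjection S.frame 𝔞 β s x σ)

include hd hb h in
theorem isEquivariantSlice (hs : σ s ∈ S.frame.flat) (hs' : σ ↑s⁻¹ ∈ S.frame.flat)
    (hws : wt 1 (σ s)) (h𝔨 : 𝔨 ≠ ⊤) :
    IsEquivariantSlice b wt 𝔨 𝔞 σ k S.t S.u S.zo S.ze (S.frame.zeroPart g) where
  mem_iff f := by
    rw [FlatFrame.mem_zeroPart, S.mem_flat, and_comm]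
  noetherian := FlatFrame.isNoetherianRing_zeroPart g (S.isGraded g hd hb)
  complete := FlatFrame.isAdicComplete_zeroPart g (S.isGraded g hd hb)
    (s := Units.map (σ : A →+* K).toMonoidHom s) hs hws
  residue := h.residue_zeroPart g hws h𝔨
  product := h.isCompletedTensor_zeroPart g (S.isGraded g hd hb) hs hs' hws
  bivector := by
    refine ⟨S.zeroBracket g hd hb, S.zeroXi g hd hb, fun f f' => ?_, fun f => ?_, fun f f' => ?_⟩
    · rw [coe_zeroBracket, S.zpow_cancel]
    · rw [coe_zeroXi, S.zpow_cancel]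
    · refine Subtype.ext ?_
      have h1 := S.bracket_t f.2.1 k
      have h2 := S.bracket_t f'.2.1 k
      rw [b.skew, neg_eq_zero] at h2
      have h3 : (((k : ℂ) • (S.zeroBracket g hd hb).bracket f f' : S.frame.zeroPart g) : K) =
        (k : K) * (↑(S.t ^ k) * b.bracket f f') := by
        rw [← map_intCast (algebraMap ℂ K) k, ← Algebra.smul_def]; rfl
      simp only [AddMemClass.coe_add, h3, coe_zeroBracket, coe_zeroXi, b.leibniz,
        b.leibniz_left, h1, h2, b.jacobi S.u, S.bracket_u_zpow, sub_self, zpow_zero, Units.val_one]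
      ring

include g hd hb h in
theorem isFiberedSlice (hs : σ s = S.t) :
    IsFiberedSlice b wt 𝔨 𝔞 β σ k S.t S.u S.zo S.ze S.frame.flat where
  mem_iff f := S.mem_flat
  noetherian := S.frame.isNoetherianRing_flat
  complete := S.frame.isAdicComplete_flat
  graded n f := by
    have hF := S.isGraded g hd hb
    obtain ⟨I, hI⟩ := g.exists_sum n (f : K)
    refine ⟨I, fun e => ⟨g.pr e f, hF.pr_mem_flat g e f.2⟩, fun e _ => g.wt_pr e f, ?_⟩
    refine S.frame.mem_flatIdeal_pow.2 ?_
    simpa using hI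
  product := by
    have hmem : ∀ c, σ (β c) ∈ S.frame.flat := fun c => by
      have hst : Units.map (σ : A →+* K).toMonoidHom s = S.t := Units.ext hs
      rw [LaurentPolynomial.ringHom_apply_eq_sum β h.base_C h.base_T c, Finsupp.sum, map_sum]
      refine sum_mem fun n _ => ?_
      rw [map_smul]
      refine Subalgebra.smul_mem _ ?_ _
      have := S.zpow_t_mem_flat n
      rw [← hst, ← map_zpow] at this
      exact this
    let γ : ℂ[T;T⁻¹] →+* S.frame.flat := RingHom.codRestrict ((σ : A →+* K).comp β) _ hmem
    refine ⟨γ, fun c => rfl, ?_⟩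
    let _ := β.toAlgebra
    let _ := γ.toAlgebra
    let _ := ((σ : A →+* K).comp β).toAlgebra
    exact S.frame.isCompletedTensor (⟨σ, fun _ => rfl⟩ : A →ₐ[ℂ[T;T⁻¹]] K)
      (⟨S.frame.flat.val, fun _ => rfl⟩ : S.frame.flat →ₐ[ℂ[T;T⁻¹]] K) (fun _ => rfl) x 𝔞 h.span
      h.map_x h.dense h.dense'
  bivector := by
    have hst : Units.map (σ : A →+* K).toMonoidHom s = S.t := Units.ext hs
    refine ⟨S.flatBracket, S.flatXi, fun f f' => rfl, fun f c => ?_, fun f => ?_,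
      fun e f hf => ?_, fun f f' => ?_⟩
    · rw [LaurentPolynomial.ringHom_apply_eq_sum β h.base_C h.base_T c, Finsupp.sum, map_sum,
        map_sum]
      refine Finset.sum_eq_zero fun n _ => ?_
      have := S.bracket_t f.2 n
      rw [← hst, ← map_zpow] at this
      rw [map_smul, map_smul]
      change c.coeff n • b.bracket f (σ ↑(s ^ n)) = 0
      rw [show b.bracket (f : K) (σ ↑(s ^ n)) = 0 from this, smul_zero]
    · rw [coe_flatXi, S.zpow_cancel]
    · rw [coe_flatXi]
      simpa using S.wt_zpow_mul_bracket g hd hb S.wt_u hf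
    · refine Subtype.ext ?_
      have h1 := S.bracket_t f.2 k
      have h2 := S.bracket_t f'.2 k
      rw [b.skew, neg_eq_zero] at h2
      simp only [AddMemClass.coe_add, coe_flatBracket, coe_flatXi, b.leibniz,
        b.leibniz_left, h1, h2, b.jacobi S.u]
      ring

end StdSystem

/-! ### Structure of the root cover -/

namespace RootCover

section Basis

variable {K : Type} [CommRing K] [Algebra ℂ K] {t : K} {ℓ : ℕ}

/-- The monomial `c * s ^ i`. -/
noncomputable def mono (t : K) (ℓ i : ℕ) : K →ₗ[ℂ] RootCover t ℓ where
  toFun c := AdjoinRoot.of _ c * AdjoinRoot.root _ ^ i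
  map_add' a b := by rw [map_add, add_mul]
  map_smul' c a := by
    have : AdjoinRoot.of (Polynomial.X ^ ℓ - Polynomial.C t) (c • a) =
      c • AdjoinRoot.of (Polynomial.X ^ ℓ - Polynomial.C t) a :=
      map_smul (IsScalarTower.toAlgHom ℂ K (RootCover t ℓ)) c a
    rw [this, smul_mul_assoc]; rfl

theorem mono_apply (i : ℕ) (c : K) :
    mono t ℓ i c = AdjoinRoot.of _ c * AdjoinRoot.root _ ^ i := rfl

theorem of_eq_mono (c : K) :
    AdjoinRoot.of (Polynomial.X ^ ℓ - Polynomial.C t) c = mono t ℓ 0 c := by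
  rw [mono_apply, pow_zero, mul_one]

theorem root_eq_mono : AdjoinRoot.root (Polynomial.X ^ ℓ - Polynomial.C t) = mono t ℓ 1 1 := by
  rw [mono_apply, pow_one, map_one, one_mul]

theorem one_eq_mono : (1 : RootCover t ℓ) = mono t ℓ 0 1 := by
  rw [mono_apply, pow_zero, map_one, one_mul]

omit [Algebra ℂ K] in
theorem root_pow : (AdjoinRoot.root _ : RootCover t ℓ) ^ ℓ = AdjoinRoot.of _ t := by
  have h2 := AdjoinRoot.eval₂_root (Polynomial.X ^ ℓ - Polynomial.C t : K[X])
  simp only [Polynomial.eval₂_sub, Polynomial.eval₂_X_pow, Polynomial.eval₂_C] at h2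
  exact sub_eq_zero.1 h2

theorem mono_mul_mono (i j : ℕ) (c e : K) :
    mono t ℓ i c * mono t ℓ j e = mono t ℓ (i + j) (c * e) := by
  simp only [mono_apply, map_mul, pow_add]; ring

theorem mono_add_self (i : ℕ) (c : K) : mono t ℓ (i + ℓ) c = mono t ℓ i (t * c) := by
  simp only [mono_apply, pow_add, root_pow, map_mul]; ring

theorem twist_mono (ζ : rootsOfUnity ℓ ℂ) (i : ℕ) (c : K) :
    twist t ℓ ζ (mono t ℓ i c) = mono t ℓ i (((ζ : ℂˣ) : ℂ) ^ i • c) := by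
  have h1 : twist t ℓ ζ (AdjoinRoot.root _) = ((ζ : ℂˣ) : ℂ) • AdjoinRoot.root _ :=
    AdjoinRoot.liftAlgHom_root _ _ _ _
  have h2 : twist t ℓ ζ (AdjoinRoot.of _ c) = AdjoinRoot.of _ c :=
    AdjoinRoot.liftAlgHom_of _ _ _ _ _
  rw [map_smul, mono_apply, map_mul, map_pow, h1, h2, smul_pow, mul_smul_comm]

theorem map_mono {A : Type} [CommRing A] [Algebra ℂ A] (σ : A →ₐ[ℂ] K) (t : A) (i : ℕ) (a : A) :
    map σ t ℓ (mono t ℓ i a) = mono (σ t) ℓ i (σ a) := by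
  have h1 : map σ t ℓ (AdjoinRoot.root _) = AdjoinRoot.root _ := by
    simp [map]
  have h2 : map σ t ℓ (AdjoinRoot.of _ a) = AdjoinRoot.of _ (σ a) := by
    simp [map]
  rw [mono_apply, map_mul, map_pow, h1, h2, mono_apply]

omit [Algebra ℂ K] in
theorem monic (hℓ : 0 < ℓ) : (Polynomial.X ^ ℓ - Polynomial.C t : K[X]).Monic :=
  Polynomial.monic_X_pow_sub_C t hℓ.ne'

variable (hℓ : 0 < ℓ)

/-- The coefficient of `s ^ i`. -/
noncomputable def coeff (t : K) (i : ℕ) : RootCover t ℓ →ₗ[ℂ] K where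
  toFun x := (AdjoinRoot.modByMonicHom (monic hℓ) x).coeff i
  map_add' x y := by rw [map_add, Polynomial.coeff_add]
  map_smul' c x := by
    rw [← algebraMap_smul K c x, map_smul, Polynomial.coeff_smul, algebraMap_smul]; rfl

variable [Nontrivial K]

theorem coeff_mono {i : ℕ} (hi : i < ℓ) (j : ℕ) (c : K) :
    coeff hℓ t j (mono t ℓ i c) = if j = i then c else 0 := by
  have h1 : mono t ℓ i c = AdjoinRoot.mk (Polynomial.X ^ ℓ - Polynomial.C t)
      (Polynomial.C c * Polynomial.X ^ i) := by
    rw [map_mul, map_pow, AdjoinRoot.mk_C, AdjoinRoot.mk_X, mono_apply]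
  change (AdjoinRoot.modByMonicHom (monic hℓ) (mono t ℓ i c)).coeff j = _
  rw [h1, AdjoinRoot.modByMonicHom_mk, (Polynomial.modByMonic_eq_self_iff (monic hℓ)).2,
    Polynomial.coeff_C_mul_X_pow]
  rw [Polynomial.degree_X_pow_sub_C hℓ]
  exact (Polynomial.degree_C_mul_X_pow_le i c).trans_lt (by exact_mod_cast hi)

theorem sum_mono_coeff (x : RootCover t ℓ) :
    x = ∑ i ∈ Finset.range ℓ, mono t ℓ i (coeff hℓ t i x) := by
  obtain ⟨p, rfl⟩ := AdjoinRoot.mk_surjective x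
  have h1 := AdjoinRoot.mk_leftInverse (monic (t := t) hℓ)
    (AdjoinRoot.mk (Polynomial.X ^ ℓ - Polynomial.C t) p)
  have h2 : (p %ₘ (Polynomial.X ^ ℓ - Polynomial.C t)).natDegree < ℓ := by
    have := Polynomial.natDegree_modByMonic_lt p (monic (t := t) hℓ) (by
      intro h
      have := congrArg Polynomial.natDegree h
      rw [Polynomial.natDegree_X_pow_sub_C, Polynomial.natDegree_one] at this
      omega)
    rwa [Polynomial.natDegree_X_pow_sub_C] at this
  rw [AdjoinRoot.modByMonicHom_mk] at h1
  conv_lhs => rw [← h1, (p %ₘ (Polynomial.X ^ ℓ - Polynomial.C t)).as_sum_range' ℓ h2]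
  rw [map_sum]
  refine Finset.sum_congr rfl fun i _ => ?_
  rw [← Polynomial.C_mul_X_pow_eq_monomial, map_mul, map_pow, AdjoinRoot.mk_C, AdjoinRoot.mk_X,
    mono_apply]
  rfl

theorem ext_coeff {x y : RootCover t ℓ} (h : ∀ i < ℓ, coeff hℓ t i x = coeff hℓ t i y) : x = y := by
  rw [sum_mono_coeff hℓ x, sum_mono_coeff hℓ y]
  exact Finset.sum_congr rfl fun i hi => by rw [h i (Finset.mem_range.1 hi)]

theorem coeff_sum_mono (f : ℕ → K) {j : ℕ} (hj : j < ℓ) :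
    coeff hℓ t j (∑ i ∈ Finset.range ℓ, mono t ℓ i (f i)) = f j := by
  rw [map_sum, Finset.sum_eq_single_of_mem j (Finset.mem_range.2 hj)]
  · rw [coeff_mono hℓ hj, if_pos rfl]
  · intro i hi hij
    rw [coeff_mono hℓ (Finset.mem_range.1 hi), if_neg hij.symm]

include hℓ in
@[elab_as_elim]
theorem induction_mono {P : RootCover t ℓ → Prop} (x : RootCover t ℓ) (h0 : P 0)
    (hadd : ∀ x y, P x → P y → P (x + y)) (hmono : ∀ i c, P (mono t ℓ i c)) : P x := by
  rw [sum_mono_coeff hℓ x]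
  exact Finset.sum_induction _ P hadd h0 fun i _ => hmono _ _

theorem coeff_zero_of (c : K) : coeff hℓ t 0 (AdjoinRoot.of _ c) = c := by
  rw [of_eq_mono, coeff_mono hℓ hℓ, if_pos rfl]

omit [Nontrivial K] in
theorem coeff_of_mul (i : ℕ) (c : K) (x : RootCover t ℓ) :
    coeff hℓ t i (AdjoinRoot.of _ c * x) = c * coeff hℓ t i x := by
  have : AdjoinRoot.of _ c * x = c • x := by rw [Algebra.smul_def]; rfl
  rw [this]
  change (AdjoinRoot.modByMonicHom (monic hℓ) (c • x)).coeff i = _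
  rw [map_smul, Polynomial.coeff_smul]; rfl

theorem mem_map_iff (J : Ideal K) (x : RootCover t ℓ) :
    x ∈ J.map (AdjoinRoot.of _) ↔ ∀ i < ℓ, coeff hℓ t i x ∈ J := by
  constructor
  · intro hx
    suffices h : ∀ a, ∀ i < ℓ, coeff hℓ t i (x * a) ∈ J by simpa using h 1
    refine Submodule.span_induction ?_ ?_ ?_ ?_ hx
    · rintro _ ⟨j, hj, rfl⟩ a i _
      rw [coeff_of_mul]
      exact Ideal.mul_mem_right _ _ hj
    · intro a i _; simp
    · intro x y _ _ hx hy a i hi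
      rw [add_mul, map_add]
      exact J.add_mem (hx a i hi) (hy a i hi)
    · intro c x _ hx a i hi
      rw [smul_eq_mul, mul_comm c, mul_assoc]
      exact hx _ i hi
  · intro h
    rw [sum_mono_coeff hℓ x]
    refine Ideal.sum_mem _ fun i hi => Ideal.mul_mem_right _ _ ?_
    exact Ideal.mem_map_of_mem _ (h i (Finset.mem_range.1 hi))

variable {𝔨 : Ideal K}

theorem mem_map_pow_iff {n : ℕ} (x : RootCover t ℓ) :
    x ∈ (𝔨.map (AdjoinRoot.of _)) ^ n ↔ ∀ i < ℓ, coeff hℓ t i x ∈ 𝔨 ^ n := by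
  rw [← Ideal.map_pow, mem_map_iff hℓ]

include hℓ in
theorem of_mem_map_pow_iff {n : ℕ} (f : K) :
    (AdjoinRoot.of _ f : RootCover t ℓ) ∈ (𝔨.map (AdjoinRoot.of _)) ^ n ↔ f ∈ 𝔨 ^ n := by
  rw [mem_map_pow_iff hℓ]
  constructor
  · intro h; simpa [coeff_zero_of] using h 0 hℓ
  · intro h i _
    rw [of_eq_mono, coeff_mono hℓ hℓ]
    split_ifs
    · exact h
    · exact Ideal.zero_mem _

include hℓ in
theorem isAdicComplete [IsAdicComplete 𝔨 K] :
    IsAdicComplete (𝔨.map (AdjoinRoot.of (Polynomial.X ^ ℓ - Polynomial.C t)))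
      (RootCover t ℓ) := by
  refine isAdicComplete_of _ (fun x hx => ext_coeff hℓ fun i hi => ?_) (fun a ha => ?_)
  · rw [map_zero]
    exact eq_zero_of_forall_mem_pow (𝔨 := 𝔨) fun n => (mem_map_pow_iff hℓ x).1 (hx n) i hi
  · have h : ∀ i, ∃ L, i < ℓ → ∀ n, L - coeff hℓ t i (a n) ∈ 𝔨 ^ n := fun i => by
      by_cases hi : i < ℓ
      · obtain ⟨L, hL⟩ := exists_adic_limit (𝔨 := 𝔨) (fun n => coeff hℓ t i (a n))
          fun n => by simpa using (mem_map_pow_iff hℓ _).1 (ha n) i hi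
        exact ⟨L, fun _ => hL⟩
      · exact ⟨0, fun h => absurd h hi⟩
    choose L hL using h
    refine ⟨∑ i ∈ Finset.range ℓ, mono t ℓ i (L i), fun n => ?_⟩
    rw [mem_map_pow_iff hℓ]
    intro i hi
    rw [map_sub, coeff_sum_mono hℓ _ hi]
    exact hL i hi n

include hℓ in
theorem injective_of : Function.Injective
    (AdjoinRoot.of (Polynomial.X ^ ℓ - Polynomial.C t : K[X])) := fun a c h => by
  rw [← coeff_zero_of (t := t) hℓ a, h, coeff_zero_of]

include hℓ in
theorem invariants (x : RootCover t ℓ) :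
    (∀ ζ, twist t ℓ ζ x = x) ↔ ∃ f, AdjoinRoot.of _ f = x := by
  constructor
  · intro h
    refine ⟨coeff hℓ t 0 x, ext_coeff hℓ fun i hi => ?_⟩
    rw [of_eq_mono, coeff_mono hℓ hℓ]
    split_ifs with h0
    · rw [h0]
    · have hp := Complex.isPrimitiveRoot_exp ℓ hℓ.ne'
      have := NeZero.of_pos hℓ
      have h1 := h hp.toRootsOfUnity
      rw [sum_mono_coeff hℓ x, map_sum] at h1
      simp only [twist_mono] at h1
      have h2 := congrArg (coeff hℓ t i) h1
      rw [coeff_sum_mono hℓ _ hi, coeff_sum_mono hℓ _ hi] at h2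
      have h3 := hp.pow_ne_one_of_pos_of_lt h0 hi
      have h4 : (Complex.exp (2 * Real.pi * Complex.I / ℓ) ^ i - 1) • coeff hℓ t i x = 0 := by
        rw [sub_smul, one_smul, sub_eq_zero]
        exact h2
      have h5 := congrArg ((Complex.exp (2 * Real.pi * Complex.I / ℓ) ^ i - 1)⁻¹ • ·) h4
      simp only [smul_smul, inv_mul_cancel₀ (sub_ne_zero.2 h3), one_smul, smul_zero] at h5
      exact h5.symm
  · rintro ⟨f, rfl⟩ ζ
    rw [of_eq_mono, twist_mono, pow_zero, one_smul]

end Basis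

section Grading

variable {K : Type} [CommRing K] [Algebra ℂ K] [Nontrivial K] {t : K} {ℓ : ℕ} (hℓ : 0 < ℓ)
  {𝔨 : Ideal K} {wt : ℤ → K → Prop} (g : TopGrading 𝔨 wt)

include hℓ in
theorem isWeight_iff (d : ℤ) (x : RootCover t ℓ) :
    IsWeight t ℓ wt d x ↔ ∀ i < ℓ, wt (d - i) (coeff hℓ t i x) := by
  constructor
  · rintro ⟨f, hf, rfl⟩ i hi
    have h := coeff_sum_mono (t := t) hℓ (fun i => if h : i < ℓ then f ⟨i, h⟩ else 0) hi
    rw [Finset.sum_range] at h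
    simp only [Fin.is_lt, dite_true, hi] at h
    change wt _ (coeff hℓ t i (∑ i : Fin ℓ, mono t ℓ i (f i)))
    rw [h]
    exact hf ⟨i, hi⟩
  · intro h
    refine ⟨fun i => coeff hℓ t i x, fun i => h i i.2, ?_⟩
    conv_lhs => rw [sum_mono_coeff hℓ x, Finset.sum_range]
    rfl

variable (ht : wt ℓ t)

include hℓ g ht in
theorem isWeight_mono {d : ℤ} (i : ℕ) {c : K} (hc : wt (d - i) c) :
    IsWeight t ℓ wt d (mono t ℓ i c) := by
  induction i using Nat.strong_induction_on generalizing c with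
  | _ i ih =>
    by_cases hi : i < ℓ
    · rw [isWeight_iff hℓ]
      intro j _
      rw [coeff_mono hℓ hi]
      split_ifs with h
      · rw [h]; exact hc
      · exact g.wt_zero _
    · obtain ⟨j, rfl⟩ := Nat.exists_eq_add_of_le (not_lt.1 hi)
      rw [add_comm, mono_add_self]
      refine ih j (by omega) ?_
      convert! g.mul ht hc using 1
      push_cast; ring

include hℓ in
theorem weight_of (g : TopGrading 𝔨 wt) (e : ℤ) (f : K) :
    wt e f ↔ IsWeight t ℓ wt e (AdjoinRoot.of _ f) := by
  rw [isWeight_iff hℓ]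
  constructor
  · intro h i _
    rw [of_eq_mono, coeff_mono hℓ hℓ]
    split_ifs with h0
    · subst h0; simpa using h
    · exact g.wt_zero _
  · intro h
    have := h 0 hℓ
    rw [coeff_zero_of] at this
    simpa using this

/-- The components of an element of the cover. -/
noncomputable def pr (d : ℤ) : RootCover t ℓ →ₗ[ℂ] RootCover t ℓ :=
  ∑ i ∈ Finset.range ℓ, (mono t ℓ i).comp ((g.pr (d - i)).comp (coeff hℓ t i))

theorem coeff_pr (d : ℤ) (x : RootCover t ℓ) {i : ℕ} (hi : i < ℓ) :
    coeff hℓ t i (pr hℓ g d x) = g.pr (d - i) (coeff hℓ t i x) := by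
  rw [pr, LinearMap.sum_apply]
  exact coeff_sum_mono hℓ (fun i => g.pr (d - i) (coeff hℓ t i x)) hi

include hℓ g ht in
theorem isWeight_mul {d e : ℤ} {x y : RootCover t ℓ} (hx : IsWeight t ℓ wt d x)
    (hy : IsWeight t ℓ wt e y) : IsWeight t ℓ wt (d + e) (x * y) := by
  rw [isWeight_iff hℓ] at hx hy
  have hs : ∀ (I : Finset ℕ) (f : ℕ → RootCover t ℓ),
      (∀ i ∈ I, IsWeight t ℓ wt (d + e) (f i)) → IsWeight t ℓ wt (d + e) (∑ i ∈ I, f i) := by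
    intro I f hf
    rw [isWeight_iff hℓ]
    intro j hj
    rw [map_sum]
    exact sum_mem (S := g.space _) fun i hi => (isWeight_iff hℓ _ _).1 (hf i hi) j hj
  rw [sum_mono_coeff hℓ x, sum_mono_coeff hℓ y, Finset.sum_mul_sum]
  refine hs _ _ fun i hi => hs _ _ fun j hj => ?_
  rw [mono_mul_mono]
  refine isWeight_mono hℓ g ht _ ?_
  convert! g.mul (hx i (Finset.mem_range.1 hi)) (hy j (Finset.mem_range.1 hj)) using 1
  push_cast; ring

/-- The grading of the cover. -/
noncomputable def topGrading :
    TopGrading (𝔨.map (AdjoinRoot.of (Polynomial.X ^ ℓ - Polynomial.C t))) (IsWeight t ℓ wt) where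
  pr := pr hℓ g
  wt_iff {d x} := by
    rw [isWeight_iff hℓ]
    constructor
    · intro h
      refine ext_coeff hℓ fun i hi => ?_
      rw [coeff_pr hℓ g d x hi, g.pr_self (h i hi)]
    · intro h i hi
      rw [← h, coeff_pr hℓ g d x hi]
      exact g.wt_pr _ _
  wt_pr d x := by
    rw [isWeight_iff hℓ]
    intro i hi
    rw [coeff_pr hℓ g d x hi]
    exact g.wt_pr _ _
  pr_ne {e e' x} hx he := by
    rw [isWeight_iff hℓ] at hx
    refine ext_coeff hℓ fun i hi => ?_
    rw [coeff_pr hℓ g e' x hi, g.pr_ne (hx i hi) (by omega), map_zero]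
  pr_mem {e n x} hx := by
    rw [mem_map_pow_iff hℓ] at hx ⊢
    intro i hi
    rw [coeff_pr hℓ g e x hi]
    exact g.pr_mem (hx i hi)
  exists_sum n x := by
    choose s hs using fun i => g.exists_sum n (coeff hℓ t i x)
    have key : ∀ i < ℓ, ∀ S : Finset ℤ, (∀ e ∈ s i, e + i ∈ S) →
        coeff hℓ t i x - ∑ e ∈ S, g.pr (e - i) (coeff hℓ t i x) ∈ 𝔨 ^ n := by
      intro i hi S hS
      have h1 : ∑ e ∈ S, g.pr (e - i) (coeff hℓ t i x) =
          ∑ e ∈ S.image (fun e => e - (i : ℤ)), g.pr e (coeff hℓ t i x) :=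
        (Finset.sum_image (g := fun e : ℤ => e - (i : ℤ))
          (f := fun e => g.pr e (coeff hℓ t i x)) (by intro a _ b _ h; simpa using h)).symm
      have h2 : s i ⊆ S.image (fun e => e - (i : ℤ)) := fun e he =>
        Finset.mem_image.2 ⟨e + i, hS e he, by ring⟩
      rw [h1, ← Finset.sum_sdiff h2, add_comm, ← sub_sub]
      exact Ideal.sub_mem _ (hs i) (Ideal.sum_mem _ fun e he =>
        g.pr_mem_of_notMem (hs i) (Finset.mem_sdiff.1 he).2)
    refine ⟨(Finset.range ℓ).biUnion fun i => (s i).image fun e => e + (i : ℤ), ?_⟩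
    rw [mem_map_pow_iff hℓ]
    intro i hi
    rw [map_sub, map_sum, Finset.sum_congr rfl fun e _ => coeff_pr hℓ g e x hi]
    refine key i hi _ fun e he => ?_
    exact Finset.mem_biUnion.2 ⟨i, Finset.mem_range.2 hi, Finset.mem_image.2 ⟨e, he, rfl⟩⟩
  one := by
    rw [one_eq_mono]
    exact isWeight_mono hℓ g ht 0 (by simpa using g.one)
  mul := isWeight_mul hℓ g ht

end Grading

end RootCover

namespace RootCover

variable {K : Type} [CommRing K] [Algebra ℂ K] (b : PoissonBracket K) (t : Kˣ) (ℓ : ℕ)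

/-- The coefficient of the bracket of the monomials `c * s ^ i` and `e * s ^ j`. -/
noncomputable def monoBracket (i j : ℕ) : K →ₗ[ℂ] K →ₗ[ℂ] K :=
  LinearMap.mk₂ ℂ (fun c e => b.bracket c e + algebraMap ℂ K (ℓ : ℂ)⁻¹ * ↑t⁻¹ *
      (i * c * b.bracket t e + j * e * b.bracket c t))
    (fun _ _ _ => by simp only [map_add, LinearMap.add_apply]; ring)
    (fun r c e => by
      rw [map_smul, LinearMap.smul_apply, LinearMap.smul_apply]
      simp only [Algebra.smul_def]; ring)
    (fun _ _ _ => by simp only [map_add]; ring)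
    (fun r c e => by
      rw [map_smul, map_smul]
      simp only [Algebra.smul_def]; ring)

theorem monoBracket_apply (i j : ℕ) (c e : K) : monoBracket b t ℓ i j c e =
    b.bracket c e + algebraMap ℂ K (ℓ : ℂ)⁻¹ * ↑t⁻¹ *
      (i * c * b.bracket t e + j * e * b.bracket c t) := rfl

theorem monoBracket_skew (i j : ℕ) (c e : K) :
    monoBracket b t ℓ i j c e = - monoBracket b t ℓ j i e c := by
  rw [monoBracket_apply, monoBracket_apply, b.skew c e, b.skew t e, b.skew c t]
  ring

theorem monoBracket_mul (i j k : ℕ) (c e f : K) : monoBracket b t ℓ i (j + k) c (e * f) =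
    monoBracket b t ℓ i j c e * f + e * monoBracket b t ℓ i k c f := by
  simp only [monoBracket_apply, b.leibniz]
  push_cast
  ring

theorem monoBracket_jacobi (i j k : ℕ) (c e f : K) :
    monoBracket b t ℓ i (j + k) c (monoBracket b t ℓ j k e f) =
      monoBracket b t ℓ (i + j) k (monoBracket b t ℓ i j c e) f +
        monoBracket b t ℓ j (i + k) e (monoBracket b t ℓ i k c f) := by
  have hnat : ∀ (x : K) (n : ℕ), b.bracket x (n : K) = 0 := fun x n => by
    simpa using b.bracket_algebraMap x (n : ℂ)
  have hnat' : ∀ (x : K) (n : ℕ), b.bracket (n : K) x = 0 := fun x n => by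
    simpa using b.algebraMap_bracket x (n : ℂ)
  have hinv' : ∀ x : K, b.bracket (↑t⁻¹ : K) x = -(↑t⁻¹ * ↑t⁻¹ * b.bracket (t : K) x) := fun x => by
    rw [b.skew, b.bracket_inv, b.skew t]; ring
  simp only [monoBracket_apply, map_add, LinearMap.add_apply, b.leibniz, b.leibniz_left, hnat,
    hnat', hinv', b.bracket_inv, b.bracket_algebraMap, b.algebraMap_bracket, b.bracket_self]
  push_cast
  generalize algebraMap ℂ K (ℓ : ℂ)⁻¹ = q
  have h1 := b.jacobi c e f
  have h2 := b.jacobi t e f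
  have h3 := b.jacobi c t f
  have h4 := b.jacobi c e t
  have s1 := b.skew c t
  have s2 := b.skew e t
  have s4 := b.skew e c
  have s5 := b.skew (b.bracket t c) t
  have s6 := b.skew (b.bracket t e) t
  have s8 := b.skew (b.bracket c e) t
  simp only [s1, s2, map_neg, LinearMap.neg_apply, s5, s6, s8, s4] at h1 h2 h3 h4 ⊢
  linear_combination h1 + (i : K) * q * (↑t⁻¹ : K) * c * h2 + (j : K) * q * (↑t⁻¹ : K) * e * h3 +
    (k : K) * q * (↑t⁻¹ : K) * f * h4

theorem monoBracket_mul_t (hℓ : 0 < ℓ) (i j : ℕ) (c e : K) :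
    monoBracket b t ℓ i j (t * c) e = t * monoBracket b t ℓ (i + ℓ) j c e := by
  have h : algebraMap ℂ K (ℓ : ℂ)⁻¹ * (ℓ : K) = 1 := by
    rw [← map_natCast (algebraMap ℂ K), ← map_mul, inv_mul_cancel₀ (by exact_mod_cast hℓ.ne'),
      map_one]
  have h2 := Units.mul_inv t
  simp only [monoBracket_apply, b.leibniz_left, b.bracket_self]
  push_cast
  linear_combination -(c * b.bracket (t : K) e * (t : K) * ↑t⁻¹) * h - (c * b.bracket (t : K) e) * h2

variable {ℓ} (hℓ : 0 < ℓ)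

/-- The extension of a Poisson bracket to the cover, as a bilinear map. -/
noncomputable def bracketMap :
    RootCover (t : K) ℓ →ₗ[ℂ] RootCover (t : K) ℓ →ₗ[ℂ] RootCover (t : K) ℓ :=
  ∑ i ∈ Finset.range ℓ, ∑ j ∈ Finset.range ℓ,
    ((monoBracket b t ℓ i j).compr₂ (mono (t : K) ℓ (i + j))).compl₁₂
      (coeff hℓ (t : K) i) (coeff hℓ (t : K) j)

variable [Nontrivial K]

theorem bracketMap_mono (i j : ℕ) (c e : K) :
    bracketMap b t hℓ (mono (t : K) ℓ i c) (mono (t : K) ℓ j e) =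
      mono (t : K) ℓ (i + j) (monoBracket b t ℓ i j c e) := by
  have h0 : ∀ i < ℓ, ∀ j < ℓ, ∀ c e,
      bracketMap b t hℓ (mono (t : K) ℓ i c) (mono (t : K) ℓ j e) =
        mono (t : K) ℓ (i + j) (monoBracket b t ℓ i j c e) := by
    intro i hi j hj c e
    simp only [bracketMap, LinearMap.sum_apply, LinearMap.compl₁₂_apply, LinearMap.compr₂_apply,
      coeff_mono hℓ hi, coeff_mono hℓ hj]
    rw [Finset.sum_eq_single_of_mem i (Finset.mem_range.2 hi),
      Finset.sum_eq_single_of_mem j (Finset.mem_range.2 hj), if_pos rfl, if_pos rfl]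
    · intro k _ hk; rw [if_neg hk, map_zero, map_zero]
    · intro k _ hk; simp [if_neg hk]
  have h1 : ∀ i, ∀ j < ℓ, ∀ c e,
      bracketMap b t hℓ (mono (t : K) ℓ i c) (mono (t : K) ℓ j e) =
        mono (t : K) ℓ (i + j) (monoBracket b t ℓ i j c e) := by
    intro i
    induction i using Nat.strong_induction_on with
    | _ i ih =>
      intro j hj c e
      by_cases hi : i < ℓ
      · exact h0 i hi j hj c e
      · obtain ⟨k, rfl⟩ := Nat.exists_eq_add_of_le' (not_lt.1 hi)
        rw [mono_add_self, ih k (by omega) j hj, monoBracket_mul_t b t ℓ hℓ, ← mono_add_self,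
          add_right_comm]
  induction j using Nat.strong_induction_on generalizing e with
  | _ j ih =>
    by_cases hj : j < ℓ
    · exact h1 i j hj c e
    · obtain ⟨k, rfl⟩ := Nat.exists_eq_add_of_le' (not_lt.1 hj)
      rw [mono_add_self, ih k (by omega), monoBracket_skew, monoBracket_mul_t b t ℓ hℓ, ← mul_neg,
        ← monoBracket_skew, ← mono_add_self, add_assoc]

/-- The extension of a Poisson bracket to the cover. -/
noncomputable def bracket : PoissonBracket (RootCover (t : K) ℓ) where
  bracket := bracketMap b t hℓ
  bracket_self f := by
    have ind := @induction_mono K _ _ (t : K) ℓ hℓ _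
    have hs : ∀ x y, bracketMap b t hℓ x y + bracketMap b t hℓ y x = 0 := by
      intro x y
      induction x using ind with
      | h0 => simp
      | hadd x x' h h' =>
        rw [map_add, map_add, LinearMap.add_apply, add_add_add_comm, h, h', add_zero]
      | hmono i c =>
        induction y using ind with
        | h0 => simp
        | hadd x x' h h' =>
          rw [map_add, map_add, LinearMap.add_apply, add_add_add_comm, h, h', add_zero]
        | hmono j e =>
          rw [bracketMap_mono, bracketMap_mono, add_comm j, ← map_add, monoBracket_skew,
            neg_add_cancel, map_zero]
    have h2 := hs f f
    rw [← two_smul ℂ] at h2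
    have h3 := congrArg ((2 : ℂ)⁻¹ • ·) h2
    simpa [smul_smul] using h3
  leibniz f x y := by
    have ind := @induction_mono K _ _ (t : K) ℓ hℓ _
    induction f using ind with
    | h0 => simp
    | hadd f f' h h' => simp only [map_add, LinearMap.add_apply, h, h']; ring
    | hmono i c =>
      induction x using ind with
      | h0 => simp
      | hadd f f' h h' => simp only [map_add, add_mul, h, h']; ring
      | hmono j e =>
        induction y using ind with
        | h0 => simp
        | hadd f f' h h' => simp only [map_add, mul_add, h, h']; ring
        | hmono k f =>
          simp only [mono_mul_mono, bracketMap_mono, monoBracket_mul, map_add]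
          rw [← add_assoc, add_left_comm j i k, ← add_assoc]
  jacobi f x y := by
    have ind := @induction_mono K _ _ (t : K) ℓ hℓ _
    induction f using ind with
    | h0 => simp
    | hadd f f' h h' => simp only [map_add, LinearMap.add_apply, h, h']; abel
    | hmono i c =>
      induction x using ind with
      | h0 => simp
      | hadd f f' h h' => simp only [map_add, LinearMap.add_apply, h, h']; abel
      | hmono j e =>
        induction y using ind with
        | h0 => simp
        | hadd f f' h h' => simp only [map_add, h, h']; abel
        | hmono k f =>
          simp only [bracketMap_mono]
          rw [monoBracket_jacobi, map_add, ← add_assoc, add_left_comm j i k, ← add_assoc]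

theorem bracket_mono (i j : ℕ) (c e : K) :
    (bracket b t hℓ).bracket (mono (t : K) ℓ i c) (mono (t : K) ℓ j e) =
      mono (t : K) ℓ (i + j) (monoBracket b t ℓ i j c e) := bracketMap_mono b t hℓ i j c e

theorem bracket_of (f h : K) :
    (bracket b t hℓ).bracket (AdjoinRoot.of _ f) (AdjoinRoot.of _ h) =
      AdjoinRoot.of _ (b.bracket f h) := by
  rw [of_eq_mono, of_eq_mono, of_eq_mono, bracket_mono, monoBracket_apply]
  simp

theorem bracket_twist (ζ : rootsOfUnity ℓ ℂ) (x y : RootCover (t : K) ℓ) :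
    (bracket b t hℓ).bracket (twist (t : K) ℓ ζ x) (twist (t : K) ℓ ζ y) =
      twist (t : K) ℓ ζ ((bracket b t hℓ).bracket x y) := by
  have ind := @induction_mono K _ _ (t : K) ℓ hℓ _
  induction x using ind with
  | h0 => simp
  | hadd f f' h h' => simp only [map_add, LinearMap.add_apply, h, h']
  | hmono i c =>
    induction y using ind with
    | h0 => simp
    | hadd f f' h h' => simp only [map_add, h, h']
    | hmono j e =>
      rw [twist_mono, twist_mono, bracket_mono, bracket_mono, twist_mono, map_smul, map_smul,
        map_smul, LinearMap.smul_apply, map_smul, map_smul, smul_smul, ← pow_add, add_comm j]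

variable {𝔨 : Ideal K} {wt : ℤ → K → Prop} (g : TopGrading 𝔨 wt) (ht : wt ℓ (t : K)) {d : ℤ}
  (hb : ∀ i j f h, wt i f → wt j h → wt (i + j + d) (b.bracket f h)) [IsHausdorff 𝔨 K]

include g ht hb in
theorem isWeight_bracket (i j : ℤ) (x y : RootCover (t : K) ℓ)
    (hx : IsWeight (t : K) ℓ wt i x) (hy : IsWeight (t : K) ℓ wt j y) :
    IsWeight (t : K) ℓ wt (i + j + d) ((bracket b t hℓ).bracket x y) := by
  let gc := topGrading hℓ g ht
  rw [isWeight_iff hℓ] at hx hy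
  rw [sum_mono_coeff hℓ x, sum_mono_coeff hℓ y, map_sum (bracket b t hℓ).bracket,
    LinearMap.sum_apply]
  refine sum_mem (S := gc.space (i + j + d)) fun a ha => ?_
  rw [map_sum]
  refine sum_mem (S := gc.space (i + j + d)) fun a' ha' => ?_
  rw [bracket_mono]
  refine isWeight_mono hℓ g ht _ ?_
  have hx := hx a (Finset.mem_range.1 ha)
  have hy := hy a' (Finset.mem_range.1 ha')
  have hti := g.wt_inv ht
  have hq : wt (-ℓ) (algebraMap ℂ K (ℓ : ℂ)⁻¹ * ↑t⁻¹) := by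
    rw [← Algebra.smul_def]; exact g.wt_smul _ hti
  have hn : ∀ (n : ℕ) {e : ℤ} {f : K}, wt e f → wt e (n * f) := fun n e f hf => by
    have := g.wt_smul (n : ℂ) hf
    rwa [Algebra.smul_def, map_natCast] at this
  rw [monoBracket_apply, mul_add]
  refine g.wt_add ?_ (g.wt_add ?_ ?_)
  · convert! hb _ _ _ _ hx hy using 1
    push_cast; ring
  · convert! g.mul hq (g.mul (hn a hx) (hb _ _ _ _ ht hy)) using 1
    push_cast; ring
  · convert! g.mul hq (g.mul (hn a' hy) (hb _ _ _ _ hx ht)) using 1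
    push_cast; ring

include hℓ g ht in
omit [IsHausdorff 𝔨 K] in
theorem isWeight_twist (ζ : rootsOfUnity ℓ ℂ) {e : ℤ} {x : RootCover (t : K) ℓ}
    (hx : IsWeight (t : K) ℓ wt e x) : IsWeight (t : K) ℓ wt e (twist (t : K) ℓ ζ x) := by
  rw [isWeight_iff hℓ] at hx
  rw [sum_mono_coeff hℓ x, map_sum]
  refine sum_mem (S := (topGrading hℓ g ht).space e) fun a ha => ?_
  rw [twist_mono]
  exact isWeight_mono hℓ g ht _ (g.wt_smul _ (hx a (Finset.mem_range.1 ha)))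

end RootCover

namespace StdSystem

variable {K : Type} [CommRing K] [Algebra ℂ K] [Nontrivial K] {b : PoissonBracket K}
  {wt : ℤ → K → Prop} {𝔨 : Ideal K} {k : ℤ} {ℓ m : ℕ} (S : StdSystem b wt 𝔨 k ℓ m)
  (hℓ : 0 < ℓ) (g : TopGrading 𝔨 wt)

/-- Standard coordinates on the cover. -/
noncomputable def cover : StdSystem (RootCover.bracket b S.t hℓ)
    (RootCover.IsWeight (S.t : K) ℓ wt)
    (𝔨.map (AdjoinRoot.of (Polynomial.X ^ ℓ - Polynomial.C (S.t : K)))) k ℓ m where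
  t := Units.map (AdjoinRoot.of _).toMonoidHom S.t
  u := AdjoinRoot.of _ S.u
  zo i := AdjoinRoot.of _ (S.zo i)
  ze i := AdjoinRoot.of _ (S.ze i)
  std := by
    have hz : ∀ n : ℤ, (↑((Units.map (AdjoinRoot.of
        (Polynomial.X ^ ℓ - Polynomial.C (S.t : K))).toMonoidHom S.t) ^ n) : RootCover (S.t : K) ℓ)
        = AdjoinRoot.of _ (↑(S.t ^ n) : K) := fun n => by rw [← map_zpow]; rfl
    have ht : (↑((Units.map (AdjoinRoot.of
        (Polynomial.X ^ ℓ - Polynomial.C (S.t : K))).toMonoidHom S.t)) : RootCover (S.t : K) ℓ)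
        = AdjoinRoot.of _ (S.t : K) := rfl
    constructor
    · rw [hz, ht, RootCover.bracket_of, S.std.u_t]
    all_goals intro i
    · rw [hz, ← map_mul, RootCover.bracket_of, S.std.u_zo, map_zero]
    · rw [RootCover.bracket_of, S.std.u_ze, map_zero]
    · rw [hz, ht, ← map_mul, RootCover.bracket_of, S.std.t_zo, map_zero]
    · rw [ht, RootCover.bracket_of, S.std.t_ze, map_zero]
    all_goals intro j
    · rw [hz, ← map_mul, ← map_mul, RootCover.bracket_of, S.std.zo_zo, map_zero]
    · rw [RootCover.bracket_of, S.std.ze_ze, map_zero]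
    · rw [hz, ← map_mul, RootCover.bracket_of, S.std.zo_ze]
      split_ifs <;> simp
  wt_t := (RootCover.weight_of hℓ g _ _).1 S.wt_t
  wt_u := (RootCover.weight_of hℓ g _ _).1 S.wt_u
  wt_zo i := (RootCover.weight_of hℓ g _ _).1 (S.wt_zo i)
  wt_ze i := (RootCover.weight_of hℓ g _ _).1 (S.wt_ze i)
  u_mem := Ideal.mem_map_of_mem _ S.u_mem
  zo_mem i := Ideal.mem_map_of_mem _ (S.zo_mem i)
  ze_mem i := Ideal.mem_map_of_mem _ (S.ze_mem i)

end StdSystem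

namespace RootCover

variable {K : Type} [CommRing K] [Algebra ℂ K] (t : Kˣ) {ℓ : ℕ} (hℓ : 0 < ℓ)

/-- The root of the unit `t`, as a unit. -/
noncomputable def rootUnit : (RootCover (t : K) ℓ)ˣ where
  val := AdjoinRoot.root _
  inv := AdjoinRoot.of _ (↑t⁻¹ : K) * AdjoinRoot.root _ ^ (ℓ - 1)
  val_inv := by
    rw [mul_left_comm, ← pow_succ', Nat.sub_add_cancel hℓ, root_pow, ← map_mul, Units.inv_mul,
      map_one]
  inv_val := by
    rw [mul_assoc, ← pow_succ, Nat.sub_add_cancel hℓ, root_pow, ← map_mul, Units.inv_mul, map_one]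

omit [Algebra ℂ K] in
theorem of_zpow (n : ℤ) :
    (AdjoinRoot.of _ (↑(t ^ n) : K) : RootCover (t : K) ℓ) = ↑(rootUnit t hℓ ^ (ℓ * n)) := by
  have h : Units.map (AdjoinRoot.of
      (Polynomial.X ^ ℓ - Polynomial.C (t : K))).toMonoidHom t = rootUnit t hℓ ^ ℓ :=
    Units.ext root_pow.symm
  rw [zpow_mul, zpow_natCast, ← h, ← map_zpow]
  rfl

include hℓ in
theorem dense [Nontrivial K] {𝔫 : Ideal K} (γ : ℂ[T;T⁻¹] →+* K)
    (hC : ∀ c, γ (LaurentPolynomial.C c) = algebraMap ℂ K c) (hT : γ (LaurentPolynomial.T 1) = t)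
    (hγ : ∀ f, ∃ c, f - γ c ∈ 𝔫) (γ' : ℂ[T;T⁻¹] →+* RootCover (t : K) ℓ)
    (hC' : ∀ c, γ' (LaurentPolynomial.C c) = algebraMap ℂ _ c)
    (hT' : γ' (LaurentPolynomial.T 1) = AdjoinRoot.root _) (x : RootCover (t : K) ℓ) :
    ∃ c, x - γ' c ∈ 𝔫.map (AdjoinRoot.of (Polynomial.X ^ ℓ - Polynomial.C (t : K))) := by
  have ind := @induction_mono K _ _ (t : K) ℓ hℓ _
  induction x using ind with
  | h0 => exact ⟨0, by simp⟩
  | hadd x y hx hy =>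
    obtain ⟨c, hc⟩ := hx
    obtain ⟨e, he⟩ := hy
    refine ⟨c + e, ?_⟩
    rw [map_add, add_sub_add_comm]
    exact Ideal.add_mem _ hc he
  | hmono i f =>
    have h1 : ∀ e, AdjoinRoot.of (Polynomial.X ^ ℓ - Polynomial.C (t : K)) (γ e) ∈ γ'.range := by
      intro e
      induction e using LaurentPolynomial.induction_on' with
      | add p q hp hq => rw [map_add, map_add]; exact add_mem hp hq
      | C_mul_T n a =>
        refine ⟨LaurentPolynomial.C a * LaurentPolynomial.T (ℓ * n), ?_⟩
        rw [map_mul, map_mul, map_mul, hC, hC', LaurentPolynomial.ringHom_T γ hT,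
          LaurentPolynomial.ringHom_T γ' (s := rootUnit t hℓ) hT', of_zpow t hℓ]
        rfl
    obtain ⟨e, he⟩ := hγ f
    obtain ⟨c, hc⟩ := h1 e
    refine ⟨c * LaurentPolynomial.T 1 ^ i, ?_⟩
    rw [map_mul, map_pow, hT', hc, mono_apply, ← sub_mul, ← map_sub]
    exact Ideal.mul_mem_right _ _ (Ideal.mem_map_of_mem _ he)

end RootCover

namespace StdSystem

variable {K A : Type} [CommRing K] [Algebra ℂ K] [CommRing A] [Algebra ℂ A] {b : PoissonBracket K}
  {wt : ℤ → K → Prop} {𝔨 : Ideal K} {k : ℤ} {ℓ m : ℕ} (S : StdSystem b wt 𝔨 k ℓ m)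
  (g : TopGrading 𝔨 wt) {d : ℤ} (hd : d = -(k * ℓ)) (hℓ : 0 < ℓ)
  (hb : ∀ i j f h, wt i f → wt j h → wt (i + j + d) (b.bracket f h)) [IsAdicComplete 𝔨 K]
  [IsNoetherianRing K] {𝔞 : Ideal A} {β : ℂ[T;T⁻¹] →+* A}
  {σ : A →ₐ[ℂ] K}

omit [IsAdicComplete 𝔨 K] [IsNoetherianRing K] in
theorem cover_conj [Nontrivial K] (i : DiskIdx m) :
    (S.cover hℓ g).conj i = AdjoinRoot.of _ (S.conj i) := by
  rcases i with _ | i | i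
  · rfl
  · rfl
  · simp only [conj, cover, map_mul]
    rw [← map_zpow]; rfl

include g hd hb hℓ in
theorem exists_isCoverSlice (t : Aˣ) (u : A) (zo ze : Fin m → A)
    (ht : S.t = Units.map σ.toRingHom.toMonoidHom t) (hu : S.u = σ u)
    (hzo : S.zo = fun i => σ (zo i)) (hze : S.ze = fun i => σ (ze i)) {x : DiskIdx m → A}
    (h : IsChartProjection S.frame 𝔞 β t x σ) (h𝔨 : 𝔨 ≠ ⊤) :
    ∃ (bK : PoissonBracket (RootCover (σ t) ℓ)) (R : Subalgebra ℂ (RootCover (σ t) ℓ)),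
      IsCoverSlice b wt 𝔨 𝔞 σ k ℓ t u zo ze bK R := by
  obtain ⟨t', u', zo', ze', std, wt_t, wt_u, wt_zo, wt_ze, u_mem, zo_mem, ze_mem⟩ := S
  dsimp only at ht hu hzo hze
  subst ht hu hzo hze
  set S : StdSystem b wt 𝔨 k ℓ m := ⟨Units.map σ.toRingHom.toMonoidHom t, σ u, fun i => σ (zo i),
    fun i => σ (ze i), std, wt_t, wt_u, wt_zo, wt_ze, u_mem, zo_mem, ze_mem⟩ with hS
  have : Nontrivial K := by
    by_contra hK
    rw [not_nontrivial_iff_subsingleton] at hK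
    exact h𝔨 ((Ideal.eq_top_iff_one _).2 (by rw [Subsingleton.elim (1 : K) 0]; exact zero_mem _))
  have : Nontrivial A := (σ : A →+* K).domain_nontrivial
  let S' := S.cover hℓ g
  let g' := RootCover.topGrading hℓ g S.wt_t
  let 𝔨' := 𝔨.map (AdjoinRoot.of (Polynomial.X ^ ℓ - Polynomial.C (S.t : K)))
  have hcomp : IsAdicComplete 𝔨' (RootCover (S.t : K) ℓ) := RootCover.isAdicComplete hℓ
  have hnoeth : IsNoetherianRing (RootCover (S.t : K) ℓ) :=
    isNoetherianRing_of_surjective K[X] _ _ AdjoinRoot.mk_surjective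
  let σ' : RootCover (t : A) ℓ →ₐ[ℂ] RootCover (S.t : K) ℓ := RootCover.map σ (t : A) ℓ
  have hσ'of : ∀ a, σ' (AdjoinRoot.of _ a) = AdjoinRoot.of _ (σ a) := fun a => by
    rw [RootCover.of_eq_mono, RootCover.of_eq_mono]
    exact RootCover.map_mono σ (t : A) 0 a
  have hσ'root : σ' (AdjoinRoot.root _) = AdjoinRoot.root _ := by
    rw [RootCover.root_eq_mono, RootCover.root_eq_mono]
    refine (RootCover.map_mono σ (t : A) 1 1).trans ?_
    rw [map_one]; rfl
  let s' := RootCover.rootUnit t hℓ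
  let β' : ℂ[T;T⁻¹] →+* RootCover (t : A) ℓ :=
    LaurentPolynomial.eval₂ (algebraMap ℂ (RootCover (t : A) ℓ)) s'
  have hβC : ∀ c, β' (LaurentPolynomial.C c) = algebraMap ℂ _ c := fun c =>
    LaurentPolynomial.eval₂_C _ _ c
  have hβT : β' (LaurentPolynomial.T 1) = AdjoinRoot.root _ := by
    have := LaurentPolynomial.eval₂_T (algebraMap ℂ (RootCover (t : A) ℓ)) s' 1
    rw [zpow_one] at this
    exact this
  have hproj : IsChartProjection S'.frame
      (𝔞.map (AdjoinRoot.of (Polynomial.X ^ ℓ - Polynomial.C (t : A)))) β' s'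
      (fun i => AdjoinRoot.of _ (x i)) σ' := by
    refine ⟨hβC, hβT, ?_, fun i => ?_, ?_, ?_⟩
    · rw [h.span, Ideal.map_span, ← Set.range_comp]; rfl
    · rw [hσ'of, h.map_x]
      rcases i with _ | i | i <;> rfl
    · exact RootCover.dense t hℓ β h.base_C h.base_T h.dense β' hβC hβT
    · exact RootCover.dense S.t hℓ ((σ : A →+* K).comp β)
        (fun c => by rw [RingHom.comp_apply, h.base_C]; exact σ.commutes c)
        (by rw [RingHom.comp_apply, h.base_T]; rfl) h.dense'
        ((σ' : RootCover (t : A) ℓ →+* RootCover (S.t : K) ℓ).comp β')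
        (fun c => by rw [RingHom.comp_apply, hβC]; exact σ'.commutes c)
        (by rw [RingHom.comp_apply, hβT]; exact hσ'root)
  have hroot : ∀ i, (RootCover.bracket b S.t hℓ).bracket (S'.conj i)
      (RootCover.rootUnit S.t hℓ : RootCover (S.t : K) ℓ) = 0 := by
    intro i
    rw [S.cover_conj g hℓ, RootCover.of_eq_mono]
    change (RootCover.bracket b S.t hℓ).bracket _ (AdjoinRoot.root _) = 0
    rw [RootCover.root_eq_mono, RootCover.bracket_mono, RootCover.monoBracket_apply, S.conj_t,
      b.bracket_one]
    simp
  have hs : σ' s' ∈ S'.frame.flat := by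
    change σ' (AdjoinRoot.root _) ∈ _
    rw [hσ'root]
    exact S'.mem_flat_iff_conj.2 hroot
  have hs' : σ' ↑s'⁻¹ ∈ S'.frame.flat := by
    have e : σ' ↑s'⁻¹ = ↑(Units.map (σ' : _ →+* RootCover (S.t : K) ℓ).toMonoidHom s')⁻¹ := by
      rw [← map_inv]; rfl
    rw [e, S'.mem_flat_iff_conj]
    intro i
    have := S'.mem_flat_iff_conj.1 hs i
    rw [PoissonBracket.bracket_inv]
    change -(_ * _ * (RootCover.bracket b S.t hℓ).bracket (S'.conj i) (σ' s')) = 0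
    rw [this]
    simp
  have hws : RootCover.IsWeight (S.t : K) ℓ wt 1 (σ' s') := by
    change RootCover.IsWeight (S.t : K) ℓ wt 1 (σ' (AdjoinRoot.root _))
    rw [hσ'root, RootCover.root_eq_mono]
    exact RootCover.isWeight_mono hℓ g S.wt_t _ (by simpa using g.one)
  have h𝔨' : 𝔨' ≠ ⊤ := fun h => h𝔨 ((Ideal.eq_top_iff_one _).2 (by
    have h1 := (Ideal.eq_top_iff_one _).1 h
    have h2 := (RootCover.of_mem_map_pow_iff (t := (S.t : K)) (𝔨 := 𝔨) hℓ (n := 1) 1).1 (by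
      rw [pow_one, map_one]; exact h1)
    rwa [pow_one] at h2))
  refine ⟨RootCover.bracket b S.t hℓ, S'.frame.zeroPart g', ?_⟩
  exact
    { injective := RootCover.injective_of (t := (S.t : K)) hℓ
      invariants := RootCover.invariants (t := (S.t : K)) hℓ
      weight := RootCover.weight_of (t := (S.t : K)) hℓ g
      mem_pow := fun n f => (RootCover.of_mem_map_pow_iff (t := (S.t : K)) hℓ f).symm
      bracket_of := RootCover.bracket_of b S.t hℓ
      bracket_twist := RootCover.bracket_twist b S.t hℓ
      map_twist := fun ζ a => by
        have ind := @RootCover.induction_mono A _ _ (t : A) ℓ hℓ _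
        induction a using ind with
        | h0 => simp
        | hadd x y hx hy => simp only [map_add, hx, hy]
        | hmono i c =>
          rw [RootCover.twist_mono, RootCover.map_mono, RootCover.map_mono, RootCover.twist_mono,
            map_smul σ]
      twist_mem := fun ζ f hf => by
        refine ⟨S'.mem_flat_iff_conj.2 fun i => ?_,
          RootCover.isWeight_twist S.t hℓ g S.wt_t ζ hf.2⟩
        have h1 := RootCover.bracket_twist b S.t hℓ ζ (S'.conj i) f
        rw [S'.mem_flat_iff_conj.1 hf.1 i, map_zero, S.cover_conj g hℓ, RootCover.of_eq_mono,
          RootCover.twist_mono, pow_zero, one_smul] at h1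
        rw [S.cover_conj g hℓ, RootCover.of_eq_mono]
        exact h1
      slice := S'.isEquivariantSlice g' hd (RootCover.isWeight_bracket b S.t hℓ g S.wt_t hb) hproj
        hs hs' hws h𝔨' }

end StdSystem

theorem MvPowerSeries.sub_truncTotal_mem_pow {ι C : Type} [Finite ι] [CommRing C] (n : ℕ)
    (f : MvPowerSeries ι C) : f - (f.truncTotal n : MvPolynomial ι C) ∈
      (Ideal.span (Set.range MvPowerSeries.X) : Ideal (MvPowerSeries ι C)) ^ n := by
  classical
  let 𝔪 : Ideal (MvPowerSeries ι C) := Ideal.span (Set.range MvPowerSeries.X)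
  obtain ⟨E, hE, -⟩ := exists_evalSeries 𝔪 (MvPowerSeries.C (σ := ι) (R := C)) MvPowerSeries.X
    fun i => Ideal.subset_span ⟨i, rfl⟩
  have hp : ∀ p : MvPolynomial ι C, MvPolynomial.eval₂ MvPowerSeries.C MvPowerSeries.X p =
      (p : MvPowerSeries ι C) := fun p => by
    change MvPolynomial.eval₂Hom _ _ p = MvPolynomial.coeToMvPowerSeries.ringHom p
    congr 1
    ext i <;> simp
  have hid : E f = f := by
    ext d
    let n := d.degree + 1
    have h1 := hE n f
    rw [hp] at h1
    have h2 : 𝔪.map (MvPowerSeries.truncTotalAlgHom ι C n) ≤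
        (MvPolynomial.idealOfVars ι C).map (Ideal.Quotient.mk _) := by
      rw [Ideal.map_span, Ideal.span_le]
      rintro _ ⟨_, ⟨i, rfl⟩, rfl⟩
      have h3 : MvPowerSeries.truncTotalAlgHom ι C n (MvPowerSeries.X i) =
          Ideal.Quotient.mk _ (MvPolynomial.X i) := by
        rw [← MvPolynomial.coe_X]
        exact (MvPowerSeries.truncTotalAlgHom ι C n).commutes (MvPolynomial.X i)
      rw [h3]
      exact Ideal.mem_map_of_mem _ (Ideal.subset_span ⟨i, rfl⟩)
    have h4 := Ideal.mem_map_of_mem (MvPowerSeries.truncTotalAlgHom ι C n) h1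
    rw [Ideal.map_pow] at h4
    have h5 := Ideal.pow_right_mono h2 n h4
    rw [← Ideal.map_pow, Ideal.map_quotient_self, Ideal.mem_bot] at h5
    have h6 : MvPowerSeries.truncTotalAlgHom ι C n
        ((f.truncTotal n : MvPolynomial ι C) : MvPowerSeries ι C) =
          Ideal.Quotient.mk _ (f.truncTotal n) :=
      (MvPowerSeries.truncTotalAlgHom ι C n).commutes _
    rw [map_sub, h6] at h5
    change Ideal.Quotient.mk _ ((E f).truncTotal n) - _ = 0 at h5
    rw [← map_sub, Ideal.Quotient.eq_zero_iff_mem, MvPolynomial.mem_pow_idealOfVars_iff'] at h5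
    have h7 := h5 d (Nat.lt_succ_self _)
    rw [MvPolynomial.coeff_sub, MvPowerSeries.coeff_truncTotal _ (Nat.lt_succ_self _),
      MvPowerSeries.coeff_truncTotal _ (Nat.lt_succ_self _)] at h7
    exact sub_eq_zero.1 h7
  have := hE n f
  rwa [hid, hp] at this

/-! ### Constructing standard coordinates -/

section Normalize

variable {K : Type} [CommRing K] [Algebra ℂ K] {𝔨 : Ideal K} [IsAdicComplete 𝔨 K]

/-- A coordinate may be normalized to have derivative one. -/
theorem exists_normalized (D : Derivation ℂ K K) {x : K} (hx : x ∈ 𝔨) {c : Kˣ} (hc : D x = c) :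
    ∃ x' ∈ 𝔨, D x' = 1 ∧ ∀ N : Submodule ℂ K, IsAdicClosed 𝔨 (N : Set K) → (∀ f ∈ N, D f ∈ N) →
      (∀ f ∈ N, (↑c⁻¹ : K) * f ∈ N) → (∀ f ∈ N, x * f ∈ N) → (↑c⁻¹ : K) - 1 ∈ N →
        x' - x ∈ N := by
  obtain ⟨v, hv, hN⟩ := exists_integral ((↑c⁻¹ : K) • D) hx
    (by rw [Derivation.smul_apply, hc, smul_eq_mul, Units.inv_mul]) ((↑c⁻¹ : K) - 1)
  refine ⟨x + x * v, Ideal.add_mem _ hx (Ideal.mul_mem_right _ _ hx), ?_, ?_⟩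
  · rw [Derivation.smul_apply, smul_eq_mul] at hv
    have h2 := congrArg ((c : K) * ·) hv
    simp only [Units.mul_inv_cancel_left, mul_sub, Units.mul_inv, mul_one] at h2
    rw [map_add, hc, h2]; ring
  · intro N h1 h2 h3 h4 h5
    rw [add_sub_cancel_left]
    exact hN N h1 (fun f hf => h3 _ (h2 f hf)) h4 h5

end Normalize

/-- A closed Poisson ideal. -/
structure IsPoissonIdeal {K : Type} [CommRing K] [Algebra ℂ K] (b : PoissonBracket K)
    (𝔨 P : Ideal K) : Prop where
  closed : IsAdicClosed 𝔨 (P : Set K)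
  bracket_mem : ∀ f, ∀ h ∈ P, b.bracket f h ∈ P

theorem IsPoissonIdeal.bracket_mem_left {K : Type} [CommRing K] [Algebra ℂ K]
    {b : PoissonBracket K} {𝔨 P : Ideal K} (hP : IsPoissonIdeal b 𝔨 P) (f : K) {h : K}
    (hh : h ∈ P) : b.bracket h f ∈ P := by
  rw [b.skew]
  exact P.neg_mem (hP.bracket_mem f h hh)

theorem Ideal.inv_sub_one_mem {K : Type} [CommRing K] {P : Ideal K} {c : Kˣ}
    (h : (c : K) - 1 ∈ P) : (↑c⁻¹ : K) - 1 ∈ P := by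
  have := P.mul_mem_left (-(↑c⁻¹ : K)) h
  rwa [neg_mul, mul_sub, Units.inv_mul, mul_one, neg_sub] at this

namespace StdSystem

variable {K : Type} [CommRing K] [Algebra ℂ K] {b : PoissonBracket K}
  {wt : ℤ → K → Prop} {𝔨 : Ideal K} {k : ℤ} {ℓ : ℕ} (g : TopGrading 𝔨 wt) {d : ℤ}
  (hd : d = -(k * ℓ))
  (hb : ∀ i j f h, wt i f → wt j h → wt (i + j + d) (b.bracket f h)) [IsAdicComplete 𝔨 K]

include g hd hb in
theorem exists_zero (t : Kˣ) (ht : wt ℓ (t : K)) {u : K} (hu : u ∈ 𝔨) (hwu : wt 0 u)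
    (hunit : IsUnit (b.bracket u t)) :
    ∃ S : StdSystem b wt 𝔨 k ℓ 0, S.t = t ∧ ∀ P : Ideal K, IsPoissonIdeal b 𝔨 P →
      b.bracket u t - ↑(t ^ (1 - k)) ∈ P → S.u - u ∈ P := by
  obtain ⟨w, hw⟩ := hunit
  let D : Derivation ℂ K K := -(↑(t ^ (k - 1)) : K) • b.ham t
  have hD : ∀ f, D f = ↑(t ^ (k - 1)) * b.bracket f t := fun f => by
    change -(↑(t ^ (k - 1)) : K) * b.bracket t f = _
    rw [b.skew f t]; ring
  have hwD : ∀ e f, wt e f → wt e (D f) := fun e f hf => by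
    rw [hD]
    convert! g.mul (g.wt_zpow ht (k - 1)) (hb _ _ _ _ hf ht) using 1
    rw [hd]; ring
  let c : Kˣ := t ^ (k - 1) * w
  have hc : D u = c := by rw [hD, ← hw]; rfl
  have hwc : wt 0 (↑c⁻¹ : K) := by
    have : wt 0 (c : K) := hc ▸ hwD 0 u hwu
    simpa using g.wt_inv this
  obtain ⟨u', hu', h1, hN⟩ := exists_normalized D hu hc
  refine ⟨⟨t, u', finZeroElim, finZeroElim, ⟨?_, finZeroElim, finZeroElim, finZeroElim,
    finZeroElim, finZeroElim, finZeroElim, finZeroElim⟩, ht, ?_, finZeroElim, finZeroElim, hu',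
    finZeroElim, finZeroElim⟩, rfl, ?_⟩
  · rw [hD] at h1
    have h2 := congrArg ((↑(t ^ (1 - k)) : K) * ·) h1
    simp only [mul_one] at h2
    rw [← h2, ← mul_assoc, ← Units.val_mul, ← zpow_add]
    simp
  · have := hN (g.space 0) (g.isAdicClosed_space 0) (hwD 0)
      (fun f hf => show wt 0 _ by simpa using g.mul hwc hf)
      (fun f hf => show wt 0 _ by simpa using g.mul hwu hf)
      (g.wt_sub hwc g.one)
    have h2 := g.wt_add this hwu
    rwa [sub_add_cancel] at h2
  · intro P hP hPu
    refine hN (P.restrictScalars ℂ) hP.closed (fun f hf => ?_) (fun f hf => P.mul_mem_left _ hf)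
      (fun f hf => P.mul_mem_left _ hf) (Ideal.inv_sub_one_mem ?_)
    · rw [hD]
      exact P.mul_mem_left _ (hP.bracket_mem_left _ hf)
    · have h2 := P.mul_mem_left (↑(t ^ (k - 1)) : K) hPu
      rw [mul_sub, ← Units.val_mul, ← zpow_add] at h2
      rw [← hc, hD]
      simpa using h2

variable {r : ℕ} (S : StdSystem b wt 𝔨 k ℓ r)

omit [IsAdicComplete 𝔨 K] in
theorem zpow_bracket {f : K} (hf : f ∈ S.frame.flat) (n : ℤ) : b.bracket ↑(S.t ^ n) f = 0 := by
  rw [b.skew, S.bracket_t hf, neg_zero]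

/-- The frame given by a pair of conjugate flat elements. -/
def pairFrame {p q : K} (hp : p ∈ S.frame.flat) (hq : q ∈ S.frame.flat) (hp' : p ∈ 𝔨) (hq' : q ∈ 𝔨)
    (hpq : ↑(S.t ^ k) * b.bracket p q = 1) : FlatFrame 𝔨 Bool where
  x := Bool.rec p q
  D := Bool.rec (-(↑(S.t ^ k) : K) • b.ham q) (b.ham (↑(S.t ^ k) * p))
  x_mem := by rintro (_ | _) <;> assumption
  D_self := by
    rintro (_ | _)
    · change -(↑(S.t ^ k) : K) * b.bracket q p = 1
      rw [b.skew, neg_mul_neg, hpq]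
    · change b.bracket (↑(S.t ^ k) * p) q = 1
      rw [b.leibniz_left, S.zpow_bracket hq, hpq]; simp
  D_ne := by
    rintro (_ | _) (_ | _) h
    · exact absurd rfl h
    · change -(↑(S.t ^ k) : K) * b.bracket q q = 0
      rw [b.bracket_self, mul_zero]
    · change b.bracket (↑(S.t ^ k) * p) p = 0
      rw [b.leibniz_left, S.zpow_bracket hp, b.bracket_self]; simp
    · exact absurd rfl h
  comm := by
    have key : ∀ f, -(↑(S.t ^ k) : K) * b.bracket q (b.bracket (↑(S.t ^ k) * p) f) =
        b.bracket (↑(S.t ^ k) * p) (-(↑(S.t ^ k) : K) * b.bracket q f) := by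
      intro f
      have h1 : b.bracket (↑(S.t ^ k) * p) (-(↑(S.t ^ k) : K)) = 0 := by
        rw [map_neg, b.leibniz_left, b.bracket_self, S.bracket_t hp]; simp
      have h2 : b.bracket q (↑(S.t ^ k) * p) = -1 := by
        rw [b.leibniz, S.bracket_t hq, b.skew q p, zero_mul, zero_add, mul_neg, hpq]
      have h3 : b.bracket (-1) f = 0 := by
        rw [b.skew, map_neg, b.bracket_one]; simp
      rw [b.leibniz, h1, b.jacobi q, h2, h3]; ring
    rintro (_ | _) (_ | _) f
    · rfl
    · exact key f
    · exact (key f).symm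
    · rfl

omit [IsAdicComplete 𝔨 K] in
theorem conj_u_bracket {q : K} (hq : q ∈ S.frame.flat) (i : DiskIdx r) :
    b.bracket (b.bracket (S.conj i) S.u) q = 0 := by
  rcases i with _ | i | i
  · change b.bracket (b.bracket S.t S.u) q = 0
    rw [b.skew S.t, S.std.u_t, b.skew, map_neg, neg_neg, S.bracket_t hq]
  · change b.bracket (b.bracket (S.ze i) S.u) q = 0
    rw [b.skew (S.ze i), S.std.u_ze]; simp
  · change b.bracket (b.bracket (((S.t ^ k : Kˣ) : K) * S.zo i) S.u) q = 0
    rw [b.skew (_ * S.zo i), S.std.u_zo]; simp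

include g hd hb in
theorem exists_succ {x q : K} (hx : x ∈ S.frame.flat) (hq : q ∈ S.frame.flat) (hwx : wt 0 x)
    (hwq : wt 0 q) (hx𝔨 : x ∈ 𝔨) (hq𝔨 : q ∈ 𝔨) (hunit : IsUnit (b.bracket x q)) :
    ∃ S' : StdSystem b wt 𝔨 k ℓ (r + 1), S'.t = S.t ∧
      (∀ i : Fin r, S'.zo i.castSucc = S.zo i) ∧ (∀ i : Fin r, S'.ze i.castSucc = S.ze i) ∧
      S'.ze (Fin.last r) = q ∧
      ∀ P : Ideal K, IsPoissonIdeal b 𝔨 P → ↑(S.t ^ k) * b.bracket x q - 1 ∈ P →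
        b.bracket S.u (↑(S.t ^ k) * x) ∈ P → b.bracket S.u q ∈ P →
          S'.zo (Fin.last r) - x ∈ P ∧ S'.u - S.u ∈ P := by
  obtain ⟨w, hw⟩ := hunit
  let D : Derivation ℂ K K := -(↑(S.t ^ k) : K) • b.ham q
  have hD : ∀ f, D f = ↑(S.t ^ k) * b.bracket f q := fun f => by
    change -(↑(S.t ^ k) : K) * b.bracket q f = _
    rw [b.skew f q]; ring
  have hwD : ∀ f, wt 0 f → wt 0 (D f) := fun f hf => by
    rw [hD]
    simpa using S.wt_zpow_mul_bracket g hd hb hf hwq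
  let c : Kˣ := S.t ^ k * w
  have hc : D x = c := by rw [hD, ← hw]; rfl
  have hwc : wt 0 (↑c⁻¹ : K) := by
    have : wt 0 (c : K) := hc ▸ hwD x hwx
    simpa using g.wt_inv this
  have hcflat : (↑c⁻¹ : K) ∈ S.frame.flat := by
    have h1 : (c : K) ∈ S.frame.flat := by
      rw [← hc, hD]
      exact mul_mem (S.zpow_t_mem_flat k) (S.bracket_mem_flat hx hq)
    rw [S.mem_flat_iff_conj] at h1 ⊢
    intro i
    rw [b.bracket_inv, h1 i]; simp
  obtain ⟨p, hp𝔨, hp1, hN⟩ := exists_normalized D hx𝔨 hc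
  have hwp : wt 0 p := by
    have := hN (g.space 0) (g.isAdicClosed_space 0) hwD
      (fun f hf => show wt 0 _ by simpa using g.mul hwc hf)
      (fun f hf => show wt 0 _ by simpa using g.mul hwx hf)
      (g.wt_sub hwc g.one)
    have h2 := g.wt_add this hwx
    rwa [sub_add_cancel] at h2
  have hker : ∀ i, IsAdicClosed 𝔨 (LinearMap.ker (b.bracket (S.conj i)) : Set K) := fun i =>
    isAdicClosed_ker (b.ham (S.conj i))
  have hp : p ∈ S.frame.flat := by
    have hsub : p - x ∈ Subalgebra.toSubmodule S.frame.flat := by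
      refine hN _ ?_ (fun f hf => ?_) (fun f hf => S.frame.flat.mul_mem hcflat hf)
        (fun f hf => S.frame.flat.mul_mem hx hf) (S.frame.flat.sub_mem hcflat (one_mem _))
      · intro f hf
        refine S.mem_flat_iff_conj.2 fun i => hker i f fun n => ?_
        obtain ⟨h, hh, h2⟩ := hf n
        exact ⟨h, S.mem_flat_iff_conj.1 hh i, h2⟩
      · rw [hD]
        exact S.frame.flat.mul_mem (S.zpow_t_mem_flat k) (S.bracket_mem_flat hf hq)
    have := add_mem (show p - x ∈ S.frame.flat from hsub) hx
    rwa [sub_add_cancel] at this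
  rw [hD] at hp1
  let F := S.pairFrame hp hq hp𝔨 hq𝔨 hp1
  have hpc := S.mem_flat_iff_conj.1 hp
  have hqc := S.mem_flat_iff_conj.1 hq
  have hF0 : ∀ f, F.D false f = -(↑(S.t ^ k) : K) * b.bracket q f := fun f => rfl
  have hF1 : ∀ f, F.D true f = b.bracket (↑(S.t ^ k) * p) f := fun f => rfl
  have htc : ∀ i, b.bracket (S.conj i) ↑(S.t ^ k) = 0 := fun i =>
    b.bracket_zpow_eq_zero (S.conj_t i) k
  let u' : K := F.projFun S.u
  have hu'flat := F.projFun_mem S.u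
  have hu'q : b.bracket u' q = 0 := by
    have := hu'flat false
    rw [hF0, neg_mul, neg_eq_zero, Units.mul_right_eq_zero] at this
    rw [b.skew, this, neg_zero]
  have hu'p : b.bracket u' (↑(S.t ^ k) * p) = 0 := by
    have := hu'flat true
    rw [hF1] at this
    rw [b.skew, this, neg_zero]
  have hu'c : ∀ i, b.bracket (S.conj i) u' = b.bracket (S.conj i) S.u := by
    intro i
    have hm : S.u - u' ∈ LinearMap.ker (b.bracket (S.conj i)) := by
      refine F.sub_projFun_mem_of_stable ⟨hker i, ?_, ?_⟩ ?_
      · rintro (_ | _) f hf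
        · rw [LinearMap.mem_ker] at hf ⊢
          rw [hF0, b.leibniz, map_neg, htc, b.jacobi, hqc, hf]; simp
        · rw [LinearMap.mem_ker] at hf ⊢
          rw [hF1, b.jacobi, b.leibniz, htc, hpc, hf]; simp
      · rintro (_ | _) f hf
        · rw [LinearMap.mem_ker] at hf ⊢
          change b.bracket _ (p * f) = 0
          rw [b.leibniz, hpc, hf]; simp
        · rw [LinearMap.mem_ker] at hf ⊢
          change b.bracket _ (q * f) = 0
          rw [b.leibniz, hqc, hf]; simp
      · rintro (_ | _)
        · rw [LinearMap.mem_ker, hF0, b.leibniz, map_neg, htc, b.jacobi, hqc,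
            b.skew q (b.bracket _ _), S.conj_u_bracket hq]; simp
        · rw [LinearMap.mem_ker, hF1, b.jacobi, b.leibniz, htc, hpc,
            b.skew (_ * p) (b.bracket _ _), S.conj_u_bracket (mul_mem (S.zpow_t_mem_flat k) hp)]; simp
    rw [LinearMap.mem_ker, map_sub, sub_eq_zero] at hm
    exact hm.symm
  have hwu' : wt 0 u' := by
    have hwF : ∀ (i : Bool) f, wt 0 f → wt 0 (F.D i f) := by
      rintro (_ | _) f hf
      · rw [hF0, neg_mul]
        exact g.wt_neg (by simpa using S.wt_zpow_mul_bracket g hd hb hwq hf)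
      · rw [hF1]
        convert! hb _ _ _ _ (g.mul (g.wt_zpow S.wt_t k) hwp) hf using 1
        rw [hd]; ring
    have := F.sub_projFun_mem_of_stable (N := g.space 0) ⟨g.isAdicClosed_space 0, hwF, ?_⟩
      fun i => hwF i _ S.wt_u
    · have h2 := g.wt_sub S.wt_u this
      rwa [sub_sub_cancel] at h2
    · rintro (_ | _) f hf
      · exact show wt 0 (p * f) by simpa using g.mul hwp hf
      · exact show wt 0 (q * f) by simpa using g.mul hwq hf
  have hu'𝔨 : u' ∈ 𝔨 := by
    have := Ideal.sub_mem _ S.u_mem (F.ideal_le (F.sub_projFun_mem S.u))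
    rwa [sub_sub_cancel] at this
  have hpt := (S.mem_flat.1 hp).1
  have hqt := (S.mem_flat.1 hq).1
  have hpp : b.bracket (↑(S.t ^ k) * p) (↑(S.t ^ k) * p) = 0 := b.bracket_self _
  have hzop : ∀ i, b.bracket (↑(S.t ^ k) * S.zo i) (↑(S.t ^ k) * p) = 0 := fun i => by
    have h1 := htc (some (Sum.inr i))
    have h2 := hpc (some (Sum.inr i))
    change b.bracket (↑(S.t ^ k) * S.zo i) _ = 0 at h1 h2
    rw [b.leibniz, h1, h2]; simp
  have hzoq : ∀ i, b.bracket (↑(S.t ^ k) * S.zo i) q = 0 := fun i => hqc (some (Sum.inr i))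
  have hzep : ∀ i, b.bracket (↑(S.t ^ k) * p) (S.ze i) = 0 := fun i => by
    rw [b.skew, b.leibniz]
    have h1 := htc (some (Sum.inl i))
    have h2 := hpc (some (Sum.inl i))
    change b.bracket (S.ze i) _ = 0 at h1 h2
    rw [h1, h2]; simp
  have hzeq : ∀ i, b.bracket (S.ze i) q = 0 := fun i => hqc (some (Sum.inl i))
  have hu'zo : ∀ i, b.bracket u' (↑(S.t ^ k) * S.zo i) = 0 := fun i => by
    have := hu'c (some (Sum.inr i))
    change b.bracket (↑(S.t ^ k) * S.zo i) u' = b.bracket (↑(S.t ^ k) * S.zo i) S.u at this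
    rw [b.skew, this, ← b.skew, S.std.u_zo]
  have hu'ze : ∀ i, b.bracket u' (S.ze i) = 0 := fun i => by
    have := hu'c (some (Sum.inl i))
    change b.bracket (S.ze i) u' = b.bracket (S.ze i) S.u at this
    rw [b.skew, this, ← b.skew, S.std.u_ze]
  have hu't : b.bracket u' S.t = ↑(S.t ^ (1 - k)) := by
    have := hu'c none
    change b.bracket S.t u' = b.bracket S.t S.u at this
    rw [b.skew, this, ← b.skew, S.std.u_t]
  have hpq1 : b.bracket (↑(S.t ^ k) * p) q = 1 := by
    rw [b.leibniz_left, S.zpow_bracket hq, hp1]; simp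
  refine ⟨⟨S.t, u', Fin.snoc (α := fun _ => K) S.zo p, Fin.snoc (α := fun _ => K) S.ze q,
    ⟨hu't, ?_, ?_, ?_, ?_, ?_, ?_, ?_⟩, S.wt_t, hwu', ?_, ?_, hu'𝔨, ?_, ?_⟩, rfl, ?_, ?_, ?_, ?_⟩
  · intro i
    refine Fin.lastCases ?_ (fun i => ?_) i
    · simpa using hu'p
    · simpa using hu'zo i
  · intro i
    refine Fin.lastCases ?_ (fun i => ?_) i
    · simpa using hu'q
    · simpa using hu'ze i
  · intro i
    refine Fin.lastCases ?_ (fun i => ?_) i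
    · rw [Fin.snoc_last, b.leibniz, b.bracket_zpow_eq_zero (b.bracket_self _), b.skew _ p, hpt]
      simp
    · rw [Fin.snoc_castSucc]; exact S.std.t_zo i
  · intro i
    refine Fin.lastCases ?_ (fun i => ?_) i
    · rw [Fin.snoc_last, b.skew, hqt, neg_zero]
    · rw [Fin.snoc_castSucc]; exact S.std.t_ze i
  · intro i j
    refine Fin.lastCases ?_ (fun i => ?_) i <;> refine Fin.lastCases ?_ (fun j => ?_) j <;>
      simp only [Fin.snoc_last, Fin.snoc_castSucc]
    · exact b.bracket_self _
    · rw [b.skew, hzop, neg_zero]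
    · exact hzop i
    · exact S.std.zo_zo i j
  · intro i j
    refine Fin.lastCases ?_ (fun i => ?_) i <;> refine Fin.lastCases ?_ (fun j => ?_) j <;>
      simp only [Fin.snoc_last, Fin.snoc_castSucc]
    · exact b.bracket_self _
    · rw [b.skew, hzeq, neg_zero]
    · exact hzeq i
    · exact S.std.ze_ze i j
  · intro i j
    refine Fin.lastCases ?_ (fun i => ?_) i <;> refine Fin.lastCases ?_ (fun j => ?_) j <;>
      simp only [Fin.snoc_last, Fin.snoc_castSucc]
    · rw [hpq1]; simp
    · rw [hzep, if_neg (Fin.castSucc_lt_last j).ne']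
    · rw [hzoq, if_neg (Fin.castSucc_lt_last i).ne]
    · rw [S.std.zo_ze]; simp
  · intro i
    refine Fin.lastCases ?_ (fun i => ?_) i
    · rw [Fin.snoc_last]; exact hwp
    · rw [Fin.snoc_castSucc]; exact S.wt_zo i
  · intro i
    refine Fin.lastCases ?_ (fun i => ?_) i
    · rw [Fin.snoc_last]; exact hwq
    · rw [Fin.snoc_castSucc]; exact S.wt_ze i
  · intro i
    refine Fin.lastCases ?_ (fun i => ?_) i
    · rw [Fin.snoc_last]; exact hp𝔨
    · rw [Fin.snoc_castSucc]; exact S.zo_mem i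
  · intro i
    refine Fin.lastCases ?_ (fun i => ?_) i
    · rw [Fin.snoc_last]; exact hq𝔨
    · rw [Fin.snoc_castSucc]; exact S.ze_mem i
  · intro i; simp
  · intro i; simp
  · simp
  · intro P hP hP1 hP2 hP3
    have h1 : p - x ∈ P := by
      refine hN (P.restrictScalars ℂ) hP.closed (fun f hf => ?_) (fun f hf => P.mul_mem_left _ hf)
        (fun f hf => P.mul_mem_left _ hf) (Ideal.inv_sub_one_mem ?_)
      · rw [hD]
        exact P.mul_mem_left _ (hP.bracket_mem_left _ hf)
      · rw [← hc, hD]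
        exact hP1
    refine ⟨by simpa using h1, ?_⟩
    have h2 : S.u - u' ∈ P.restrictScalars ℂ := by
      refine F.sub_projFun_mem_of_stable ⟨hP.closed, ?_, fun i f hf => P.mul_mem_left _ hf⟩ ?_
      · rintro (_ | _) f hf
        · exact P.mul_mem_left _ (hP.bracket_mem _ _ hf)
        · exact hP.bracket_mem _ _ hf
      · rintro (_ | _)
        · refine P.mul_mem_left _ ?_
          change b.bracket q S.u ∈ P
          rw [b.skew]
          exact P.neg_mem hP3
        · change b.bracket (↑(S.t ^ k) * p) S.u ∈ P
          rw [b.skew]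
          have h4 := P.add_mem hP2 (hP.bracket_mem S.u _ (P.mul_mem_left (↑(S.t ^ k) : K) h1))
          rw [← map_add, ← mul_add, add_sub_cancel] at h4
          exact P.neg_mem h4
    have h3 := P.neg_mem h2
    rwa [neg_sub] at h3

end StdSystem

namespace StdSystem

theorem zo_ze {K : Type} [CommRing K] [Algebra ℂ K] {b : PoissonBracket K}
    {wt : ℤ → K → Prop} {𝔨 : Ideal K} {k : ℤ} {ℓ m : ℕ} (S : StdSystem b wt 𝔨 k ℓ m) (i : Fin m) :
    ↑(S.t ^ k) * b.bracket (S.zo i) (S.ze i) = 1 := by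
  have h1 := S.std.zo_ze i i
  have h2 : b.bracket ↑(S.t ^ k) (S.ze i) = 0 := by
    rw [b.skew, neg_eq_zero]
    exact b.bracket_zpow_eq_zero (S.conj_t (some (Sum.inl i))) k
  rw [b.leibniz_left, h2, if_pos rfl] at h1
  simpa using h1

end StdSystem

section Lifting

variable {K : Type} [CommRing K] [Algebra ℂ K] {b : PoissonBracket K} {wt : ℤ → K → Prop}
  {𝔨 : Ideal K} (g : TopGrading 𝔨 wt) {k d : ℤ} {ℓ : ℕ} (hd : d = -(k * ℓ))
  (hb : ∀ i j f h, wt i f → wt j h → wt (i + j + d) (b.bracket f h)) [IsAdicComplete 𝔨 K]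
  {P : Ideal K} (hP : IsPoissonIdeal b 𝔨 P) (hP𝔨 : P ≤ 𝔨)
  {bA : PoissonBracket (K ⧸ P)}
  (hbA : ∀ f h, bA.bracket (Ideal.Quotient.mk P f) (Ideal.Quotient.mk P h) =
    Ideal.Quotient.mk P (b.bracket f h))
  {wtA : ℤ → K ⧸ P → Prop} (hwtA : ∀ e a, wtA e a ↔ ∃ f, wt e f ∧ Ideal.Quotient.mk P f = a)

include hP𝔨 in
omit [Algebra ℂ K] [IsAdicComplete 𝔨 K] in
theorem mem_of_mk_mem {f : K} (h : Ideal.Quotient.mk P f ∈ 𝔨.map (Ideal.Quotient.mk P)) :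
    f ∈ 𝔨 := by
  have h2 := Ideal.mem_comap.2 h
  rwa [Ideal.comap_map_of_surjective _ Ideal.Quotient.mk_surjective, ← RingHom.ker_eq_comap_bot,
    Ideal.mk_ker, sup_eq_left.2 hP𝔨] at h2

include hP𝔨 in
omit [Algebra ℂ K] in
theorem isUnit_of_mk {f : K} (h : IsUnit (Ideal.Quotient.mk P f)) : IsUnit f := by
  obtain ⟨a, ha⟩ := h.exists_right_inv
  obtain ⟨f', rfl⟩ := Ideal.Quotient.mk_surjective a
  rw [← map_mul, ← map_one (Ideal.Quotient.mk P), Ideal.Quotient.eq] at ha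
  exact isUnit_of_mul_isUnit_left (isUnit_of_sub_mem (𝔨 := 𝔨) isUnit_one (hP𝔨 ha))

theorem mk_zpow {R S : Type} [CommRing R] [CommRing S] (φ : R →+* S) {t : Rˣ} {s : Sˣ}
    (h : φ t = s) (n : ℤ) : φ ↑(t ^ n) = ↑(s ^ n) := by
  have : Units.map φ.toMonoidHom t = s := Units.ext h
  rw [← this, ← map_zpow]; rfl

include g hd hb hP hP𝔨 hbA hwtA in
/-- Standard coordinates on a closed Poisson subscheme lift to standard coordinates. -/
theorem StdSystem.exists_lift {m : ℕ}
    (SA : StdSystem bA wtA (𝔨.map (Ideal.Quotient.mk P)) k ℓ m) :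
    ∃ S : StdSystem b wt 𝔨 k ℓ m, Ideal.Quotient.mk P S.t = SA.t ∧
      ∀ i, Ideal.Quotient.mk P (S.x i) = SA.x i := by
  let π := Ideal.Quotient.mk P
  obtain ⟨t0, ht0, ht⟩ := (hwtA _ _).1 SA.wt_t
  obtain ⟨t, rfl⟩ := isUnit_of_mk hP𝔨 (ht ▸ SA.t.isUnit : IsUnit (Ideal.Quotient.mk P t0))
  have htz := mk_zpow (Ideal.Quotient.mk P) ht
  suffices h : ∀ r (hr : r ≤ m), ∃ S : StdSystem b wt 𝔨 k ℓ r, S.t = t ∧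
      π S.u = SA.u ∧ (∀ i, π (S.zo i) = SA.zo (Fin.castLE hr i)) ∧
      (∀ i, π (S.ze i) = SA.ze (Fin.castLE hr i)) by
    obtain ⟨S, h1, h2, h3, h4⟩ := h m le_rfl
    refine ⟨S, h1 ▸ ht, ?_⟩
    rintro (_ | i | i)
    · exact h2
    · exact h3 i
    · exact h4 i
  intro r
  induction r with
  | zero =>
    intro _
    obtain ⟨u, hwu, hu⟩ := (hwtA _ _).1 SA.wt_u
    have hP1 : b.bracket u t - ↑(t ^ (1 - k)) ∈ P := by
      rw [← Ideal.Quotient.eq, ← hbA, hu, ht, SA.std.u_t, htz]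
    obtain ⟨S, hS, hS2⟩ := exists_zero g hd hb t ht0 (mem_of_mk_mem hP𝔨 (hu ▸ SA.u_mem)) hwu
      (isUnit_of_sub_mem (𝔨 := 𝔨) (Units.isUnit _) (hP𝔨 hP1))
    refine ⟨S, hS, ?_, fun i => i.elim0, fun i => i.elim0⟩
    rw [← hu]
    exact Ideal.Quotient.eq.2 (hS2 P hP hP1)
  | succ r ih =>
    intro hr
    obtain ⟨S, rfl, hSu, hSo, hSe⟩ := ih (Nat.le_of_succ_le hr)
    let j : Fin m := ⟨r, hr⟩
    obtain ⟨x0, hwx0, hx0⟩ := (hwtA _ _).1 (SA.wt_zo j)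
    obtain ⟨q0, hwq0, hq0⟩ := (hwtA _ _).1 (SA.wt_ze j)
    have hF := S.isGraded g hd hb
    let emb : DiskIdx r → DiskIdx m := Option.map (Sum.map (Fin.castLE (Nat.le_of_succ_le hr))
      (Fin.castLE (Nat.le_of_succ_le hr)))
    have hfac : ∀ i, π (S.factor i) = SA.factor (emb i) := by
      rintro (_ | i | i)
      · change π (-_) = -_
        rw [map_neg, htz]
      · change π (-_) = -_
        rw [map_neg, htz]
      · exact map_one _
    have hconj : ∀ i, π (S.conj i) = SA.conj (emb i) := by
      rintro (_ | i | i)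
      · exact ht
      · exact hSe i
      · change π (_ * _) = _ * _
        rw [map_mul, htz, hSo]
    have hDmk : ∀ i f, π (S.frame.D i f) = SA.frame.D (emb i) (π f) := by
      intro i f
      change π (S.factor i * b.bracket (S.conj i) f) =
        SA.factor (emb i) * bA.bracket (SA.conj (emb i)) (π f)
      rw [map_mul, ← hbA, hfac, ← hconj]
    have hstab : S.frame.IsStable (P.restrictScalars ℂ) :=
      ⟨hP.closed, fun i f hf => P.mul_mem_left _ (hP.bracket_mem _ _ hf),
        fun i f hf => P.mul_mem_left _ hf⟩
    have hne : ∀ i, emb i ≠ some (Sum.inl j) ∧ emb i ≠ some (Sum.inr j) := by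
      rintro (_ | i | i)
      · exact ⟨nofun, nofun⟩
      · refine ⟨fun h => ?_, nofun⟩
        have := congrArg Fin.val (Sum.inl.inj (Option.some.inj h))
        exact absurd this i.2.ne
      · refine ⟨nofun, fun h => ?_⟩
        have := congrArg Fin.val (Sum.inr.inj (Option.some.inj h))
        exact absurd this i.2.ne
    have hx : π (S.frame.proj x0) = SA.zo j := by
      have := S.frame.sub_projFun_mem_of_stable hstab (f := x0) fun i => by
        change _ ∈ P
        rw [← Ideal.Quotient.eq_zero_iff_mem]
        refine (hDmk i x0).trans ?_
        change SA.frame.D (emb i) (Ideal.Quotient.mk P x0) = 0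
        rw [hx0]
        exact SA.frame.D_ne _ (some (Sum.inl j)) (hne i).1
      rw [← hx0]
      exact (Ideal.Quotient.eq.2 this).symm
    have hq : π (S.frame.proj q0) = SA.ze j := by
      have := S.frame.sub_projFun_mem_of_stable hstab (f := q0) fun i => by
        change _ ∈ P
        rw [← Ideal.Quotient.eq_zero_iff_mem]
        refine (hDmk i q0).trans ?_
        change SA.frame.D (emb i) (Ideal.Quotient.mk P q0) = 0
        rw [hq0]
        exact SA.frame.D_ne _ (some (Sum.inr j)) (hne i).2
      rw [← hq0]
      exact (Ideal.Quotient.eq.2 this).symm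
    generalize hxx : S.frame.proj x0 = x at hx
    generalize hqq : S.frame.proj q0 = q at hq
    have hP1 : ↑(S.t ^ k) * b.bracket (x : K) (q : K) - 1 ∈ P := by
      rw [← Ideal.Quotient.eq, map_mul, ← hbA, htz]
      change _ * bA.bracket (π x) (π q) = _
      rw [hx, hq, SA.zo_ze, map_one]
    have hunit : IsUnit (b.bracket (x : K) (q : K)) := by
      have := isUnit_of_sub_mem (𝔨 := 𝔨) isUnit_one (hP𝔨 hP1)
      exact isUnit_of_mul_isUnit_right this
    obtain ⟨S', h1, h2, h3, h4, h5⟩ := S.exists_succ g hd hb x.2 q.2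
      (hxx ▸ hF.wt_proj g hwx0) (hqq ▸ hF.wt_proj g hwq0)
      (mem_of_mk_mem hP𝔨 (by change π x ∈ _; rw [hx]; exact SA.zo_mem j))
      (mem_of_mk_mem hP𝔨 (by change π q ∈ _; rw [hq]; exact SA.ze_mem j)) hunit
    obtain ⟨h6, h7⟩ := h5 P hP hP1
      (by
        rw [← Ideal.Quotient.eq_zero_iff_mem, ← hbA, map_mul, htz]
        change bA.bracket (π S.u) (_ * π x) = 0
        rw [hSu, hx, SA.std.u_zo])
      (by
        rw [← Ideal.Quotient.eq_zero_iff_mem, ← hbA]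
        change bA.bracket (π S.u) (π q) = 0
        rw [hSu, hq, SA.std.u_ze])
    refine ⟨S', h1, ?_, ?_, ?_⟩
    · rw [← hSu]
      exact Ideal.Quotient.eq.2 h7
    · intro i
      refine Fin.lastCases ?_ (fun i => ?_) i
      · refine (Ideal.Quotient.eq.2 h6).trans hx
      · rw [h2]; exact hSo i
    · intro i
      refine Fin.lastCases ?_ (fun i => ?_) i
      · rw [h4]; exact hq
      · rw [h3]; exact hSe i

end Lifting

namespace FormalChart

variable {A : Type} [CommRing A] [Algebra ℂ A] {𝔞 : Ideal A} {wtA : ℤ → A → Prop} {ℓ m : ℕ}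
  (Φ : FormalChart 𝔞 wtA ℓ m)

/-- The coordinates of a chart. -/
noncomputable def x (i : DiskIdx m) : A := Φ.equiv.symm (MvPowerSeries.X i)

theorem symm_mem_pow {n : ℕ} {f : DiskFun m}
    (hf : f ∈ Ideal.span (Set.range MvPowerSeries.X) ^ n) : Φ.equiv.symm f ∈ 𝔞 ^ n := by
  rw [← Φ.map_ideal, ← Ideal.map_pow] at hf
  obtain ⟨a, ha, rfl⟩ := (Ideal.mem_map_iff_of_surjective _ Φ.equiv.surjective).1 hf
  simpa using ha

theorem equiv_mem_pow {n : ℕ} {a : A} (ha : a ∈ 𝔞 ^ n) :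
    Φ.equiv a ∈ Ideal.span (Set.range MvPowerSeries.X) ^ n := by
  rw [← Φ.map_ideal, ← Ideal.map_pow]
  exact Ideal.mem_map_of_mem (Φ.equiv : A →+* DiskFun m) ha

theorem x_mem (i : DiskIdx m) : Φ.x i ∈ 𝔞 := by
  have := Φ.symm_mem_pow (n := 1) (f := MvPowerSeries.X i)
    (by rw [pow_one]; exact Ideal.subset_span ⟨i, rfl⟩)
  rwa [pow_one] at this

theorem ideal_eq_span : 𝔞 = Ideal.span (Set.range Φ.x) := by
  refine le_antisymm (fun a ha => ?_) (Ideal.span_le.2 ?_)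
  · have h1 := Φ.equiv_mem_pow (n := 1) (by rwa [pow_one])
    rw [pow_one] at h1
    have h2 := Ideal.mem_map_of_mem (Φ.equiv.symm : DiskFun m →+* A) h1
    rw [Ideal.map_span, ← Set.range_comp] at h2
    have h3 : (Φ.equiv.symm : DiskFun m →+* A) (Φ.equiv a) = a := Φ.equiv.symm_apply_apply a
    exact h3 ▸ h2
  · rintro _ ⟨i, rfl⟩
    exact Φ.x_mem i

theorem wt_x (i : DiskIdx m) : wtA 0 (Φ.x i) := by
  classical
  rw [Φ.weight]
  intro α j h
  rw [x, AlgEquiv.apply_symm_apply, MvPowerSeries.coeff_X] at h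
  split_ifs at h
  · have hj : j = 0 := by
      by_contra hj
      refine h ?_
      rw [← LaurentPolynomial.T_zero, LaurentPolynomial.T, AddMonoidAlgebra.coeff_single,
        Finsupp.single_eq_of_ne hj]
    simp [hj]
  · exact absurd rfl h

theorem wt_t : wtA ℓ (Φ.t : A) := by
  classical
  rw [Φ.weight]
  intro α j h
  change (MvPowerSeries.coeff α (Φ.equiv (Φ.equiv.symm (MvPowerSeries.C
    (LaurentPolynomial.T 1))))).coeff j ≠ 0 at h
  rw [AlgEquiv.apply_symm_apply, MvPowerSeries.coeff_C] at h
  split_ifs at h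
  · have hj : j = 1 := by
      by_contra hj
      refine h ?_
      rw [LaurentPolynomial.T, AddMonoidAlgebra.coeff_single, Finsupp.single_eq_of_ne hj]
    simp [hj]
  · exact absurd rfl h

/-- The standard coordinates of a chart in which the bracket is standard. -/
noncomputable def stdSystem {bA : PoissonBracket A} {k : ℤ}
    (hstd : IsStandard bA k Φ.t Φ.u Φ.zo Φ.ze) : StdSystem bA wtA 𝔞 k ℓ m where
  t := Φ.t
  u := Φ.u
  zo := Φ.zo
  ze := Φ.ze
  std := hstd
  wt_t := Φ.wt_t
  wt_u := Φ.wt_x none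
  wt_zo i := Φ.wt_x (some (Sum.inl i))
  wt_ze i := Φ.wt_x (some (Sum.inr i))
  u_mem := Φ.x_mem none
  zo_mem i := Φ.x_mem (some (Sum.inl i))
  ze_mem i := Φ.x_mem (some (Sum.inr i))

theorem stdSystem_x {bA : PoissonBracket A} {k : ℤ}
    (hstd : IsStandard bA k Φ.t Φ.u Φ.zo Φ.ze) (i : DiskIdx m) :
    (Φ.stdSystem hstd).x i = Φ.x i := by
  rcases i with _ | i | i <;> rfl

theorem _root_.MvPowerSeries.C_laurentC (c : ℂ) :
    MvPowerSeries.C (σ := DiskIdx m) (LaurentPolynomial.C c) = algebraMap ℂ (DiskFun m) c := by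
  rw [MvPowerSeries.algebraMap_apply]
  rfl

theorem base_C (c : ℂ) : Φ.base (LaurentPolynomial.C c) = algebraMap ℂ A c := by
  change Φ.equiv.symm (MvPowerSeries.C (LaurentPolynomial.C c)) = _
  rw [MvPowerSeries.C_laurentC, AlgEquiv.commutes]

theorem base_T : Φ.base (LaurentPolynomial.T 1) = Φ.t := rfl

theorem dense (a : A) : ∃ c, a - Φ.base c ∈ 𝔞 := by
  classical
  have h := MvPowerSeries.sub_truncTotal_mem_pow 1 (Φ.equiv a)
  have h2 : ((Φ.equiv a).truncTotal 1) =
      MvPolynomial.C (MvPowerSeries.constantCoeff (Φ.equiv a)) := by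
    ext α
    rw [MvPolynomial.coeff_C]
    split_ifs with hα
    · subst hα
      rw [MvPowerSeries.coeff_truncTotal _ (by simp), MvPowerSeries.coeff_zero_eq_constantCoeff]
    · have h0 : 1 ≤ α.degree := by
        rw [Nat.one_le_iff_ne_zero, Ne, Finsupp.degree_eq_zero_iff]
        exact Ne.symm hα
      rw [MvPowerSeries.coeff_truncTotal_eq_zero _ h0]
  rw [h2, MvPolynomial.coe_C] at h
  refine ⟨MvPowerSeries.constantCoeff (Φ.equiv a), ?_⟩
  have h3 := Φ.symm_mem_pow h
  rwa [map_sub, AlgEquiv.symm_apply_apply, pow_one] at h3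

end FormalChart

theorem LaurentPolynomial.ringHom_ext_of_T {S : Type} [CommRing S] [Algebra ℂ S]
    {β β' : ℂ[T;T⁻¹] →+* S} (hC : ∀ c, β (C c) = algebraMap ℂ S c)
    (hC' : ∀ c, β' (C c) = algebraMap ℂ S c) {s : Sˣ} (hT : β (T 1) = s) (hT' : β' (T 1) = s) :
    β = β' :=
  RingHom.ext fun c => by
    rw [ringHom_apply_eq_sum β hC hT, ringHom_apply_eq_sum β' hC' hT']

section Section

variable {K : Type} [CommRing K] [Algebra ℂ K] {b : PoissonBracket K} {wt : ℤ → K → Prop}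
  {𝔨 : Ideal K} (g : TopGrading 𝔨 wt) {k d : ℤ} {ℓ m : ℕ} (hd : d = -(k * ℓ))
  (hb : ∀ i j f h, wt i f → wt j h → wt (i + j + d) (b.bracket f h)) [IsAdicComplete 𝔨 K]
  {P : Ideal K} (hP : IsPoissonIdeal b 𝔨 P) (hP𝔨 : P ≤ 𝔨)
  {bA : PoissonBracket (K ⧸ P)}
  (hbA : ∀ f h, bA.bracket (Ideal.Quotient.mk P f) (Ideal.Quotient.mk P h) =
    Ideal.Quotient.mk P (b.bracket f h))
  {wtA : ℤ → K ⧸ P → Prop} (hwtA : ∀ e a, wtA e a ↔ ∃ f, wt e f ∧ Ideal.Quotient.mk P f = a)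
  (Φ : FormalChart (𝔨.map (Ideal.Quotient.mk P)) wtA ℓ m)
  (hstd : IsStandard bA k Φ.t Φ.u Φ.zo Φ.ze)

include g hd hb hP hP𝔨 hbA hwtA hstd in
/-- A standard chart of a closed Poisson subscheme extends to an equivariant Poisson projection. -/
theorem FormalChart.exists_section :
    ∃ (σ : K ⧸ P →ₐ[ℂ] K) (S : StdSystem b wt 𝔨 k ℓ m), (∀ a, Ideal.Quotient.mk P (σ a) = a) ∧
      (∀ e a, wtA e a → wt e (σ a)) ∧
      (∀ a a', b.bracket (σ a) (σ a') = σ (bA.bracket a a')) ∧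
      σ Φ.t = S.t ∧ ∀ i, σ (Φ.x i) = S.x i := by
  obtain ⟨S, hSt, hSx⟩ := StdSystem.exists_lift g hd hb hP hP𝔨 hbA hwtA (Φ.stdSystem hstd)
  let π := Ideal.Quotient.mk P
  let 𝔞 := 𝔨.map π
  have hA : IsAdicComplete 𝔞 (K ⧸ P) := isAdicComplete_quotient 𝔨 P hP.closed
  let φ : ℂ[T;T⁻¹] →+* K := LaurentPolynomial.eval₂ (algebraMap ℂ K) S.t
  have hφC : ∀ c, φ (LaurentPolynomial.C c) = algebraMap ℂ K c :=
    fun c => LaurentPolynomial.eval₂_C _ _ c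
  have hφT : φ (LaurentPolynomial.T 1) = S.t := by
    have := LaurentPolynomial.eval₂_T (algebraMap ℂ K) S.t 1
    rwa [zpow_one] at this
  obtain ⟨E, hE, hEp⟩ := exists_evalSeries 𝔨 φ S.x S.frame.x_mem
  have hEC : ∀ c, E (MvPowerSeries.C c) = φ c := fun c => by
    rw [← MvPolynomial.coe_C, hEp, MvPolynomial.eval₂_C]
  have hEX : ∀ i, E (MvPowerSeries.X i) = S.x i := fun i => by
    rw [← MvPolynomial.coe_X, hEp, MvPolynomial.eval₂_X]
  let σ : K ⧸ P →ₐ[ℂ] K :=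
    { E.comp (Φ.equiv : K ⧸ P →+* DiskFun m) with
      commutes' := fun c => by
        change E (Φ.equiv (algebraMap ℂ _ c)) = _
        rw [AlgEquiv.commutes, ← MvPowerSeries.C_laurentC]
        exact (hEC (LaurentPolynomial.C c)).trans (hφC c) }
  have hσ : ∀ a, σ a = E (Φ.equiv a) := fun _ => rfl
  have hσx : ∀ i, σ (Φ.x i) = S.x i := fun i => by
    rw [hσ, FormalChart.x, AlgEquiv.apply_symm_apply, hEX]
  have hσbase : ∀ c, σ (Φ.base c) = φ c := fun c => by
    rw [hσ]
    change E (Φ.equiv (Φ.equiv.symm (MvPowerSeries.C c))) = φ c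
    rw [AlgEquiv.apply_symm_apply, hEC]
  have hσt : σ Φ.t = S.t := (hσbase _).trans hφT
  have hσpow : ∀ {n a}, a ∈ 𝔞 ^ n → σ a ∈ 𝔨 ^ n := fun {n a} ha => by
    have h1 := Ideal.mem_map_of_mem E (Φ.equiv_mem_pow ha)
    rw [Ideal.map_pow] at h1
    refine Ideal.pow_right_mono ?_ n h1
    rw [Ideal.map_span, Ideal.span_le]
    rintro _ ⟨_, ⟨i, rfl⟩, rfl⟩
    rw [hEX]
    exact S.frame.x_mem i
  let a₀ : ℕ → K ⧸ P → K ⧸ P := fun n a =>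
    Φ.equiv.symm (((Φ.equiv a).truncTotal n : MvPolynomial _ _) : DiskFun m)
  have ha₀ : ∀ n a, a - a₀ n a ∈ 𝔞 ^ n := fun n a => by
    have := Φ.symm_mem_pow (MvPowerSeries.sub_truncTotal_mem_pow n (Φ.equiv a))
    rwa [map_sub, AlgEquiv.symm_apply_apply] at this
  have hbase : ∀ c, π (φ c) = Φ.base c := by
    have : π.comp φ = Φ.base := LaurentPolynomial.ringHom_ext_of_T (s := Φ.t)
      (fun c => by rw [RingHom.comp_apply, hφC]; rfl) Φ.base_C
      (by rw [RingHom.comp_apply, hφT]; exact hSt) Φ.base_T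
    exact fun c => congrArg (fun h => h c) this
  have hπp : ∀ p : MvPolynomial (DiskIdx m) ℂ[T;T⁻¹],
      Φ.equiv.symm (p : DiskFun m) = π (MvPolynomial.eval₂ φ S.x p) := by
    intro p
    have : (Φ.equiv.symm : DiskFun m →+* K ⧸ P).comp MvPolynomial.coeToMvPowerSeries.ringHom =
        π.comp (MvPolynomial.eval₂Hom φ S.x) := by
      refine MvPolynomial.ringHom_ext (fun c => ?_) (fun i => ?_)
      · simp only [RingHom.comp_apply, MvPolynomial.eval₂Hom_C, hbase]
        change Φ.equiv.symm ((MvPolynomial.C c : MvPolynomial (DiskIdx m) ℂ[T;T⁻¹]) : DiskFun m) = Φ.base c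
        rw [MvPolynomial.coe_C]; rfl
      · simp only [RingHom.comp_apply, MvPolynomial.eval₂Hom_X']
        change Φ.equiv.symm ((MvPolynomial.X i : MvPolynomial (DiskIdx m) ℂ[T;T⁻¹]) : DiskFun m) = _
        rw [MvPolynomial.coe_X]
        exact ((hSx i).trans (Φ.stdSystem_x hstd i)).symm
    exact congrArg (fun h => h p) this
  have hσa₀ : ∀ n a, σ (a₀ n a) = MvPolynomial.eval₂ φ S.x ((Φ.equiv a).truncTotal n) :=
    fun n a => by rw [hσ, AlgEquiv.apply_symm_apply, hEp]
  have hsec : ∀ a, π (σ a) = a := fun a => by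
    rw [← sub_eq_zero]
    refine eq_zero_of_forall_mem_pow (𝔨 := 𝔞) fun n => ?_
    have h1 : π (σ (a - a₀ n a)) ∈ 𝔞 ^ n := by
      rw [← Ideal.map_pow]
      exact Ideal.mem_map_of_mem π (hσpow (ha₀ n a))
    rw [map_sub, map_sub, hσa₀, ← hπp] at h1
    have h2 := Ideal.sub_mem _ h1 (ha₀ n a)
    rwa [sub_sub_sub_cancel_right] at h2
  refine ⟨σ, S, hsec, fun e a ha => ?_, ?_, hσt, hσx⟩
  · refine g.isAdicClosed_space e _ fun n => ⟨σ (a₀ n a), ?_, by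
      rw [← map_sub]; exact hσpow (ha₀ n a)⟩
    change wt e _
    rw [hσa₀, MvPolynomial.eval₂_eq]
    refine sum_mem (S := g.space e) fun α _ => ?_
    have h1 : wt e (φ (((Φ.equiv a).truncTotal n).coeff α)) := by
      by_cases hα : α.degree < n
      · rw [MvPowerSeries.coeff_truncTotal _ hα,
          LaurentPolynomial.ringHom_apply_eq_sum φ hφC hφT, Finsupp.sum]
        refine sum_mem (S := g.space e) fun j hj => (g.space e).smul_mem _ ?_
        have := (Φ.weight e a).1 ha α j (Finsupp.mem_support_iff.1 hj)
        rw [← this]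
        exact g.wt_zpow S.wt_t j
      · rw [MvPowerSeries.coeff_truncTotal_eq_zero _ (not_lt.1 hα), map_zero]
        exact g.wt_zero e
    have h2 : wt 0 (∏ i ∈ α.support, S.x i ^ α i) := by
      refine Finset.prod_induction _ (wt 0) (fun _ _ h h' => by simpa using g.mul h h') g.one
        fun i _ => ?_
      have hx : wt 0 (S.x i) := by
        rcases i with _ | i | i
        · exact S.wt_u
        · exact S.wt_zo i
        · exact S.wt_ze i
      simpa using g.wt_pow hx (α i)
    change wt e _
    simpa using g.mul h1 h2
  · have hσz : ∀ j : ℤ, σ ↑(Φ.t ^ j) = ↑(S.t ^ j) := mk_zpow (σ : K ⧸ P →+* K) hσt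
    let Q : K ⧸ P → K ⧸ P → Prop := fun a a' => b.bracket (σ a) (σ a') = σ (bA.bracket a a')
    have hQs : ∀ {a a'}, Q a a' → Q a' a := fun {a a'} h => by
      change _ = _
      rw [b.skew, bA.skew, map_neg, show b.bracket (σ a) (σ a') = _ from h]
    have hQm : ∀ {a a' a''}, Q a a'' → Q a' a'' → Q (a * a') a'' := fun {a a' a''} h h' => by
      change _ = _
      rw [map_mul, b.leibniz_left, bA.leibniz_left, map_add, map_mul, map_mul,
        show b.bracket (σ a) (σ a'') = _ from h, show b.bracket (σ a') (σ a'') = _ from h']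
    have hQa : ∀ {a a' a''}, Q a a'' → Q a' a'' → Q (a + a') a'' := fun {a a' a''} h h' => by
      change _ = _
      rw [map_add, map_add, map_add, LinearMap.add_apply, LinearMap.add_apply, map_add,
        show b.bracket (σ a) (σ a'') = _ from h, show b.bracket (σ a') (σ a'') = _ from h']
    have hQz : ∀ {a}, Q Φ.t a → ∀ j : ℤ, Q ↑(Φ.t ^ j) a := fun {a} h j => by
      change _ = _
      have h1 : b.bracket (σ a) S.t = σ (bA.bracket a Φ.t) := by rw [← hσt]; exact hQs h
      rw [hσz, b.skew, bA.skew, b.bracket_zpow, bA.bracket_zpow, h1, map_neg, map_mul, map_mul,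
        hσz, map_intCast]
    have hgen : ∀ a, Q Φ.t a → Q Φ.u a → (∀ i, Q (↑(Φ.t ^ k) * Φ.zo i) a) → (∀ i, Q (Φ.ze i) a) →
        ∀ a', Q a' a := by
      intro a h1 h2 h3 h4 a'
      have hx : ∀ i, Q (Φ.x i) a := by
        rintro (_ | i | i)
        · exact h2
        · have e : Φ.zo i = ↑(Φ.t ^ (-k)) * (↑(Φ.t ^ k) * Φ.zo i) := by
            rw [← mul_assoc, ← Units.val_mul, ← zpow_add]; simp
          have h5 := hQm (hQz h1 (-k)) (h3 i)
          rw [← e] at h5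
          exact h5
        · exact h4 i
      have h0 : Q 0 a := by
        change _ = _
        simp
      have hp : ∀ p : MvPolynomial (DiskIdx m) ℂ[T;T⁻¹], Q (Φ.equiv.symm (p : DiskFun m)) a := by
        intro p
        induction p using MvPolynomial.induction_on with
        | C c =>
          rw [MvPolynomial.coe_C]
          change Q (Φ.base c) a
          rw [LaurentPolynomial.ringHom_apply_eq_sum Φ.base Φ.base_C Φ.base_T, Finsupp.sum]
          refine Finset.sum_induction _ (Q · a) (fun _ _ => hQa) h0 fun j _ => ?_
          have h5 := hQz h1 j
          change _ = _ at h5 ⊢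
          rw [map_smul, map_smul, map_smul, LinearMap.smul_apply, LinearMap.smul_apply, map_smul,
            h5]
        | add p q hp hq =>
          rw [MvPolynomial.coe_add, map_add]
          exact hQa hp hq
        | mul_X p i hp =>
          rw [MvPolynomial.coe_mul, map_mul, MvPolynomial.coe_X]
          exact hQm hp (hx i)
      change _ = _
      rw [← sub_eq_zero]
      refine eq_zero_of_forall_mem_pow (𝔨 := 𝔨) fun n => ?_
      have h5 := hp ((Φ.equiv a').truncTotal (n + 1))
      change b.bracket (σ (a₀ (n + 1) a')) (σ a) = σ (bA.bracket (a₀ (n + 1) a') a) at h5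
      have h6 : b.bracket (σ (a' - a₀ (n + 1) a')) (σ a) ∈ 𝔨 ^ n := by
        rw [b.skew]
        exact Ideal.neg_mem_iff _ |>.2 ((b.ham (σ a)).map_mem_pow n (hσpow (ha₀ _ _)))
      have h7 : σ (bA.bracket (a' - a₀ (n + 1) a') a) ∈ 𝔨 ^ n := by
        rw [bA.skew]
        exact hσpow (Ideal.neg_mem_iff _ |>.2 ((bA.ham a).map_mem_pow n (ha₀ _ _)))
      have h8 := Ideal.sub_mem _ h6 h7
      simp only [map_sub, LinearMap.sub_apply, h5] at h8
      rwa [sub_sub_sub_cancel_right] at h8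
    have hσu : σ Φ.u = S.u := hσx none
    have hσzo : ∀ i, σ (Φ.zo i) = S.zo i := fun i => hσx (some (Sum.inl i))
    have hσze : ∀ i, σ (Φ.ze i) = S.ze i := fun i => hσx (some (Sum.inr i))
    have q1 : Q Φ.u Φ.t := by
      change _ = _
      rw [hσu, hσt, S.std.u_t, hstd.u_t, hσz]
    have q2 : ∀ i, Q Φ.u (↑(Φ.t ^ k) * Φ.zo i) := fun i => by
      change _ = _
      rw [map_mul, hσu, hσz, hσzo, S.std.u_zo, hstd.u_zo, map_zero]
    have q3 : ∀ i, Q Φ.u (Φ.ze i) := fun i => by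
      change _ = _
      rw [hσu, hσze, S.std.u_ze, hstd.u_ze, map_zero]
    have q4 : ∀ i, Q Φ.t (↑(Φ.t ^ k) * Φ.zo i) := fun i => by
      change _ = _
      rw [map_mul, hσt, hσz, hσzo, S.std.t_zo, hstd.t_zo, map_zero]
    have q5 : ∀ i, Q Φ.t (Φ.ze i) := fun i => by
      change _ = _
      rw [hσt, hσze, S.std.t_ze, hstd.t_ze, map_zero]
    have q6 : ∀ i j, Q (↑(Φ.t ^ k) * Φ.zo i) (↑(Φ.t ^ k) * Φ.zo j) := fun i j => by
      change _ = _
      rw [map_mul σ, map_mul σ, hσz, hσzo, hσzo, S.std.zo_zo, hstd.zo_zo, map_zero]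
    have q7 : ∀ i j, Q (Φ.ze i) (Φ.ze j) := fun i j => by
      change _ = _
      rw [hσze, hσze, S.std.ze_ze, hstd.ze_ze, map_zero]
    have q8 : ∀ i j, Q (↑(Φ.t ^ k) * Φ.zo i) (Φ.ze j) := fun i j => by
      change _ = _
      rw [map_mul, hσz, hσzo, hσze, S.std.zo_ze, hstd.zo_ze]
      split_ifs <;> simp
    have q0 : ∀ a, Q a a := fun a => by
      change _ = _
      rw [b.bracket_self, bA.bracket_self, map_zero]
    intro a a'
    refine hgen a' ?_ ?_ (fun i => ?_) (fun i => ?_) a <;> refine hQs ?_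
    · exact hgen Φ.t (q0 _) q1 (fun i => hQs (q4 i)) (fun i => hQs (q5 i)) a'
    · exact hgen Φ.u (hQs q1) (q0 _) (fun i => hQs (q2 i)) (fun i => hQs (q3 i)) a'
    · exact hgen _ (q4 i) (q2 i) (fun j => q6 j i) (fun j => hQs (q8 i j)) a'
    · exact hgen _ (q5 i) (q3 i) (fun j => q8 j i) (fun j => q7 j i) a'

include g hd hb hP hP𝔨 hbA hwtA hstd in
/-- The slices transversal to a closed Poisson subscheme with a standard chart. -/
theorem FormalChart.exists_slices [IsNoetherianRing K] (h𝔨 : 𝔨 ≠ ⊤) (hℓ : 0 < ℓ) :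
    ∃ σ : K ⧸ P →ₐ[ℂ] K, (∀ a, Ideal.Quotient.mk P (σ a) = a) ∧
      (∀ e a, wtA e a → wt e (σ a)) ∧
      (∀ a a', b.bracket (σ a) (σ a') = σ (bA.bracket a a')) ∧
      (ℓ = 1 → ∃ R : Subalgebra ℂ K, IsEquivariantSlice b wt 𝔨 (𝔨.map (Ideal.Quotient.mk P)) σ k
        (Units.map σ.toRingHom.toMonoidHom Φ.t) (σ Φ.u) (fun i => σ (Φ.zo i))
        (fun i => σ (Φ.ze i)) R) ∧
      (∃ (bK : PoissonBracket (RootCover (σ Φ.t) ℓ)) (R : Subalgebra ℂ (RootCover (σ Φ.t) ℓ)),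
        IsCoverSlice b wt 𝔨 (𝔨.map (Ideal.Quotient.mk P)) σ k ℓ Φ.t Φ.u Φ.zo Φ.ze bK R) ∧
      ∃ Q : Subalgebra ℂ K, IsFiberedSlice b wt 𝔨 (𝔨.map (Ideal.Quotient.mk P)) Φ.base σ k
        (Units.map σ.toRingHom.toMonoidHom Φ.t) (σ Φ.u) (fun i => σ (Φ.zo i))
        (fun i => σ (Φ.ze i)) Q := by
  obtain ⟨σ, S, h1, h2, h3, h4, h5⟩ := Φ.exists_section g hd hb hP hP𝔨 hbA hwtA hstd
  have ht : S.t = Units.map σ.toRingHom.toMonoidHom Φ.t := Units.ext h4.symm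
  have hu : S.u = σ Φ.u := (h5 none).symm
  have hzo : S.zo = fun i => σ (Φ.zo i) := funext fun i => (h5 (some (Sum.inl i))).symm
  have hze : S.ze = fun i => σ (Φ.ze i) := funext fun i => (h5 (some (Sum.inr i))).symm
  have hproj : IsChartProjection S.frame (𝔨.map (Ideal.Quotient.mk P)) Φ.base Φ.t Φ.x σ :=
    ⟨Φ.base_C, Φ.base_T, Φ.ideal_eq_span, h5, Φ.dense, fun f => by
      obtain ⟨c, hc⟩ := Φ.dense (Ideal.Quotient.mk P f)
      refine ⟨c, mem_of_mk_mem hP𝔨 ?_⟩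
      rwa [map_sub, h1]⟩
  refine ⟨σ, h1, h2, h3, fun hℓ1 => ⟨S.frame.zeroPart g, ?_⟩,
    S.exists_isCoverSlice g hd hℓ hb Φ.t Φ.u Φ.zo Φ.ze ht hu hzo hze hproj h𝔨, S.frame.flat, ?_⟩
  · rw [← ht, ← hu, ← hzo, ← hze]
    have hz := S.zpow_t_mem_flat
    refine S.isEquivariantSlice g hd hb hproj ?_ ?_ ?_ h𝔨
    · rw [h4]; simpa using hz 1
    · have : σ ↑Φ.t⁻¹ = ↑(S.t⁻¹) := by rw [ht, ← map_inv]; rfl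
      rw [this]; simpa using hz (-1)
    · rw [h4]
      simpa [hℓ1] using S.wt_t
  · rw [← ht, ← hu, ← hzo, ← hze]
    exact S.isFiberedSlice g hd hb hproj h4

end Section

/-- The functions on the formal neighborhood of an orbit with finite stabilizer of order `ℓ`: the
quotient by the ideal of definition is `ℂ[T, T⁻¹]`, with `T` of weight `ℓ`, and all weights are
divisible by `ℓ`. -/
structure OrbitRing {A : Type} [CommRing A] [Algebra ℂ A] (𝔞 : Ideal A) (wt : ℤ → A → Prop)
    (ℓ : ℕ) where
  ψ : A →ₐ[ℂ] ℂ[T;T⁻¹]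
  t : Aˣ
  ψ_eq_zero : ∀ f, ψ f = 0 ↔ f ∈ 𝔞
  wt_t : wt ℓ (t : A)
  ψ_t : ψ t = LaurentPolynomial.T 1
  dvd : ∀ e f, wt e f → f ≠ 0 → (ℓ : ℤ) ∣ e
  pos : 0 < ℓ

namespace OrbitRing

variable {A : Type} [CommRing A] [Algebra ℂ A] {𝔞 : Ideal A} {wt : ℤ → A → Prop} {ℓ : ℕ}
  (O : OrbitRing 𝔞 wt ℓ)

/-- Evaluation at the base point of the orbit. -/
noncomputable def ev : A →+* ℂ :=
  (LaurentPolynomial.eval₂ (RingHom.id ℂ) 1).comp (O.ψ : A →+* ℂ[T;T⁻¹])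

/-- The inclusion of the Laurent polynomials in `t`. -/
noncomputable def φ : ℂ[T;T⁻¹] →+* A := LaurentPolynomial.eval₂ (algebraMap ℂ A) O.t

theorem φ_C (c : ℂ) : O.φ (LaurentPolynomial.C c) = algebraMap ℂ A c :=
  LaurentPolynomial.eval₂_C _ _ c

theorem φ_T : O.φ (LaurentPolynomial.T 1) = O.t := by
  have := LaurentPolynomial.eval₂_T (algebraMap ℂ A) O.t 1
  rwa [zpow_one] at this

theorem ψ_φ (c : ℂ[T;T⁻¹]) : O.ψ (O.φ c) = c := by
  have : (O.ψ : A →+* ℂ[T;T⁻¹]).comp O.φ = RingHom.id _ :=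
    LaurentPolynomial.ringHom_ext_of_T (s := ⟨LaurentPolynomial.T 1, LaurentPolynomial.T (-1),
        by rw [← LaurentPolynomial.T_add]; simp, by rw [← LaurentPolynomial.T_add]; simp⟩)
      (fun c => by
        rw [RingHom.comp_apply, O.φ_C]
        exact O.ψ.commutes c)
      (fun c => rfl) (by rw [RingHom.comp_apply, O.φ_T]; exact O.ψ_t) rfl
  exact congrArg (fun h => h c) this

theorem φ_injective : Function.Injective O.φ :=
  Function.LeftInverse.injective O.ψ_φ

theorem ev_algebraMap (c : ℂ) : O.ev (algebraMap ℂ A c) = c := by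
  rw [ev, RingHom.comp_apply]
  change LaurentPolynomial.eval₂ (RingHom.id ℂ) 1 (O.ψ (algebraMap ℂ A c)) = c
  rw [O.ψ.commutes]
  exact LaurentPolynomial.eval₂_C _ _ c

theorem ev_smul (c : ℂ) (f : A) : O.ev (c • f) = c * O.ev f := by
  rw [Algebra.smul_def, map_mul, ev_algebraMap]

theorem ev_of_mem {f : A} (hf : f ∈ 𝔞) : O.ev f = 0 := by
  rw [ev, RingHom.comp_apply]
  change LaurentPolynomial.eval₂ (RingHom.id ℂ) 1 (O.ψ f) = 0
  rw [(O.ψ_eq_zero f).2 hf, map_zero]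

theorem ev_t : O.ev O.t = 1 := by
  rw [ev, RingHom.comp_apply]
  change LaurentPolynomial.eval₂ (RingHom.id ℂ) 1 (O.ψ O.t) = 1
  rw [O.ψ_t, LaurentPolynomial.eval₂_T]
  simp

theorem ev_zpow (n : ℤ) : O.ev ↑(O.t ^ n) = 1 := by
  have h := mk_zpow O.ev (t := O.t) (s := 1) O.ev_t n
  rw [h]; simp

include O in
theorem ne_top : 𝔞 ≠ ⊤ := fun h => by
  have := O.ev_of_mem (f := 1) (h ▸ Submodule.mem_top)
  simp at this

theorem sub_φ_mem (f : A) : f - O.φ (O.ψ f) ∈ 𝔞 := by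
  rw [← O.ψ_eq_zero, map_sub, O.ψ_φ, sub_self]

/-- A first order version of the evaluation at the base point. -/
theorem exists_dual : ∃ χ : A →+* DualNumber ℂ, (∀ f, (χ f).fst = O.ev f) ∧
    (∀ f ∈ 𝔞, χ f = 0) ∧ χ O.t = 1 + DualNumber.eps := by
  let e : (DualNumber ℂ)ˣ := ⟨1 + DualNumber.eps, 1 - DualNumber.eps, by
    ring_nf; simp [pow_two], by ring_nf; simp [pow_two]⟩
  let χ₀ : ℂ[T;T⁻¹] →+* DualNumber ℂ := LaurentPolynomial.eval₂ (algebraMap ℂ (DualNumber ℂ)) e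
  have h0 : χ₀ (LaurentPolynomial.T 1) = e := by
    have := LaurentPolynomial.eval₂_T (algebraMap ℂ (DualNumber ℂ)) e 1
    rwa [zpow_one] at this
  refine ⟨χ₀.comp (O.ψ : A →+* ℂ[T;T⁻¹]), fun f => ?_, fun f hf => ?_, ?_⟩
  · have : ((TrivSqZeroExt.fstHom ℂ ℂ ℂ : DualNumber ℂ →ₐ[ℂ] ℂ) : DualNumber ℂ →+* ℂ).comp χ₀ =
        LaurentPolynomial.eval₂ (RingHom.id ℂ) 1 :=
      LaurentPolynomial.ringHom_ext_of_T (s := 1) (fun c => by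
          rw [RingHom.comp_apply]
          have : χ₀ (LaurentPolynomial.C c) = algebraMap ℂ _ c := LaurentPolynomial.eval₂_C _ _ c
          rw [this]
          rfl)
        (fun c => LaurentPolynomial.eval₂_C _ _ c)
        (by rw [RingHom.comp_apply, h0]; simp [e]) (by
          have := LaurentPolynomial.eval₂_T (RingHom.id ℂ) 1 1
          rwa [one_zpow] at this)
    exact congrArg (fun h => h (O.ψ f)) this
  · change χ₀ (O.ψ f) = 0
    rw [(O.ψ_eq_zero f).2 hf, map_zero]
  · change χ₀ (O.ψ O.t) = _
    rw [O.ψ_t, h0]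

theorem ker_ev_le {f : A} (hf : O.ev f = 0) :
    f ∈ Ideal.span {(O.t : A) - 1} ⊔ 𝔞 := by
  have h : ∀ c : ℂ[T;T⁻¹], O.φ c - algebraMap ℂ A (LaurentPolynomial.eval₂ (RingHom.id ℂ) 1 c) ∈
      Ideal.span {(O.t : A) - 1} := by
    intro c
    rw [← Ideal.Quotient.eq]
    have : (Ideal.Quotient.mk (Ideal.span {(O.t : A) - 1})).comp O.φ =
        (Ideal.Quotient.mk (Ideal.span {(O.t : A) - 1})).comp
          ((algebraMap ℂ A).comp (LaurentPolynomial.eval₂ (RingHom.id ℂ) 1)) := by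
      refine LaurentPolynomial.ringHom_ext_of_T (s := 1) (fun c => by
        rw [RingHom.comp_apply, O.φ_C]; rfl) (fun c => ?_) ?_ ?_
      · rw [RingHom.comp_apply, RingHom.comp_apply, LaurentPolynomial.eval₂_C]; rfl
      · rw [RingHom.comp_apply, O.φ_T, Units.val_one, ← map_one (Ideal.Quotient.mk _),
          Ideal.Quotient.eq]
        exact Ideal.subset_span rfl
      · rw [RingHom.comp_apply, RingHom.comp_apply, LaurentPolynomial.eval₂_T]; simp
    exact congrArg (fun h => h c) this
  have h1 := h (O.ψ f)
  have h2 : LaurentPolynomial.eval₂ (RingHom.id ℂ) 1 (O.ψ f) = 0 := hf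
  rw [h2, map_zero, sub_zero] at h1
  rw [← sub_add_cancel f (O.φ (O.ψ f)), add_comm]
  exact Submodule.add_mem_sup h1 (O.sub_φ_mem f)

theorem add_smul_notMem {q : A} (hq : q ∈ 𝔞) {c : ℂ} (hc : c ≠ 0) :
    q + c • ((O.t : A) - 1) ∉ RingHom.ker O.ev ^ 2 := by
  obtain ⟨χ, h1, h2, h3⟩ := O.exists_dual
  intro h
  have h4 : ∀ f ∈ RingHom.ker O.ev ^ 2, χ f = 0 := fun f hf => by
    rw [pow_two] at hf
    refine Submodule.mul_induction_on hf (fun x hx y hy => ?_) (fun x y hx hy => by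
      rw [map_add, hx, hy, add_zero])
    rw [map_mul]
    ext <;> simp [h1, (RingHom.mem_ker).1 hx, (RingHom.mem_ker).1 hy]
  have h5 := h4 _ h
  rw [map_add, h2 q hq, Algebra.smul_def, map_mul, map_sub, h3, map_one, add_sub_cancel_left,
    zero_add] at h5
  have h6 := congrArg TrivSqZeroExt.snd h5
  simp [h1, O.ev_algebraMap, hc] at h6

theorem t_sub_one_notMem : (O.t : A) - 1 ∉ RingHom.ker O.ev ^ 2 := by
  simpa using O.add_smul_notMem 𝔞.zero_mem one_ne_zero

variable (g : TopGrading 𝔞 wt)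

include g in
theorem pr_φ [IsHausdorff 𝔞 A] (j : ℤ) (c : ℂ[T;T⁻¹]) :
    g.pr (j * ℓ) (O.φ c) = c.coeff j • (↑(O.t ^ j) : A) := by
  rw [LaurentPolynomial.ringHom_apply_eq_sum O.φ O.φ_C O.φ_T, Finsupp.sum, map_sum]
  rw [Finset.sum_eq_single j]
  · rw [map_smul, g.pr_self (g.wt_zpow O.wt_t j)]
  · intro i _ hi
    rw [map_smul, g.pr_ne (g.wt_zpow O.wt_t i), smul_zero]
    intro h
    exact hi (mul_right_cancel₀ (by exact_mod_cast O.pos.ne') h)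
  · intro h
    rw [Finsupp.notMem_support_iff.1 h, zero_smul, map_zero]

include g in
theorem sub_ev_smul_mem [IsHausdorff 𝔞 A] {j : ℤ} {f : A} (hf : wt (j * ℓ) f) :
    f - O.ev f • (↑(O.t ^ j) : A) ∈ 𝔞 := by
  have h1 : f - O.φ (O.ψ f) ∈ 𝔞 ^ 1 := by
    rw [pow_one]
    exact O.sub_φ_mem f
  have h2 := g.pr_mem (e := j * ℓ) h1
  rw [map_sub, g.pr_self hf, O.pr_φ g, pow_one] at h2
  have h3 := O.ev_of_mem h2
  rw [map_sub, O.ev_smul, O.ev_zpow, mul_one, sub_eq_zero] at h3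
  rwa [h3]

include g in
theorem isUnit_of_ev_ne_zero [IsAdicComplete 𝔞 A] {e : ℤ} {f : A} (hf : wt e f)
    (h : O.ev f ≠ 0) : IsUnit f := by
  obtain ⟨j, rfl⟩ := O.dvd e f hf (fun h0 => h (by rw [h0, map_zero]))
  rw [mul_comm] at hf
  refine isUnit_of_sub_mem ?_ (O.sub_ev_smul_mem g hf)
  rw [Algebra.smul_def]
  exact ((isUnit_iff_ne_zero.2 h).map (algebraMap ℂ A)).mul (Units.isUnit _)

include g in
/-- Homogeneous elements are at the base point as deep as along the whole orbit. -/
theorem mem_sq_of_mem_ker_sq [IsHausdorff 𝔞 A] {q : A} (hw : wt 0 q) (hq : q ∈ 𝔞)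
    (h : q ∈ RingHom.ker O.ev ^ 2) : q ∈ 𝔞 ^ 2 := by
  have h1 : q ∈ (Ideal.span {(O.t : A) - 1} ⊔ 𝔞) ^ 2 :=
    Ideal.pow_right_mono (fun f hf => O.ker_ev_le hf) 2 h
  obtain ⟨a, c, hc, hqa⟩ : ∃ a, ∃ c ∈ 𝔞 ^ 2, q = ((O.t : A) - 1) * a + c ∧ a ∈ 𝔞 := by
    rw [pow_two, Ideal.sup_mul, Ideal.mul_sup, Ideal.mul_sup, ← pow_two 𝔞,
      Ideal.span_singleton_mul_span_singleton, mul_comm 𝔞, ← sup_assoc, sup_assoc (Ideal.span _),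
      sup_idem] at h1
    obtain ⟨x, hx, c, hc, rfl⟩ := Submodule.mem_sup.1 h1
    obtain ⟨x1, hx1, x2, hx2, rfl⟩ := Submodule.mem_sup.1 hx
    obtain ⟨a1, rfl⟩ := Ideal.mem_span_singleton'.1 hx1
    obtain ⟨a2, ha2, rfl⟩ := Ideal.mem_span_singleton_mul.1 hx2
    refine ⟨a1 * (O.t - 1) + a2, c, hc, by ring, ?_⟩
    have h2 : O.ψ (a1 * (O.t - 1)) = 0 := by
      have h3 : O.ψ (a1 * ((O.t - 1) * (O.t - 1))) = 0 := by
        rw [O.ψ_eq_zero]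
        have e : a1 * ((O.t - 1) * (O.t - 1) : A) =
            (a1 * ((O.t - 1) * (O.t - 1)) + (O.t - 1) * a2 + c) - ((O.t - 1) * a2 + c) := by ring
        rw [e]
        exact 𝔞.sub_mem hq (𝔞.add_mem (𝔞.mul_mem_left _ ha2) (Ideal.pow_le_self two_ne_zero hc))
      rw [← mul_assoc, map_mul] at h3
      rcases mul_eq_zero.1 h3 with h3 | h3
      · exact h3
      · exfalso
        rw [O.ψ_eq_zero] at h3
        obtain ⟨χ, -, h2, h3'⟩ := O.exists_dual
        have := h2 _ h3
        rw [map_sub, h3', map_one, add_sub_cancel_left] at this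
        have := congrArg TrivSqZeroExt.snd this
        simp at this
    exact 𝔞.add_mem ((O.ψ_eq_zero _).1 h2) ha2
  obtain ⟨hqa, -⟩ := hqa
  obtain ⟨s, hs⟩ := g.exists_sum 2 a
  obtain ⟨N, hN⟩ : ∃ N : ℕ, ∀ j : ℤ, (N : ℤ) ≤ |j| → (j * ℓ) ∉ s := by
    obtain ⟨M, hM⟩ := (s.image fun e => |e|).bddAbove
    refine ⟨(M + 1).toNat, fun j hj hjs => ?_⟩
    have h2 : |j * ℓ| ≤ M := hM (Finset.mem_coe.2 (Finset.mem_image_of_mem _ hjs))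
    have h3 : M + 1 ≤ |j| := (Int.self_le_toNat _).trans hj
    have h4 : (1 : ℤ) ≤ ℓ := by exact_mod_cast O.pos
    rw [abs_mul, Nat.abs_cast] at h2
    nlinarith [abs_nonneg j]
  have hsmall : ∀ j : ℤ, (N : ℤ) ≤ |j| → g.pr (j * ℓ) a ∈ 𝔞 ^ 2 := fun j hj =>
    g.pr_mem_of_notMem hs (hN j hj)
  let w : ℤ → A := fun j => ↑(O.t ^ (-j)) * g.pr (j * ℓ) a
  have hterm : ∀ j : ℤ, (↑(O.t ^ (-j)) : A) * g.pr (j * ℓ) ((O.t - 1) * a) = w (j - 1) - w j := by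
    intro j
    have h2 := g.pr_mul O.wt_t ((j - 1) * ℓ) a
    have e : (ℓ : ℤ) + (j - 1) * ℓ = j * ℓ := by ring
    rw [e] at h2
    rw [sub_mul, one_mul, map_sub, h2, mul_sub, ← mul_assoc]
    congr 2
    rw [show -(j - 1) = -j + 1 by ring, zpow_add, zpow_one, Units.val_mul]
  have htel : ∀ M : ℕ, ∑ i ∈ Finset.range (2 * M + 1), (w ((i : ℤ) - M - 1) - w ((i : ℤ) - M)) =
      w (-M - 1) - w M := by
    intro M
    have := Finset.sum_range_sub' (fun i : ℕ => w ((i : ℤ) - M - 1)) (2 * M + 1)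
    simp only [Nat.cast_add, Nat.cast_one, Nat.cast_zero, Nat.cast_mul, Nat.cast_ofNat] at this
    rw [show (2 * (M : ℤ) + 1 - M - 1) = M by ring, zero_sub] at this
    rw [← this]
    refine Finset.sum_congr rfl fun i _ => ?_
    congr 2
    ring
  have hq2 : ∑ i ∈ Finset.range (2 * N + 1), (↑(O.t ^ (-((i : ℤ) - N))) : A) *
      g.pr (((i : ℤ) - N) * ℓ) q = q := by
    rw [Finset.sum_eq_single N]
    · simp [g.pr_self hw]
    · intro i _ hi
      rw [g.pr_ne hw, mul_zero]
      intro h0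
      have h2 : ((i : ℤ) - N) = 0 :=
        (mul_eq_zero.1 h0.symm).resolve_right (by exact_mod_cast O.pos.ne')
      omega
    · intro h0
      exact absurd (Finset.mem_range.2 (by omega)) h0
  rw [← hq2]
  have hsum : ∀ i : ℕ, (↑(O.t ^ (-((i : ℤ) - N))) : A) * g.pr (((i : ℤ) - N) * ℓ) q =
      (w ((i : ℤ) - N - 1) - w ((i : ℤ) - N)) +
        (↑(O.t ^ (-((i : ℤ) - N))) : A) * g.pr (((i : ℤ) - N) * ℓ) c := fun i => by
    rw [← hterm, ← mul_add, ← map_add, ← hqa]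
  rw [Finset.sum_congr rfl fun i _ => hsum i, Finset.sum_add_distrib, htel]
  refine Ideal.add_mem _ (Ideal.sub_mem _ ?_ ?_) (Ideal.sum_mem _ fun i _ => ?_)
  · refine Ideal.mul_mem_left _ _ (hsmall _ ?_)
    rw [abs_of_nonpos (by omega)]; omega
  · exact Ideal.mul_mem_left _ _ (hsmall _ (by simp))
  · exact Ideal.mul_mem_left _ _ (g.pr_mem hc)

end OrbitRing

namespace OrbitRing

variable {A : Type} [CommRing A] [Algebra ℂ A] {𝔞 : Ideal A} {wt : ℤ → A → Prop} {ℓ : ℕ}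
  (O : OrbitRing 𝔞 wt ℓ) (g : TopGrading 𝔞 wt) {b : PoissonBracket A} {d : ℤ}
  (hb : ∀ i j f h, wt i f → wt j h → wt (i + j + d) (b.bracket f h))
  (hnd : ∀ f, O.ev f = 0 → (∀ h, O.ev (b.bracket f h) = 0) → f ∈ RingHom.ker O.ev ^ 2)

include g in
theorem ev_pr_eq_zero {f : A} {s : Finset ℤ} (D : Derivation ℂ A A)
    (hs : f - ∑ e ∈ s, g.pr e f ∈ 𝔞 ^ (1 + 1)) (h : ∀ e, O.ev (D (g.pr e f)) = 0) :
    O.ev (D f) = 0 := by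
  have h1 := O.ev_of_mem (f := D (f - ∑ e ∈ s, g.pr e f)) (by
    simpa using D.map_mem_pow 1 hs)
  rw [map_sub, map_sub, map_sum, map_sum, Finset.sum_eq_zero (fun e _ => h e), sub_zero] at h1
  exact h1

include g in
/-- A derivation not vanishing at the base point does not vanish on some homogeneous element of
weight zero of the ideal of definition, if it kills `t`. -/
theorem exists_homogeneous (D : Derivation ℂ A A) {f : A} (h : O.ev (D f) ≠ 0) :
    ∃ j : ℤ, O.ev (D (g.pr (j * ℓ) f)) ≠ 0 := by
  by_contra! hcon
  obtain ⟨s, hs⟩ := g.exists_sum 2 f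
  refine h (O.ev_pr_eq_zero g D hs fun e => ?_)
  by_cases h0 : g.pr e f = 0
  · rw [h0, map_zero, map_zero]
  · obtain ⟨j, rfl⟩ := O.dvd _ _ (g.wt_pr e f) h0
    rw [mul_comm]
    exact hcon j

include g in
theorem sub_ev_mem [IsHausdorff 𝔞 A] {f : A} (hf : wt 0 f) : f - algebraMap ℂ A (O.ev f) ∈ 𝔞 := by
  have h := O.sub_ev_smul_mem g (j := 0) (f := f) (by simpa using hf)
  rwa [zpow_zero, Units.val_one, ← Algebra.algebraMap_eq_smul_one] at h

include hnd hb g in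
theorem exists_stdSystem_zero [IsAdicComplete 𝔞 A] :
    ∃ k : ℤ, d = -(k * ℓ) ∧ ∃ S : StdSystem b wt 𝔞 k ℓ 0, S.t = O.t := by
  obtain ⟨f, hf⟩ : ∃ f, O.ev (b.bracket O.t f) ≠ 0 := by
    by_contra! h
    refine O.t_sub_one_notMem (hnd _ (by rw [map_sub, O.ev_t, map_one, sub_self]) fun f => ?_)
    rw [map_sub, LinearMap.sub_apply, ← map_one (algebraMap ℂ A), b.algebraMap_bracket, sub_zero]
    exact h f
  obtain ⟨j, hj⟩ := O.exists_homogeneous g (b.ham O.t) hf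
  rw [b.ham_apply] at hj
  set f' := g.pr (j * ℓ) f
  have hw : wt (j * ℓ) f' := g.wt_pr _ _
  have hwb := hb _ _ _ _ O.wt_t hw
  obtain ⟨i, hi⟩ := O.dvd _ _ hwb (fun h => hj (by rw [h, map_zero]))
  have hd : d = -((1 + j - i) * ℓ) := by linear_combination hi
  refine ⟨1 + j - i, hd, ?_⟩
  let v : A := ↑(O.t ^ (-j)) * f'
  have hv : wt 0 v := by
    have := g.mul (g.wt_zpow O.wt_t (-j)) hw
    rwa [neg_mul, neg_add_cancel] at this
  have hvt : b.bracket (v - algebraMap ℂ A (O.ev v)) O.t = -(↑(O.t ^ (-j)) * b.bracket O.t f') := by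
    rw [map_sub, LinearMap.sub_apply, b.algebraMap_bracket, sub_zero, b.leibniz_left,
      b.skew f', b.skew (↑(O.t ^ (-j)) : A), b.bracket_zpow, b.bracket_self]
    ring
  obtain ⟨S, hS, -⟩ := StdSystem.exists_zero g hd hb O.t O.wt_t (O.sub_ev_mem g hv)
    (g.wt_sub hv (g.wt_algebraMap _)) (by
      rw [hvt, IsUnit.neg_iff]
      exact (Units.isUnit _).mul (O.isUnit_of_ev_ne_zero g hwb hj))
  exact ⟨S, hS⟩

variable {k : ℤ} (hd : d = -(k * ℓ))

include hnd hb g hd in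
theorem exists_stdSystem_succ [IsAdicComplete 𝔞 A] {r : ℕ} (S : StdSystem b wt 𝔞 k ℓ r)
    (hS : S.t = O.t) (hflat : ¬ ∀ f ∈ S.frame.flat, f ∈ 𝔞 → f ∈ 𝔞 ^ 2) :
    ∃ S' : StdSystem b wt 𝔞 k ℓ (r + 1), S'.t = O.t := by
  have hF := S.isGraded g hd hb
  obtain ⟨q, hq, hq𝔞, hwq, hq2⟩ : ∃ q ∈ S.frame.flat, q ∈ 𝔞 ∧ wt 0 q ∧ q ∉ 𝔞 ^ 2 := by
    push Not at hflat
    obtain ⟨f, hf, hf1, hf2⟩ := hflat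
    obtain ⟨e, he⟩ := g.exists_pr_notMem (N := (𝔞 ^ 2).toAddSubgroup) (n := 2)
      (fun f hf => hf) hf2
    have h0 : g.pr e f ≠ 0 := fun h => he (by rw [h]; exact zero_mem _)
    have hw := g.wt_pr e f
    obtain ⟨j, rfl⟩ := O.dvd _ _ hw h0
    rw [mul_comm (ℓ : ℤ)] at *
    have hm : g.pr (j * ℓ) f ∈ 𝔞 := by
      rw [← pow_one 𝔞] at hf1
      simpa using g.pr_mem hf1
    refine ⟨↑(O.t ^ (-j)) * g.pr (j * ℓ) f, mul_mem ?_ (hF.pr_mem_flat g _ hf),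
      𝔞.mul_mem_left _ hm, ?_, fun h => he ?_⟩
    · rw [← hS]; exact S.zpow_t_mem_flat _
    · have := g.mul (g.wt_zpow O.wt_t (-j)) hw
      rwa [neg_mul, neg_add_cancel] at this
    · have h2 := Ideal.mul_mem_left _ (↑(O.t ^ j) : A) h
      rw [← mul_assoc, ← Units.val_mul, ← zpow_add, add_neg_cancel, zpow_zero, Units.val_one,
        one_mul] at h2
      exact h2
  have hqt := (S.mem_flat.1 hq).1
  have hut := congrArg O.ev S.std.u_t
  rw [hS, O.ev_zpow] at hut
  rw [hS] at hqt
  set μ : ℂ := O.ev (b.bracket q S.u)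
  let q' : A := q + μ • ((O.t : A) - 1)
  have hq't : ∀ f, b.bracket q' f = b.bracket q f + μ • b.bracket O.t f := fun f => by
    simp only [q', map_add, map_smul, map_sub, LinearMap.add_apply, LinearMap.smul_apply,
      LinearMap.sub_apply]
    rw [b.skew 1 f, b.bracket_one, neg_zero, sub_zero]
  have hq'x : ∀ i, O.ev (b.bracket q' (S.x i)) = 0 := by
    intro i
    rw [hq't, map_add, O.ev_smul]
    rcases i with _ | i | i
    · change μ + μ * O.ev (b.bracket O.t S.u) = 0
      rw [b.skew, map_neg, hut]
      ring
    · have h1 : b.bracket O.t (S.zo i) = 0 := by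
        have := S.bracket_conj_zo none i
        change b.bracket S.t _ = _ * b.bracket S.t _ at this
        rwa [S.std.t_zo, mul_zero, hS] at this
      change O.ev (b.bracket q (S.zo i)) + μ * O.ev (b.bracket O.t (S.zo i)) = 0
      rw [((S.mem_flat.1 hq).2 i).1, h1, map_zero, mul_zero, zero_add]
    · have h1 := S.std.t_ze i
      rw [hS] at h1
      change O.ev (b.bracket q (S.ze i)) + μ * O.ev (b.bracket O.t (S.ze i)) = 0
      rw [((S.mem_flat.1 hq).2 i).2, h1, map_zero, mul_zero, zero_add]
  obtain ⟨f, hf⟩ : ∃ f, O.ev (b.bracket q' f) ≠ 0 := by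
    by_contra! h
    have h1 := hnd q' (by
      rw [map_add, O.ev_smul, map_sub, O.ev_t, map_one, O.ev_of_mem hq𝔞]; ring) h
    by_cases hμ : μ = 0
    · rw [show q' = q by simp [q', hμ]] at h1
      exact hq2 (O.mem_sq_of_mem_ker_sq g hwq hq𝔞 h1)
    · exact O.add_smul_notMem hq𝔞 hμ h1
  have hproj : O.ev (b.bracket q (S.frame.proj f : A)) ≠ 0 := by
    have h1 : ∀ a ∈ S.frame.ideal, O.ev (b.bracket q' a) = 0 := by
      intro a ha
      refine Submodule.span_induction (fun x hx => ?_) (by simp) (fun x y _ _ hx hy => by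
        rw [map_add, map_add, hx, hy, add_zero]) (fun c x hx' hx => ?_) ha
      · obtain ⟨i, rfl⟩ := hx
        exact hq'x i
      · rw [smul_eq_mul, b.leibniz, map_add, map_mul, map_mul, hx,
          O.ev_of_mem (S.frame.ideal_le hx'), mul_zero, mul_zero, add_zero]
    have h2 := h1 _ (S.frame.sub_proj_mem f)
    rw [map_sub, map_sub, sub_eq_zero] at h2
    have h3 := S.bracket_t (S.frame.proj f).2 1
    rw [zpow_one, hS] at h3
    rw [h2, hq't, b.skew O.t, h3, neg_zero, smul_zero, add_zero] at hf
    exact hf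
  obtain ⟨j, hj⟩ := O.exists_homogeneous g (b.ham q) hproj
  rw [b.ham_apply] at hj
  set p := g.pr (j * ℓ) (S.frame.proj f : A)
  have hp : p ∈ S.frame.flat := hF.pr_mem_flat g _ (S.frame.proj f).2
  have hwp : wt (j * ℓ) p := g.wt_pr _ _
  let v : A := ↑(O.t ^ (-j)) * p
  have hv : wt 0 v := by
    have := g.mul (g.wt_zpow O.wt_t (-j)) hwp
    rwa [neg_mul, neg_add_cancel] at this
  have hvq : b.bracket (v - algebraMap ℂ A (O.ev v)) q = -(↑(O.t ^ (-j)) * b.bracket q p) := by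
    rw [map_sub, LinearMap.sub_apply, b.algebraMap_bracket, sub_zero, b.leibniz_left,
      b.skew p, b.skew (↑(O.t ^ (-j)) : A), b.bracket_zpow, hqt]
    ring
  obtain ⟨S', hS', -⟩ := S.exists_succ g hd hb (x := v - algebraMap ℂ A (O.ev v)) (q := q)
    (sub_mem (mul_mem (by rw [← hS]; exact S.zpow_t_mem_flat _) hp)
      (Subalgebra.algebraMap_mem _ _)) hq (g.wt_sub hv (g.wt_algebraMap _)) hwq
    (O.sub_ev_mem g hv) hq𝔞 (by
      rw [hvq, IsUnit.neg_iff]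
      exact (Units.isUnit _).mul (O.isUnit_of_ev_ne_zero g (hb _ _ _ _ hwq hwp) hj))
  exact ⟨S', hS'.trans hS⟩

include O in
/-- The number of coordinates is bounded by the number of generators. -/
theorem card_le_of_span {ι : Type} [Fintype ι] (F : FlatFrame 𝔞 ι) {n : ℕ} (f : Fin n → A)
    (hf : 𝔞 = Ideal.span (Set.range f)) : Fintype.card ι ≤ n := by
  classical
  have h1 : ∀ i, ∃ c : Fin n → A, ∑ l, c l * f l = F.x i := fun i => by
    have := hf.le (F.x_mem i)
    exact (Ideal.mem_span_range_iff_exists_fun).1 this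
  choose c hc using h1
  let M : Matrix ι (Fin n) ℂ := Matrix.of fun i l => O.ev (c i l)
  let N : Matrix (Fin n) ι ℂ := Matrix.of fun l i => O.ev (F.D i (f l))
  have hMN : M * N = 1 := by
    ext i j
    have h2 := congrArg (fun a => O.ev (F.D j a)) (hc i)
    simp only [map_sum, Derivation.leibniz, smul_eq_mul, map_add, map_mul] at h2
    have h3 : ∀ l, O.ev (f l) = 0 := fun l =>
      O.ev_of_mem (hf.ge (Ideal.subset_span ⟨l, rfl⟩))
    simp only [h3, zero_mul, add_zero] at h2
    rw [Matrix.mul_apply, Matrix.one_apply]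
    simp only [M, N, Matrix.of_apply]
    rw [h2]
    split_ifs with h4
    · rw [h4, F.D_self, map_one]
    · rw [F.D_ne j i (Ne.symm h4), map_zero]
  have h4 := Matrix.rank_mul_le_left M N
  rw [hMN, Matrix.rank_one] at h4
  exact h4.trans ((Matrix.rank_le_card_width M).trans (by simp))

include hnd hb g in
/-- Existence of standard coordinates which exhaust the directions transversal to the orbit. -/
theorem exists_maximal_stdSystem [IsNoetherianRing A] [IsAdicComplete 𝔞 A] :
    ∃ k : ℤ, d = -(k * ℓ) ∧ ∃ (r : ℕ) (S : StdSystem b wt 𝔞 k ℓ r), S.t = O.t ∧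
      ∀ f ∈ S.frame.flat, f ∈ 𝔞 → f ∈ 𝔞 ^ 2 := by
  obtain ⟨k, hd, S₀, hS₀⟩ := O.exists_stdSystem_zero g hb hnd
  refine ⟨k, hd, ?_⟩
  by_contra! hcon
  have h : ∀ r, ∃ S : StdSystem b wt 𝔞 k ℓ r, S.t = O.t := fun r => by
    induction r with
    | zero => exact ⟨S₀, hS₀⟩
    | succ r ih =>
      obtain ⟨S, hS⟩ := ih
      refine O.exists_stdSystem_succ g hb hnd hd S hS fun h => ?_
      obtain ⟨f, h1, h2, h3⟩ := hcon r S hS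
      exact h3 (h f h1 h2)
  obtain ⟨n, f, hf⟩ := Submodule.fg_iff_exists_fin_generating_family.1 (IsNoetherian.noetherian 𝔞)
  obtain ⟨S, -⟩ := h n
  have := O.card_le_of_span S.frame f hf.symm
  simp at this

end OrbitRing

namespace StdSystem

variable {A : Type} [CommRing A] [Algebra ℂ A] {𝔞 : Ideal A} {wt : ℤ → A → Prop} {ℓ : ℕ}
  (O : OrbitRing 𝔞 wt ℓ) (g : TopGrading 𝔞 wt) {b : PoissonBracket A} {d : ℤ}
  (hb : ∀ i j f h, wt i f → wt j h → wt (i + j + d) (b.bracket f h)) {k : ℤ}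
  (hd : d = -(k * ℓ)) [IsAdicComplete 𝔞 A] {r : ℕ} (S : StdSystem b wt 𝔞 k ℓ r)
  (hS : S.t = O.t) (hflat : ∀ f ∈ S.frame.flat, f ∈ 𝔞 → f ∈ 𝔞 ^ 2)

include hflat in
theorem flat_inf_eq_zero {f : A} (hf : f ∈ S.frame.flat) (h : f ∈ 𝔞) : f = 0 := by
  have hsq : S.frame.flatIdeal ≤ S.frame.flatIdeal ^ 2 := fun q hq => by
    rw [S.frame.mem_flatIdeal_pow]
    exact hflat q q.2 hq
  have hpow : ∀ n, S.frame.flatIdeal ≤ S.frame.flatIdeal ^ n := fun n => by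
    induction n with
    | zero => simp
    | succ n ih =>
      refine hsq.trans ?_
      rw [pow_two, pow_succ]
      exact Ideal.mul_mono ih le_rfl
  refine eq_zero_of_forall_mem_pow (𝔨 := 𝔞) fun n => ?_
  exact S.frame.mem_flatIdeal_pow.1 (hpow n (show (⟨f, hf⟩ : S.frame.flat) ∈ _ from h))

include hflat hS in
theorem coeff_eq_zero {n : ℕ} {p : MvPolynomial (DiskIdx r) ℂ[T;T⁻¹]}
    (hp : MvPolynomial.eval₂ O.φ S.x p ∈ 𝔞 ^ n) {α : DiskIdx r →₀ ℕ} (hα : α.degree < n) :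
    p.coeff α = 0 := by
  have hφ : ∀ c, O.φ c ∈ S.frame.flat := fun c => by
    rw [LaurentPolynomial.ringHom_apply_eq_sum O.φ O.φ_C O.φ_T]
    refine sum_mem fun j _ => Subalgebra.smul_mem _ ?_ _
    rw [← hS]
    exact S.zpow_t_mem_flat j
  let φ' : ℂ[T;T⁻¹] →+* S.frame.flat := O.φ.codRestrict _ hφ
  have h1 : S.frame.evalPoly (MvPolynomial.map φ' p) = MvPolynomial.eval₂ O.φ S.x p := by
    change MvPolynomial.eval₂ (S.frame.flat.val : S.frame.flat →+* A) S.x _ = _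
    rw [MvPolynomial.eval₂_map]
    rfl
  rw [← h1] at hp
  have h2 := S.frame.coeff_mem_of_evalPoly_mem hp α
  rw [MvPolynomial.coeff_map] at h2
  have h3 := Ideal.pow_le_self (by omega) h2
  have h4 := S.flat_inf_eq_zero hflat (hφ _) h3
  rwa [map_eq_zero_iff _ O.φ_injective] at h4

include hflat hS hb hd g in
/-- Standard coordinates which exhaust the directions transversal to the orbit form a chart. -/
theorem exists_formalChart :
    ∃ Φ : FormalChart 𝔞 wt ℓ r, IsStandard b k Φ.t Φ.u Φ.zo Φ.ze ∧ Φ.t = O.t := by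
  have hF := S.isGraded g hd hb
  have h𝔞 : 𝔞 = Ideal.span (Set.range S.x) := by
    refine le_antisymm (S.frame.le_sup.trans (sup_le le_rfl ?_)) S.frame.ideal_le
    refine Ideal.map_le_iff_le_comap.2 fun q hq => ?_
    rw [Ideal.mem_comap]
    have : (q : A) = 0 := S.flat_inf_eq_zero hflat q.2 hq
    change (q : A) ∈ _
    rw [this]
    exact zero_mem _
  obtain ⟨E, hE, hEp⟩ := exists_evalSeries 𝔞 O.φ S.x S.frame.x_mem
  have hEC : ∀ c, E (MvPowerSeries.C c) = O.φ c := fun c => by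
    rw [← MvPolynomial.coe_C, hEp, MvPolynomial.eval₂_C]
  have hEX : ∀ i, E (MvPowerSeries.X i) = S.x i := fun i => by
    rw [← MvPolynomial.coe_X, hEp, MvPolynomial.eval₂_X]
  have hsurj : Function.Surjective E := surjective_of_evalSeries 𝔞 hEp h𝔞 fun f =>
    ⟨O.ψ f, O.sub_φ_mem f⟩
  have hinj : Function.Injective E := by
    refine (injective_iff_map_eq_zero E).2 fun f hf => ?_
    refine MvPowerSeries.ext fun α => ?_
    have h1 := hE (α.degree + 1) f
    rw [hf, zero_sub, neg_mem_iff] at h1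
    have h2 := S.coeff_eq_zero O hS hflat h1 (Nat.lt_succ_self α.degree)
    rwa [MvPowerSeries.coeff_truncTotal _ (Nat.lt_succ_self _)] at h2
  let Ea : DiskFun r →ₐ[ℂ] A :=
    { E with
      commutes' := fun c => by
        change E (algebraMap ℂ (DiskFun r) c) = _
        rw [← MvPowerSeries.C_laurentC, hEC, O.φ_C] }
  let Ee : DiskFun r ≃ₐ[ℂ] A := AlgEquiv.ofBijective Ea ⟨hinj, hsurj⟩
  have hEe : ∀ f, Ee f = E f := fun _ => rfl
  have htr : ∀ n a, a - MvPolynomial.eval₂ O.φ S.x ((Ee.symm a).truncTotal n) ∈ 𝔞 ^ n :=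
    fun n a => by
      have := hE n (Ee.symm a)
      rwa [← hEe, AlgEquiv.apply_symm_apply] at this
  have hwx : ∀ α : DiskIdx r →₀ ℕ, wt 0 (∏ i ∈ α.support, S.x i ^ α i) := fun α => by
    refine Finset.prod_induction _ (wt 0) (fun _ _ h h' => by simpa using g.mul h h') g.one
      fun i _ => ?_
    simpa using g.wt_pow (hF.wt_x i) (α i)
  let Φ : FormalChart 𝔞 wt ℓ r :=
    { equiv := Ee.symm
      map_ideal := by
        have h1 : 𝔞 = (Ideal.span (Set.range MvPowerSeries.X)).map (Ee : DiskFun r →+* A) := by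
          rw [Ideal.map_span, ← Set.range_comp]
          conv_lhs => rw [h𝔞]
          congr 2
          funext i
          exact (hEX i).symm
        conv_lhs => rw [h1]
        rw [Ideal.map_map]
        have : (Ee.symm : A →+* DiskFun r).comp (Ee : DiskFun r →+* A) = RingHom.id _ :=
          RingHom.ext fun f => Ee.symm_apply_apply f
        rw [this, Ideal.map_id]
      weight := by
        intro e a
        constructor
        · intro ha α j hj
          by_contra hne
          refine hj ?_
          let n := α.degree + 1
          let p := (Ee.symm a).truncTotal n
          let p' : MvPolynomial (DiskIdx r) ℂ[T;T⁻¹] :=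
            ∑ β ∈ p.support, MvPolynomial.monomial β
              (LaurentPolynomial.C ((p.coeff β).coeff j) * LaurentPolynomial.T j)
          have h1 : g.pr (j * ℓ) (MvPolynomial.eval₂ O.φ S.x p) =
              MvPolynomial.eval₂ O.φ S.x p' := by
            rw [MvPolynomial.eval₂_eq, map_sum, MvPolynomial.eval₂_sum]
            refine Finset.sum_congr rfl fun β _ => ?_
            rw [mul_comm (O.φ _), ← zero_add (j * (ℓ : ℤ)), g.pr_mul (hwx β), O.pr_φ g,
              MvPolynomial.eval₂_monomial, mul_comm, map_mul, O.φ_C,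
              LaurentPolynomial.ringHom_T O.φ O.φ_T, Algebra.smul_def, Finsupp.prod]
          have h2 : MvPolynomial.eval₂ O.φ S.x p' ∈ 𝔞 ^ n := by
            have h3 := g.pr_mem (e := j * ℓ) (htr n a)
            rw [map_sub, g.pr_ne ha (Ne.symm hne), zero_sub, neg_mem_iff, h1] at h3
            exact h3
          have h4 := S.coeff_eq_zero O hS hflat h2 (Nat.lt_succ_self α.degree)
          have h5 : p'.coeff α =
              LaurentPolynomial.C ((p.coeff α).coeff j) * LaurentPolynomial.T j := by
            rw [MvPolynomial.coeff_sum]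
            simp only [MvPolynomial.coeff_monomial]
            rw [Finset.sum_ite_eq']
            split_ifs with h6
            · rfl
            · rw [MvPolynomial.notMem_support_iff.1 h6]
              simp
          rw [h5, ← LaurentPolynomial.single_eq_C_mul_T] at h4
          have h6 := congrArg (fun c => c.coeff j) h4
          simp only [AddMonoidAlgebra.coeff_single, Finsupp.single_eq_same] at h6
          rw [MvPowerSeries.coeff_truncTotal _ (Nat.lt_succ_self _)] at h6
          exact h6
        · intro h
          refine g.isAdicClosed_space e _ fun n =>
            ⟨MvPolynomial.eval₂ O.φ S.x ((Ee.symm a).truncTotal n), ?_, htr n a⟩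
          change wt e _
          rw [MvPolynomial.eval₂_eq]
          refine sum_mem (S := g.space e) fun α _ => ?_
          change wt e _
          have h1 : wt e (O.φ (((Ee.symm a).truncTotal n).coeff α)) := by
            by_cases hα : α.degree < n
            · rw [MvPowerSeries.coeff_truncTotal _ hα,
                LaurentPolynomial.ringHom_apply_eq_sum O.φ O.φ_C O.φ_T, Finsupp.sum]
              refine sum_mem (S := g.space e) fun j hj => (g.space e).smul_mem _ ?_
              rw [← h α j (Finsupp.mem_support_iff.1 hj)]
              exact g.wt_zpow O.wt_t j
            · rw [MvPowerSeries.coeff_truncTotal_eq_zero _ (not_lt.1 hα), map_zero]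
              exact g.wt_zero e
          simpa using g.mul h1 (hwx α) }
  have hΦs : ∀ f, Φ.equiv.symm f = E f := fun _ => rfl
  have ht : Φ.t = O.t := Units.ext (by
    change Φ.equiv.symm (MvPowerSeries.C (LaurentPolynomial.T 1)) = _
    rw [hΦs, hEC, O.φ_T])
  have hx : ∀ i, Φ.equiv.symm (MvPowerSeries.X i) = S.x i := fun i => by rw [hΦs, hEX]
  have hu : Φ.u = S.u := hx none
  have hzo : Φ.zo = S.zo := funext fun i => hx (some (Sum.inl i))
  have hze : Φ.ze = S.ze := funext fun i => hx (some (Sum.inr i))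
  refine ⟨Φ, ?_, ht⟩
  rw [ht, hu, hzo, hze, ← hS]
  exact S.std

end StdSystem

/-- The equivariant Darboux theorem along an orbit. -/
theorem OrbitRing.exists_standard_chart {A : Type} [CommRing A] [Algebra ℂ A] {𝔞 : Ideal A}
    {wt : ℤ → A → Prop} {ℓ : ℕ} (O : OrbitRing 𝔞 wt ℓ) (g : TopGrading 𝔞 wt)
    {b : PoissonBracket A} {d : ℤ}
    (hb : ∀ i j f h, wt i f → wt j h → wt (i + j + d) (b.bracket f h))
    (hnd : ∀ f, O.ev f = 0 → (∀ h, O.ev (b.bracket f h) = 0) → f ∈ RingHom.ker O.ev ^ 2)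
    [IsNoetherianRing A] [IsAdicComplete 𝔞 A] :
    ∃ (k : ℤ) (r : ℕ), d = -(k * ℓ) ∧
      ∃ Φ : FormalChart 𝔞 wt ℓ r, IsStandard b k Φ.t Φ.u Φ.zo Φ.ze ∧ Φ.t = O.t := by
  obtain ⟨k, hd, r, S, hS, hflat⟩ := O.exists_maximal_stdSystem g hb hnd
  exact ⟨k, r, hd, S.exists_formalChart O g hb hd hS hflat⟩

section Height

/-- The homomorphism to dual numbers given by a derivation. -/
def Derivation.dual {R S : Type} [CommRing R] [Algebra ℂ R] [CommRing S] [Algebra ℂ S]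
    (D : Derivation ℂ R R) (φ : R →ₐ[ℂ] S) : R →ₐ[ℂ] DualNumber S where
  toFun r := TrivSqZeroExt.inl (φ r) + TrivSqZeroExt.inr (φ (D r))
  map_one' := by ext <;> simp
  map_mul' r s := by
    ext <;> simp
    ring
  map_zero' := by ext <;> simp
  map_add' r s := by ext <;> simp
  commutes' c := by ext <;> simp [TrivSqZeroExt.algebraMap_eq_inl']

/-- The derivation given by a section of the projection of the dual numbers. -/
def Derivation.ofDual {S : Type} [CommRing S] [Algebra ℂ S] (L : S →ₐ[ℂ] DualNumber S)
    (h : ∀ s, (L s).fst = s) : Derivation ℂ S S where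
  toFun s := (L s).snd
  map_add' := by simp
  map_smul' := by simp
  map_one_eq_zero' := by simp
  leibniz' a b := by
    simp [h, mul_comm]

theorem Derivation.exists_quotient {R : Type} [CommRing R] [Algebra ℂ R] (D : Derivation ℂ R R)
    (I : Ideal R) (h : ∀ f ∈ I, D f ∈ I) : ∃ D' : Derivation ℂ (R ⧸ I) (R ⧸ I),
      ∀ f, D' (Ideal.Quotient.mk I f) = Ideal.Quotient.mk I (D f) := by
  let L : R ⧸ I →ₐ[ℂ] DualNumber (R ⧸ I) :=
    Ideal.Quotient.liftₐ I (D.dual (Ideal.Quotient.mkₐ ℂ I)) fun f hf => by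
      ext
      · simpa [Derivation.dual] using Ideal.Quotient.eq_zero_iff_mem.2 hf
      · simpa [Derivation.dual] using Ideal.Quotient.eq_zero_iff_mem.2 (h f hf)
  have hL : ∀ f, L (Ideal.Quotient.mk I f) = D.dual (Ideal.Quotient.mkₐ ℂ I) f := fun f => rfl
  refine ⟨Derivation.ofDual L fun s => ?_, fun f => ?_⟩
  · obtain ⟨f, rfl⟩ := Ideal.Quotient.mk_surjective s
    rw [hL]
    simp [Derivation.dual]
  · change (L _).snd = _
    rw [hL]
    simp [Derivation.dual]

theorem Derivation.exists_localization {R : Type} [CommRing R] [Algebra ℂ R]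
    (D : Derivation ℂ R R) (M : Submonoid R) :
    ∃ D' : Derivation ℂ (Localization M) (Localization M),
      ∀ f, D' (algebraMap R _ f) = algebraMap R _ (D f) := by
  let φ : R →ₐ[ℂ] Localization M := IsScalarTower.toAlgHom ℂ R (Localization M)
  let L : Localization M →ₐ[ℂ] DualNumber (Localization M) :=
    IsLocalization.liftAlgHom (M := M) (f := D.dual φ) fun y => by
      rw [TrivSqZeroExt.isUnit_iff_isUnit_fst]
      simpa [Derivation.dual, φ] using IsLocalization.map_units (Localization M) y
  have hL : ∀ f, L (algebraMap R _ f) = D.dual φ f := fun f => IsLocalization.lift_eq _ _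
  refine ⟨Derivation.ofDual L fun s => ?_, fun f => ?_⟩
  · have : (TrivSqZeroExt.fstHom (Localization M) (Localization M)
        (Localization M) : DualNumber (Localization M) →+* Localization M).comp
          (L : Localization M →+* DualNumber (Localization M)) = RingHom.id _ := by
      refine IsLocalization.ringHom_ext M (RingHom.ext fun f => ?_)
      change (L (algebraMap R _ f)).fst = _
      rw [hL]
      simp [Derivation.dual, φ]
    exact congrArg (fun h => h s) this
  · change (L _).snd = _
    rw [hL]
    simp [Derivation.dual]
    rfl

theorem Derivation.eq_zero_of_mul_eq_zero {R : Type} [CommRing R] [Algebra ℂ R]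
    [IsNoetherianRing R] (D : Derivation ℂ R R) {x : R} (hD : D x = 1) {f : R} (hf : x * f = 0) :
    f = 0 := by
  classical
  have hDpow : ∀ (n : ℕ) f, D (x ^ (n + 1) * f) = ((n : ℂ) + 1) • (x ^ n * f) + x ^ (n + 1) * D f :=
    fun n f => by
      rw [D.leibniz, D.leibniz_pow, hD, add_comm]
      have e : ((n : ℂ) + 1) • (x ^ n * f) = ((n : R) + 1) * (x ^ n * f) := by
        rw [Algebra.smul_def, map_add, _root_.map_natCast, map_one]
      rw [e, nsmul_eq_mul]
      simp only [Nat.add_sub_cancel, smul_eq_mul, mul_one, Nat.cast_add, Nat.cast_one]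
      ring
  have hc : ∀ n : ℕ, ((n : ℂ) + 1) ≠ 0 := fun n => by exact_mod_cast n.succ_ne_zero
  have hstab : ∃ N : ℕ, ∀ f, x ^ (N + 1) * f = 0 → x ^ N * f = 0 := by
    let c : ℕ →o Ideal R := ⟨fun n => LinearMap.ker (LinearMap.mulLeft R (x ^ n)), by
      refine monotone_nat_of_le_succ fun n f hf => ?_
      rw [LinearMap.mem_ker, LinearMap.mulLeft_apply] at hf ⊢
      rw [pow_succ', mul_assoc, hf, mul_zero]⟩
    obtain ⟨N, hN⟩ := monotone_stabilizes_iff_noetherian.2 ‹IsNoetherianRing R› c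
    refine ⟨N, fun f hf => ?_⟩
    have h1 : f ∈ c (N + 1) := hf
    rw [← hN (N + 1) (Nat.le_succ N)] at h1
    exact h1
  obtain ⟨N, hN, hmin⟩ := Nat.findX hstab
  rcases N with _ | M
  · simpa using hN f (by simpa using hf)
  · exfalso
    refine hmin M (Nat.lt_succ_self M) fun f hf => ?_
    have h1 := hDpow (M + 1) f
    rw [pow_succ' x (M + 1), mul_assoc, hf, smul_zero, zero_add, mul_zero, map_zero] at h1
    have h2 := hN (D f) (by rw [pow_succ' x (M + 1)]; exact h1.symm)
    have h3 := hDpow M f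
    rw [hf, map_zero, h2, add_zero] at h3
    exact (smul_eq_zero_iff_right (hc M)).1 h3.symm

theorem le_ringKrullDim_of_derivation (n : ℕ) : ∀ {R : Type} [CommRing R] [Algebra ℂ R]
    [IsNoetherianRing R] (D : Fin n → Derivation ℂ R R) (x : Fin n → R),
    (∀ i j, D i (x j) = if i = j then 1 else 0) → Ideal.span (Set.range x) ≠ ⊤ →
      (n : WithBot ℕ∞) ≤ ringKrullDim R := by
  induction n with
  | zero =>
    intro R _ _ _ D x _ hx
    have : Nontrivial R := by
      by_contra h
      rw [not_nontrivial_iff_subsingleton] at h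
      exact hx (Subsingleton.elim _ _)
    simpa using ringKrullDim_nonneg_of_nontrivial (R := R)
  | succ n ih =>
    intro R _ _ _ D x h hx
    let I : Ideal R := Ideal.span {x 0}
    have hDI : ∀ i : Fin n, ∀ f ∈ I, D i.succ f ∈ I := fun i f hf => by
      obtain ⟨a, rfl⟩ := Ideal.mem_span_singleton'.1 hf
      rw [Derivation.leibniz, h, if_neg (Fin.succ_ne_zero i), smul_zero, zero_add, smul_eq_mul]
      exact I.mul_mem_right _ (Ideal.mem_span_singleton_self _)
    choose D' hD' using fun i => (D (Fin.succ i)).exists_quotient I (hDI i)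
    have h1 := ih D' (fun i => Ideal.Quotient.mk I (x i.succ)) (fun i j => by
      rw [hD', h]
      simp only [Fin.succ_inj]
      split_ifs <;> simp) (fun htop => hx (by
        rw [Ideal.eq_top_iff_one] at htop ⊢
        have h2 : Set.range (fun i : Fin n => Ideal.Quotient.mk I (x i.succ)) =
            Ideal.Quotient.mk I '' Set.range (fun i : Fin n => x i.succ) := by
          rw [← Set.range_comp]; rfl
        rw [h2, ← Ideal.map_span, ← map_one (Ideal.Quotient.mk I), ← Ideal.mem_comap,
          Ideal.comap_map_of_surjective _ Ideal.Quotient.mk_surjective] at htop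
        refine (sup_le ?_ ?_ : _ ≤ Ideal.span (Set.range x)) htop
        · exact Ideal.span_mono (by rintro _ ⟨i, rfl⟩; exact ⟨i.succ, rfl⟩)
        · rw [← RingHom.ker_eq_comap_bot, Ideal.mk_ker]
          exact Ideal.span_mono (by rintro _ rfl; exact ⟨0, rfl⟩)))
    have h2 := ringKrullDim_quotient_succ_le_of_nonZeroDivisor (r := x 0)
      (mem_nonZeroDivisors_iff_left.2 fun f hf => (D 0).eq_zero_of_mul_eq_zero (by simp [h]) hf)
    refine le_trans ?_ h2
    push_cast
    exact add_le_add_left h1 1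

theorem Ideal.le_height_of_derivation {B : Type} [CommRing B] [Algebra ℂ B] [IsNoetherianRing B]
    (𝔭 : Ideal B) [𝔭.IsPrime] {n : ℕ} (D : Fin n → Derivation ℂ B B) (x : Fin n → B)
    (hx : ∀ i, x i ∈ 𝔭) (hD : ∀ i j, D i (x j) - (if i = j then 1 else 0) ∈ 𝔭) :
    (n : ℕ∞) ≤ 𝔭.height := by
  classical
  let R := Localization.AtPrime 𝔭
  choose D' hD' using fun i => (D i).exists_localization 𝔭.primeCompl
  let M : Matrix (Fin n) (Fin n) R := Matrix.of fun i j => algebraMap B R (D i (x j))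
  have hM : IsUnit M.det := by
    have h0 : (Matrix.of fun i j => D i (x j)).det ∉ 𝔭 := by
      intro h
      have h1 := Ideal.Quotient.eq_zero_iff_mem.2 h
      rw [RingHom.map_det] at h1
      have h2 : (Ideal.Quotient.mk 𝔭).mapMatrix (Matrix.of fun i j => D i (x j)) = 1 := by
        ext i j
        rw [RingHom.mapMatrix_apply, Matrix.map_apply, Matrix.of_apply, Matrix.one_apply,
          Ideal.Quotient.eq.2 (hD i j)]
        split_ifs <;> simp
      rw [h2, Matrix.det_one] at h1
      exact one_ne_zero h1
    have h3 : M.det = algebraMap B R (Matrix.of fun i j => D i (x j)).det := by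
      rw [RingHom.map_det]
      rfl
    rw [h3]
    exact IsLocalization.map_units R (⟨_, h0⟩ : 𝔭.primeCompl)
  have h1 := le_ringKrullDim_of_derivation n (fun i => ∑ l, M⁻¹ i l • D' l)
    (fun j => algebraMap B R (x j)) (fun i j => by
      have h2 := congrFun (congrFun (Matrix.nonsing_inv_mul M hM) i) j
      rw [Matrix.mul_apply, Matrix.one_apply] at h2
      have hsum : ∀ (s : Finset (Fin n)) (E : Fin n → Derivation ℂ R R) (f : R),
          (∑ l ∈ s, E l) f = ∑ l ∈ s, E l f := fun s E f => by
        induction s using Finset.induction_on with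
        | empty => simp
        | insert a s ha ih => rw [Finset.sum_insert ha, Finset.sum_insert ha, Derivation.add_apply, ih]
      rw [← h2, hsum]
      refine Finset.sum_congr rfl fun l _ => ?_
      rw [Derivation.smul_apply, hD', smul_eq_mul]
      rfl) (fun h => by
        have h2 : Ideal.span (Set.range fun j => algebraMap B R (x j)) ≤
            IsLocalRing.maximalIdeal R := by
          rw [Ideal.span_le]
          rintro _ ⟨j, rfl⟩
          exact (IsLocalization.AtPrime.to_map_mem_maximal_iff R 𝔭 (x j)).2 (hx j)
        rw [h, top_le_iff] at h2
        exact (IsLocalRing.maximalIdeal.isMaximal R).ne_top h2)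
  rw [IsLocalization.AtPrime.ringKrullDim_eq_height 𝔭 R] at h1
  exact_mod_cast h1

theorem Ideal.height_le_of_le_sup_sq {B : Type} [CommRing B] [IsNoetherianRing B]
    (𝔭 : Ideal B) [h𝔭 : 𝔭.IsPrime] {n : ℕ} (x : Fin n → B) (hx : ∀ i, x i ∈ 𝔭)
    (h : 𝔭 ≤ Ideal.span (Set.range x) ⊔ 𝔭 ^ 2) : 𝔭.height ≤ n := by
  classical
  have hmin : 𝔭 ∈ (Ideal.span (Set.range x)).minimalPrimes := by
    refine ⟨⟨h𝔭, Ideal.span_le.2 (by rintro _ ⟨i, rfl⟩; exact hx i)⟩, fun q ⟨hq, hxq⟩ hq𝔭 => ?_⟩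
    have h1 : IsIdempotentElem (𝔭.map (Ideal.Quotient.mk q)) := by
      refine le_antisymm Ideal.mul_le_right ?_
      rw [← pow_two, ← Ideal.map_pow]
      refine (Ideal.map_mono h).trans ?_
      rw [Ideal.map_sup]
      refine sup_le ?_ le_rfl
      refine (Ideal.map_mono hxq).trans ?_
      rw [Ideal.map_quotient_self]
      exact bot_le
    rcases (Ideal.isIdempotentElem_iff_eq_bot_or_top _ (IsNoetherian.noetherian _)).1 h1 with h2 | h2
    · rw [Ideal.map_eq_bot_iff_le_ker, Ideal.mk_ker] at h2
      exact h2
    · exfalso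
      have h3 : (1 : B ⧸ q) ∈ 𝔭.map (Ideal.Quotient.mk q) := h2 ▸ Submodule.mem_top
      rw [← map_one (Ideal.Quotient.mk q), Ideal.mem_quotient_iff_mem hq𝔭] at h3
      exact h𝔭.ne_top ((Ideal.eq_top_iff_one _).2 h3)
  have h1 := Ideal.height_le_card_of_mem_minimalPrimes_span_finset
    (s := Finset.univ.image x) (p := 𝔭) (by simpa using hmin)
  refine h1.trans ?_
  exact_mod_cast Finset.card_image_le.trans (by simp)

end Height

section ChartHeight

variable {A : Type} [CommRing A] [Algebra ℂ A] {𝔞 : Ideal A} {wt : ℤ → A → Prop} {ℓ m : ℕ}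
  (O : OrbitRing 𝔞 wt ℓ) {b : PoissonBracket A} {k : ℤ}

theorem OrbitRing.ev_bracket_eq {f f' h h' : A} (hf : f - f' ∈ 𝔞 ^ 2) (hh : h - h' ∈ 𝔞 ^ 2) :
    O.ev (b.bracket f h) = O.ev (b.bracket f' h') := by
  have := O.ev_of_mem (f := b.bracket f h - b.bracket f' h')
    (by simpa using b.bracket_sub_mem 𝔞 1 hf hh)
  rwa [map_sub, sub_eq_zero] at this

/-- The dimension of a Poisson variety at a point whose formal neighborhood along the orbit has a
standard chart. -/
theorem FormalChart.height_eq (Φ : FormalChart 𝔞 wt ℓ m)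
    (hstd : IsStandard b k Φ.t Φ.u Φ.zo Φ.ze) (ht : Φ.t = O.t)
    {B : Type} [CommRing B] [Algebra ℂ B] [IsNoetherianRing B] (bB : PoissonBracket B)
    (ι : B →+* A) (hι : ∀ f h, b.bracket (ι f) (ι h) = ι (bB.bracket f h))
    (hιC : ∀ c : ℂ, ι (algebraMap ℂ B c) = algebraMap ℂ A c)
    (hdense : ∀ a, ∃ f, a - ι f ∈ 𝔞 ^ 2) (𝔭 : Ideal B) [𝔭.IsPrime]
    (h𝔭 : ∀ f, f ∈ 𝔭 ↔ O.ev (ι f) = 0) (hker : ∀ f, ι f ∈ 𝔞 ^ 2 → f ∈ 𝔭 ^ 2) :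
    𝔭.height = 2 * m + 2 := by
  classical
  let S := Φ.stdSystem hstd
  have hSt : S.t = O.t := ht
  let y : Option (DiskIdx m) → A := Option.elim' (O.t - 1) S.x
  let w : Option (DiskIdx m) → A := Option.elim' S.u S.conj
  let c : Option (DiskIdx m) → ℂ := Option.elim' 1 fun i => O.ev (S.factor i)
  have hy : ∀ i, O.ev (y i) = 0 := by
    rintro (_ | i)
    · change O.ev (O.t - 1) = 0
      rw [map_sub, O.ev_t, map_one, sub_self]
    · exact O.ev_of_mem (S.frame.x_mem i)
  have hw : ∀ i j, c i * O.ev (b.bracket (w i) (y j)) = if i = j then 1 else 0 := by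
    have hone : ∀ f, b.bracket f (O.t - 1) = b.bracket f S.t := fun f => by
      rw [map_sub, b.bracket_one, sub_zero, hSt]
    rintro (_ | i) (_ | j)
    · change 1 * O.ev (b.bracket S.u (O.t - 1)) = _
      rw [hone, S.std.u_t, hSt, O.ev_zpow]
      simp
    · change 1 * O.ev (b.bracket S.u (S.x j)) = _
      rw [if_neg (by simp), one_mul]
      rcases j with _ | j | j
      · exact (congrArg O.ev (b.bracket_self S.u)).trans (map_zero _)
      · have h1 := congrArg O.ev (S.std.u_zo j)
        rw [b.leibniz, map_add, map_mul, map_mul, O.ev_of_mem (S.zo_mem j), mul_zero, zero_add,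
          hSt, O.ev_zpow, one_mul, map_zero] at h1
        exact h1
      · exact (congrArg O.ev (S.std.u_ze j)).trans (map_zero _)
    · change O.ev (S.factor i) * O.ev (b.bracket (S.conj i) (O.t - 1)) = _
      rw [hone, S.conj_t, map_zero, mul_zero, if_neg (by simp)]
    · change O.ev (S.factor i) * O.ev (b.bracket (S.conj i) (S.x j)) = _
      rw [← map_mul]
      change O.ev (S.frame.D i (S.frame.x j)) = _
      by_cases h : i = j
      · rw [h, S.frame.D_self, map_one, if_pos rfl]
      · rw [S.frame.D_ne i j h, map_zero, if_neg (by simpa using h)]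
  choose y' hy' using fun i => hdense (y i)
  choose w' hw' using fun i => hdense (w i)
  let e : Fin (2 * m + 2) ≃ Option (DiskIdx m) := Fintype.equivOfCardEq (by
    simp
    ring)
  have hsq : 𝔞 ^ 2 ≤ 𝔞 := Ideal.pow_le_self two_ne_zero
  have hy'𝔭 : ∀ i, y' i ∈ 𝔭 := fun i => by
    rw [h𝔭]
    have := O.ev_of_mem (hsq (hy' i))
    rw [map_sub, hy, zero_sub, neg_eq_zero] at this
    exact this
  have hscalar : ∀ (c : ℂ) (f : B), ι (c • f) = c • ι f := fun c f => by
    rw [Algebra.smul_def, Algebra.smul_def, map_mul, hιC]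
  refine le_antisymm ?_ ?_
  · have h1 := 𝔭.height_le_of_le_sup_sq (fun i => y' (e i)) (fun i => hy'𝔭 _) fun f hf => by
      have h2 := O.ker_ev_le ((h𝔭 f).1 hf)
      have h3 : ι f ∈ Ideal.span (Set.range y) := by
        refine (sup_le ?_ ?_ : _ ≤ Ideal.span (Set.range y)) h2
        · exact Ideal.span_mono (by rintro _ rfl; exact ⟨none, rfl⟩)
        · refine Φ.ideal_eq_span.le.trans (Ideal.span_mono ?_)
          rintro _ ⟨i, rfl⟩
          exact ⟨some i, Φ.stdSystem_x hstd i⟩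
      obtain ⟨a, ha⟩ := Ideal.mem_span_range_iff_exists_fun.1 h3
      choose a' ha' using fun i => hdense (a i)
      have h4 : f - ∑ i, a' i * y' i ∈ 𝔭 ^ 2 := by
        refine hker _ ?_
        rw [map_sub, map_sum, ← ha, ← Finset.sum_sub_distrib]
        refine Ideal.sum_mem _ fun i _ => ?_
        rw [map_mul, show a i * y i - ι (a' i) * ι (y' i) =
          (a i - ι (a' i)) * y i + ι (a' i) * (y i - ι (y' i)) by ring]
        exact Ideal.add_mem _ (Ideal.mul_mem_right _ _ (ha' i)) (Ideal.mul_mem_left _ _ (hy' i))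
      rw [← add_sub_cancel (∑ i, a' i * y' i) f]
      refine Submodule.add_mem_sup (Ideal.sum_mem _ fun i _ => Ideal.mul_mem_left _ _
        (Ideal.subset_span ⟨e.symm i, congrArg y' (e.apply_symm_apply i)⟩)) h4
    exact_mod_cast h1
  · have h1 := 𝔭.le_height_of_derivation (fun i => c (e i) • bB.ham (w' (e i)))
      (fun i => y' (e i)) (fun i => hy'𝔭 _) fun i j => by
        rw [h𝔭, map_sub, map_sub, Derivation.smul_apply, bB.ham_apply, hscalar, O.ev_smul,
          ← hι, ← O.ev_bracket_eq (hw' _) (hy' _), hw]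
        by_cases h : i = j
        · simp [h]
        · simp [h]
    exact_mod_cast h1

end ChartHeight

/-- The character `c ↦ c ^ j` of `ℂˣ`. -/
def unitsChar (j : ℤ) : ℂˣ →* ℂ := (Units.coeHom ℂ).comp (zpowGroupHom j)

theorem unitsChar_apply (j : ℤ) (c : ℂˣ) : unitsChar j c = ((c ^ j : ℂˣ) : ℂ) := rfl

theorem unitsChar_injective : Function.Injective unitsChar := fun i j h => by
  have h1 := congrArg (fun χ => χ (Units.mk0 2 two_ne_zero)) h
  simp only [unitsChar_apply, Units.val_zpow_eq_zpow_val, Units.val_mk0] at h1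
  have h2 := congrArg norm h1
  rw [norm_zpow, norm_zpow] at h2
  exact zpow_right_injective₀ (by simp) (by simp) h2

/-- The coefficients of a Laurent polynomial lie in a subspace if its values do. -/
theorem mem_of_forall_sum_mem {S : Type} [AddCommGroup S] [Module ℂ S] (N : Submodule ℂ S)
    (s : Finset ℤ) (p : ℤ → S) (h : ∀ c : ℂˣ, ∑ j ∈ s, ((c ^ j : ℂˣ) : ℂ) • p j ∈ N) {j : ℤ}
    (hj : j ∈ s) : p j ∈ N := by
  by_contra hp
  obtain ⟨lam, h1, h2⟩ := N.exists_le_ker_of_notMem hp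
  refine h1 ?_
  have hli := (linearIndependent_monoidHom ℂˣ ℂ).comp _ unitsChar_injective
  refine linearIndependent_iff'.1 hli s (fun j => lam (p j)) (funext fun c => ?_) j hj
  have h3 := h2 (h c)
  rw [LinearMap.mem_ker, map_sum] at h3
  simp only [Finset.sum_apply, Pi.smul_apply, Function.comp_apply, Pi.zero_apply, smul_eq_mul]
  rw [← h3]
  refine Finset.sum_congr rfl fun i _ => ?_
  rw [map_smul, smul_eq_mul, mul_comm]
  rfl

/-- The value of a Laurent polynomial with coefficients in a complex vector space. -/
noncomputable def laurentEval {S : Type} [AddCommGroup S] [Module ℂ S] (c : ℂˣ) :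
    (ℤ →₀ S) →ₗ[ℂ] S :=
  Finsupp.lsum ℂ fun j => ((c ^ j : ℂˣ) : ℂ) • LinearMap.id

section LaurentEval

variable {S : Type} [AddCommGroup S] [Module ℂ S]

theorem laurentEval_apply (c : ℂˣ) (p : ℤ →₀ S) :
    laurentEval c p = ∑ j ∈ p.support, ((c ^ j : ℂˣ) : ℂ) • p j := by
  rw [laurentEval, Finsupp.lsum_apply, Finsupp.sum]
  rfl

theorem laurentEval_single (c : ℂˣ) (j : ℤ) (r : S) :
    laurentEval c (Finsupp.single j r) = ((c ^ j : ℂˣ) : ℂ) • r := by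
  rw [laurentEval, Finsupp.lsum_single]
  rfl

theorem mem_of_forall_laurentEval_mem (N : Submodule ℂ S) {p : ℤ →₀ S}
    (h : ∀ c : ℂˣ, laurentEval c p ∈ N) (j : ℤ) : p j ∈ N := by
  by_cases hj : j ∈ p.support
  · exact mem_of_forall_sum_mem N p.support p (fun c => by rw [← laurentEval_apply]; exact h c) hj
  · rw [Finsupp.notMem_support_iff.1 hj]; exact N.zero_mem

theorem laurentEval_ext {p q : ℤ →₀ S} (h : ∀ c : ℂˣ, laurentEval c p = laurentEval c q) :
    p = q := by
  rw [← sub_eq_zero]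
  ext j
  exact mem_of_forall_laurentEval_mem ⊥ (p := p - q) (fun c => by
    rw [map_sub, h, sub_self]; exact Submodule.zero_mem _) j

end LaurentEval

namespace AdicCompletion

variable {R : Type} [CommRing R] {I : Ideal R}

theorem mem_map_pow_iff (hI : I.FG) (n : ℕ) (f : AdicCompletion I R) :
    f ∈ (I.map (algebraMap R (AdicCompletion I R))) ^ n ↔ evalₐ I n f = 0 := by
  have h1 : f ∈ (I.map (algebraMap R (AdicCompletion I R))) ^ n ↔
      f ∈ (I ^ n • ⊤ : Submodule R (AdicCompletion I R)) := by
    rw [Ideal.smul_top_eq_map, ← Ideal.map_pow]; rfl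
  have h2 : I ^ n ≤ (I ^ n • ⊤ : Ideal R) := by
    rw [smul_eq_mul, Ideal.mul_top]
  rw [h1, pow_smul_top_eq_ker_eval hI, LinearMap.mem_ker, ← factor_evalₐ_eq_eval _ _ h2]
  constructor
  · intro h
    obtain ⟨a, ha⟩ := Ideal.Quotient.mk_surjective (evalₐ I n f)
    rw [← ha, Ideal.Quotient.factor_mk, Ideal.Quotient.eq_zero_iff_mem, smul_eq_mul,
      Ideal.mul_top] at h
    rw [← ha, Ideal.Quotient.eq_zero_iff_mem]
    exact h
  · intro h
    rw [h, _root_.map_zero]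

/-- A coherent sequence of residue classes defines an element of the completion. -/
theorem exists_evalₐ_eq (s : ℕ → R) (h : ∀ n, s (n + 1) - s n ∈ I ^ n) :
    ∃ f : AdicCompletion I R, ∀ n, evalₐ I n f = Ideal.Quotient.mk _ (s n) :=
  ⟨mk I R (AdicCauchySequence.mk I R s fun n => by
    rw [SModEq.sub_mem, smul_eq_mul, Ideal.mul_top, ← neg_sub]
    exact neg_mem (h n)), fun n => by rw [evalₐ_mk]; rfl⟩

theorem isAdicComplete_map (hI : I.FG) :
    IsAdicComplete (I.map (algebraMap R (AdicCompletion I R))) (AdicCompletion I R) := by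
  refine isAdicComplete_of _ (fun f hf => ext_evalₐ fun n => ?_) fun s hs => ?_
  · rw [_root_.map_zero, ← mem_map_pow_iff hI]; exact hf n
  · choose r hr using fun n => Ideal.Quotient.mk_surjective (evalₐ I n (s n))
    obtain ⟨f, hf⟩ := exists_evalₐ_eq (I := I) r fun n => by
      have h1 := (mem_map_pow_iff hI n _).1 (hs n)
      rw [map_sub, ← hr n, PoissonBracket.mk_of_le (Nat.le_succ n) (hr (n + 1)) |>.symm,
        ← map_sub, Ideal.Quotient.eq_zero_iff_mem] at h1
      exact h1
    refine ⟨f, fun n => ?_⟩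
    rw [mem_map_pow_iff hI, map_sub, hf, hr, sub_self]

theorem algebraMap_eq_of (r : R) : algebraMap R (AdicCompletion I R) r = of I R r := rfl

theorem sub_algebraMap_mem (hI : I.FG) {n : ℕ} {f : AdicCompletion I R} {a : R}
    (h : evalₐ I n f = Ideal.Quotient.mk _ a) :
    f - algebraMap R _ a ∈ (I.map (algebraMap R (AdicCompletion I R))) ^ n := by
  rw [mem_map_pow_iff hI, map_sub, h, algebraMap_eq_of, evalₐ_of, sub_self]

theorem exists_sub_algebraMap_mem (hI : I.FG) (n : ℕ) (f : AdicCompletion I R) :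
    ∃ a, f - algebraMap R _ a ∈ (I.map (algebraMap R (AdicCompletion I R))) ^ n := by
  obtain ⟨a, ha⟩ := Ideal.Quotient.mk_surjective (evalₐ I n f)
  exact ⟨a, sub_algebraMap_mem hI ha.symm⟩

theorem isNoetherianRing_of_isNoetherianRing [IsNoetherianRing R] :
    IsNoetherianRing (AdicCompletion I R) := by
  have hI : I.FG := IsNoetherian.noetherian I
  have := isAdicComplete_map hI
  refine isNoetherianRing_of_complete (I.map (algebraMap R (AdicCompletion I R)))
    (algebraMap R _) (hI.map _) fun f => ?_
  simpa using exists_sub_algebraMap_mem hI 1 f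

theorem mem_map_iff [IsNoetherianRing R] (J : Ideal R) (f : AdicCompletion I R) :
    f ∈ J.map (algebraMap R (AdicCompletion I R)) ↔
      ∀ n, evalₐ I n f ∈ J.map (Ideal.Quotient.mk (I ^ n)) := by
  have hI : I.FG := IsNoetherian.noetherian I
  have := isAdicComplete_map hI
  have := isNoetherianRing_of_isNoetherianRing (I := I)
  constructor
  · intro h n
    have h1 := Ideal.mem_map_of_mem (evalₐ I n : AdicCompletion I R →+* R ⧸ I ^ n) h
    rw [Ideal.map_map] at h1
    have : (evalₐ I n : AdicCompletion I R →+* R ⧸ I ^ n).comp (algebraMap R _) =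
        Ideal.Quotient.mk (I ^ n) := RingHom.ext fun r => evalₐ_of I n r
    rwa [this] at h1
  · intro h
    refine isAdicClosed_ideal (I.map (algebraMap R (AdicCompletion I R))) _ f fun n => ?_
    obtain ⟨a, ha, hf⟩ := (Ideal.mem_map_iff_of_surjective _ Ideal.Quotient.mk_surjective).1 (h n)
    exact ⟨algebraMap R _ a, Ideal.mem_map_of_mem _ ha, sub_algebraMap_mem hI hf.symm⟩

variable [Algebra ℂ R]

/-- A compatible family of linear maps to the quotients defines one to the completion. -/
theorem exists_linearMap (π : ∀ n, R →ₗ[ℂ] R ⧸ I ^ n) (hkill : ∀ n, ∀ a ∈ I ^ n, π n a = 0)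
    (hcompat : ∀ n a b, Ideal.Quotient.mk (I ^ (n + 1)) b = π (n + 1) a →
      Ideal.Quotient.mk (I ^ n) b = π n a) :
    ∃ L : AdicCompletion I R →ₗ[ℂ] AdicCompletion I R, ∀ n f a,
      evalₐ I n f = Ideal.Quotient.mk _ a → evalₐ I n (L f) = π n a := by
  have h : ∀ f : AdicCompletion I R, ∃ f' : AdicCompletion I R, ∀ n a,
      evalₐ I n f = Ideal.Quotient.mk _ a → evalₐ I n f' = π n a := by
    intro f
    have hindep : ∀ n a a', evalₐ I n f = Ideal.Quotient.mk _ a →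
        evalₐ I n f = Ideal.Quotient.mk _ a' → π n a = π n a' := fun n a a' h h' => by
      rw [← sub_eq_zero, ← map_sub]
      exact hkill n _ (Ideal.Quotient.eq.1 (h.symm.trans h'))
    choose r hr using fun n => Ideal.Quotient.mk_surjective (π n (PoissonBracket.rep n f))
    obtain ⟨f', hf'⟩ := exists_evalₐ_eq (I := I) r fun n => by
      rw [← Ideal.Quotient.eq, hr, hcompat n _ _ (hr (n + 1))]
      exact hindep n _ _ (PoissonBracket.mk_of_le (Nat.le_succ n) (PoissonBracket.mk_rep _ f)).symm
        (PoissonBracket.mk_rep _ f).symm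
    exact ⟨f', fun n a ha => by
      rw [hf', hr]
      exact hindep n _ _ (PoissonBracket.mk_rep _ f).symm ha⟩
  choose F hF using h
  have hrep : ∀ n f, evalₐ I n (F f) = π n (PoissonBracket.rep n f) := fun n f =>
    hF f n _ (PoissonBracket.mk_rep n f).symm
  refine ⟨{ toFun := F, map_add' := fun f g => ext_evalₐ fun n => ?_, map_smul' := fun c f =>
    ext_evalₐ fun n => ?_ }, fun n f a h => hF f n a h⟩
  · rw [map_add, hrep n f, hrep n g, hF (f + g) n (PoissonBracket.rep n f + PoissonBracket.rep n g)
      (by rw [map_add, map_add, PoissonBracket.mk_rep, PoissonBracket.mk_rep]), map_add]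
  · rw [RingHom.id_apply, PoissonBracket.evalₐ_smul, hrep n f,
      hF (c • f) n (c • PoissonBracket.rep n f) (by
        rw [PoissonBracket.evalₐ_smul, ← PoissonBracket.mk_rep]; rfl), map_smul]

end AdicCompletion

/-- An algebraic action of `ℂˣ` on the formal completion of `Spec R` along `I`: the pull-backs of
functions along the elements of `ℂˣ`, modulo all powers of `I`. -/
structure FormalAction {R : Type} [CommRing R] [Algebra ℂ R] (I : Ideal R) where
  τ : ∀ n : ℕ, ℂˣ → R →ₐ[ℂ] R ⧸ I ^ n
  algebraic : ∀ n a, ∃ p : ℤ →₀ R ⧸ I ^ n, ∀ c, τ n c a = laurentEval c p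
  compat : ∀ n c a b, Ideal.Quotient.mk (I ^ (n + 1)) b = τ (n + 1) c a →
    Ideal.Quotient.mk (I ^ n) b = τ n c a
  map_mem : ∀ n c, ∀ a ∈ I ^ n, τ n c a = 0
  one : ∀ n a, τ n 1 a = Ideal.Quotient.mk _ a
  mul : ∀ n c c' a b, Ideal.Quotient.mk _ b = τ n c a → τ n c' b = τ n (c * c') a

namespace FormalAction

variable {R : Type} [CommRing R] [Algebra ℂ R] {I : Ideal R} (F : FormalAction I)

/-- The functions of weight `e`. -/
def wt (e : ℤ) (f : AdicCompletion I R) : Prop :=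
  ∀ (c : ℂˣ) (n : ℕ) (a : R), AdicCompletion.evalₐ I n f = Ideal.Quotient.mk _ a →
    F.τ n c a = ((c ^ e : ℂˣ) : ℂ) • Ideal.Quotient.mk (I ^ n) a

theorem τ_eq_of_mk_eq {n : ℕ} {a a' : R}
    (h : Ideal.Quotient.mk (I ^ n) a = Ideal.Quotient.mk (I ^ n) a') (c : ℂˣ) :
    F.τ n c a = F.τ n c a' := by
  rw [← sub_eq_zero, ← map_sub]
  exact F.map_mem n c _ (Ideal.Quotient.eq.1 h)

theorem wt_of_exists {e : ℤ} {f : AdicCompletion I R}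
    (h : ∀ n c, ∃ a : R, AdicCompletion.evalₐ I n f = Ideal.Quotient.mk _ a ∧
      F.τ n c a = ((c ^ e : ℂˣ) : ℂ) • Ideal.Quotient.mk (I ^ n) a) : F.wt e f := by
  intro c n a ha
  obtain ⟨a', ha', h'⟩ := h n c
  rw [ha] at ha'
  rw [F.τ_eq_of_mk_eq ha', h', ha']

/-- The coefficients of the coaction. -/
noncomputable def coeff (n : ℕ) (a : R) : ℤ →₀ R ⧸ I ^ n := (F.algebraic n a).choose

theorem laurentEval_coeff (n : ℕ) (a : R) (c : ℂˣ) : laurentEval c (F.coeff n a) = F.τ n c a :=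
  ((F.algebraic n a).choose_spec c).symm

theorem coeff_eq {n : ℕ} {a : R} {p : ℤ →₀ R ⧸ I ^ n} (h : ∀ c, F.τ n c a = laurentEval c p) :
    F.coeff n a = p :=
  laurentEval_ext fun c => by rw [laurentEval_coeff, h]

theorem coeff_add (n : ℕ) (a b : R) : F.coeff n (a + b) = F.coeff n a + F.coeff n b :=
  F.coeff_eq fun c => by rw [map_add, map_add, laurentEval_coeff, laurentEval_coeff]

theorem coeff_smul (n : ℕ) (r : ℂ) (a : R) : F.coeff n (r • a) = r • F.coeff n a :=
  F.coeff_eq fun c => by rw [map_smul, map_smul, laurentEval_coeff]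

theorem coeff_of_mem {n : ℕ} {a : R} (h : a ∈ I ^ n) : F.coeff n a = 0 :=
  F.coeff_eq fun c => by rw [map_zero, F.map_mem n c a h]

theorem coeff_of_weight {n : ℕ} {a : R} {e : ℤ}
    (h : ∀ c, F.τ n c a = ((c ^ e : ℂˣ) : ℂ) • Ideal.Quotient.mk (I ^ n) a) :
    F.coeff n a = Finsupp.single e (Ideal.Quotient.mk (I ^ n) a) :=
  F.coeff_eq fun c => by rw [laurentEval_single, h]

theorem coeff_mem {n : ℕ} {a : R} (N : Submodule ℂ (R ⧸ I ^ n)) (h : ∀ c, F.τ n c a ∈ N) (j : ℤ) :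
    F.coeff n a j ∈ N :=
  mem_of_forall_laurentEval_mem N (fun c => by rw [laurentEval_coeff]; exact h c) j

theorem coeff_compat (n : ℕ) (a : R) (j : ℤ) {b : R}
    (h : Ideal.Quotient.mk (I ^ (n + 1)) b = F.coeff (n + 1) a j) :
    Ideal.Quotient.mk (I ^ n) b = F.coeff n a j := by
  let π : (R ⧸ I ^ (n + 1)) →ₗ[ℂ] R ⧸ I ^ n :=
    (Ideal.Quotient.factorₐ ℂ (Ideal.pow_le_pow_right (Nat.le_succ n))).toLinearMap
  have hπ : ∀ r, π (Ideal.Quotient.mk _ r) = Ideal.Quotient.mk _ r := fun r => rfl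
  have h1 : Finsupp.mapRange.linearMap π (F.coeff (n + 1) a) = F.coeff n a := by
    refine (F.coeff_eq fun c => ?_).symm
    have h2 : ∀ p : ℤ →₀ R ⧸ I ^ (n + 1),
        laurentEval c (Finsupp.mapRange.linearMap π p) = π (laurentEval c p) := by
      intro p
      induction p using Finsupp.induction_linear with
      | zero => simp
      | add p q hp hq => rw [map_add, map_add, map_add, map_add, hp, hq]
      | single i r =>
        rw [Finsupp.mapRange.linearMap_apply, Finsupp.mapRange_single, laurentEval_single,
          laurentEval_single, map_smul]
    obtain ⟨r, hr⟩ := Ideal.Quotient.mk_surjective (F.τ (n + 1) c a)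
    rw [h2, laurentEval_coeff, ← hr, hπ, F.compat n c a r hr]
  rw [← h1, Finsupp.mapRange.linearMap_apply, Finsupp.mapRange_apply, ← h, hπ]

theorem τ_of_coeff {n : ℕ} {a : R} {j : ℤ} {b : R}
    (h : Ideal.Quotient.mk (I ^ n) b = F.coeff n a j) (c : ℂˣ) :
    F.τ n c b = ((c ^ j : ℂˣ) : ℂ) • Ideal.Quotient.mk (I ^ n) b := by
  let T : (R ⧸ I ^ n) →ₐ[ℂ] R ⧸ I ^ n := Ideal.Quotient.liftₐ (I ^ n) (F.τ n c) (F.map_mem n c)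
  have hT : ∀ r, T (Ideal.Quotient.mk _ r) = F.τ n c r := fun r => rfl
  rw [← hT, h]
  by_cases hj : j ∈ (F.coeff n a).support
  · have := mem_of_forall_sum_mem (⊥ : Submodule ℂ (R ⧸ I ^ n)) (F.coeff n a).support
      (fun j => T (F.coeff n a j) - ((c ^ j : ℂˣ) : ℂ) • F.coeff n a j) (fun c' => by
        rw [Submodule.mem_bot]
        obtain ⟨r, hr⟩ := Ideal.Quotient.mk_surjective (F.τ n c' a)
        have h1 := F.mul n c' c a r hr
        rw [← hT, hr, ← F.laurentEval_coeff n a c', ← F.laurentEval_coeff n a (c' * c),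
          laurentEval_apply, laurentEval_apply, map_sum, ← sub_eq_zero,
          ← Finset.sum_sub_distrib] at h1
        rw [← h1]
        refine Finset.sum_congr rfl fun i _ => ?_
        rw [map_smul, smul_sub, smul_smul, mul_zpow, Units.val_mul]) hj
    exact sub_eq_zero.1 ((Submodule.mem_bot ℂ).1 this)
  · rw [Finsupp.notMem_support_iff.1 hj, map_zero, smul_zero]

theorem exists_pr : ∃ pr : ℤ → AdicCompletion I R →ₗ[ℂ] AdicCompletion I R, ∀ j n f a,
    AdicCompletion.evalₐ I n f = Ideal.Quotient.mk _ a →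
      AdicCompletion.evalₐ I n (pr j f) = F.coeff n a j := by
  have h : ∀ j : ℤ, ∃ L : AdicCompletion I R →ₗ[ℂ] AdicCompletion I R, ∀ n f a,
    AdicCompletion.evalₐ I n f = Ideal.Quotient.mk _ a →
      AdicCompletion.evalₐ I n (L f) = F.coeff n a j := fun j =>
    AdicCompletion.exists_linearMap (fun n =>
      { toFun := fun a => F.coeff n a j
        map_add' := fun a b => by rw [F.coeff_add]; rfl
        map_smul' := fun c a => by rw [F.coeff_smul]; rfl })
      (fun n a ha => by
        change F.coeff n a j = 0
        rw [F.coeff_of_mem ha]; rfl)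
      (fun n a b hb => F.coeff_compat n a j hb)
  choose pr hpr using h
  exact ⟨pr, hpr⟩

/-- The projection to the functions of weight `j`. -/
noncomputable def pr : ℤ → AdicCompletion I R →ₗ[ℂ] AdicCompletion I R := F.exists_pr.choose

theorem evalₐ_pr (j : ℤ) {n : ℕ} {f : AdicCompletion I R} {a : R}
    (h : AdicCompletion.evalₐ I n f = Ideal.Quotient.mk _ a) :
    AdicCompletion.evalₐ I n (F.pr j f) = F.coeff n a j :=
  F.exists_pr.choose_spec j n f a h

theorem wt_pr (j : ℤ) (f : AdicCompletion I R) : F.wt j (F.pr j f) := by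
  intro c n b hb
  obtain ⟨a, ha⟩ := Ideal.Quotient.mk_surjective (AdicCompletion.evalₐ I n f)
  rw [F.evalₐ_pr j ha.symm] at hb
  exact F.τ_of_coeff hb.symm c

theorem evalₐ_pr_of_wt {e : ℤ} {f : AdicCompletion I R} (hf : F.wt e f) (j : ℤ) (n : ℕ) :
    AdicCompletion.evalₐ I n (F.pr j f) =
      Finsupp.single e (AdicCompletion.evalₐ I n f) j := by
  obtain ⟨a, ha⟩ := Ideal.Quotient.mk_surjective (AdicCompletion.evalₐ I n f)
  rw [F.evalₐ_pr j ha.symm, F.coeff_of_weight fun c => hf c n a ha.symm, ha]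

/-- The topological grading given by an action. -/
noncomputable def topGrading (hI : I.FG) :
    TopGrading (I.map (algebraMap R (AdicCompletion I R))) F.wt where
  pr := F.pr
  wt_iff {e f} := by
    refine ⟨fun hf => AdicCompletion.ext_evalₐ fun n => ?_, fun h => h ▸ F.wt_pr e f⟩
    rw [F.evalₐ_pr_of_wt hf, Finsupp.single_eq_same]
  wt_pr := F.wt_pr
  pr_ne {e e' f} hf he := AdicCompletion.ext_evalₐ fun n => by
    rw [F.evalₐ_pr_of_wt hf, Finsupp.single_eq_of_ne (Ne.symm he), map_zero]
  pr_mem {e n f} hf := by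
    rw [AdicCompletion.mem_map_pow_iff hI] at hf ⊢
    rw [F.evalₐ_pr e (a := 0) (by rw [hf, map_zero]), F.coeff_of_mem (zero_mem _)]
    rfl
  exists_sum n f := by
    obtain ⟨a, ha⟩ := Ideal.Quotient.mk_surjective (AdicCompletion.evalₐ I n f)
    refine ⟨(F.coeff n a).support, ?_⟩
    rw [AdicCompletion.mem_map_pow_iff hI, map_sub, map_sum,
      Finset.sum_congr rfl fun j _ => F.evalₐ_pr j ha.symm, ← ha, ← F.one n a,
      ← F.laurentEval_coeff, laurentEval_apply, sub_eq_zero]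
    refine Finset.sum_congr rfl fun j _ => ?_
    rw [one_zpow, Units.val_one, one_smul]
  one := F.wt_of_exists fun n c => ⟨1, by rw [map_one, map_one], by
    rw [map_one, map_one, zpow_zero, Units.val_one, one_smul]⟩
  mul {i j f g} hf hg := F.wt_of_exists fun n c => by
    obtain ⟨a, ha⟩ := Ideal.Quotient.mk_surjective (AdicCompletion.evalₐ I n f)
    obtain ⟨b, hb⟩ := Ideal.Quotient.mk_surjective (AdicCompletion.evalₐ I n g)
    refine ⟨a * b, by rw [map_mul, map_mul, ha, hb], ?_⟩
    rw [map_mul, map_mul, hf c n a ha.symm, hg c n b hb.symm, smul_mul_smul_comm, zpow_add,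
      Units.val_mul]

theorem pr_mem_map [IsNoetherianRing R] {J : Ideal R}
    (hJ : ∀ n c, ∀ a ∈ J, F.τ n c a ∈ J.map (Ideal.Quotient.mk (I ^ n))) (e : ℤ)
    {f : AdicCompletion I R} (hf : f ∈ J.map (algebraMap R (AdicCompletion I R))) :
    F.pr e f ∈ J.map (algebraMap R (AdicCompletion I R)) := by
  rw [AdicCompletion.mem_map_iff] at hf ⊢
  intro n
  obtain ⟨a, ha, haf⟩ :=
    (Ideal.mem_map_iff_of_surjective _ Ideal.Quotient.mk_surjective).1 (hf n)
  rw [F.evalₐ_pr e haf.symm]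
  exact F.coeff_mem ((J.map (Ideal.Quotient.mk (I ^ n))).restrictScalars ℂ)
    (fun c => hJ n c a ha) e

theorem wt_bracket {b : PoissonBracket R} {d : ℤ}
    (hhom : ∀ n c i j a a',
      F.τ (n + 1) c a = ((c ^ i : ℂˣ) : ℂ) • Ideal.Quotient.mk (I ^ (n + 1)) a →
      F.τ (n + 1) c a' = ((c ^ j : ℂˣ) : ℂ) • Ideal.Quotient.mk (I ^ (n + 1)) a' →
      F.τ n c (b.bracket a a') =
        ((c ^ (i + j + d) : ℂˣ) : ℂ) • Ideal.Quotient.mk (I ^ n) (b.bracket a a'))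
    (i j : ℤ) (f h : AdicCompletion I R) (hf : F.wt i f) (hh : F.wt j h) :
    F.wt (i + j + d) ((b.completion I).bracket f h) := F.wt_of_exists fun n c => by
  obtain ⟨a, ha⟩ := Ideal.Quotient.mk_surjective (AdicCompletion.evalₐ I (n + 1) f)
  obtain ⟨a', ha'⟩ := Ideal.Quotient.mk_surjective (AdicCompletion.evalₐ I (n + 1) h)
  exact ⟨b.bracket a a', b.evalₐ_completionFun n ha ha',
    hhom n c i j a a' (hf c _ a ha.symm) (hh c _ a' ha'.symm)⟩

end FormalAction

section Quotient

variable {K : Type} [CommRing K] [Algebra ℂ K] {𝔨 : Ideal K} {wt : ℤ → K → Prop}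

/-- The grading on the quotient by a graded ideal. -/
theorem TopGrading.exists_quotient (g : TopGrading 𝔨 wt) (P : Ideal K)
    (hP : ∀ e, ∀ f ∈ P, g.pr e f ∈ P) :
    Nonempty (TopGrading (𝔨.map (Ideal.Quotient.mk P))
      fun e a => ∃ f, wt e f ∧ Ideal.Quotient.mk P f = a) := by
  let r : K ⧸ P → K := fun a => (Ideal.Quotient.mk_surjective a).choose
  have hr : ∀ a, Ideal.Quotient.mk P (r a) = a := fun a =>
    (Ideal.Quotient.mk_surjective a).choose_spec
  have hpr : ∀ e f f', Ideal.Quotient.mk P f = Ideal.Quotient.mk P f' →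
      Ideal.Quotient.mk P (g.pr e f) = Ideal.Quotient.mk P (g.pr e f') := fun e f f' h => by
    rw [Ideal.Quotient.eq, ← map_sub]
    exact hP e _ (Ideal.Quotient.eq.1 h)
  let pr : ℤ → (K ⧸ P) →ₗ[ℂ] (K ⧸ P) := fun e =>
    { toFun := fun a => Ideal.Quotient.mk P (g.pr e (r a))
      map_add' := fun a b => by
        rw [← map_add, ← map_add]
        exact hpr e _ _ (by rw [map_add, hr, hr, hr])
      map_smul' := fun c a => by
        have h1 : ∀ f, Ideal.Quotient.mk P (c • f) = c • Ideal.Quotient.mk P f := fun f => rfl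
        rw [RingHom.id_apply, ← h1, ← map_smul]
        exact hpr e _ _ (by rw [h1, hr, hr]) }
  have hmk : ∀ e f, pr e (Ideal.Quotient.mk P f) = Ideal.Quotient.mk P (g.pr e f) := fun e f =>
    hpr e _ _ (hr _)
  refine ⟨{
    pr := pr
    wt_iff := fun {e a} => ?_
    wt_pr := fun e a => ⟨g.pr e (r a), g.wt_pr _ _, rfl⟩
    pr_ne := ?_
    pr_mem := fun {e n a} ha => ?_
    exists_sum := fun n a => ?_
    one := ⟨1, g.one, map_one _⟩
    mul := ?_ }⟩
  · constructor
    · rintro ⟨f, hf, rfl⟩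
      rw [hmk, g.pr_self hf]
    · intro h
      exact ⟨g.pr e (r a), g.wt_pr _ _, h⟩
  · rintro e e' _ ⟨f, hf, rfl⟩ he
    rw [hmk, g.pr_ne hf he, map_zero]
  · obtain ⟨f, rfl⟩ := Ideal.Quotient.mk_surjective a
    obtain ⟨h, hh, hfh⟩ := (mem_map_quotient_pow_iff 𝔨 P n f).1 ha
    rw [hmk]
    refine (mem_map_quotient_pow_iff 𝔨 P n _).2 ⟨g.pr e h, hP e h hh, ?_⟩
    rw [← map_sub]
    exact g.pr_mem hfh
  · obtain ⟨f, rfl⟩ := Ideal.Quotient.mk_surjective a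
    obtain ⟨s, hs⟩ := g.exists_sum n f
    refine ⟨s, ?_⟩
    simp only [hmk]
    rw [← map_sum, ← map_sub, ← Ideal.map_pow]
    exact Ideal.mem_map_of_mem _ hs
  · rintro i j _ _ ⟨f, hf, rfl⟩ ⟨h, hh, rfl⟩
    exact ⟨f * h, g.mul hf hh, map_mul _ _ _⟩

/-- The Poisson bracket on the quotient by a Poisson ideal. -/
theorem PoissonBracket.exists_quotient (b : PoissonBracket K) (P : Ideal K)
    (hP : ∀ f, ∀ h ∈ P, b.bracket f h ∈ P) : ∃ b' : PoissonBracket (K ⧸ P), ∀ f h,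
      b'.bracket (Ideal.Quotient.mk P f) (Ideal.Quotient.mk P h) =
        Ideal.Quotient.mk P (b.bracket f h) := by
  let r : K ⧸ P → K := fun a => (Ideal.Quotient.mk_surjective a).choose
  have hr : ∀ a, Ideal.Quotient.mk P (r a) = a := fun a =>
    (Ideal.Quotient.mk_surjective a).choose_spec
  let B : K ⧸ P → K ⧸ P → K ⧸ P := fun x y => Ideal.Quotient.mk P (b.bracket (r x) (r y))
  have hB : ∀ f h, B (Ideal.Quotient.mk P f) (Ideal.Quotient.mk P h) =
      Ideal.Quotient.mk P (b.bracket f h) := fun f h => by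
    have h1 := hP (r (Ideal.Quotient.mk P f)) _ (Ideal.Quotient.eq.1 (hr (Ideal.Quotient.mk P h)))
    have h2 := hP h _ (Ideal.Quotient.eq.1 (hr (Ideal.Quotient.mk P f)))
    rw [map_sub] at h1 h2
    refine Ideal.Quotient.eq.2 ?_
    convert! P.sub_mem h1 h2 using 1
    rw [b.skew h (r _), b.skew h f]
    ring
  have hsm : ∀ (c : ℂ) f, Ideal.Quotient.mk P (c • f) = c • Ideal.Quotient.mk P f :=
    fun c f => rfl
  refine ⟨{
    bracket := LinearMap.mk₂ ℂ B ?_ ?_ ?_ ?_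
    bracket_self := ?_
    leibniz := ?_
    jacobi := ?_ }, fun f h => ?_⟩
  · intro x x' y
    obtain ⟨f, rfl⟩ := Ideal.Quotient.mk_surjective x
    obtain ⟨f', rfl⟩ := Ideal.Quotient.mk_surjective x'
    obtain ⟨h, rfl⟩ := Ideal.Quotient.mk_surjective y
    rw [← map_add, hB, hB, hB, map_add, LinearMap.add_apply, map_add]
  · intro c x y
    obtain ⟨f, rfl⟩ := Ideal.Quotient.mk_surjective x
    obtain ⟨h, rfl⟩ := Ideal.Quotient.mk_surjective y
    rw [← hsm, hB, hB, map_smul, LinearMap.smul_apply, hsm]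
  · intro x y y'
    obtain ⟨f, rfl⟩ := Ideal.Quotient.mk_surjective x
    obtain ⟨h, rfl⟩ := Ideal.Quotient.mk_surjective y
    obtain ⟨h', rfl⟩ := Ideal.Quotient.mk_surjective y'
    rw [← map_add, hB, hB, hB, map_add, map_add]
  · intro c x y
    obtain ⟨f, rfl⟩ := Ideal.Quotient.mk_surjective x
    obtain ⟨h, rfl⟩ := Ideal.Quotient.mk_surjective y
    rw [← hsm, hB, hB, map_smul, hsm]
  · intro x
    obtain ⟨f, rfl⟩ := Ideal.Quotient.mk_surjective x
    rw [LinearMap.mk₂_apply, hB, b.bracket_self, map_zero]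
  · intro x y z
    obtain ⟨f, rfl⟩ := Ideal.Quotient.mk_surjective x
    obtain ⟨h, rfl⟩ := Ideal.Quotient.mk_surjective y
    obtain ⟨l, rfl⟩ := Ideal.Quotient.mk_surjective z
    simp only [LinearMap.mk₂_apply]
    rw [← map_mul, hB, hB, hB, b.leibniz, map_add, map_mul, map_mul]
  · intro x y z
    obtain ⟨f, rfl⟩ := Ideal.Quotient.mk_surjective x
    obtain ⟨h, rfl⟩ := Ideal.Quotient.mk_surjective y
    obtain ⟨l, rfl⟩ := Ideal.Quotient.mk_surjective z
    change B (Ideal.Quotient.mk P f) (B (Ideal.Quotient.mk P h) (Ideal.Quotient.mk P l)) =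
      B (B (Ideal.Quotient.mk P f) (Ideal.Quotient.mk P h)) (Ideal.Quotient.mk P l) +
        B (Ideal.Quotient.mk P h) (B (Ideal.Quotient.mk P f) (Ideal.Quotient.mk P l))
    rw [hB h l, hB f h, hB f l, hB, hB, hB, b.jacobi, map_add]
  · exact hB f h

end Quotient

section PullSpec

variable {X : Scheme.{0}} (p : X ⟶ Spec (CommRingCat.of ℂ))

/-- The open subset of `W` where a function on `W` does not vanish. -/
noncomputable def Fun.basicOpen {W : X.Opens} (g : Fun p W) : X.Opens :=
  X.basicOpen (show Γ(X, W) from g)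

theorem Fun.basicOpen_le {W : X.Opens} (g : Fun p W) : g.basicOpen ≤ W :=
  X.basicOpen_le _

theorem mem_pointIdeal_iff {W : X.Opens} {x : X} (hx : x ∈ W) (g : Fun p W) :
    g ∈ pointIdeal p W x hx ↔ x ∉ g.basicOpen :=
  (not_congr (Scheme.mem_basicOpen X (show Γ(X, W) from g) x hx)).symm

instance pointIdeal_isPrime {W : X.Opens} {x : X} (hx : x ∈ W) : (pointIdeal p W x hx).IsPrime :=
  Ideal.comap_isPrime _ _

theorem mem_vanishingIdeal_iff {W : X.Opens} {Z : Set X} (g : Fun p W) :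
    g ∈ vanishingIdeal p W Z ↔ ∀ x ∈ Z, ∀ hx : x ∈ W, g ∈ pointIdeal p W x hx := by
  simp only [vanishingIdeal, Ideal.mem_iInf]

theorem res_mem_pointIdeal_iff {V W : X.Opens} (h : V ≤ W) {x : X} (hx : x ∈ V) (g : Fun p W) :
    Fun.res p h g ∈ pointIdeal p V x hx ↔ g ∈ pointIdeal p W x (h hx) := by
  rw [mem_pointIdeal_iff, mem_pointIdeal_iff]
  have h1 : (Fun.res p h g).basicOpen = V ⊓ g.basicOpen :=
    Scheme.basicOpen_res X (show Γ(X, W) from g) (homOfLE h).op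
  rw [h1]
  exact not_congr ⟨fun h => h.2, fun h => ⟨hx, h⟩⟩

variable {S : Type} [CommRing S]

/-- The ring homomorphism given by a morphism from an affine scheme into an open subset. -/
noncomputable def pullSpec (f : Spec (CommRingCat.of S) ⟶ X) (W : X.Opens) (h : ⊤ ≤ f ⁻¹ᵁ W) :
    Fun p W →+* S :=
  (f.appLE W ⊤ h ≫ (Scheme.ΓSpecIso (CommRingCat.of S)).hom).hom

variable {p}

theorem pullSpec_res (f : Spec (CommRingCat.of S) ⟶ X) {V W : X.Opens} (hVW : V ≤ W)
    (h : ⊤ ≤ f ⁻¹ᵁ V) (g : Fun p W) :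
    pullSpec p f V h (Fun.res p hVW g) = pullSpec p f W (h.trans (f.preimage_mono hVW)) g := by
  have := Scheme.Hom.map_appLE f h (homOfLE hVW).op
  exact congr((Scheme.ΓSpecIso (CommRingCat.of S)).hom ($this g))

theorem pullSpec_comp {T : Type} [CommRing T] (φ : S →+* T) (f : Spec (CommRingCat.of S) ⟶ X)
    (W : X.Opens) (h : ⊤ ≤ f ⁻¹ᵁ W) (h' : ⊤ ≤ (Spec.map (CommRingCat.ofHom φ) ≫ f) ⁻¹ᵁ W)
    (g : Fun p W) :
    pullSpec p (Spec.map (CommRingCat.ofHom φ) ≫ f) W h' g = φ (pullSpec p f W h g) := by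
  have h1 := Scheme.Hom.appLE_comp_appLE (Spec.map (CommRingCat.ofHom φ)) f W ⊤ ⊤ h le_top
  have h2 := Scheme.ΓSpecIso_naturality (CommRingCat.ofHom φ)
  have h3 : (Spec.map (CommRingCat.ofHom φ) ≫ f).appLE W ⊤ h' ≫ (Scheme.ΓSpecIso _).hom =
      (f.appLE W ⊤ h ≫ (Scheme.ΓSpecIso _).hom) ≫ CommRingCat.ofHom φ := by
    rw [← h1, Category.assoc, Category.assoc, ← h2]
    rw [Scheme.Hom.appTop, Scheme.Hom.app_eq_appLE]
    rfl
  exact congr($h3 g)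

theorem GmAction.pullSpec_act (G : GmAction p) (c : ℂˣ) (f : Spec (CommRingCat.of S) ⟶ X)
    (W : X.Opens) (h : ⊤ ≤ (f ≫ (G.act c).hom) ⁻¹ᵁ W) (g : Fun p W) :
    pullSpec p (f ≫ (G.act c).hom) W h g =
      pullSpec p f ((G.act c).hom ⁻¹ᵁ W) h (G.pull c W g) := by
  have := Scheme.Hom.comp_appLE f (G.act c).hom W ⊤ h
  exact congr((Scheme.ΓSpecIso (CommRingCat.of S)).hom ($this g))

theorem pullSpec_mem_iff (f : Spec (CommRingCat.of S) ⟶ X) {W : X.Opens} (h : ⊤ ≤ f ⁻¹ᵁ W)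
    (s : Spec (CommRingCat.of S)) (g : Fun p W) :
    pullSpec p f W h g ∈ PrimeSpectrum.asIdeal (R := S) s ↔ g ∈ pointIdeal p W (f s) (h trivial) := by
  have h1 := Scheme.basicOpen_appLE f ⊤ W h g
  have h3 := basicOpen_eq_of_affine (R := CommRingCat.of S) (pullSpec p f W h g)
  have h4 : (Scheme.ΓSpecIso (CommRingCat.of S)).inv (pullSpec p f W h g) = f.appLE W ⊤ h g :=
    congr($((Scheme.ΓSpecIso (CommRingCat.of S)).hom_inv_id) (f.appLE W ⊤ h g))
  rw [h4] at h3
  have h5 : s ∈ (Spec (CommRingCat.of S)).basicOpen (f.appLE W ⊤ h g) ↔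
      pullSpec p f W h g ∉ PrimeSpectrum.asIdeal (R := S) s := by
    rw [h3]; rfl
  have h6 : s ∈ (Spec (CommRingCat.of S)).basicOpen (f.appLE W ⊤ h g) ↔ f s ∈ g.basicOpen := by
    rw [h1]
    exact ⟨fun h => h.2, fun h => ⟨trivial, h⟩⟩
  refine Iff.trans ?_ (mem_pointIdeal_iff p _ g).symm
  exact not_iff_not.1 (h5.symm.trans (h6.trans not_not.symm))

theorem preimage_comp_top {T : Type} [CommRing T] (φ : S →+* T)
    (f : Spec (CommRingCat.of S) ⟶ X) {W : X.Opens} (h : ⊤ ≤ f ⁻¹ᵁ W) :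
    ⊤ ≤ (Spec.map (CommRingCat.ofHom φ) ≫ f) ⁻¹ᵁ W := fun _ _ => h trivial

theorem IsAffineOpen.top_le_preimage {U : X.Opens} (hU : IsAffineOpen U) (φ : Fun p U →+* S) :
    ⊤ ≤ (Spec.map (CommRingCat.ofHom φ : Γ(X, U) ⟶ _) ≫ hU.fromSpec) ⁻¹ᵁ U := by
  intro s _
  have := hU.fromSpec_preimage_self.ge (x := Spec.map (CommRingCat.ofHom φ : Γ(X, U) ⟶ _) s) trivial
  exact this

theorem pullSpec_fromSpec {U : X.Opens} (hU : IsAffineOpen U) (φ : Fun p U →+* S) (g : Fun p U) :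
    pullSpec p (Spec.map (CommRingCat.ofHom φ : Γ(X, U) ⟶ _) ≫ hU.fromSpec) U
      (IsAffineOpen.top_le_preimage hU φ) g = φ g := by
  have h0 : ⊤ ≤ hU.fromSpec ⁻¹ᵁ U := hU.fromSpec_preimage_self.ge
  refine (pullSpec_comp (S := Γ(X, U)) φ hU.fromSpec U h0 _ g).trans (congrArg φ ?_)
  have h1 := hU.ΓSpecIso_hom_fromSpec_app
  have h2 : hU.fromSpec.appLE U ⊤ h0 ≫ (Scheme.ΓSpecIso Γ(X, U)).hom = 𝟙 _ := by
    rw [Scheme.Hom.appLE, hU.fromSpec_app_self, Category.assoc, Category.assoc,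
      ← Functor.map_comp_assoc]
    have : (eqToHom hU.fromSpec_preimage_self).op ≫ (homOfLE h0).op = 𝟙 _ := Subsingleton.elim _ _
    rw [this]
    simp
  exact congr($h2 g)

theorem eq_map_pullSpec {U : X.Opens} (hU : IsAffineOpen U) (f : Spec (CommRingCat.of S) ⟶ X)
    (h : ⊤ ≤ f ⁻¹ᵁ U) :
    f = Spec.map (CommRingCat.ofHom (pullSpec p f U h) : Γ(X, U) ⟶ _) ≫ hU.fromSpec := by
  have h1 := IsAffineOpen.SpecMap_appLE_fromSpec f hU (isAffineOpen_top _) h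
  have h2 : Spec.map (CommRingCat.ofHom (pullSpec p f U h) : Γ(X, U) ⟶ _) =
      Spec.map (Scheme.ΓSpecIso (CommRingCat.of S)).hom ≫ Spec.map (f.appLE U ⊤ h) := by
    rw [← Spec.map_comp]; rfl
  rw [h2, Category.assoc, h1, IsAffineOpen.fromSpec_top, ← Category.assoc]
  have h3 : Spec.map (Scheme.ΓSpecIso (CommRingCat.of S)).hom ≫
      (Spec (CommRingCat.of S)).isoSpec.inv = 𝟙 _ := by
    rw [Iso.comp_inv_eq, Category.id_comp]
    simp [Scheme.isoSpec]
  rw [h3, Category.id_comp]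

theorem pullSpec_ext {U : X.Opens} (hU : IsAffineOpen U) {f f' : Spec (CommRingCat.of S) ⟶ X}
    (h : ⊤ ≤ f ⁻¹ᵁ U) (h' : ⊤ ≤ f' ⁻¹ᵁ U)
    (H : ∀ g : Fun p U, pullSpec p f U h g = pullSpec p f' U h' g) : f = f' := by
  rw [eq_map_pullSpec (p := p) hU f h, eq_map_pullSpec (p := p) hU f' h', RingHom.ext H]

theorem pullSpec_algebraMap [Algebra ℂ S] (f : Spec (CommRingCat.of S) ⟶ X)
    (hf : f ≫ p = Spec.map (CommRingCat.ofHom (algebraMap ℂ S))) (W : X.Opens)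
    (h : ⊤ ≤ f ⁻¹ᵁ W) (c : ℂ) :
    pullSpec p f W h (algebraMap ℂ (Fun p W) c) = algebraMap ℂ S c := by
  have h1 : (Scheme.ΓSpecIso (CommRingCat.of ℂ)).inv ≫ p.appTop ≫
      X.presheaf.map (homOfLE (le_top : W ≤ ⊤)).op ≫ f.appLE W ⊤ h ≫
        (Scheme.ΓSpecIso (CommRingCat.of S)).hom = CommRingCat.ofHom (algebraMap ℂ S) := by
    rw [Scheme.Hom.map_appLE_assoc]
    have h2 := Scheme.Hom.comp_appTop f p
    rw [hf] at h2
    have h4 : f.appLE ⊤ ⊤ le_top = f.appTop := by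
      rw [Scheme.Hom.appTop, Scheme.Hom.app_eq_appLE]
      rfl
    have h3 := Scheme.ΓSpecIso_naturality (CommRingCat.ofHom (algebraMap ℂ S))
    rw [h4, ← Category.assoc p.appTop, ← h2, h3]
    simp
  exact congr($h1 c)

theorem Fun.res_algebraMap {V W : X.Opens} (h : V ≤ W) (c : ℂ) :
    Fun.res p h (algebraMap ℂ (Fun p W) c) = algebraMap ℂ (Fun p V) c := by
  have := X.presheaf.map_comp (homOfLE (le_top : W ≤ ⊤)).op (homOfLE h).op
  exact congr($this.symm (p.appTop ((Scheme.ΓSpecIso (CommRingCat.of ℂ)).inv c)))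

theorem GmAction.pull_algebraMap (G : GmAction p) (c' : ℂˣ) (W : X.Opens) (c : ℂ) :
    G.pull c' W (algebraMap ℂ (Fun p W) c) = algebraMap ℂ _ c := by
  have h1 := (G.act c').hom.naturality (homOfLE (le_top : W ≤ ⊤)).op
  have h2 := Scheme.Hom.comp_appTop (G.act c').hom p
  rw [G.act_comp] at h2
  have h3 : (p.appTop ≫ X.presheaf.map (homOfLE (le_top : W ≤ ⊤)).op ≫ (G.act c').hom.app W) =
      p.appTop ≫ X.presheaf.map (homOfLE (le_top : (G.act c').hom ⁻¹ᵁ W ≤ ⊤)).op := by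
    rw [h1]
    conv_rhs => rw [h2]
    rw [Category.assoc]
    rfl
  exact congr($h3 ((Scheme.ΓSpecIso (CommRingCat.of ℂ)).inv c))

theorem Fun.res_res {U V W : X.Opens} (h : V ≤ W) (h' : U ≤ V) (g : Fun p W) :
    Fun.res p h' (Fun.res p h g) = Fun.res p (h'.trans h) g := by
  have := X.presheaf.map_comp (homOfLE h).op (homOfLE h').op
  exact congr($this.symm g)

end PullSpec

section ClosedPoints

variable {X : Scheme.{0}} {p : X ⟶ Spec (CommRingCat.of ℂ)}

theorem Fun.exists_basicOpen_le {U : X.Opens} (hU : IsAffineOpen U) {V : X.Opens} {x : X}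
    (hxU : x ∈ U) (hxV : x ∈ V) : ∃ g : Fun p U, g.basicOpen ≤ V ∧ x ∈ g.basicOpen :=
  hU.exists_basicOpen_le (V := V) ⟨x, hxV⟩ hxU

theorem Fun.exists_res_eq_pow_mul {U : X.Opens} (hU : IsAffineOpen U) (g : Fun p U)
    (x : Fun p g.basicOpen) : ∃ (n : ℕ) (a : Fun p U),
      Fun.res p (g.basicOpen_le p) a = Fun.res p (g.basicOpen_le p) g ^ n * x :=
  exists_eq_pow_mul_of_isAffineOpen X U hU g x

theorem Fun.exists_pow_mul_eq_zero {U : X.Opens} (hU : IsAffineOpen U) (g x : Fun p U)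
    (h : Fun.res p (g.basicOpen_le p) x = 0) : ∃ n : ℕ, g ^ n * x = 0 :=
  exists_pow_mul_eq_zero_of_res_basicOpen_eq_zero_of_isCompact X hU.isCompact
    (show Γ(X, U) from x) g h

theorem Fun.basicOpen_res {U V : X.Opens} (hVU : V ≤ U) (g : Fun p U) :
    (Fun.res p hVU g).basicOpen = V ⊓ g.basicOpen :=
  Scheme.basicOpen_res X (show Γ(X, U) from g) (homOfLE hVU).op

theorem exists_pointIdeal_eq {W : X.Opens} (hW : IsAffineOpen W) (𝔮 : Ideal (Fun p W))
    [h𝔮 : 𝔮.IsPrime] : ∃ (x : X) (hx : x ∈ W), 𝔮 = pointIdeal p W x hx ∧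
      (𝔮.IsMaximal → JacobsonSpace X → IsClosed {x}) := by
  have h1 := IsAffineOpen.top_le_preimage hW (RingHom.id (Fun p W))
  have h2 := fun g => pullSpec_fromSpec hW (RingHom.id (Fun p W)) g
  have h0 : Spec.map (CommRingCat.ofHom (RingHom.id (Fun p W)) : Γ(X, W) ⟶ Γ(X, W)) ≫ hW.fromSpec =
      hW.fromSpec := by
    have : (CommRingCat.ofHom (RingHom.id (Fun p W)) : Γ(X, W) ⟶ Γ(X, W)) = 𝟙 _ := rfl
    rw [this, Spec.map_id, Category.id_comp]
  let s : Spec Γ(X, W) := (⟨𝔮, h𝔮⟩ : PrimeSpectrum (Fun p W))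
  have h3 := fun g : Fun p W => pullSpec_mem_iff (p := p) _ h1 s g
  refine ⟨(Spec.map (CommRingCat.ofHom (RingHom.id (Fun p W)) : Γ(X, W) ⟶ Γ(X, W)) ≫ hW.fromSpec) s,
    h1 trivial, ?_, ?_⟩
  · ext g
    refine Iff.trans ?_ (h3 g)
    exact (congrArg (· ∈ 𝔮) (h2 g).symm).to_iff
  · intro hm hJ
    rw [h0]
    have h4 : IsClosed {s} := (PrimeSpectrum.isClosed_singleton_iff_isMaximal _).2 hm
    exact (hW.fromSpec.isOpenEmbedding.preimage_closedPoints).ge h4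

theorem mem_closure_of_vanishingIdeal_le {W : X.Opens} (hW : IsAffineOpen W) {Z : Set X} {x : X}
    (hx : x ∈ W) (h : vanishingIdeal p W Z ≤ pointIdeal p W x hx) : x ∈ closure Z := by
  by_contra hc
  let V : X.Opens := ⟨(closure Z)ᶜ, isClosed_closure.isOpen_compl⟩
  obtain ⟨g, hg, hxg⟩ := Fun.exists_basicOpen_le (p := p) hW (V := V) hx hc
  refine (mem_pointIdeal_iff p hx g).1 (h ?_) hxg
  rw [mem_vanishingIdeal_iff]
  intro z hz hzW
  rw [mem_pointIdeal_iff]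
  exact fun hzg => hg hzg (subset_closure hz)

theorem exists_mul_pow_eq_res {U V : X.Opens} (hU : IsAffineOpen U) (hV : IsAffineOpen V)
    (hVU : V ≤ U) {z : X} (hz : z ∈ V) (h : Fun p V) :
    ∃ (g a : Fun p U) (N : ℕ), z ∈ g.basicOpen ∧ g.basicOpen ≤ V ∧
      Fun.res p hVU g ^ N * h = Fun.res p hVU a := by
  obtain ⟨g, hg, hzg⟩ := Fun.exists_basicOpen_le (p := p) hU (V := V) (hVU hz) hz
  obtain ⟨n, a, ha⟩ := Fun.exists_res_eq_pow_mul hU g (Fun.res p hg h)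
  have hb : (Fun.res p hVU g).basicOpen ≤ g.basicOpen := by
    rw [Fun.basicOpen_res]; exact inf_le_right
  obtain ⟨m, hm⟩ := Fun.exists_pow_mul_eq_zero hV (Fun.res p hVU g)
    (Fun.res p hVU g ^ n * h - Fun.res p hVU a) (by
      have h1 := congrArg (Fun.res p hb) ha
      rw [map_mul, map_pow, Fun.res_res, Fun.res_res, Fun.res_res] at h1
      rw [map_sub, map_mul, map_pow, Fun.res_res, Fun.res_res, h1, sub_self])
  refine ⟨g, g ^ m * a, m + n, hzg, hg, ?_⟩
  rw [map_mul, map_pow, pow_add, mul_assoc]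
  rw [mul_sub, sub_eq_zero] at hm
  exact hm

variable (p) [LocallyOfFiniteType p]

include p in
theorem jacobsonSpace_of_locallyOfFiniteType : JacobsonSpace X :=
  LocallyOfFiniteType.jacobsonSpace p

variable {p}

theorem exists_pointIdeal_eq_of_isMaximal {W : X.Opens} (hW : IsAffineOpen W)
    (𝔪 : Ideal (Fun p W)) (h𝔪 : 𝔪.IsMaximal) :
    ∃ (x : X) (hx : x ∈ W), IsClosed {x} ∧ 𝔪 = pointIdeal p W x hx := by
  have := h𝔪.isPrime
  obtain ⟨x, hx, h1, h2⟩ := exists_pointIdeal_eq hW 𝔪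
  exact ⟨x, hx, h2 h𝔪 (jacobsonSpace_of_locallyOfFiniteType p), h1⟩

variable (p) in
/-- The value of a function at a closed point. -/
noncomputable def evalAt {x : X} (hx : IsClosed {x}) (W : X.Opens) (hxW : x ∈ W) :
    Fun p W →ₐ[ℂ] ℂ :=
  { pullSpec p (pointOfClosedPoint p x hx) W (fun s _ => by
      change pointOfClosedPoint p x hx s ∈ W
      rwa [pointOfClosedPoint_apply]) with
    commutes' := fun c => pullSpec_algebraMap _
      ((pointOfClosedPoint_comp p x hx).trans (Spec.map_id _).symm) _ _ c }

theorem evalAt_eq_zero_iff {x : X} (hx : IsClosed {x}) {W : X.Opens} (hxW : x ∈ W) (g : Fun p W) :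
    evalAt p hx W hxW g = 0 ↔ g ∈ pointIdeal p W x hxW := by
  let s : Spec (CommRingCat.of ℂ) := (⟨⊥, Ideal.isPrime_bot⟩ : PrimeSpectrum ℂ)
  have h1 := pullSpec_mem_iff (pointOfClosedPoint p x hx) (W := W) (fun s _ => by
      change pointOfClosedPoint p x hx s ∈ W
      rwa [pointOfClosedPoint_apply]) s g
  have h2 : ∀ x', x' = x → ∀ h : x' ∈ W, (g ∈ pointIdeal p W x' h ↔ g ∈ pointIdeal p W x hxW) := by
    rintro _ rfl _; rfl
  exact h1.trans (h2 _ (pointOfClosedPoint_apply p x hx s) _)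

theorem evalAt_res {x : X} (hx : IsClosed {x}) {V W : X.Opens} (hVW : V ≤ W) (hxV : x ∈ V)
    (g : Fun p W) : evalAt p hx V hxV (Fun.res p hVW g) = evalAt p hx W (hVW hxV) g :=
  pullSpec_res _ hVW _ g

omit [LocallyOfFiniteType p] in
theorem GmAction.isClosed_smul (G : GmAction p) (c : ℂˣ) {x : X} (hx : IsClosed {x}) :
    IsClosed {G.smul c x} := by
  have h1 := ((Scheme.homeoOfIso (G.act c)).isClosedMap) {x} hx
  rwa [Set.image_singleton] at h1

theorem GmAction.pointOfClosedPoint_act (G : GmAction p) (c : ℂˣ) {x : X} (hx : IsClosed {x}) :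
    pointOfClosedPoint p x hx ≫ (G.act c).hom =
      pointOfClosedPoint p (G.smul c x) (G.isClosed_smul c hx) := by
  refine ext_of_apply_closedPoint_eq p ?_ (pointOfClosedPoint_comp _ _ _) ?_
  · rw [Category.assoc, G.act_comp, pointOfClosedPoint_comp]
  · exact (congrArg (G.act c).hom (pointOfClosedPoint_apply p x hx _)).trans
      (pointOfClosedPoint_apply p _ (G.isClosed_smul c hx) _).symm

theorem GmAction.evalAt_pull (G : GmAction p) (c : ℂˣ) {x : X} (hx : IsClosed {x}) {W : X.Opens}
    (hxW : G.smul c x ∈ W) (g : Fun p W) :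
    evalAt p hx ((G.act c).hom ⁻¹ᵁ W) hxW (G.pull c W g) =
      evalAt p (G.isClosed_smul c hx) W hxW g := by
  have h1 : ⊤ ≤ (pointOfClosedPoint p x hx ≫ (G.act c).hom) ⁻¹ᵁ W := fun s _ => by
    change (G.act c).hom (pointOfClosedPoint p x hx s) ∈ W
    have h0 : (G.act c).hom (pointOfClosedPoint p x hx s) = G.smul c x :=
      congrArg (G.act c).hom (pointOfClosedPoint_apply p x hx s)
    exact h0.symm ▸ hxW
  refine (G.pullSpec_act c _ W h1 g).symm.trans ?_
  have h2 : ∀ f, f = pointOfClosedPoint p (G.smul c x) (G.isClosed_smul c hx) → ∀ h,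
    pullSpec p f W h g = evalAt p (G.isClosed_smul c hx) W hxW g := by
    rintro _ rfl _; rfl
  exact h2 _ (G.pointOfClosedPoint_act c hx) _

theorem sub_evalAt_mem {x : X} (hx : IsClosed {x}) {W : X.Opens} (hxW : x ∈ W) (g : Fun p W) :
    g - algebraMap ℂ _ (evalAt p hx W hxW g) ∈ pointIdeal p W x hxW := by
  rw [← evalAt_eq_zero_iff hx, map_sub, AlgHom.commutes]
  exact sub_self _

/-- A closed point at which all functions on an affine neighborhood have the same values. -/
theorem eq_of_evalAt_eq {x x' : X} (hx : IsClosed {x}) (hx' : IsClosed {x'}) {W : X.Opens}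
    (hW : IsAffineOpen W) (hxW : x ∈ W) (hxW' : x' ∈ W)
    (h : ∀ g, evalAt p hx W hxW g = evalAt p hx' W hxW' g) : x = x' := by
  have := pullSpec_ext (p := p) hW (f := pointOfClosedPoint p x hx)
    (f' := pointOfClosedPoint p x' hx') (fun s _ => by
      change pointOfClosedPoint p x hx s ∈ W
      rwa [pointOfClosedPoint_apply]) (fun s _ => by
      change pointOfClosedPoint p x' hx' s ∈ W
      rwa [pointOfClosedPoint_apply]) h
  exact (pointOfClosedPoint_apply p x hx (IsLocalRing.closedPoint ℂ)).symm.trans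
    ((congrArg (fun f => f (IsLocalRing.closedPoint ℂ)) this).trans
      (pointOfClosedPoint_apply p x' hx' _))

theorem exists_evalAt_eq {W : X.Opens} (hW : IsAffineOpen W) (χ : Fun p W →ₐ[ℂ] ℂ) :
    ∃ (x : X) (hx : IsClosed {x}) (hxW : x ∈ W), χ = evalAt p hx W hxW := by
  obtain ⟨x, hxW, hx, h⟩ := exists_pointIdeal_eq_of_isMaximal hW (RingHom.ker χ)
    (RingHom.ker_isMaximal_of_surjective _ fun c => ⟨algebraMap ℂ _ c, by simp⟩)
  refine ⟨x, hx, hxW, AlgHom.ext fun g => ?_⟩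
  have h1 := sub_evalAt_mem hx hxW g
  rw [← h, RingHom.mem_ker, map_sub, AlgHom.commutes, sub_eq_zero] at h1
  exact h1

/-- Functions vanishing at all closed points of a locally closed subset vanish on it. -/
theorem mem_vanishingIdeal_of_isClosed {W : X.Opens} {Z : Set X} (hZ : IsLocallyClosed Z)
    (g : Fun p W) (h : ∀ x ∈ Z, IsClosed {x} → ∀ hx : x ∈ W, g ∈ pointIdeal p W x hx) :
    g ∈ vanishingIdeal p W Z := by
  have := jacobsonSpace_of_locallyOfFiniteType p
  rw [mem_vanishingIdeal_iff]
  intro x hx hxW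
  by_contra hc
  rw [mem_pointIdeal_iff, not_not] at hc
  obtain ⟨z, ⟨hz1, hz2⟩, hz3⟩ := nonempty_inter_closedPoints (Z := Z ∩ (g.basicOpen : Set X))
    ⟨x, hx, hc⟩ (hZ.inter g.basicOpen.isOpen.isLocallyClosed)
  exact (mem_pointIdeal_iff p _ g).1 (h z hz1 hz3 (g.basicOpen_le p hz2)) hz2

variable (p) in
theorem finiteType_fun {W : X.Opens} (hW : IsAffineOpen W) : Algebra.FiniteType ℂ (Fun p W) := by
  have h1 := LocallyOfFiniteType.finiteType_appLE (f := p) (isAffineOpen_top _) hW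
    (le_top : W ≤ p ⁻¹ᵁ ⊤)
  have h2 : (algebraMap ℂ (Fun p W)) = (p.appLE ⊤ W le_top).hom.comp
    (Scheme.ΓSpecIso (CommRingCat.of ℂ)).inv.hom := rfl
  have h3 : (algebraMap ℂ (Fun p W)).FiniteType := by
    rw [h2]
    exact h1.comp (RingHom.FiniteType.of_surjective _
      (Scheme.ΓSpecIso (CommRingCat.of ℂ)).symm.commRingCatIsoToRingEquiv.surjective)
  exact h3

end ClosedPoints

section Thickening

variable {X : Scheme.{0}} {p : X ⟶ Spec (CommRingCat.of ℂ)}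

theorem IsAffineOpen.fromSpec_comp {U : X.Opens} (hU : IsAffineOpen U) :
    hU.fromSpec ≫ p = Spec.map (CommRingCat.ofHom (algebraMap ℂ (Fun p U)) : _ ⟶ Γ(X, U)) := by
  have h1 := IsAffineOpen.SpecMap_appLE_fromSpec p (isAffineOpen_top _) hU (le_top : U ≤ p ⁻¹ᵁ ⊤)
  rw [← h1, IsAffineOpen.fromSpec_top]
  have h2 : (CommRingCat.ofHom (algebraMap ℂ (Fun p U)) : _ ⟶ Γ(X, U)) =
    (Scheme.ΓSpecIso (CommRingCat.of ℂ)).inv ≫ p.appLE ⊤ U le_top := rfl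
  rw [h2, Spec.map_comp]
  congr 1
  rw [← cancel_mono (Spec (CommRingCat.of ℂ)).isoSpec.hom, Iso.inv_hom_id]
  simp [Scheme.isoSpec]

variable {U : X.Opens} (hU : IsAffineOpen U) (Z : Set X)

/-- An infinitesimal neighborhood of a closed subset of an affine open subset `U`. -/
noncomputable def thickening (n : ℕ) :
    Spec (CommRingCat.of (Fun p U ⧸ vanishingIdeal p U Z ^ n)) ⟶ X :=
  Spec.map (CommRingCat.ofHom (Ideal.Quotient.mk (vanishingIdeal p U Z ^ n)) : Γ(X, U) ⟶ _) ≫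
    hU.fromSpec

theorem thickening_comp (n : ℕ) : thickening (p := p) hU Z n ≫ p =
    Spec.map (CommRingCat.ofHom (algebraMap ℂ (Fun p U ⧸ vanishingIdeal p U Z ^ n))) := by
  rw [thickening, Category.assoc, IsAffineOpen.fromSpec_comp, ← Spec.map_comp]
  rfl

/-- A subset of `U` which is closed in `U`, as far as closed points of `U` are concerned. -/
structure IsClosedIn (U : X.Opens) (Z : Set X) : Prop where
  subset : Z ⊆ U
  isClosed_singleton : ∀ x ∈ Z, IsClosed {x}
  mem_of_mem_closure : ∀ x ∈ U, IsClosed {x} → x ∈ closure Z → x ∈ Z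

variable {Z}

theorem IsClosedIn.mono (hZ : IsClosedIn U Z) {V : X.Opens} (hVU : V ≤ U) (hZV : Z ⊆ V) :
    IsClosedIn V Z :=
  ⟨hZV, hZ.2, fun x hx => hZ.3 x (hVU hx)⟩

variable [LocallyOfFiniteType p]

include hU in
theorem IsClosedIn.exists_pointIdeal_eq (hZ : IsClosedIn U Z) (𝔪 : Ideal (Fun p U))
    (h𝔪 : 𝔪.IsMaximal) (h : vanishingIdeal p U Z ≤ 𝔪) :
    ∃ (z : X) (hz : z ∈ Z), 𝔪 = pointIdeal p U z (hZ.subset hz) := by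
  obtain ⟨x, hx, hc, rfl⟩ := exists_pointIdeal_eq_of_isMaximal hU 𝔪 h𝔪
  exact ⟨x, hZ.3 x hx hc (mem_closure_of_vanishingIdeal_le hU hx h), rfl⟩

include hU in
theorem IsClosedIn.isUnit_mk (hZ : IsClosedIn U Z) (n : ℕ) (f : Fun p U)
    (h : ∀ z, ∀ hz : z ∈ Z, f ∉ pointIdeal p U z (hZ.subset hz)) :
    IsUnit (Ideal.Quotient.mk (vanishingIdeal p U Z ^ n) f) := by
  by_contra hc
  obtain ⟨𝔪, h𝔪, hf⟩ := exists_max_ideal_of_mem_nonunits hc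
  have h1 := Ideal.comap_isMaximal_of_surjective
    (Ideal.Quotient.mk (vanishingIdeal p U Z ^ n)) Ideal.Quotient.mk_surjective (K := 𝔪)
  obtain ⟨z, hz, h2⟩ := hZ.exists_pointIdeal_eq hU _ h1 (by
    refine Ideal.IsPrime.le_of_pow_le (n := n) fun x hx => ?_
    rw [Ideal.mem_comap, Ideal.Quotient.eq_zero_iff_mem.2 hx]
    exact zero_mem _)
  exact h z hz (h2 ▸ hf)

theorem IsClosedIn.top_le_preimage_thickening (hZ : IsClosedIn U Z) (n : ℕ) {V : X.Opens}
    (hZV : Z ⊆ V) : ⊤ ≤ thickening (p := p) hU Z n ⁻¹ᵁ V := by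
  intro s _
  have h1 := IsAffineOpen.top_le_preimage hU (Ideal.Quotient.mk (vanishingIdeal p U Z ^ n))
  have h2 : thickening (p := p) hU Z n s ∈ U := h1 trivial
  let 𝔮 := pointIdeal p U (thickening (p := p) hU Z n s) h2
  have h3 : vanishingIdeal p U Z ≤ 𝔮 := by
    refine Ideal.IsPrime.le_of_pow_le (n := n) fun g hg => ?_
    refine (pullSpec_mem_iff (p := p) _ h1 s g).1 ?_
    have := pullSpec_fromSpec hU (Ideal.Quotient.mk (vanishingIdeal p U Z ^ n)) g
    rw [Ideal.Quotient.eq_zero_iff_mem.2 hg] at this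
    exact this.symm ▸ zero_mem _
  obtain ⟨𝔪, h𝔪, hle⟩ := Ideal.exists_le_maximal 𝔮 (Ideal.IsPrime.ne_top inferInstance)
  obtain ⟨z, hz, rfl⟩ := hZ.exists_pointIdeal_eq hU 𝔪 h𝔪 (h3.trans hle)
  obtain ⟨g, hg1, hg2⟩ := Fun.exists_basicOpen_le (p := p) hU (hZ.subset hz) (hZV hz)
  refine hg1 ?_
  by_contra hc
  exact (mem_pointIdeal_iff p _ g).1 (hle ((mem_pointIdeal_iff p _ g).2 hc)) hg2

/-- Restriction of functions to an infinitesimal neighborhood. -/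
noncomputable def IsClosedIn.germ (hZ : IsClosedIn U Z) (n : ℕ) {V : X.Opens} (hZV : Z ⊆ V) :
    Fun p V →+* Fun p U ⧸ vanishingIdeal p U Z ^ n :=
  pullSpec p (thickening hU Z n) V (hZ.top_le_preimage_thickening hU n hZV)

namespace IsClosedIn

variable (hZ : IsClosedIn U Z) (n : ℕ)

theorem germ_res {V W : X.Opens} (hVW : V ≤ W) (hZV : Z ⊆ V) (g : Fun p W) :
    hZ.germ hU n hZV (Fun.res p hVW g) = hZ.germ hU n (hZV.trans hVW) g :=
  pullSpec_res _ _ _ _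

theorem germ_self (g : Fun p U) :
    hZ.germ hU n hZ.subset g = Ideal.Quotient.mk (vanishingIdeal p U Z ^ n) g :=
  pullSpec_fromSpec hU _ g

theorem germ_algebraMap {V : X.Opens} (hZV : Z ⊆ V) (c : ℂ) :
    hZ.germ hU n hZV (algebraMap ℂ (Fun p V) c) = algebraMap ℂ _ c :=
  pullSpec_algebraMap _ (thickening_comp hU Z n) _ _ _

theorem germ_smul {V : X.Opens} (hZV : Z ⊆ V) (c : ℂ) (g : Fun p V) :
    hZ.germ hU n hZV (c • g) = c • hZ.germ hU n hZV g := by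
  rw [Algebra.smul_def, map_mul, germ_algebraMap, ← Algebra.smul_def]

variable {V : X.Opens} (hV : IsAffineOpen V) (hVU : V ≤ U) (hZV : Z ⊆ V)

include hV hVU in
theorem germ_mem_map {Y : Set X} {h : Fun p V} (hh : h ∈ vanishingIdeal p V Y) :
    hZ.germ hU n hZV h ∈
      (vanishingIdeal p U Y).map (Ideal.Quotient.mk (vanishingIdeal p U Z ^ n)) := by
  set J := (vanishingIdeal p U Y).map (Ideal.Quotient.mk (vanishingIdeal p U Z ^ n))
  let C : Ideal (Fun p U) :=
    (J.colon {hZ.germ hU n hZV h}).comap (Ideal.Quotient.mk (vanishingIdeal p U Z ^ n))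
  have hC : ∀ s, s ∈ C ↔ Ideal.Quotient.mk (vanishingIdeal p U Z ^ n) s *
      hZ.germ hU n hZV h ∈ J := fun s => by
    rw [Ideal.mem_comap, Submodule.mem_colon_singleton, smul_eq_mul]
  suffices hCt : C = ⊤ by
    have := (hC 1).1 (hCt ▸ trivial)
    rwa [map_one, one_mul] at this
  by_contra hne
  obtain ⟨𝔪, h𝔪, hle⟩ := Ideal.exists_le_maximal C hne
  obtain ⟨z, hz, rfl⟩ := hZ.exists_pointIdeal_eq hU 𝔪 h𝔪 (by
    refine Ideal.IsPrime.le_of_pow_le (n := n) fun x hx => hle ((hC x).2 ?_)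
    rw [Ideal.Quotient.eq_zero_iff_mem.2 hx, zero_mul]
    exact zero_mem _)
  obtain ⟨g, a, N, hzg, hgV, hga⟩ := exists_mul_pow_eq_res hU hV hVU (hZV hz) h
  refine (mem_pointIdeal_iff p _ g).1 (h𝔪.isPrime.mem_of_pow_mem (N + 1) (hle ((hC _).2 ?_))) hzg
  have h1 := congrArg (hZ.germ hU n hZV) hga
  rw [map_mul, map_pow, germ_res, germ_res, germ_self, germ_self] at h1
  rw [map_pow, pow_succ', mul_assoc, h1, ← map_mul]
  refine Ideal.mem_map_of_mem _ ?_
  rw [mem_vanishingIdeal_iff]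
  intro x hx hxU
  by_cases hxg : x ∈ g.basicOpen
  · refine Ideal.mul_mem_left _ _ ?_
    rw [← res_mem_pointIdeal_iff p hVU (hgV hxg), ← hga]
    exact Ideal.mul_mem_left _ _ ((mem_vanishingIdeal_iff p h).1 hh x hx _)
  · exact Ideal.mul_mem_right _ _ ((mem_pointIdeal_iff p _ g).2 hxg)

include hV hVU in
theorem germ_eq_zero_iff {h : Fun p V} :
    hZ.germ hU n hZV h = 0 ↔ h ∈ vanishingIdeal p V Z ^ n := by
  constructor
  · intro h0
    let C : Ideal (Fun p V) := (vanishingIdeal p V Z ^ n).colon {h}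
    have hC : ∀ s, s ∈ C ↔ s * h ∈ vanishingIdeal p V Z ^ n := fun s => by
      rw [Submodule.mem_colon_singleton, smul_eq_mul]
    suffices hCt : C = ⊤ by
      have := (hC 1).1 (hCt ▸ trivial)
      rwa [one_mul] at this
    by_contra hne
    obtain ⟨𝔪, h𝔪, hle⟩ := Ideal.exists_le_maximal C hne
    obtain ⟨z, hz, rfl⟩ := (hZ.mono hVU hZV).exists_pointIdeal_eq hV 𝔪 h𝔪
      (Ideal.IsPrime.le_of_pow_le (n := n) fun x hx => hle ((hC x).2 (Ideal.mul_mem_right _ _ hx)))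
    obtain ⟨g, a, N, hzg, hgV, hga⟩ := exists_mul_pow_eq_res hU hV hVU (hZV hz) h
    have h1 := congrArg (hZ.germ hU n hZV) hga
    rw [map_mul, h0, mul_zero, germ_res, germ_self, eq_comm, Ideal.Quotient.eq_zero_iff_mem] at h1
    have h2 : Fun.res p hVU g ^ N ∈ C := by
      rw [hC, hga]
      have h3 : (vanishingIdeal p U Z).map (Fun.res p hVU) ≤ vanishingIdeal p V Z := by
        rw [Ideal.map_le_iff_le_comap]
        intro f hf
        rw [Ideal.mem_comap, mem_vanishingIdeal_iff]
        intro x hx hxV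
        rw [res_mem_pointIdeal_iff]
        exact (mem_vanishingIdeal_iff p f).1 hf x hx _
      have h4 := Ideal.mem_map_of_mem (Fun.res p hVU) h1
      rw [Ideal.map_pow] at h4
      exact Ideal.pow_right_mono h3 n h4
    have h5 := h𝔪.isPrime.mem_of_pow_mem N (hle h2)
    rw [res_mem_pointIdeal_iff] at h5
    exact (mem_pointIdeal_iff p _ g).1 h5 hzg
  · intro hh
    have h1 : (vanishingIdeal p V Z ^ n).map (hZ.germ hU n hZV) ≤ ⊥ := by
      rw [Ideal.map_pow]
      have h2 : (vanishingIdeal p V Z).map (hZ.germ hU n hZV) ≤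
          (vanishingIdeal p U Z).map (Ideal.Quotient.mk (vanishingIdeal p U Z ^ n)) :=
        Ideal.map_le_iff_le_comap.2 fun f hf => hZ.germ_mem_map hU n hV hVU hZV hf
      refine (Ideal.pow_right_mono h2 n).trans ?_
      rw [← Ideal.map_pow, Ideal.map_quotient_self]
    exact h1 (Ideal.mem_map_of_mem _ hh)

end IsClosedIn

end Thickening

theorem LaurentPolynomial.eval₂_id_eq_laurentEval {S : Type} [CommRing S] [Algebra ℂ S] (c : ℂˣ)
    (q : S[T;T⁻¹]) :
    LaurentPolynomial.eval₂ (RingHom.id S) (Units.map (algebraMap ℂ S).toMonoidHom c) q =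
      laurentEval c q.coeff := by
  induction q using LaurentPolynomial.induction_on' with
  | add p q hp hq =>
    rw [map_add, hp, hq, ← map_add]
    rfl
  | C_mul_T n a =>
    rw [LaurentPolynomial.eval₂_C_mul_T, ← LaurentPolynomial.single_eq_C_mul_T,
      AddMonoidAlgebra.coeff_single, laurentEval_single, Algebra.smul_def, mul_comm, ← map_zpow]
    rfl

theorem LaurentPolynomial.ringHom_ext_of_C_of_T {R S : Type} [CommRing R] [CommRing S]
    {f g : R[T;T⁻¹] →+* S} (hC : ∀ r, f (C r) = g (C r)) (hT : f (T 1) = g (T 1)) : f = g := by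
  let u : R[T;T⁻¹]ˣ := ⟨T 1, T (-1), by rw [← T_add]; simp, by rw [← T_add]; simp⟩
  have hu : ∀ n : ℤ, ((u ^ n : R[T;T⁻¹]ˣ) : R[T;T⁻¹]) = T n := fun n => by
    have h1 := LaurentPolynomial.eval₂_T (LaurentPolynomial.C (R := R)) u n
    rw [← h1]
    have h2 : ∀ m : ℕ, ((u ^ m : R[T;T⁻¹]ˣ) : R[T;T⁻¹]) = T m := fun m => by
      rw [Units.val_pow_eq_pow_val]
      change T 1 ^ m = _
      rw [T_pow, mul_one]
    rw [h1]
    obtain ⟨m, rfl | rfl⟩ := n.eq_nat_or_neg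
    · exact_mod_cast h2 m
    · rw [zpow_neg, zpow_natCast]
      refine Units.inv_eq_of_mul_eq_one_left ?_
      rw [h2, ← T_add]; simp
  have h1 : Units.map (f : R[T;T⁻¹] →* S) u = Units.map (g : R[T;T⁻¹] →* S) u := Units.ext hT
  refine RingHom.ext fun q => ?_
  induction q using LaurentPolynomial.induction_on' with
  | add p q hp hq => rw [map_add, map_add, hp, hq]
  | C_mul_T n a =>
    rw [map_mul, map_mul, hC, ← hu]
    congr 1
    have h2 : Units.map (f : R[T;T⁻¹] →* S) (u ^ n) = Units.map (g : R[T;T⁻¹] →* S) (u ^ n) := by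
      rw [map_zpow, map_zpow, h1]
    exact congrArg Units.val h2

theorem exists_algHom_of_isMaximal {S : Type} [CommRing S] [Algebra ℂ S] [Algebra.FiniteType ℂ S]
    (𝔪 : Ideal S) [𝔪.IsMaximal] : ∃ χ : S →ₐ[ℂ] ℂ, RingHom.ker χ = 𝔪 := by
  let := Ideal.Quotient.field 𝔪
  have h1 : Module.Finite ℂ (S ⧸ 𝔪) := finite_of_finite_type_of_isJacobsonRing ℂ (S ⧸ 𝔪)
  have h2 := IsAlgClosed.algebraMap_bijective_of_isIntegral (k := ℂ) (K := S ⧸ 𝔪)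
  let e := AlgEquiv.ofBijective (Algebra.ofId ℂ (S ⧸ 𝔪)) h2
  refine ⟨(e.symm : (S ⧸ 𝔪) →ₐ[ℂ] ℂ).comp (Ideal.Quotient.mkₐ ℂ 𝔪), ?_⟩
  ext x
  rw [RingHom.mem_ker]
  change e.symm (Ideal.Quotient.mk 𝔪 x) = 0 ↔ _
  rw [EmbeddingLike.map_eq_zero_iff, Ideal.Quotient.eq_zero_iff_mem]

section Action

variable {X : Scheme.{0}} {p : X ⟶ Spec (CommRingCat.of ℂ)} (G : GmAction p)

theorem GmAction.basicOpen_pull (c : ℂˣ) {W : X.Opens} (g : Fun p W) :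
    (G.pull c W g).basicOpen = (G.act c).hom ⁻¹ᵁ g.basicOpen :=
  (Scheme.preimage_basicOpen (G.act c).hom (show Γ(X, W) from g)).symm

theorem GmAction.pull_mem_pointIdeal_iff (c : ℂˣ) {W : X.Opens} {x : X}
    (hx : x ∈ (G.act c).hom ⁻¹ᵁ W) (g : Fun p W) :
    G.pull c W g ∈ pointIdeal p _ x hx ↔ g ∈ pointIdeal p W (G.smul c x) hx := by
  refine (mem_pointIdeal_iff p hx _).trans (Iff.trans ?_ (mem_pointIdeal_iff p _ g).symm)
  rw [G.basicOpen_pull]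
  rfl

theorem GmAction.pull_mem_vanishingIdeal {Y : Set X} (hY : ∀ c, ∀ x ∈ Y, G.smul c x ∈ Y) (c : ℂˣ)
    {W : X.Opens} {g : Fun p W} (hg : g ∈ vanishingIdeal p W Y) :
    G.pull c W g ∈ vanishingIdeal p _ Y := by
  rw [mem_vanishingIdeal_iff] at hg ⊢
  intro x hx hxW
  rw [G.pull_mem_pointIdeal_iff]
  exact hg _ (hY c x hx) _

theorem res_mem_vanishingIdeal {Y : Set X} {V W : X.Opens} (h : V ≤ W) {g : Fun p W}
    (hg : g ∈ vanishingIdeal p W Y) : Fun.res p h g ∈ vanishingIdeal p V Y := by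
  rw [mem_vanishingIdeal_iff] at hg ⊢
  intro x hx hxV
  rw [res_mem_pointIdeal_iff]
  exact hg _ hx _

theorem IsAffineOpen.inf_of_isSeparated [IsSeparated p] {V W : X.Opens} (hV : IsAffineOpen V)
    (hW : IsAffineOpen W) : IsAffineOpen (V ⊓ W) := by
  have : IsSeparated (terminal.from X) := by
    rw [← terminal.comp_from p]; infer_instance
  exact hV.inf hW

theorem GmAction.isAffineOpen_preimage (c : ℂˣ) {W : X.Opens} (hW : IsAffineOpen W) :
    IsAffineOpen ((G.act c).hom ⁻¹ᵁ W) :=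
  have : IsIso (G.act c).hom := (show X ≅ X from G.act c).isIso_hom
  hW.preimage_of_isIso _

theorem GmAction.act_mul_hom (c c' : ℂˣ) :
    (G.act (c * c')).hom = (G.act c').hom ≫ (G.act c).hom := by
  rw [map_mul]; rfl

theorem GmAction.smul_mul (c c' : ℂˣ) (x : X) : G.smul (c * c') x = G.smul c (G.smul c' x) := by
  unfold GmAction.smul
  rw [G.act_mul_hom]; rfl

theorem GmAction.smul_one (x : X) : G.smul 1 x = x := by
  unfold GmAction.smul
  rw [map_one]; rfl

/-- The morphism `𝔾ₘ × Spec S ⟶ X` given by a morphism `Spec S ⟶ X` and the action. -/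
theorem GmAction.exists_orbit_morphism (G : GmAction p) {S : Type} [CommRing S] [Algebra ℂ S]
    (f : Spec (CommRingCat.of S) ⟶ X)
    (hf : f ≫ p = Spec.map (CommRingCat.ofHom (algebraMap ℂ S))) :
    ∃ j : Spec (CommRingCat.of S[T;T⁻¹]) ⟶ X, ∀ c : ℂˣ,
      Spec.map (CommRingCat.ofHom (LaurentPolynomial.eval₂ (RingHom.id S)
        (Units.map (algebraMap ℂ S).toMonoidHom c))) ≫ j = f ≫ (G.act c).hom := by
  obtain ⟨α, -, hα⟩ := G.algebraic
  let φ : ℂ[T;T⁻¹] →+* S[T;T⁻¹] := LaurentPolynomial.eval₂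
    (LaurentPolynomial.C.comp (algebraMap ℂ S))
    ⟨LaurentPolynomial.T 1, LaurentPolynomial.T (-1), by rw [← LaurentPolynomial.T_add]; simp,
      by rw [← LaurentPolynomial.T_add]; simp⟩
  let ι : S →+* S[T;T⁻¹] := LaurentPolynomial.C
  let ev : ℂˣ → S[T;T⁻¹] →+* S := fun c =>
    LaurentPolynomial.eval₂ (RingHom.id S) (Units.map (algebraMap ℂ S).toMonoidHom c)
  have hφC : φ.comp (algebraMap ℂ ℂ[T;T⁻¹]) = ι.comp (algebraMap ℂ S) :=
    RingHom.ext fun r => LaurentPolynomial.eval₂_C _ _ r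
  have hevι : ∀ c, (ev c).comp ι = RingHom.id S := fun c =>
    RingHom.ext fun r => LaurentPolynomial.eval₂_C _ _ r
  have hevφ : ∀ c, (ev c).comp φ =
      (algebraMap ℂ S).comp (LaurentPolynomial.eval₂ (RingHom.id ℂ) c) := fun c => by
    refine LaurentPolynomial.ringHom_ext_of_C_of_T (fun r => ?_) ?_
    · change ev c (φ (LaurentPolynomial.C r)) = algebraMap ℂ S (LaurentPolynomial.eval₂ _ _ _)
      simp only [φ, ev, LaurentPolynomial.eval₂_C, RingHom.comp_apply, RingHom.id_apply]
    · change ev c (φ (LaurentPolynomial.T 1)) = algebraMap ℂ S (LaurentPolynomial.eval₂ _ _ _)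
      simp only [φ, ev, LaurentPolynomial.eval₂_T, zpow_one]
      rfl
  let j := pullback.lift (f := Spec.map (CommRingCat.ofHom (algebraMap ℂ ℂ[T;T⁻¹]))) (g := p)
    (Spec.map (CommRingCat.ofHom φ)) (Spec.map (CommRingCat.ofHom ι) ≫ f)
    (by
      rw [Category.assoc, hf, ← Spec.map_comp, ← Spec.map_comp,
        ← CommRingCat.ofHom_comp, ← CommRingCat.ofHom_comp, hφC])
  refine ⟨j ≫ α, fun c => ?_⟩
  change Spec.map (CommRingCat.ofHom (ev c)) ≫ j ≫ α = _
  rw [← hα c, ← Category.assoc, ← Category.assoc]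
  congr 1
  apply pullback.hom_ext
  · rw [Category.assoc, Category.assoc, pullback.lift_fst, pullback.lift_fst, ← Category.assoc,
      hf, ← Spec.map_comp, ← Spec.map_comp, ← CommRingCat.ofHom_comp,
      ← CommRingCat.ofHom_comp, hevφ]
  · rw [Category.assoc, Category.assoc, pullback.lift_snd, pullback.lift_snd, ← Category.assoc,
      ← Spec.map_comp, ← CommRingCat.ofHom_comp, hevι, Category.comp_id]
    exact (congrArg (· ≫ f) (Spec.map_id _)).trans (Category.id_comp _)

variable {U : X.Opens} (hU : IsAffineOpen U) {Z : Set X} (hZ : IsClosedIn U Z)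
  (hGZ : ∀ c, ∀ x ∈ Z, G.smul c x ∈ Z) [LocallyOfFiniteType p]

include hZ hGZ in
omit [LocallyOfFiniteType p] in
theorem IsClosedIn.subset_preimage (c : ℂˣ) : Z ⊆ (G.act c).hom ⁻¹ᵁ U :=
  fun x hx => hZ.subset (hGZ c x hx)

namespace IsClosedIn

/-- The action of an element of `ℂˣ` on functions on an infinitesimal neighborhood. -/
noncomputable def translate (n : ℕ) (c : ℂˣ) :
    Fun p U →ₐ[ℂ] Fun p U ⧸ vanishingIdeal p U Z ^ n :=
  { (hZ.germ hU n (hZ.subset_preimage G hGZ c)).comp (G.pull c U) with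
    commutes' := fun r => by
      change hZ.germ hU n (hZ.subset_preimage G hGZ c) (G.pull c U _) = _
      rw [G.pull_algebraMap, germ_algebraMap] }

theorem translate_apply (n : ℕ) (c : ℂˣ) (a : Fun p U) : hZ.translate G hU hGZ n c a =
    hZ.germ hU n (hZ.subset_preimage G hGZ c) (G.pull c U a) := rfl

include hZ hGZ in
theorem top_le_preimage_act (n : ℕ) (c : ℂˣ) :
    ⊤ ≤ (thickening (p := p) hU Z n ≫ (G.act c).hom) ⁻¹ᵁ U :=
  hZ.top_le_preimage_thickening hU n (hZ.subset_preimage G hGZ c)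

theorem translate_eq_pullSpec (n : ℕ) (c : ℂˣ) (a : Fun p U) : hZ.translate G hU hGZ n c a =
    pullSpec p (thickening (p := p) hU Z n ≫ (G.act c).hom) U
      (hZ.top_le_preimage_act G hU hGZ n c) a :=
  (G.pullSpec_act c _ U _ a).symm

theorem translate_eq_of_comp_eq {n : ℕ} {c : ℂˣ}
    {f : Spec (CommRingCat.of (Fun p U ⧸ vanishingIdeal p U Z ^ n)) ⟶ X}
    (hf : thickening (p := p) hU Z n ≫ (G.act c).hom = f) (h : ⊤ ≤ f ⁻¹ᵁ U) (a : Fun p U) :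
    hZ.translate G hU hGZ n c a = pullSpec p f U h a := by
  subst hf
  exact translate_eq_pullSpec ..

theorem germ_res_sub_eq_zero_iff [IsSeparated p] (n : ℕ) (c : ℂˣ) (a : Fun p U) (r : ℂ) :
    Fun.res p (inf_le_right : U ⊓ (G.act c).hom ⁻¹ᵁ U ≤ _) (G.pull c U a) -
        r • Fun.res p (inf_le_left : U ⊓ (G.act c).hom ⁻¹ᵁ U ≤ _) a ∈
      vanishingIdeal p (U ⊓ (G.act c).hom ⁻¹ᵁ U) Z ^ n ↔
    hZ.translate G hU hGZ n c a = r • Ideal.Quotient.mk _ a := by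
  have hZV : Z ⊆ (U ⊓ (G.act c).hom ⁻¹ᵁ U : X.Opens) :=
    fun x hx => ⟨hZ.subset hx, hZ.subset_preimage G hGZ c hx⟩
  rw [← hZ.germ_eq_zero_iff hU n
    (IsAffineOpen.inf_of_isSeparated (p := p) hU (G.isAffineOpen_preimage c hU)) inf_le_left hZV,
    map_sub, germ_smul, germ_res, germ_res, germ_self, sub_eq_zero]
  rfl

theorem translate_mem_map [IsSeparated p] {Y : Set X} (hY : ∀ c, ∀ x ∈ Y, G.smul c x ∈ Y) (n : ℕ)
    (c : ℂˣ) {a : Fun p U} (ha : a ∈ vanishingIdeal p U Y) : hZ.translate G hU hGZ n c a ∈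
      (vanishingIdeal p U Y).map (Ideal.Quotient.mk (vanishingIdeal p U Z ^ n)) := by
  have hZV : Z ⊆ (U ⊓ (G.act c).hom ⁻¹ᵁ U : X.Opens) :=
    fun x hx => ⟨hZ.subset hx, hZ.subset_preimage G hGZ c hx⟩
  have h1 := hZ.germ_mem_map hU n
    (IsAffineOpen.inf_of_isSeparated (p := p) hU (G.isAffineOpen_preimage c hU)) inf_le_left hZV
    (res_mem_vanishingIdeal inf_le_right (G.pull_mem_vanishingIdeal hY c ha))
  rwa [germ_res] at h1

theorem translate_of_mem_pow [IsSeparated p] (n : ℕ) (c : ℂˣ) {a : Fun p U}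
    (ha : a ∈ vanishingIdeal p U Z ^ n) : hZ.translate G hU hGZ n c a = 0 := by
  have h2 : (vanishingIdeal p U Z).map (hZ.translate G hU hGZ n c) ≤
      (vanishingIdeal p U Z).map (Ideal.Quotient.mk (vanishingIdeal p U Z ^ n)) :=
    Ideal.map_le_iff_le_comap.2 fun f hf => hZ.translate_mem_map G hU hGZ hGZ n c hf
  have h3 := Ideal.pow_right_mono h2 n
  rw [← Ideal.map_pow, ← Ideal.map_pow, Ideal.map_quotient_self] at h3
  exact h3 (Ideal.mem_map_of_mem _ ha)

theorem germ_compat {n : ℕ} {V : X.Opens} (hZV : Z ⊆ V) {h : Fun p V} {b : Fun p U}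
    (hb : Ideal.Quotient.mk (vanishingIdeal p U Z ^ (n + 1)) b = hZ.germ hU (n + 1) hZV h) :
    Ideal.Quotient.mk (vanishingIdeal p U Z ^ n) b = hZ.germ hU n hZV h := by
  let φ := Ideal.Quotient.factor (Ideal.pow_le_pow_right (I := vanishingIdeal p U Z) n.le_succ)
  have h1 : Spec.map (CommRingCat.ofHom φ) ≫ thickening (p := p) hU Z (n + 1) =
      thickening (p := p) hU Z n := by
    rw [thickening, thickening, ← Category.assoc, ← Spec.map_comp]
    rfl
  have h2 : ∀ f, Spec.map (CommRingCat.ofHom φ) ≫ thickening (p := p) hU Z (n + 1) = f →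
      ∀ hf, φ (hZ.germ hU (n + 1) hZV h) = pullSpec p f V hf h := by
    rintro _ rfl hf
    exact (pullSpec_comp φ _ V _ hf h).symm
  have h3 := h2 _ h1 (hZ.top_le_preimage_thickening hU n hZV)
  rw [← hb] at h3
  exact h3

theorem exists_laurentEval_eq_translate (n : ℕ) (a : Fun p U) :
    ∃ q : ℤ →₀ Fun p U ⧸ vanishingIdeal p U Z ^ n,
      ∀ c, hZ.translate G hU hGZ n c a = laurentEval c q := by
  let S := Fun p U ⧸ vanishingIdeal p U Z ^ n
  let ι : S →+* S[T;T⁻¹] := LaurentPolynomial.C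
  let ev : ℂˣ → S[T;T⁻¹] →+* S := fun c =>
    LaurentPolynomial.eval₂ (RingHom.id S) (Units.map (algebraMap ℂ S).toMonoidHom c)
  obtain ⟨j, hj⟩ := G.exists_orbit_morphism (S := S) (thickening (p := p) hU Z n)
    (thickening_comp hU Z n)
  have hft : Algebra.FiniteType ℂ S[T;T⁻¹] := by
    have := finiteType_fun p hU
    have h1 : Algebra.FiniteType ℂ S := inferInstance
    have h2 : Algebra.FiniteType S S[T;T⁻¹] := inferInstance
    exact h1.trans h2
  have hjU : ⊤ ≤ j ⁻¹ᵁ U := by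
    intro s _
    obtain ⟨𝔪, h𝔪, hle⟩ := Ideal.exists_le_maximal (PrimeSpectrum.asIdeal (R := S[T;T⁻¹]) s)
      (PrimeSpectrum.isPrime (R := S[T;T⁻¹]) s).ne_top
    obtain ⟨χ, hχ⟩ := exists_algHom_of_isMaximal 𝔪
    let c : ℂˣ := Units.map (χ : S[T;T⁻¹] →* ℂ) ⟨LaurentPolynomial.T 1, LaurentPolynomial.T (-1),
      by rw [← LaurentPolynomial.T_add]; simp, by rw [← LaurentPolynomial.T_add]; simp⟩
    let χ₀ : S →ₐ[ℂ] ℂ := { (χ : S[T;T⁻¹] →+* ℂ).comp ι with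
      commutes' := fun r => χ.commutes r }
    have hχev : (χ₀ : S →+* ℂ).comp (ev c) = χ := by
      refine LaurentPolynomial.ringHom_ext_of_C_of_T (fun r => ?_) ?_
      · change χ₀ (ev c (LaurentPolynomial.C r)) = _
        simp only [ev, LaurentPolynomial.eval₂_C, RingHom.id_apply]
        rfl
      · change χ₀ (ev c (LaurentPolynomial.T 1)) = _
        simp only [ev, LaurentPolynomial.eval₂_T, zpow_one]
        exact χ₀.commutes c
    let s₀ : Spec (CommRingCat.of S) :=
      (⟨RingHom.ker χ₀, RingHom.ker_isPrime _⟩ : PrimeSpectrum S)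
    let s₁ : Spec (CommRingCat.of S[T;T⁻¹]) := (⟨𝔪, h𝔪.isPrime⟩ : PrimeSpectrum S[T;T⁻¹])
    have h1 : Spec.map (CommRingCat.ofHom (ev c)) s₀ = s₁ := by
      refine PrimeSpectrum.ext (R := S[T;T⁻¹]) ?_
      refine Eq.trans ?_ hχ
      ext x
      exact (congrArg (· = 0) (congr($hχev x))).to_iff
    have h2 : j s₁ ∈ U := by
      have h3 : (Spec.map (CommRingCat.ofHom (ev c)) ≫ j) s₀ ∈ U := by
        rw [hj c]
        exact hZ.top_le_preimage_act G hU hGZ n c trivial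
      rw [← h1]
      exact h3
    have h3 : s ⤳ s₁ := (PrimeSpectrum.le_iff_specializes (R := S[T;T⁻¹]) s s₁).1 hle
    exact h3.mem_open (j ⁻¹ᵁ U).isOpen h2
  refine ⟨(pullSpec p j U hjU a).coeff, fun c => ?_⟩
  rw [← LaurentPolynomial.eval₂_id_eq_laurentEval]
  refine (hZ.translate_eq_of_comp_eq G hU hGZ (hj c).symm (preimage_comp_top _ _ hjU) a).trans ?_
  exact pullSpec_comp (ev c) j U hjU _ a

/-- The action of `ℂˣ` on the formal neighborhood of a stable closed subset. -/
noncomputable def formalAction [IsSeparated p] : FormalAction (vanishingIdeal p U Z) where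
  τ := hZ.translate G hU hGZ
  algebraic := hZ.exists_laurentEval_eq_translate G hU hGZ
  compat n c a b hb := hZ.germ_compat hU (hZ.subset_preimage G hGZ c) (h := G.pull c U a) hb
  map_mem n c a ha := hZ.translate_of_mem_pow G hU hGZ n c ha
  one n a := by
    refine (hZ.translate_eq_of_comp_eq G hU hGZ (f := thickening hU Z n) ?_
      (hZ.top_le_preimage_thickening hU n hZ.subset) a).trans (hZ.germ_self hU n a)
    rw [map_one]
    exact Category.comp_id _
  mul n c c' a b hb := by
    let φ := Ideal.Quotient.lift (vanishingIdeal p U Z ^ n)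
      (hZ.translate G hU hGZ n c' : Fun p U →+* Fun p U ⧸ vanishingIdeal p U Z ^ n)
      (fun a ha => hZ.translate_of_mem_pow G hU hGZ n c' ha)
    have h1 : Spec.map (CommRingCat.ofHom φ) ≫ thickening (p := p) hU Z n =
        thickening (p := p) hU Z n ≫ (G.act c').hom := by
      have h0 := hZ.top_le_preimage_thickening (p := p) hU n hZ.subset
      refine pullSpec_ext (p := p) hU (preimage_comp_top _ _ h0)
        (hZ.top_le_preimage_act G hU hGZ n c') fun g => ?_
      rw [← translate_eq_pullSpec G hU hZ hGZ]
      refine (pullSpec_comp φ _ U h0 _ g).trans ?_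
      exact congrArg φ (hZ.germ_self hU n g)
    have h2 : thickening (p := p) hU Z n ≫ (G.act (c * c')).hom =
        Spec.map (CommRingCat.ofHom φ) ≫ thickening (p := p) hU Z n ≫ (G.act c).hom := by
      rw [G.act_mul_hom, ← Category.assoc, ← h1, Category.assoc]
    have h3 := hZ.top_le_preimage_act G hU hGZ n c
    rw [hZ.translate_eq_of_comp_eq G hU hGZ h2 (preimage_comp_top _ _ h3) a]
    refine Eq.trans ?_ (pullSpec_comp φ _ U h3 _ a).symm
    rw [← translate_eq_pullSpec G hU hZ hGZ, ← hb]
    rfl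

theorem formalAction_wt_iff [IsSeparated p] (e : ℤ) (f : FormalNhd p U Z) :
    (hZ.formalAction G hU hGZ).wt e f ↔ IsWeight G U Z e f := by
  refine forall_congr' fun c => forall_congr' fun n => forall_congr' fun a =>
    imp_congr_right fun _ => ?_
  exact (hZ.germ_res_sub_eq_zero_iff G hU hGZ n c a _).symm

end IsClosedIn

end Action

theorem LaurentPolynomial.ext_of_eval₂_pow {ℓ : ℕ} (hℓ : 0 < ℓ) {q q' : ℂ[T;T⁻¹]}
    (h : ∀ c : ℂˣ, LaurentPolynomial.eval₂ (RingHom.id ℂ) (c ^ ℓ) q =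
      LaurentPolynomial.eval₂ (RingHom.id ℂ) (c ^ ℓ) q') : q = q' := by
  have h1 : ∀ c : ℂˣ, ∃ c' : ℂˣ, c' ^ ℓ = c := fun c => by
    obtain ⟨z, hz⟩ := IsAlgClosed.exists_pow_nat_eq (c : ℂ) hℓ
    have hz0 : z ≠ 0 := by
      rintro rfl
      rw [zero_pow hℓ.ne'] at hz
      exact c.ne_zero hz.symm
    exact ⟨Units.mk0 z hz0, Units.ext hz⟩
  have h2 : q.coeff = q'.coeff := laurentEval_ext fun c => by
    obtain ⟨c', rfl⟩ := h1 c
    rw [← LaurentPolynomial.eval₂_id_eq_laurentEval, ← LaurentPolynomial.eval₂_id_eq_laurentEval]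
    exact h c'
  exact AddMonoidAlgebra.coeff_injective h2

namespace FormalAction

variable {R : Type} [CommRing R] [Algebra ℂ R] {I : Ideal R} (F : FormalAction I)

/-- The functions on an orbit with finite stabilizer of order `ℓ` are the Laurent polynomials in a
function of weight `ℓ`. -/
theorem exists_orbit_map (χ : (R ⧸ I ^ 1) →ₐ[ℂ] ℂ) {ℓ : ℕ} (hℓ : 0 < ℓ)
    (hunit : ∀ f, (∀ c, χ (F.τ 1 c f) ≠ 0) → IsUnit (Ideal.Quotient.mk (I ^ 1) f))
    (hstab : Nat.card {c : ℂˣ | ∀ f, χ (F.τ 1 c f) = χ (F.τ 1 1 f)} = ℓ) :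
    ∃ θ : R →ₐ[ℂ] ℂ[T;T⁻¹],
      (∀ f c, LaurentPolynomial.eval₂ (RingHom.id ℂ) (c ^ ℓ) (θ f) = χ (F.τ 1 c f)) ∧
      ∃ t₀, θ t₀ = LaurentPolynomial.T 1 ∧
        ∀ c, F.τ 1 c t₀ = ((c ^ (ℓ : ℤ) : ℂˣ) : ℂ) • Ideal.Quotient.mk (I ^ 1) t₀ := by
  let q : R → ℤ →₀ ℂ := fun f => Finsupp.mapRange.linearMap χ.toLinearMap (F.coeff 1 f)
  have hχq : ∀ p : ℤ →₀ R ⧸ I ^ 1, ∀ c,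
      χ (laurentEval c p) = laurentEval c (Finsupp.mapRange.linearMap χ.toLinearMap p) := by
    intro p c
    induction p using Finsupp.induction_linear with
    | zero => simp
    | add p q hp hq => rw [map_add, map_add, map_add, map_add, hp, hq]
    | single i r =>
      rw [Finsupp.mapRange.linearMap_apply, Finsupp.mapRange_single, laurentEval_single,
        laurentEval_single, map_smul]
      rfl
  have hq : ∀ f c, χ (F.τ 1 c f) = laurentEval c (q f) := fun f c => by
    rw [← F.laurentEval_coeff, hχq]
  let S : ℤ → R → Prop := fun j a => (∀ c, χ (F.τ 1 c a) = ((c ^ j : ℂˣ) : ℂ)) ∧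
    ∀ c, F.τ 1 c a = ((c ^ j : ℂˣ) : ℂ) • Ideal.Quotient.mk (I ^ 1) a
  have hS : ∀ f j, q f j ≠ 0 → ∃ a, S j a := by
    intro f j hj
    obtain ⟨b, hb⟩ := Ideal.Quotient.mk_surjective (F.coeff 1 f j)
    have h1 := F.τ_of_coeff hb
    have h2 : χ (Ideal.Quotient.mk (I ^ 1) b) = q f j := by rw [hb]; rfl
    refine ⟨(q f j)⁻¹ • b, fun c => ?_, fun c => ?_⟩
    · rw [map_smul, map_smul, h1, map_smul, h2, smul_eq_mul, smul_eq_mul]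
      field_simp
    · rw [map_smul, h1, smul_comm]; rfl
  let M : AddSubgroup ℤ :=
    { carrier := {j | ∃ a, S j a}
      zero_mem' := ⟨1, fun c => by simp, fun c => by simp⟩
      add_mem' := by
        rintro i j ⟨a, ha, ha'⟩ ⟨b, hb, hb'⟩
        refine ⟨a * b, fun c => ?_, fun c => ?_⟩
        · rw [map_mul, map_mul, ha, hb, zpow_add, Units.val_mul]
        · rw [map_mul, map_mul, ha', hb', smul_mul_smul_comm, zpow_add, Units.val_mul]
      neg_mem' := by
        rintro j ⟨a, ha, ha'⟩
        obtain ⟨h, hh⟩ := (hunit a fun c => by rw [ha]; exact Units.ne_zero _).exists_right_inv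
        obtain ⟨h, rfl⟩ := Ideal.Quotient.mk_surjective h
        rw [← map_mul, ← map_one (Ideal.Quotient.mk (I ^ 1))] at hh
        refine hS h (-j) ?_
        have h1 : q h = Finsupp.single (-j) 1 := laurentEval_ext fun c => by
          rw [← hq, laurentEval_single, smul_eq_mul, mul_one]
          have h2 := congrArg χ (F.τ_eq_of_mk_eq hh c)
          rw [map_mul, map_mul, ha, map_one, map_one] at h2
          rw [zpow_neg, Units.val_inv_eq_inv_val]
          exact eq_inv_of_mul_eq_one_right h2
        rw [h1, Finsupp.single_eq_same]
        exact one_ne_zero }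
  obtain ⟨g, hg⟩ := Int.subgroup_cyclic M
  have hgM : ∀ j, (∃ a, S j a) ↔ g ∣ j := fun j => by
    have : j ∈ M ↔ j ∈ AddSubgroup.zmultiples g := by
      rw [hg, AddSubgroup.zmultiples_eq_closure]
    rw [Int.mem_zmultiples_iff] at this
    exact this
  have hst : {c : ℂˣ | ∀ f, χ (F.τ 1 c f) = χ (F.τ 1 1 f)} = {c | c ^ g.natAbs = 1} := by
    ext c
    have hc : c ^ g.natAbs = 1 ↔ c ^ g = 1 := by
      rcases Int.natAbs_eq g with h | h
      · conv_rhs => rw [h, zpow_natCast]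
      · conv_rhs => rw [h, zpow_neg, zpow_natCast, inv_eq_one]
    rw [Set.mem_ofPred_eq, Set.mem_ofPred_eq, hc]
    constructor
    · intro h
      obtain ⟨a, ha, -⟩ := (hgM g).2 dvd_rfl
      have := h a
      rw [ha, ha, one_zpow] at this
      exact Units.ext this
    · intro h f
      rw [hq, hq, laurentEval_apply, laurentEval_apply]
      refine Finset.sum_congr rfl fun j hj => ?_
      obtain ⟨m, rfl⟩ := (hgM j).1 (hS f j (Finsupp.mem_support_iff.1 hj))
      rw [zpow_mul, h, one_zpow, one_zpow]
  have hgℓ : g.natAbs = ℓ := by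
    rw [hst] at hstab
    rcases Nat.eq_zero_or_pos g.natAbs with h0 | hpos
    · rw [h0] at hstab
      have h1 : {c : ℂˣ | c ^ 0 = 1} = Set.univ := by ext c; simp
      have h2 : Infinite ℂˣ := Infinite.of_injective
        (fun n : ℕ => Units.mk0 ((n : ℂ) + 1) (by exact_mod_cast n.succ_ne_zero)) fun m n h => by
          have := congrArg Units.val h
          simpa using this
      rw [h1, Nat.card_coe_set_eq, Set.ncard_univ, Nat.card_eq_zero_of_infinite] at hstab
      omega
    · have : NeZero g.natAbs := ⟨hpos.ne'⟩
      exact (Complex.card_rootsOfUnity g.natAbs).symm.trans hstab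
  have hdvd : ∀ j, (∃ a, S j a) ↔ (ℓ : ℤ) ∣ j := fun j => by
    rw [hgM, ← hgℓ, Int.natAbs_dvd]
  have hex : ∀ f, ∃ r : ℂ[T;T⁻¹], ∀ c : ℂˣ,
      LaurentPolynomial.eval₂ (RingHom.id ℂ) (c ^ ℓ) r = χ (F.τ 1 c f) := by
    intro f
    refine ⟨∑ j ∈ (q f).support, LaurentPolynomial.C (q f j) * LaurentPolynomial.T (j / ℓ),
      fun c => ?_⟩
    rw [hq, laurentEval_apply, map_sum]
    refine Finset.sum_congr rfl fun j hj => ?_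
    obtain ⟨m, rfl⟩ := (hdvd j).1 (hS f j (Finsupp.mem_support_iff.1 hj))
    rw [LaurentPolynomial.eval₂_C_mul_T, Int.mul_ediv_cancel_left _ (by exact_mod_cast hℓ.ne'),
      zpow_mul, zpow_natCast, smul_eq_mul, mul_comm]
    rfl
  choose θ hθ using hex
  let θ' : R →ₐ[ℂ] ℂ[T;T⁻¹] :=
    { toFun := θ
      map_one' := LaurentPolynomial.ext_of_eval₂_pow hℓ fun c => by
        rw [hθ, map_one, map_one, map_one]
      map_mul' := fun a b => LaurentPolynomial.ext_of_eval₂_pow hℓ fun c => by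
        rw [hθ, map_mul, map_mul, map_mul, hθ, hθ]
      map_zero' := LaurentPolynomial.ext_of_eval₂_pow hℓ fun c => by
        rw [hθ, map_zero, map_zero, map_zero]
      map_add' := fun a b => LaurentPolynomial.ext_of_eval₂_pow hℓ fun c => by
        rw [hθ, map_add, map_add, map_add, hθ, hθ]
      commutes' := fun r => LaurentPolynomial.ext_of_eval₂_pow hℓ fun c => by
        rw [hθ, AlgHom.commutes, AlgHom.commutes]
        exact (LaurentPolynomial.eval₂_C (RingHom.id ℂ) _ r).symm }
  refine ⟨θ', hθ, ?_⟩
  obtain ⟨t₀, ht, ht'⟩ := (hdvd ℓ).2 dvd_rfl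
  refine ⟨t₀, LaurentPolynomial.ext_of_eval₂_pow hℓ fun c => ?_, ht'⟩
  refine (hθ t₀ c).trans ?_
  rw [ht, LaurentPolynomial.eval₂_T, zpow_one, zpow_natCast]

end FormalAction

namespace FormalAction

variable {R : Type} [CommRing R] [Algebra ℂ R] {I : Ideal R} (F : FormalAction I)

theorem exists_orbitRing (hI : I.FG) {J : Ideal R} (hJI : J ≤ I) (χ : (R ⧸ I ^ 1) →ₐ[ℂ] ℂ) {ℓ : ℕ}
    (hℓ : 0 < ℓ)
    (hunit : ∀ f, (∀ c, χ (F.τ 1 c f) ≠ 0) → IsUnit (Ideal.Quotient.mk (I ^ 1) f))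
    (hker : ∀ f, (∀ c, χ (F.τ 1 c f) = 0) ↔ f ∈ I)
    (hstab : Nat.card {c : ℂˣ | ∀ f, χ (F.τ 1 c f) = χ (F.τ 1 1 f)} = ℓ)
    (hdvd : ∀ e f, F.wt e f → f ∉ J.map (algebraMap R (AdicCompletion I R)) → (ℓ : ℤ) ∣ e) :
    ∃ O : OrbitRing ((I.map (algebraMap R (AdicCompletion I R))).map
        (Ideal.Quotient.mk (J.map (algebraMap R (AdicCompletion I R)))))
        (fun e a => ∃ f, F.wt e f ∧ Ideal.Quotient.mk _ f = a) ℓ,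
      ∀ f : R, O.ev (Ideal.Quotient.mk _ (algebraMap R _ f)) =
        χ (Ideal.Quotient.mk (I ^ 1) f) := by
  obtain ⟨θ, hθ, t₀, ht₀, ht₀'⟩ := F.exists_orbit_map χ hℓ hunit hstab
  have hθ0 : ∀ f, θ f = 0 ↔ f ∈ I := fun f => by
    rw [← hker]
    constructor
    · intro h c
      rw [← hθ, h, map_zero]
    · intro h
      exact LaurentPolynomial.ext_of_eval₂_pow hℓ fun c => by rw [hθ, h, map_zero]
  have hT : ∀ c, χ (F.τ 1 c t₀) ≠ 0 := fun c => by
    rw [← hθ, ht₀, LaurentPolynomial.eval₂_T]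
    exact Units.ne_zero _
  obtain ⟨h, hh⟩ := (hunit t₀ hT).exists_right_inv
  obtain ⟨h, rfl⟩ := Ideal.Quotient.mk_surjective h
  set 𝔨 := I.map (algebraMap R (AdicCompletion I R)) with h𝔨
  set P := J.map (algebraMap R (AdicCompletion I R))
  have hP𝔨 : P ≤ 𝔨 := Ideal.map_mono hJI
  have := AdicCompletion.isAdicComplete_map hI
  let ψ₁ : (R ⧸ I ^ 1) →ₐ[ℂ] ℂ[T;T⁻¹] := Ideal.Quotient.liftₐ (I ^ 1) θ fun a ha => by
    rw [hθ0]; rwa [pow_one] at ha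
  let ψ₀ : AdicCompletion I R →ₐ[ℂ] ℂ[T;T⁻¹] :=
    { (ψ₁ : _ →+* ℂ[T;T⁻¹]).comp (AdicCompletion.evalₐ I 1 : _ →+* R ⧸ I ^ 1) with
      commutes' := fun r => by
        change ψ₁ (AdicCompletion.evalₐ I 1 (algebraMap ℂ _ r)) = _
        rw [Algebra.algebraMap_eq_smul_one, PoissonBracket.evalₐ_smul, map_one, map_smul, map_one,
          Algebra.algebraMap_eq_smul_one] }
  have hψ₀ : ∀ f a, AdicCompletion.evalₐ I 1 f = Ideal.Quotient.mk _ a → ψ₀ f = θ a := fun f a hf =>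
    congrArg ψ₁ hf
  have hψ₀0 : ∀ f, ψ₀ f = 0 ↔ f ∈ 𝔨 := fun f => by
    obtain ⟨a, ha⟩ := Ideal.Quotient.mk_surjective (AdicCompletion.evalₐ I 1 f)
    have h1 := AdicCompletion.mem_map_pow_iff hI 1 f
    rw [← ha, Ideal.Quotient.eq_zero_iff_mem, pow_one, pow_one] at h1
    rw [hψ₀ f a ha.symm, hθ0, ← h1]
  let ψ : (AdicCompletion I R ⧸ P) →ₐ[ℂ] ℂ[T;T⁻¹] :=
    Ideal.Quotient.liftₐ P ψ₀ fun f hf => (hψ₀0 f).2 (hP𝔨 hf)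
  have hψ : ∀ f, ψ (Ideal.Quotient.mk P f) = ψ₀ f := fun f => rfl
  have hof : ∀ a, AdicCompletion.evalₐ I 1 (algebraMap R (AdicCompletion I R) a) =
      Ideal.Quotient.mk _ a := fun a => by
    rw [AdicCompletion.algebraMap_eq_of, AdicCompletion.evalₐ_of]
  have ht₁ : ψ₀ (F.pr ℓ (algebraMap R _ t₀)) = LaurentPolynomial.T 1 := by
    rw [hψ₀ _ t₀, ht₀]
    rw [F.evalₐ_pr ℓ (hof t₀), F.coeff_of_weight ht₀', Finsupp.single_eq_same]
  have hunit₁ : IsUnit (F.pr ℓ (algebraMap R _ t₀)) := by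
    refine isUnit_of_mul_isUnit_left (y := algebraMap R _ h)
      (isUnit_of_sub_mem (𝔨 := 𝔨) isUnit_one ?_)
    rw [← hψ₀0, map_sub, map_mul, ht₁, ← ht₀, hψ₀ _ h (hof h), ← map_mul, map_one, sub_eq_zero,
      ← map_one θ, ← sub_eq_zero, ← map_sub, hθ0]
    rw [← map_mul, ← map_one (Ideal.Quotient.mk (I ^ 1)), Ideal.Quotient.eq, pow_one] at hh
    exact hh
  refine ⟨{
    ψ := ψ
    t := (hunit₁.map (Ideal.Quotient.mk P)).unit
    ψ_eq_zero := fun a => ?_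
    wt_t := ⟨_, F.wt_pr _ _, rfl⟩
    ψ_t := ht₁
    dvd := ?_
    pos := hℓ }, fun f => ?_⟩
  · obtain ⟨f, rfl⟩ := Ideal.Quotient.mk_surjective a
    rw [hψ, hψ₀0]
    refine ⟨Ideal.mem_map_of_mem _, mem_of_mk_mem hP𝔨⟩
  · rintro e _ ⟨f, hf, rfl⟩ hne
    exact hdvd e f hf fun hfP => hne (Ideal.Quotient.eq_zero_iff_mem.2 hfP)
  · change LaurentPolynomial.eval₂ (RingHom.id ℂ) 1 (ψ₀ (algebraMap R _ f)) = _
    rw [hψ₀ _ f (hof f), ← one_pow ℓ, hθ, F.one]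

end FormalAction

theorem Fun.res_smul {X : Scheme.{0}} {p : X ⟶ Spec (CommRingCat.of ℂ)} {V W : X.Opens}
    (h : V ≤ W) (r : ℂ) (f : Fun p W) : Fun.res p h (r • f) = r • Fun.res p h f := by
  rw [Algebra.smul_def, map_mul, Fun.res_algebraMap, ← Algebra.smul_def]

section Orbit

variable {X : Scheme.{0}} {p : X ⟶ Spec (CommRingCat.of ℂ)} [LocallyOfFiniteType p]
  (G : GmAction p) {U : X.Opens} (hU : IsAffineOpen U)

namespace IsClosedIn

variable {Z : Set X} (hZ : IsClosedIn U Z) (hGZ : ∀ c, ∀ x ∈ Z, G.smul c x ∈ Z)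

/-- Evaluation at a point of the subset. -/
noncomputable def evalMk {z : X} (hz : z ∈ Z) :
    (Fun p U ⧸ vanishingIdeal p U Z ^ 1) →ₐ[ℂ] ℂ :=
  Ideal.Quotient.liftₐ _ (evalAt p (hZ.isClosed_singleton z hz) U (hZ.subset hz)) fun a ha => by
    rw [evalAt_eq_zero_iff]
    rw [pow_one] at ha
    exact (mem_vanishingIdeal_iff p a).1 ha z hz _

theorem evalMk_germ {z : X} (hz : z ∈ Z) {V : X.Opens} (hZV : Z ⊆ V) (h : Fun p V) :
    hZ.evalMk hz (hZ.germ hU 1 hZV h) =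
      evalAt p (hZ.isClosed_singleton z hz) V (hZV hz) h := by
  have h0 : ∀ {V : X.Opens}, z ∈ V →
      ⊤ ≤ pointOfClosedPoint p z (hZ.isClosed_singleton z hz) ⁻¹ᵁ V := fun {V} hzV s _ => by
    change pointOfClosedPoint p z _ s ∈ V
    rwa [pointOfClosedPoint_apply]
  have h1 := hZ.top_le_preimage_thickening (p := p) hU 1 hZ.subset
  have h2 : Spec.map (CommRingCat.ofHom (hZ.evalMk (p := p) hz : _ →+* ℂ)) ≫ thickening (p := p) hU Z 1 =
      pointOfClosedPoint p z (hZ.isClosed_singleton z hz) := by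
    refine pullSpec_ext (p := p) hU (preimage_comp_top _ _ h1) (h0 (hZ.subset hz)) fun g => ?_
    refine (pullSpec_comp _ _ U h1 _ g).trans ?_
    exact congrArg (hZ.evalMk hz) (hZ.germ_self hU 1 g)
  have h3 : ∀ f, Spec.map (CommRingCat.ofHom (hZ.evalMk (p := p) hz : _ →+* ℂ)) ≫
      thickening (p := p) hU Z 1 = f → ∀ hf : ⊤ ≤ f ⁻¹ᵁ V,
      hZ.evalMk hz (hZ.germ hU 1 hZV h) = pullSpec p f V hf h := by
    rintro _ rfl hf
    exact (pullSpec_comp _ _ V (hZ.top_le_preimage_thickening hU 1 hZV) hf h).symm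
  exact h3 _ h2 (h0 (hZV hz))

theorem evalMk_translate {z : X} (hz : z ∈ Z) (c : ℂˣ) (f : Fun p U) :
    hZ.evalMk hz (hZ.translate G hU hGZ 1 c f) =
      evalAt p (hZ.isClosed_singleton _ (hGZ c z hz)) U (hZ.subset (hGZ c z hz)) f := by
  rw [translate_apply, evalMk_germ]
  exact G.evalAt_pull c _ _ _

variable [IsSeparated p]

theorem translate_bracket {P : PoissonScheme p} {d : ℤ} (hd : P.IsHomogeneous G d) (n : ℕ) (c : ℂˣ)
    (i j : ℤ) (a a' : Fun p U)
    (ha : hZ.translate G hU hGZ (n + 1) c a = ((c ^ i : ℂˣ) : ℂ) • Ideal.Quotient.mk _ a)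
    (ha' : hZ.translate G hU hGZ (n + 1) c a' = ((c ^ j : ℂˣ) : ℂ) • Ideal.Quotient.mk _ a') :
    hZ.translate G hU hGZ n c ((P.br U).bracket a a') =
      ((c ^ (i + j + d) : ℂˣ) : ℂ) • Ideal.Quotient.mk _ ((P.br U).bracket a a') := by
  rw [← germ_res_sub_eq_zero_iff] at ha ha' ⊢
  have h1 := (P.br _).bracket_sub_mem _ n ha ha'
  rw [map_smul, map_smul, LinearMap.smul_apply, smul_smul, ← P.res_br, ← P.res_br] at h1
  have h2 := (vanishingIdeal p (U ⊓ (G.act c).hom ⁻¹ᵁ U) Z ^ n).mul_mem_left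
    (algebraMap ℂ _ ((c ^ d : ℂˣ) : ℂ)) h1
  rw [← Algebra.smul_def, smul_sub, smul_smul] at h2
  rw [hd c U, Fun.res_smul]
  convert! h2 using 3
  rw [zpow_add, zpow_add, Units.val_mul, Units.val_mul]
  ring

end IsClosedIn

namespace GmAction

variable {y : X}

omit [LocallyOfFiniteType p] in
theorem smul_mem_orbit (c : ℂˣ) {x : X} (hx : x ∈ G.orbit y) : G.smul c x ∈ G.orbit y := by
  obtain ⟨c', rfl⟩ := hx
  exact ⟨c * c', G.smul_mul c c' y⟩

omit [LocallyOfFiniteType p] in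
theorem isClosedIn_orbit (hy : IsClosed {y}) (horb : G.orbit y ⊆ U)
    (hclosed : ∀ x ∈ U, IsClosed {x} → x ∈ closure (G.orbit y) → x ∈ G.orbit y) :
    IsClosedIn U (G.orbit y) :=
  ⟨horb, by rintro _ ⟨c, rfl⟩; exact G.isClosed_smul c hy, hclosed⟩

variable (hZ : IsClosedIn U (G.orbit y))

include hU in
theorem evalMk_translate_eq_iff (c : ℂˣ) :
    (∀ f, hZ.evalMk (G.mem_orbit y) (hZ.translate G hU (fun c _ hx => G.smul_mem_orbit c hx) 1 c f) =
      hZ.evalMk (G.mem_orbit y) (hZ.translate G hU (fun c _ hx => G.smul_mem_orbit c hx) 1 1 f)) ↔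
      c ∈ G.stab y := by
  simp only [IsClosedIn.evalMk_translate]
  constructor
  · intro h
    have := eq_of_evalAt_eq _ _ hU _ _ h
    rw [G.smul_one] at this
    exact this
  · intro h f
    have h1 : G.smul c y = G.smul 1 y := by rw [G.smul_one]; exact h
    have h2 : ∀ x x', x = x' → ∀ (hx : IsClosed {x}) (hx' : IsClosed {x'}) hxU hxU',
        evalAt p hx U hxU f = evalAt p hx' U hxU' f := by
      rintro x _ rfl _ _ _ _; rfl
    exact h2 _ _ h1 _ _ _ _

theorem isUnit_mk_of_evalMk (f : Fun p U)
    (h : ∀ c, hZ.evalMk (G.mem_orbit y)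
      (hZ.translate G hU (fun c _ hx => G.smul_mem_orbit c hx) 1 c f) ≠ 0) :
    IsUnit (Ideal.Quotient.mk (vanishingIdeal p U (G.orbit y) ^ 1) f) := by
  refine hZ.isUnit_mk hU 1 f ?_
  rintro _ ⟨c, rfl⟩ hf
  refine h c ?_
  rw [IsClosedIn.evalMk_translate, evalAt_eq_zero_iff]
  exact hf

theorem evalMk_eq_zero_iff (f : Fun p U) :
    (∀ c, hZ.evalMk (G.mem_orbit y)
      (hZ.translate G hU (fun c _ hx => G.smul_mem_orbit c hx) 1 c f) = 0) ↔
      f ∈ vanishingIdeal p U (G.orbit y) := by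
  simp only [IsClosedIn.evalMk_translate, evalAt_eq_zero_iff]
  rw [mem_vanishingIdeal_iff]
  constructor
  · rintro h _ ⟨c, rfl⟩ _
    exact h c
  · intro h c
    exact h _ ⟨c, rfl⟩ _

end GmAction

end Orbit

section Leaf

variable {X : Scheme.{0}} {p : X ⟶ Spec (CommRingCat.of ℂ)} {P : PoissonScheme p} {Y : Set X}

namespace PoissonScheme

/-- The Hamiltonian vector field of a function at a point. -/
noncomputable def hamAt (P : PoissonScheme p) {V : X.Opens} {z : X} (hz : z ∈ V) (f : Fun p V) :
    Derivation ℂ (Fun p V) (Fun p V ⧸ pointIdeal p V z hz) :=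
  (Submodule.mkQ (pointIdeal p V z hz)).compDer ((P.br V).ham f)

theorem hamAt_apply {V : X.Opens} {z : X} (hz : z ∈ V) (f g : Fun p V) :
    P.hamAt hz f g = Ideal.Quotient.mk _ ((P.br V).bracket f g) := rfl

variable [LocallyOfFiniteType p] (hY : P.IsSymplecticLeaf Y) {U : X.Opens} (hU : IsAffineOpen U)

namespace IsSymplecticLeaf

include hY hU

theorem bracket_mem (f : Fun p U) {h : Fun p U} (hh : h ∈ vanishingIdeal p U Y) :
    (P.br U).bracket f h ∈ vanishingIdeal p U Y := by
  refine mem_vanishingIdeal_of_isClosed hY.1 _ fun z hzY hz hzU => ?_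
  have h1 := (hY.2 z hzY hz U hU hzU (P.hamAt hzU f)).2
    (Submodule.subset_span ⟨f, fun g => P.hamAt_apply hzU f g⟩) h hh
  rw [hamAt_apply] at h1
  exact Ideal.Quotient.eq_zero_iff_mem.1 h1

theorem mem_sup_of_forall_bracket_mem {y : X} (hyY : y ∈ Y) (hy : IsClosed {y}) (hyU : y ∈ U)
    {f : Fun p U} (hf : f ∈ pointIdeal p U y hyU)
    (h : ∀ g, (P.br U).bracket f g ∈ pointIdeal p U y hyU) :
    f ∈ vanishingIdeal p U Y ⊔ pointIdeal p U y hyU ^ 2 := by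
  by_contra hc
  set 𝔪 := pointIdeal p U y hyU
  let χ := evalAt p hy U hyU
  have hχ : ∀ g, χ g = 0 ↔ g ∈ 𝔪 := evalAt_eq_zero_iff hy hyU
  have hJ : vanishingIdeal p U Y ⊔ 𝔪 ^ 2 ≤ 𝔪 :=
    sup_le (fun g hg => (mem_vanishingIdeal_iff p g).1 hg y hyY hyU) (Ideal.pow_le_self two_ne_zero)
  let N : Submodule ℂ (Fun p U) := Submodule.span ℂ {1} ⊔
    (vanishingIdeal p U Y ⊔ 𝔪 ^ 2).restrictScalars ℂ
  have hfN : f ∉ N := by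
    intro hfN
    obtain ⟨a, ha, b, hb, rfl⟩ := Submodule.mem_sup.1 hfN
    obtain ⟨r, rfl⟩ := Submodule.mem_span_singleton.1 ha
    have h1 : χ (r • 1 + b) = 0 := (hχ _).2 hf
    rw [map_add, map_smul, map_one, (hχ b).2 (hJ hb), add_zero, smul_eq_mul, mul_one] at h1
    rw [h1, zero_smul, zero_add] at hc
    exact hc hb
  obtain ⟨φ, hφf, hφN⟩ := Submodule.exists_le_ker_of_notMem hfN
  have hφ1 : φ 1 = 0 := hφN (Submodule.mem_sup_left (Submodule.mem_span_singleton_self _))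
  have hφJ : ∀ g ∈ vanishingIdeal p U Y ⊔ 𝔪 ^ 2, φ g = 0 := fun g hg =>
    hφN (Submodule.mem_sup_right hg)
  have hsub : ∀ g, g - χ g • 1 ∈ 𝔪 := fun g => by
    rw [← hχ, map_sub, map_smul, map_one, smul_eq_mul, mul_one, sub_self]
  have hφmul : ∀ g h, φ (g * h) = χ g * φ h + χ h * φ g := fun g h => by
    have h1 := hφJ _ (Ideal.mem_sup_right (sq 𝔪 ▸ Ideal.mul_mem_mul (hsub g) (hsub h)))
    have h2 : (g - χ g • 1) * (h - χ h • 1) =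
        g * h - χ g • h - χ h • g + (χ g * χ h) • (1 : Fun p U) := by
      simp only [Algebra.smul_def, map_mul, mul_one]; ring
    rw [h2, map_add, map_sub, map_sub, map_smul, map_smul, map_smul, hφ1, smul_zero, add_zero,
      smul_eq_mul, smul_eq_mul, sub_sub, sub_eq_zero] at h1
    exact h1
  have hsmul : ∀ (g : Fun p U) (r : ℂ), g • (algebraMap ℂ (Fun p U ⧸ 𝔪) r) =
      algebraMap ℂ (Fun p U ⧸ 𝔪) (χ g * r) := fun g r => by
    have h1 : Ideal.Quotient.mk 𝔪 g = algebraMap ℂ (Fun p U ⧸ 𝔪) (χ g) := by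
      have := hsub g
      rw [← Algebra.algebraMap_eq_smul_one] at this
      exact Ideal.Quotient.eq.2 this
    rw [Algebra.smul_def, map_mul, ← h1]; rfl
  let D : Derivation ℂ (Fun p U) (Fun p U ⧸ 𝔪) := Derivation.mk'
    ((Algebra.linearMap ℂ (Fun p U ⧸ 𝔪)).comp φ) fun g h => by
      simp only [LinearMap.comp_apply, Algebra.linearMap_apply, hφmul, map_add]
      rw [hsmul, hsmul]
  have hD : ∀ g, D g = algebraMap ℂ (Fun p U ⧸ 𝔪) (φ g) := fun g => rfl
  have h1 := (hY.2 y hyY hy U hU hyU D).1 fun g hg => by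
    rw [hD, hφJ g (Ideal.mem_sup_left hg), map_zero]
  have h2 : D f = 0 := by
    refine Submodule.span_induction (p := fun D _ => D f = 0) ?_ rfl ?_ ?_ h1
    · rintro H ⟨g, hg⟩
      rw [hg, (P.br U).skew g f, map_neg, Ideal.Quotient.eq_zero_iff_mem.2 (h g), neg_zero]
    · intro D D' _ _ h h'
      rw [Derivation.add_apply, h, h', add_zero]
    · intro r D _ h
      rw [Derivation.smul_apply, h, smul_zero]
  rw [hD] at h2
  have : Nontrivial (Fun p U ⧸ 𝔪) := Ideal.Quotient.nontrivial_iff.2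
    (Ideal.IsPrime.ne_top inferInstance)
  exact hφf ((algebraMap ℂ (Fun p U ⧸ 𝔪)).injective (h2.trans (map_zero _).symm))

end IsSymplecticLeaf

end PoissonScheme

end Leaf

namespace OrbitRing

variable {A : Type} [CommRing A] [Algebra ℂ A] {𝔞 : Ideal A} {wt : ℤ → A → Prop} {ℓ : ℕ}
  (O : OrbitRing 𝔞 wt ℓ)

/-- Nondegeneracy at the base point may be tested on a dense subring. -/
theorem mem_ker_sq_of_dense (b : PoissonBracket A) {B : Type} [CommRing B] [Algebra ℂ B]
    (bB : PoissonBracket B) (ι : B →+* A)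
    (hι : ∀ f h, b.bracket (ι f) (ι h) = ι (bB.bracket f h))
    (hdense : ∀ a, ∃ f, a - ι f ∈ 𝔞 ^ 2)
    (hnd : ∀ f, O.ev (ι f) = 0 → (∀ g, O.ev (ι (bB.bracket f g)) = 0) →
      ι f ∈ RingHom.ker O.ev ^ 2) (a : A) (ha : O.ev a = 0)
    (h : ∀ c, O.ev (b.bracket a c) = 0) : a ∈ RingHom.ker O.ev ^ 2 := by
  obtain ⟨f, hf⟩ := hdense a
  have h𝔞 : 𝔞 ≤ RingHom.ker O.ev := fun x hx => O.ev_of_mem hx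
  have h1 : O.ev (ι f) = 0 := by
    have := h𝔞 (Ideal.pow_le_self two_ne_zero hf)
    rwa [RingHom.mem_ker, map_sub, ha, zero_sub, neg_eq_zero] at this
  have h2 : ∀ g, O.ev (ι (bB.bracket f g)) = 0 := fun g => by
    have h3 := h𝔞 (pow_one 𝔞 ▸ b.bracket_mem_pow 𝔞 (ι g) 1 hf)
    rw [b.skew, RingHom.mem_ker, map_neg, neg_eq_zero, map_sub, LinearMap.sub_apply, map_sub, h,
      zero_sub, neg_eq_zero, hι] at h3
    exact h3
  have h3 := Ideal.add_mem _ (Ideal.pow_right_mono h𝔞 2 hf) (hnd f h1 h2)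
  rwa [sub_add_cancel] at h3

end OrbitRing

/-- An algebra of finite type over `ℂ` has a `ℂ`-point at which countably many functions do not
vanish, if their products do not vanish. -/
theorem exists_algHom_of_countable {B : Type} [CommRing B] [Algebra ℂ B] [Algebra.FiniteType ℂ B]
    {ι : Type} [Countable ι] (s : ι → B) (hs : ∀ l : List ι, (l.map s).prod ≠ 0) :
    ∃ χ : B →ₐ[ℂ] ℂ, ∀ i, χ (s i) ≠ 0 := by
  let S : Submonoid B := MonoidHom.mrange (FreeMonoid.lift s)
  have hS0 : (0 : B) ∉ S := by
    rintro ⟨l, hl⟩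
    exact hs l.toList (by rwa [FreeMonoid.lift_apply] at hl)
  have : Nontrivial (Localization S) := not_subsingleton_iff_nontrivial.1 fun h =>
    hS0 ((IsLocalization.subsingleton_iff (M := S) (S := Localization S)).1 h)
  obtain ⟨𝔪, h𝔪⟩ := Ideal.exists_maximal (Localization S)
  let := Ideal.Quotient.field 𝔪
  let γ : B →ₐ[ℂ] (Localization S ⧸ 𝔪) :=
    (Ideal.Quotient.mkₐ ℂ 𝔪).comp (IsScalarTower.toAlgHom ℂ B (Localization S))
  have hγ : ∀ x : S, γ x ≠ 0 := fun x =>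
    ((IsLocalization.map_units (Localization S) x).map (Ideal.Quotient.mk 𝔪)).ne_zero
  have hfrac : ∀ κ, ∃ (b : B) (x : S), κ = γ b * (γ x)⁻¹ := fun κ => by
    obtain ⟨κ, rfl⟩ := Ideal.Quotient.mk_surjective κ
    obtain ⟨b, x, rfl⟩ := IsLocalization.exists_mk'_eq S κ
    refine ⟨b, x, ?_⟩
    rw [eq_mul_inv_iff_mul_eq₀ (hγ x)]
    change Ideal.Quotient.mk 𝔪 _ * Ideal.Quotient.mk 𝔪 (algebraMap B _ x) =
      Ideal.Quotient.mk 𝔪 (algebraMap B _ b)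
    rw [← map_mul, IsLocalization.mk'_spec]
  obtain ⟨n, f, hf⟩ := (Algebra.FiniteType.iff_quotient_mvPolynomial'' (R := ℂ) (S := B)).1 ‹_›
  let w : (Fin n →₀ ℕ) × List ι → Localization S ⧸ 𝔪 := fun ml =>
    γ (f (MvPolynomial.monomial ml.1 1)) * (γ ((ml.2.map s).prod))⁻¹
  have hw : Submodule.span ℂ (Set.range w) = ⊤ := by
    rw [eq_top_iff]
    rintro κ -
    obtain ⟨b, ⟨x, l, hl⟩, rfl⟩ := hfrac κ
    obtain ⟨q, rfl⟩ := hf b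
    have hl' : (l.toList.map s).prod = x := by rwa [FreeMonoid.lift_apply] at hl
    induction q using MvPolynomial.induction_on' with
    | monomial m a =>
      have h1 : MvPolynomial.monomial m a = a • MvPolynomial.monomial m (1 : ℂ) := by
        rw [MvPolynomial.smul_monomial, smul_eq_mul, mul_one]
      rw [h1, map_smul, map_smul, smul_mul_assoc]
      refine Submodule.smul_mem _ _ (Submodule.subset_span ⟨(m, l.toList), ?_⟩)
      simp only [w, hl']
    | add p q hp hq =>
      rw [map_add, map_add, add_mul]
      exact Submodule.add_mem _ hp hq
  have halg : Algebra.IsAlgebraic ℂ (Localization S ⧸ 𝔪) := ⟨fun x => by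
    by_contra hx
    have h1 := (show Transcendental ℂ x from hx).linearIndependent_sub_inv.cardinal_le_rank
    have h2 : Module.rank ℂ (Localization S ⧸ 𝔪) ≤ Cardinal.aleph0 := by
      rw [← rank_top, ← hw]
      exact (rank_span_le _).trans (Cardinal.le_aleph0_iff_set_countable.2 (Set.countable_range w))
    rw [Cardinal.mk_complex] at h1
    exact absurd (h1.trans h2) (not_le.2 Cardinal.aleph0_lt_continuum)⟩
  have hbij := IsAlgClosed.algebraMap_bijective_of_isIntegral (k := ℂ) (K := Localization S ⧸ 𝔪)
  let e := AlgEquiv.ofBijective (Algebra.ofId ℂ (Localization S ⧸ 𝔪)) hbij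
  refine ⟨(e.symm : _ →ₐ[ℂ] ℂ).comp γ, fun i h => ?_⟩
  refine hγ ⟨s i, FreeMonoid.of i, FreeMonoid.lift_eval_of s i⟩ ?_
  exact (map_eq_zero_iff _ e.symm.injective).1 h

section GenericPoint

variable {X : Scheme.{0}} {p : X ⟶ Spec (CommRingCat.of ℂ)}

theorem Fun.mem_basicOpen_list_prod {U : X.Opens} {x : X} (l : List (Fun p U)) (hxU : x ∈ U) :
    x ∈ l.prod.basicOpen ↔ ∀ g ∈ l, x ∈ g.basicOpen := by
  induction l with
  | nil =>
    rw [List.prod_nil, ← not_iff_not, ← mem_pointIdeal_iff p hxU]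
    simpa using Ideal.one_notMem _
  | cons a l ih =>
    rw [List.prod_cons, List.forall_mem_cons, ← ih, ← not_iff_not, ← mem_pointIdeal_iff p hxU,
      (pointIdeal_isPrime p hxU).mul_mem_iff_mem_or_mem, mem_pointIdeal_iff, mem_pointIdeal_iff]
    tauto

variable [LocallyOfFiniteType p]

/-- There are closed points of a locally closed subset in countably many neighborhoods of one of its
points, at which a function does not vanish. -/
theorem exists_closedPoint_of_countable {U : X.Opens} (hU : IsAffineOpen U) {Y : Set X}
    (hY : IsLocallyClosed Y) {z : X} (hzY : z ∈ Y) (hzU : z ∈ U) {ι : Type} [Countable ι]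
    (N : ι → X.Opens) (hN : ∀ i, z ∈ N i) (h : Fun p U)
    (hh : ∀ W : X.Opens, z ∈ W → ∃ x ∈ Y, x ∈ W ∧ x ∈ h.basicOpen) :
    ∃ x ∈ Y, IsClosed {x} ∧ x ∈ h.basicOpen ∧ ∀ i, x ∈ N i := by
  obtain ⟨O, C, hO, hC, rfl⟩ := hY
  choose g hgN hzg using fun i => Fun.exists_basicOpen_le (p := p) hU hzU (hN i)
  obtain ⟨g₀, hg₀, hzg₀⟩ := Fun.exists_basicOpen_le (p := p) hU (V := ⟨O, hO⟩) hzU hzY.1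
  let g' : Option ι → Fun p U := fun i => i.elim g₀ g
  have hg' : ∀ i, z ∈ (g' i).basicOpen := fun i => by
    cases i with
    | none => exact hzg₀
    | some i => exact hzg i
  let s : Option (Option ι) → Fun p U := fun i => i.elim h g'
  have := finiteType_fun p hU
  obtain ⟨χ, hχ⟩ := exists_algHom_of_countable
    (fun i => Ideal.Quotient.mk (vanishingIdeal p U (O ∩ C)) (s i)) fun l hl => by
      have hl' : (l.map s).prod ∈ vanishingIdeal p U (O ∩ C) := by
        rw [← Ideal.Quotient.eq_zero_iff_mem, map_list_prod, List.map_map]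
        exact hl
      obtain ⟨x, hxY, hxW, hxh⟩ := hh ((l.map fun i : Option (Option ι) => i.elim 1 g').prod).basicOpen (by
        rw [Fun.mem_basicOpen_list_prod _ hzU]
        intro a ha
        obtain ⟨i, -, rfl⟩ := List.mem_map.1 ha
        cases i with
        | none => exact (Fun.mem_basicOpen_list_prod (p := p) [] hzU).2 (by simp)
        | some i => exact hg' i)
      have hxU := Fun.basicOpen_le p h hxh
      refine (mem_pointIdeal_iff p hxU _).1 ((mem_vanishingIdeal_iff p _).1 hl' x hxY hxU) ?_
      rw [Fun.mem_basicOpen_list_prod _ hxU] at hxW ⊢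
      intro a ha
      obtain ⟨i, hi, rfl⟩ := List.mem_map.1 ha
      cases i with
      | none => exact hxh
      | some i => exact hxW _ (List.mem_map_of_mem (f := fun i => i.elim 1 g') hi)
  obtain ⟨x, hx, hxU, hχx⟩ := exists_evalAt_eq hU
    (χ.comp (Ideal.Quotient.mkₐ ℂ (vanishingIdeal p U (O ∩ C))))
  have hs : ∀ i, x ∈ (s i).basicOpen := fun i => by
    by_contra hc
    rw [← mem_pointIdeal_iff p hxU, ← evalAt_eq_zero_iff hx, ← hχx] at hc
    exact hχ i hc
  have hxcl : x ∈ closure (O ∩ C) := by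
    refine mem_closure_of_vanishingIdeal_le (p := p) hU hxU fun f hf => ?_
    rw [← evalAt_eq_zero_iff hx, ← hχx]
    change χ (Ideal.Quotient.mk _ f) = 0
    rw [Ideal.Quotient.eq_zero_iff_mem.2 hf, map_zero]
  refine ⟨x, ⟨hg₀ (hs (some none)), ?_⟩, hx, hs none, fun i => hgN i (hs (some (some i)))⟩
  exact hC.closure_subset_iff.2 Set.inter_subset_right hxcl

end GenericPoint

theorem LaurentPolynomial.eq_zero_of_infinite {q : ℂ[T;T⁻¹]}
    (h : {c : ℂˣ | LaurentPolynomial.eval₂ (RingHom.id ℂ) c q = 0}.Infinite) : q = 0 := by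
  obtain ⟨n, f, hf⟩ := q.exists_T_pow
  have h1 : f = 0 := by
    refine Polynomial.eq_zero_of_infinite_isRoot f
      ((h.image (Units.val_injective.injOn)).mono ?_)
    rintro _ ⟨c, hc, rfl⟩
    have h2 := congrArg (LaurentPolynomial.eval₂ (RingHom.id ℂ) c) hf
    rw [map_mul, show LaurentPolynomial.eval₂ (RingHom.id ℂ) c q = 0 from hc, zero_mul,
      LaurentPolynomial.eval₂_toLaurent] at h2
    exact h2
  rw [h1, map_zero] at hf
  calc q = q * LaurentPolynomial.T n * LaurentPolynomial.T (-(n : ℤ)) := by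
        rw [mul_assoc, ← LaurentPolynomial.T_add, add_neg_cancel, LaurentPolynomial.T_zero, mul_one]
    _ = 0 := by rw [← hf, zero_mul]

section Stabilizer

theorem evalAt_congr {X : Scheme.{0}} {p : X ⟶ Spec (CommRingCat.of ℂ)}
    [LocallyOfFiniteType p] {U : X.Opens} {x x' : X} (h : x = x') (hx : IsClosed {x})
    (hx' : IsClosed {x'}) (hxU : x ∈ U) (hxU' : x' ∈ U) (f : Fun p U) :
    evalAt p hx U hxU f = evalAt p hx' U hxU' f := by
  subst h; rfl

variable {X : Scheme.{0}} {p : X ⟶ Spec (CommRingCat.of ℂ)} [LocallyOfFiniteType p]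
  (G : GmAction p)

namespace GmAction

theorem stab_eq_univ_of_infinite {x : X} (hx : IsClosed {x}) (h : (G.stab x).Infinite) :
    G.stab x = Set.univ := by
  obtain ⟨j, hj⟩ := G.exists_orbit_morphism (S := ℂ) (pointOfClosedPoint p x hx)
    ((pointOfClosedPoint_comp p x hx).trans (Spec.map_id _).symm)
  let s₀ : Spec (CommRingCat.of ℂ) := (⟨⊥, Ideal.isPrime_bot⟩ : PrimeSpectrum ℂ)
  let s : ℂˣ → Spec (CommRingCat.of ℂ[T;T⁻¹]) := fun c =>
    Spec.map (CommRingCat.ofHom (LaurentPolynomial.eval₂ (RingHom.id ℂ)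
        (Units.map (algebraMap ℂ ℂ).toMonoidHom c))) s₀
  have hs : ∀ c, j (s c) = G.smul c x := fun c => by
    have h1 : j (s c) = (pointOfClosedPoint p x hx ≫ (G.act c).hom) s₀ :=
      congrArg (fun f => f s₀) (hj c)
    rw [h1]
    exact congrArg (G.act c).hom (pointOfClosedPoint_apply p x hx s₀)
  have hcl : IsClosed (j ⁻¹' {x}) := hx.preimage j.continuous
  obtain ⟨𝔟, h𝔟⟩ := (PrimeSpectrum.isClosed_iff_zeroLocus_ideal (R := ℂ[T;T⁻¹]) _).1 hcl
  have hmem : ∀ c, c ∈ G.stab x ↔ ∀ q ∈ 𝔟, LaurentPolynomial.eval₂ (RingHom.id ℂ) c q = 0 :=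
    fun c => by
      have h1 : s c ∈ j ⁻¹' {x} ↔ G.smul c x = x := by
        rw [Set.mem_preimage, hs]; rfl
      rw [h𝔟] at h1
      exact h1.symm
  have h𝔟0 : ∀ q ∈ 𝔟, q = 0 := fun q hq =>
    LaurentPolynomial.eq_zero_of_infinite (h.mono fun c hc => (hmem c).1 hc q hq)
  refine Set.eq_univ_of_forall fun c => (hmem c).2 fun q hq => ?_
  rw [h𝔟0 q hq, map_zero]

omit [LocallyOfFiniteType p] in
theorem pow_mem_stab {x : X} {c : ℂˣ} (hc : c ∈ G.stab x) (n : ℕ) : c ^ n ∈ G.stab x := by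
  change G.smul (c ^ n) x = x
  induction n with
  | zero => rw [pow_zero, G.smul_one]
  | succ n ih => rw [pow_succ, G.smul_mul, show G.smul c x = x from hc, ih]

theorem res_pull_sub_mem_iff {U : X.Opens} (c : ℂˣ) (a : Fun p U) {x : X} (hx : IsClosed {x})
    (hxV : x ∈ U ⊓ (G.act c).hom ⁻¹ᵁ U) :
    Fun.res p (inf_le_right : U ⊓ (G.act c).hom ⁻¹ᵁ U ≤ _) (G.pull c U a) -
      Fun.res p (inf_le_left : U ⊓ (G.act c).hom ⁻¹ᵁ U ≤ _) a ∈ pointIdeal p _ x hxV ↔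
    evalAt p (G.isClosed_smul c hx) U hxV.2 a = evalAt p hx U hxV.1 a := by
  rw [← evalAt_eq_zero_iff hx, map_sub, evalAt_res, evalAt_res, sub_eq_zero]
  exact (congrArg (· = _) (G.evalAt_pull c hx hxV.2 a)).to_iff

theorem exists_isOpen_of_mem_stab [IsSeparated p] {Y : Set X} (hY : IsLocallyClosed Y)
    {U : X.Opens} (hU : IsAffineOpen U) {z : X} (hzY : z ∈ Y) (hz : IsClosed {z})
    (hzU : ∀ c, G.smul c z ∈ U)
    (hmin : ∀ x ∈ Y, IsClosed {x} → G.stab x ⊆ G.stab z → G.stab x = G.stab z)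
    {ℓ : ℕ} (hℓ : 0 < ℓ) (hstab : ∀ c ∈ G.stab z, c ^ ℓ = 1) {ζ : ℂˣ} (hζ : ζ ∈ G.stab z)
    (a : Fun p U) :
    ∃ W : X.Opens, z ∈ W ∧ ∀ x ∈ Y, IsClosed {x} → x ∈ W →
      ∀ hxV : x ∈ U ⊓ (G.act ζ).hom ⁻¹ᵁ U,
      Fun.res p (inf_le_right : U ⊓ (G.act ζ).hom ⁻¹ᵁ U ≤ _) (G.pull ζ U a) -
        Fun.res p (inf_le_left : U ⊓ (G.act ζ).hom ⁻¹ᵁ U ≤ _) a ∈ pointIdeal p _ x hxV := by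
  by_contra! hcon
  have hzU1 : z ∈ U := by have := hzU 1; rwa [G.smul_one] at this
  have hzV : ∀ c, z ∈ U ⊓ (G.act c).hom ⁻¹ᵁ U := fun c => ⟨hzU1, hzU c⟩
  obtain ⟨g, h, N, hzg, hgV, hgh⟩ := exists_mul_pow_eq_res hU
    (IsAffineOpen.inf_of_isSeparated (p := p) hU (G.isAffineOpen_preimage ζ hU)) inf_le_left
    (hzV ζ) (Fun.res p (inf_le_right : U ⊓ (G.act ζ).hom ⁻¹ᵁ U ≤ _) (G.pull ζ U a) -
        Fun.res p (inf_le_left : U ⊓ (G.act ζ).hom ⁻¹ᵁ U ≤ _) a)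
  let ι := {c : ℂˣ // c ∉ G.stab z ∧ IsOfFinOrder c}
  have hsep : ∀ c : ι, ∃ f : Fun p U, evalAt p (G.isClosed_smul c hz) U (hzU c) f ≠
      evalAt p hz U hzU1 f := fun c => by
    by_contra! hc
    exact c.2.1 (eq_of_evalAt_eq _ _ hU _ _ hc)
  choose f hf using hsep
  have hcount : Countable ι := by
    have h1 : {c : ℂˣ | IsOfFinOrder c} ⊆ ⋃ n : ℕ, {c : ℂˣ | c ^ (n + 1) = 1} := fun c hc => by
      obtain ⟨n, hn, hc⟩ := isOfFinOrder_iff_pow_eq_one.1 hc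
      exact Set.mem_iUnion.2 ⟨n - 1, by
        change c ^ (n - 1 + 1) = 1
        rwa [Nat.sub_add_cancel hn]⟩
    have h2 : {c : ℂˣ | IsOfFinOrder c}.Countable := by
      refine Set.Countable.mono h1 (Set.countable_iUnion fun n => Set.Finite.countable ?_)
      have : Finite (rootsOfUnity (n + 1) ℂ) := inferInstance
      exact Set.toFinite (rootsOfUnity (n + 1) ℂ : Set ℂˣ)
    exact (h2.mono fun c hc => hc.2 : {c : ℂˣ | c ∉ G.stab z ∧ IsOfFinOrder c}.Countable).to_subtype
  obtain ⟨x, hxY, hx, hxh, hxN⟩ := exists_closedPoint_of_countable hU hY hzY hzU1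
    (fun i : Option ι => i.elim g.basicOpen fun c =>
      (Fun.res p (inf_le_right : U ⊓ (G.act (c : ℂˣ)).hom ⁻¹ᵁ U ≤ _) (G.pull c U (f c)) -
        Fun.res p (inf_le_left : U ⊓ (G.act (c : ℂˣ)).hom ⁻¹ᵁ U ≤ _) (f c)).basicOpen)
    (fun i => by
      cases i with
      | none => exact hzg
      | some c =>
        change z ∈ Fun.basicOpen p _
        by_contra hc
        rw [← mem_pointIdeal_iff p (hzV c), G.res_pull_sub_mem_iff c _ hz] at hc
        exact hf c hc) h (fun W hzW => by
      obtain ⟨x, hxY, hx, hxW, hxV, hxF⟩ := hcon (W ⊓ g.basicOpen) ⟨hzW, hzg⟩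
      refine ⟨x, hxY, hxW.1, ?_⟩
      by_contra hc
      rw [← mem_pointIdeal_iff p hxV.1, ← res_mem_pointIdeal_iff p inf_le_left hxV, ← hgh] at hc
      rcases (pointIdeal_isPrime p hxV).mem_or_mem hc with h1 | h1
      · have h2 := (pointIdeal_isPrime p hxV).mem_of_pow_mem N h1
        rw [res_mem_pointIdeal_iff, mem_pointIdeal_iff] at h2
        exact h2 hxW.2
      · exact hxF h1)
  have hxg : x ∈ g.basicOpen := hxN none
  have htors : ∀ c, IsOfFinOrder c → c ∈ G.stab x → c ∈ G.stab z := by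
    intro c hc hcx
    by_contra hcz
    have h1 : x ∈ Fun.basicOpen p _ := hxN (some ⟨c, hcz, hc⟩)
    have hxV : x ∈ U ⊓ (G.act c).hom ⁻¹ᵁ U := Fun.basicOpen_le p _ h1
    exact (mem_pointIdeal_iff p hxV _).1 ((G.res_pull_sub_mem_iff c _ hx hxV).2
      (evalAt_congr hcx _ _ _ _ _)) h1
  have hsub : G.stab x ⊆ G.stab z := by
    intro c hc
    by_cases hfin : IsOfFinOrder c
    · exact htors c hfin hc
    · have h1 := G.stab_eq_univ_of_infinite hx
        (Set.infinite_of_injective_forall_mem (injective_pow_iff_not_isOfFinOrder.2 hfin)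
          (G.pow_mem_stab hc))
      have h2 := Complex.isPrimitiveRoot_exp (2 * ℓ) (by omega)
      have h3 := h2.isUnit_unit (by omega)
      have h4 := htors _ (isOfFinOrder_iff_pow_eq_one.2 ⟨2 * ℓ, by omega, h3.pow_eq_one⟩)
        (h1 ▸ Set.mem_univ _)
      have h5 := h3.dvd_of_pow_eq_one ℓ (hstab _ h4)
      exact absurd (Nat.le_of_dvd hℓ h5) (by omega)
  have hζx : G.smul ζ x = x := by
    have := hmin x hxY hx hsub
    exact (this ▸ hζ : ζ ∈ G.stab x)
  have hxV := hgV hxg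
  have h1 := (G.res_pull_sub_mem_iff ζ a hx hxV).2 (evalAt_congr hζx _ _ _ _ _)
  have h2 := Ideal.mul_mem_left _ (Fun.res p inf_le_left g ^ N) h1
  rw [hgh, res_mem_pointIdeal_iff, mem_pointIdeal_iff] at h2
  exact h2 hxh

end GmAction

theorem IsClosedIn.germ_mem_map_of_forall {U : X.Opens} (hU : IsAffineOpen U)
    {Z Y : Set X} (hZ : IsClosedIn U Z) (hY : IsLocallyClosed Y) (n : ℕ)
    {V : X.Opens} (hV : IsAffineOpen V) (hVU : V ≤ U) (hZV : Z ⊆ V) (F : Fun p V)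
    (hF : ∀ z ∈ Z, IsClosed {z} → ∃ W : X.Opens, z ∈ W ∧ ∀ x ∈ Y, IsClosed {x} → x ∈ W →
      ∀ hxV : x ∈ V, F ∈ pointIdeal p V x hxV) :
    hZ.germ hU n hZV F ∈ (vanishingIdeal p U Y).map
      (Ideal.Quotient.mk (vanishingIdeal p U Z ^ n)) := by
  let C : Ideal (Fun p U) :=
    ((vanishingIdeal p V Y).colon {F}).comap (Fun.res p hVU)
  have hC : ∀ s, s ∈ C ↔ Fun.res p hVU s * F ∈ vanishingIdeal p V Y := fun s => by
    rw [Ideal.mem_comap, Submodule.mem_colon_singleton, smul_eq_mul]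
  have h1 : C ⊔ vanishingIdeal p U Z = ⊤ := by
    by_contra hc
    obtain ⟨𝔪, h𝔪, hle⟩ := Ideal.exists_le_maximal _ hc
    obtain ⟨z, hz, rfl⟩ := hZ.exists_pointIdeal_eq hU 𝔪 h𝔪 (le_sup_right.trans hle)
    obtain ⟨W, hzW, hW⟩ := hF z hz (hZ.isClosed_singleton z hz)
    obtain ⟨g, hg, hzg⟩ := Fun.exists_basicOpen_le (p := p) hU (V := W) (hZ.subset hz) hzW
    refine (mem_pointIdeal_iff p (hZ.subset hz) g).1 (hle (Ideal.mem_sup_left ((hC g).2 ?_))) hzg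
    refine mem_vanishingIdeal_of_isClosed hY _ fun x hxY hx hxV => ?_
    by_cases hxg : x ∈ g.basicOpen
    · exact Ideal.mul_mem_left _ _ (hW x hxY hx (hg hxg) hxV)
    · exact Ideal.mul_mem_right _ _ ((res_mem_pointIdeal_iff p hVU hxV g).2
        ((mem_pointIdeal_iff p _ g).2 hxg))
  have h2 := Ideal.sup_pow_eq_top' (n := n) h1
  obtain ⟨s, hs, i, hi, hsi⟩ := Submodule.mem_sup.1 (h2 ▸ Submodule.mem_top : (1 : Fun p U) ∈ _)
  have h3 := hZ.germ_mem_map hU n hV hVU hZV ((hC s).1 hs)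
  rw [map_mul, germ_res, germ_self] at h3
  have h4 : Ideal.Quotient.mk (vanishingIdeal p U Z ^ n) s = 1 := by
    rw [← map_one (Ideal.Quotient.mk (vanishingIdeal p U Z ^ n)), ← hsi, map_add,
      Ideal.Quotient.eq_zero_iff_mem.2 hi, add_zero]
  rwa [h4, one_mul] at h3

namespace GmAction

omit [LocallyOfFiniteType p] in
theorem mem_stab_of_mem_orbit {y z : X} (hz : z ∈ G.orbit y) {c : ℂˣ} :
    c ∈ G.stab z ↔ c ∈ G.stab y := by
  obtain ⟨a, rfl⟩ := hz
  change G.smul c (G.smul a y) = G.smul a y ↔ G.smul c y = y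
  rw [← G.smul_mul, mul_comm, G.smul_mul]
  refine ⟨fun h => ?_, fun h => by rw [h]⟩
  have h1 := congrArg (G.smul a⁻¹) h
  rwa [← G.smul_mul, ← G.smul_mul, ← G.smul_mul, inv_mul_cancel, one_mul, G.smul_one] at h1

/-- The stabilizer of a point as a subgroup. -/
noncomputable def stabilizer (x : X) : Subgroup ℂˣ where
  carrier := G.stab x
  one_mem' := G.smul_one x
  mul_mem' {a b} ha hb := by
    change G.smul (a * b) x = x
    rw [G.smul_mul, show G.smul b x = x from hb, show G.smul a x = x from ha]
  inv_mem' {a} ha := by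
    change G.smul a⁻¹ x = x
    conv_lhs => rw [← show G.smul a x = x from ha]
    rw [← G.smul_mul, inv_mul_cancel, G.smul_one]

theorem dvd_of_wt [IsSeparated p] {Y : Set X} (hY : IsLocallyClosed Y)
    (hGY : ∀ (c : ℂˣ), ∀ x ∈ Y, G.smul c x ∈ Y) {y : X} (hyY : y ∈ Y)
    {ℓ : ℕ} (hℓ : 0 < ℓ) (hstab : Nat.card (G.stab y) = ℓ)
    (hmin : ∀ x ∈ Y, IsClosed {x} → G.stab x ⊆ G.stab y → G.stab x = G.stab y)
    {U : X.Opens} (hU : IsAffineOpen U) [IsNoetherianRing (Fun p U)]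
    (hZ : IsClosedIn U (G.orbit y)) (e : ℤ) (f : FormalNhd p U (G.orbit y))
    (hf : (hZ.formalAction G hU (fun c _ hx => G.smul_mem_orbit c hx)).wt e f)
    (hfJ : f ∉ FormalNhd.subIdeal p U (G.orbit y) Y) : (ℓ : ℤ) ∣ e := by
  have hGZ : ∀ (c : ℂˣ), ∀ x ∈ G.orbit y, G.smul c x ∈ G.orbit y :=
    fun c _ hx => G.smul_mem_orbit c hx
  rw [FormalNhd.subIdeal, AdicCompletion.mem_map_iff] at hfJ
  push Not at hfJ
  obtain ⟨n, hn⟩ := hfJ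
  obtain ⟨a, ha⟩ := Ideal.Quotient.mk_surjective
    (AdicCompletion.evalₐ (vanishingIdeal p U (G.orbit y)) n f)
  rw [← ha] at hn
  have hcard : Nat.card (G.stabilizer y) = ℓ := hstab
  have : Finite (G.stabilizer y) := Nat.finite_of_card_ne_zero (hcard ▸ hℓ.ne')
  obtain ⟨ζ, hζ⟩ := IsCyclic.exists_generator (α := G.stabilizer y)
  have hord : orderOf (ζ : ℂˣ) = ℓ := by
    rw [Subgroup.orderOf_coe, orderOf_eq_card_of_forall_mem_zpowers hζ, hcard]
  have hpow : ∀ c ∈ G.stab y, c ^ ℓ = 1 := fun c hc => by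
    have h1 := pow_card_eq_one' (x := (⟨c, hc⟩ : G.stabilizer y))
    rw [hcard] at h1
    exact congrArg Subtype.val h1
  have hZV : G.orbit y ⊆ (U ⊓ (G.act ζ).hom ⁻¹ᵁ U : X.Opens) :=
    fun x hx => ⟨hZ.subset hx, hZ.subset_preimage G hGZ ζ hx⟩
  have hst : ∀ z ∈ G.orbit y, G.stab z = G.stab y := fun z hz =>
    Set.ext fun c => G.mem_stab_of_mem_orbit hz
  have hZY : G.orbit y ⊆ Y := by
    rintro _ ⟨c, rfl⟩; exact hGY c y hyY
  have h1 := hZ.germ_mem_map_of_forall hU hY n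
    (IsAffineOpen.inf_of_isSeparated (p := p) hU (G.isAffineOpen_preimage ζ hU)) inf_le_left hZV
    (Fun.res p (inf_le_right : U ⊓ (G.act ζ).hom ⁻¹ᵁ U ≤ _) (G.pull ζ U a) -
      Fun.res p (inf_le_left : U ⊓ (G.act ζ).hom ⁻¹ᵁ U ≤ _) a) fun z hz hzc =>
    G.exists_isOpen_of_mem_stab hY hU (hZY hz) hzc (fun c => hZ.subset (hGZ c z hz))
      (by rw [hst z hz]; exact hmin) hℓ (by rw [hst z hz]; exact hpow)
      (by rw [hst z hz]; exact ζ.2) a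
  rw [map_sub, IsClosedIn.germ_res, IsClosedIn.germ_res, IsClosedIn.germ_self] at h1
  have h2 : hZ.germ hU n (hZ.subset_preimage G hGZ ζ) (G.pull ζ U a) =
      (((ζ : ℂˣ) ^ e : ℂˣ) : ℂ) • Ideal.Quotient.mk _ a := hf ζ n a ha.symm
  by_contra hdvd
  have h3 : (((ζ : ℂˣ) ^ e : ℂˣ) : ℂ) - 1 ≠ 0 := fun h0 => hdvd (by
    rw [← hord, orderOf_dvd_iff_zpow_eq_one]
    exact Units.ext (sub_eq_zero.1 h0))
  refine hn ?_
  have h4 : (((ζ : ℂˣ) ^ e : ℂˣ) : ℂ) • Ideal.Quotient.mk (vanishingIdeal p U (G.orbit y) ^ n) a -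
      Ideal.Quotient.mk _ a ∈ (vanishingIdeal p U Y).map
      (Ideal.Quotient.mk (vanishingIdeal p U (G.orbit y) ^ n)) := by
    rw [← h2]; exact h1
  have h5 := Submodule.smul_of_tower_mem _ ((((ζ : ℂˣ) ^ e : ℂˣ) : ℂ) - 1)⁻¹ h4
  have h6 : (((ζ : ℂˣ) ^ e : ℂˣ) : ℂ) • Ideal.Quotient.mk (vanishingIdeal p U (G.orbit y) ^ n) a -
      Ideal.Quotient.mk _ a = ((((ζ : ℂˣ) ^ e : ℂˣ) : ℂ) - 1) •
        Ideal.Quotient.mk (vanishingIdeal p U (G.orbit y) ^ n) a := by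
    rw [sub_smul, one_smul]
  rwa [h6, smul_smul, inv_mul_cancel₀ h3, one_smul] at h5

end GmAction

end Stabilizer

theorem PoissonBracket.completion_bracket_mem {R : Type} [CommRing R] [Algebra ℂ R]
    [IsNoetherianRing R] {I J : Ideal R} (b : PoissonBracket R)
    (hJ : ∀ f, ∀ h ∈ J, b.bracket f h ∈ J) (f : AdicCompletion I R) {h : AdicCompletion I R}
    (hh : h ∈ J.map (algebraMap R (AdicCompletion I R))) :
    (b.completion I).bracket f h ∈ J.map (algebraMap R (AdicCompletion I R)) := by
  rw [AdicCompletion.mem_map_iff] at hh ⊢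
  intro n
  obtain ⟨j, hj, hjh⟩ :=
    (Ideal.mem_map_iff_of_surjective _ Ideal.Quotient.mk_surjective).1 (hh (n + 1))
  have h1 : AdicCompletion.evalₐ I n ((b.completion I).bracket f h) = _ :=
    b.evalₐ_completionFun n (mk_rep (n + 1) f) hjh
  rw [h1]
  exact Ideal.mem_map_of_mem _ (hJ _ j hj)

section CompletedQuotient

variable {R : Type} [CommRing R] {I J : Ideal R} [IsNoetherianRing R]

theorem exists_mem_of_mk_algebraMap_mem {n : ℕ} {f : R}
    (h : (Ideal.Quotient.mk (J.map (algebraMap R (AdicCompletion I R))))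
      (algebraMap R (AdicCompletion I R) f) ∈
        ((I.map (algebraMap R (AdicCompletion I R))).map (Ideal.Quotient.mk _)) ^ n) :
    ∃ j ∈ J, f - j ∈ I ^ n := by
  obtain ⟨g, hg, hfg⟩ := (mem_map_quotient_pow_iff _ _ _ _).1 h
  rw [AdicCompletion.mem_map_pow_iff (IsNoetherian.noetherian I), map_sub, sub_eq_zero,
    AdicCompletion.algebraMap_eq_of, AdicCompletion.evalₐ_of] at hfg
  obtain ⟨j, hj, hjg⟩ := (Ideal.mem_map_iff_of_surjective _ Ideal.Quotient.mk_surjective).1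
    ((AdicCompletion.mem_map_iff J g).1 hg n)
  exact ⟨j, hj, Ideal.Quotient.eq.1 (hfg.trans hjg.symm)⟩

theorem exists_sub_mk_algebraMap_mem (n : ℕ)
    (a : AdicCompletion I R ⧸ J.map (algebraMap R (AdicCompletion I R))) :
    ∃ f : R, a - Ideal.Quotient.mk _ (algebraMap R (AdicCompletion I R) f) ∈
      ((I.map (algebraMap R (AdicCompletion I R))).map (Ideal.Quotient.mk _)) ^ n := by
  obtain ⟨a, rfl⟩ := Ideal.Quotient.mk_surjective a
  obtain ⟨f, hf⟩ := AdicCompletion.exists_sub_algebraMap_mem (IsNoetherian.noetherian I) n a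
  refine ⟨f, ?_⟩
  rw [← map_sub, ← Ideal.map_pow]
  exact Ideal.mem_map_of_mem _ hf

end CompletedQuotient

theorem theorem3p3 {X : Scheme.{0}} (p : X ⟶ Spec (CommRingCat.of ℂ))
    [IsReduced X] [LocallyOfFiniteType p] [QuasiCompact p] [IsSeparated p]
    (P : PoissonScheme p) (G : GmAction p) (d : ℤ) (hd : P.IsHomogeneous G d)
    (Y : Set X) (hY : P.IsSymplecticLeaf Y) (hGY : ∀ (c : ℂˣ), ∀ x ∈ Y, G.smul c x ∈ Y)
    (y : X) (hyY : y ∈ Y) (hy : IsClosed {y})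
    (ℓ : ℕ) (hℓ : 0 < ℓ) (hstab : Nat.card (G.stab y) = ℓ)
    (hmin : ∀ x ∈ Y, IsClosed {x} → G.stab x ⊆ G.stab y → G.stab x = G.stab y)
    (U : X.Opens) (hU : IsAffineOpen U) (horb : G.orbit y ⊆ U)
    (hclosed : ∀ x ∈ U, IsClosed {x} → x ∈ closure (G.orbit y) → x ∈ G.orbit y) :
    ∃ (k : ℤ) (m : ℕ) (bY : PoissonBracket (SubFormalNhd p U (G.orbit y) Y)),
      d = -(k * ℓ) ∧
      ((pointIdeal p U y (horb (G.mem_orbit y))).map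
        (Ideal.Quotient.mk (vanishingIdeal p U Y))).height = 2 * m + 2 ∧
      (∀ f g, bY.bracket (Ideal.Quotient.mk _ f) (Ideal.Quotient.mk _ g) =
        Ideal.Quotient.mk _ (((P.br U).completion _).bracket f g)) ∧
      (∃ Φ : FormalChart (SubFormalNhd.ideal p U (G.orbit y) Y)
          (IsSubWeight G U (G.orbit y) Y) ℓ m,
        IsStandard bY k Φ.t Φ.u Φ.zo Φ.ze ∧
        ∃ a : Fun p U, a - 1 ∈ pointIdeal p U y (horb (G.mem_orbit y)) ∧
          Ideal.Quotient.mk _ (algebraMap _ _ a) - (Φ.t : SubFormalNhd p U (G.orbit y) Y) ∈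
            SubFormalNhd.ideal p U (G.orbit y) Y) ∧
      ∀ Φ : FormalChart (SubFormalNhd.ideal p U (G.orbit y) Y)
          (IsSubWeight G U (G.orbit y) Y) ℓ m,
        IsStandard bY k Φ.t Φ.u Φ.zo Φ.ze →
        ∃ σ : SubFormalNhd p U (G.orbit y) Y →ₐ[ℂ] FormalNhd p U (G.orbit y),
          (∀ a, Ideal.Quotient.mk _ (σ a) = a) ∧
          (∀ e a, IsSubWeight G U (G.orbit y) Y e a → IsWeight G U (G.orbit y) e (σ a)) ∧
          (∀ a a', ((P.br U).completion _).bracket (σ a) (σ a') = σ (bY.bracket a a')) ∧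
          (ℓ = 1 → ∃ R : Subalgebra ℂ (FormalNhd p U (G.orbit y)),
            IsEquivariantSlice ((P.br U).completion _) (IsWeight G U (G.orbit y))
              (FormalNhd.ideal p U (G.orbit y)) (SubFormalNhd.ideal p U (G.orbit y) Y) σ k
              (Units.map σ.toRingHom.toMonoidHom Φ.t) (σ Φ.u) (fun i => σ (Φ.zo i)) (fun i => σ (Φ.ze i)) R) ∧
          (∃ (bK : PoissonBracket (RootCover (σ Φ.t) ℓ)) (R : Subalgebra ℂ (RootCover (σ Φ.t) ℓ)),
            IsCoverSlice ((P.br U).completion _) (IsWeight G U (G.orbit y))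
              (FormalNhd.ideal p U (G.orbit y)) (SubFormalNhd.ideal p U (G.orbit y) Y) σ k ℓ
              Φ.t Φ.u Φ.zo Φ.ze bK R) ∧
          ∃ Q : Subalgebra ℂ (FormalNhd p U (G.orbit y)),
            IsFiberedSlice ((P.br U).completion _) (IsWeight G U (G.orbit y))
              (FormalNhd.ideal p U (G.orbit y)) (SubFormalNhd.ideal p U (G.orbit y) Y)
              Φ.base σ k (Units.map σ.toRingHom.toMonoidHom Φ.t) (σ Φ.u) (fun i => σ (Φ.zo i))
              (fun i => σ (Φ.ze i)) Q := by
  set Z := G.orbit y with hZdef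
  have hZ : IsClosedIn U Z := G.isClosedIn_orbit hy horb hclosed
  have hyU : y ∈ U := horb (G.mem_orbit y)
  have hGZ : ∀ (c : ℂˣ), ∀ x ∈ Z, G.smul c x ∈ Z := fun c _ hx => G.smul_mem_orbit c hx
  have hZY : Z ⊆ Y := by rintro _ ⟨c, rfl⟩; exact hGY c y hyY
  have : Algebra.FiniteType ℂ (Fun p U) := finiteType_fun p hU
  have : IsNoetherianRing (Fun p U) := Algebra.FiniteType.isNoetherianRing ℂ _
  set I := vanishingIdeal p U Z
  set J := vanishingIdeal p U Y
  have hI : I.FG := IsNoetherian.noetherian I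
  have hJI : J ≤ I := fun f hf => (mem_vanishingIdeal_iff p f).2 fun x hx hxU =>
    (mem_vanishingIdeal_iff p f).1 hf x (hZY hx) hxU
  let F := hZ.formalAction G hU hGZ
  have hwt : ∀ e f, F.wt e f ↔ IsWeight G U Z e f := hZ.formalAction_wt_iff G hU hGZ
  have hwt' : F.wt = IsWeight G U Z := funext fun e => funext fun f => propext (hwt e f)
  have : IsNoetherianRing (FormalNhd p U Z) := AdicCompletion.isNoetherianRing_of_isNoetherianRing
  have : IsAdicComplete (FormalNhd.ideal p U Z) (FormalNhd p U Z) :=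
    AdicCompletion.isAdicComplete_map hI
  have hP : IsPoissonIdeal ((P.br U).completion I) (FormalNhd.ideal p U Z)
      (FormalNhd.subIdeal p U Z Y) :=
    ⟨isAdicClosed_ideal _ _, fun f h hh =>
      (P.br U).completion_bracket_mem (fun f h hh => hY.bracket_mem hU f hh) f hh⟩
  have hP𝔨 : FormalNhd.subIdeal p U Z Y ≤ FormalNhd.ideal p U Z := Ideal.map_mono hJI
  have hb := F.wt_bracket (b := P.br U) (d := d) fun n c i j a a' =>
    hZ.translate_bracket G hU hGZ hd n c i j a a'
  let g : TopGrading (FormalNhd.ideal p U Z) F.wt := F.topGrading hI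
  have hsub : (fun e a => ∃ f, F.wt e f ∧ Ideal.Quotient.mk (FormalNhd.subIdeal p U Z Y) f = a) =
      IsSubWeight G U Z Y := by rw [hwt']; rfl
  obtain ⟨gA⟩ : Nonempty (TopGrading (SubFormalNhd.ideal p U Z Y) (IsSubWeight G U Z Y)) := by
    rw [← hsub]
    exact g.exists_quotient _ fun e f hf =>
      F.pr_mem_map (fun n c a ha => hZ.translate_mem_map G hU hGZ hGY n c ha) e hf
  have : IsAdicComplete (SubFormalNhd.ideal p U Z Y) (SubFormalNhd p U Z Y) :=
    isAdicComplete_quotient _ _ hP.closed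
  obtain ⟨bY, hbY⟩ := ((P.br U).completion I).exists_quotient (FormalNhd.subIdeal p U Z Y)
    hP.bracket_mem
  have hbA : ∀ i j f h, IsSubWeight G U Z Y i f → IsSubWeight G U Z Y j h →
      IsSubWeight G U Z Y (i + j + d) (bY.bracket f h) := by
    rintro i j _ _ ⟨f, hf, rfl⟩ ⟨h, hh, rfl⟩
    exact ⟨_, (hwt _ _).1 (hb i j f h ((hwt _ _).2 hf) ((hwt _ _).2 hh)), (hbY f h).symm⟩
  obtain ⟨O, hev⟩ : ∃ O : OrbitRing (SubFormalNhd.ideal p U Z Y) (IsSubWeight G U Z Y) ℓ,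
      ∀ f : Fun p U, O.ev (Ideal.Quotient.mk _ (algebraMap _ (FormalNhd p U Z) f)) =
        evalAt p hy U hyU f := by
    rw [← hsub]
    refine F.exists_orbitRing hI hJI (hZ.evalMk (G.mem_orbit y)) hℓ
      (fun f h => G.isUnit_mk_of_evalMk hU hZ f h) (fun f => G.evalMk_eq_zero_iff hU hZ f) ?_
      (fun e f hf hfJ => G.dvd_of_wt hY.1 hGY hyY hℓ hstab hmin hU hZ e f hf hfJ)
    rw [← hstab]
    exact congrArg (fun S : Set ℂˣ => Nat.card S)
      (Set.ext fun c => G.evalMk_translate_eq_iff hU hZ c)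
  set 𝔪 := pointIdeal p U y hyU
  have hev𝔪 : ∀ f : Fun p U, O.ev (Ideal.Quotient.mk _ (algebraMap _ (FormalNhd p U Z) f)) = 0 ↔
      f ∈ 𝔪 := fun f => by rw [hev]; exact evalAt_eq_zero_iff hy hyU f
  have hJ𝔪 : J ≤ 𝔪 := fun f hf => (mem_vanishingIdeal_iff p f).1 hf y hyY hyU
  have hI𝔪 : I ≤ 𝔪 := fun f hf => (mem_vanishingIdeal_iff p f).1 hf y (G.mem_orbit y) hyU
  have hnd : ∀ f, O.ev f = 0 → (∀ h, O.ev (bY.bracket f h) = 0) → f ∈ RingHom.ker O.ev ^ 2 := by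
    let ι : Fun p U →+* SubFormalNhd p U Z Y :=
      (Ideal.Quotient.mk _).comp (algebraMap _ (FormalNhd p U Z))
    have hι : ∀ f h, bY.bracket (ι f) (ι h) = ι ((P.br U).bracket f h) := fun f h =>
      (hbY _ _).trans (congrArg _ ((P.br U).completion_of I f h))
    refine O.mem_ker_sq_of_dense bY (P.br U) ι hι (exists_sub_mk_algebraMap_mem 2)
      fun f hf hbf => ?_
    have h1 := hY.mem_sup_of_forall_bracket_mem hU hyY hy hyU ((hev𝔪 f).1 hf)
      fun g => (hev𝔪 _).1 (hbf g)
    have h2 : J ⊔ 𝔪 ^ 2 ≤ (RingHom.ker O.ev ^ 2).comap ι := by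
      refine sup_le (fun j hj => ?_) ?_
      · have h3 : ι j = 0 := Ideal.Quotient.eq_zero_iff_mem.2 (Ideal.mem_map_of_mem _ hj)
        rw [Ideal.mem_comap, h3]
        exact Ideal.zero_mem _
      · rw [← Ideal.map_le_iff_le_comap, Ideal.map_pow]
        refine Ideal.pow_right_mono (Ideal.map_le_iff_le_comap.2 fun f hf => ?_) 2
        exact (hev𝔪 f).2 hf
    exact h2 h1
  obtain ⟨k, m, hdk, Φ, hΦ, hΦt⟩ := O.exists_standard_chart gA hbA hnd
  refine ⟨k, m, bY, hdk, ?_, hbY, ⟨Φ, hΦ, ?_⟩, fun Φ hΦ => ?_⟩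
  · obtain ⟨bB, hbB⟩ := (P.br U).exists_quotient J fun f h hh => hY.bracket_mem hU f hh
    have hprime : (𝔪.map (Ideal.Quotient.mk J)).IsPrime :=
      Ideal.map_isPrime_of_surjective Ideal.Quotient.mk_surjective (by rwa [Ideal.mk_ker])
    have hmem : ∀ f, Ideal.Quotient.mk J f ∈ 𝔪.map (Ideal.Quotient.mk J) ↔ f ∈ 𝔪 := fun f =>
      ⟨mem_of_mk_mem hJ𝔪, Ideal.mem_map_of_mem _⟩
    let ι : Fun p U ⧸ J →+* SubFormalNhd p U Z Y := Ideal.quotientMap (FormalNhd.subIdeal p U Z Y)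
      (algebraMap (Fun p U) (FormalNhd p U Z)) Ideal.le_comap_map
    have hιmk : ∀ f, ι (Ideal.Quotient.mk J f) =
      Ideal.Quotient.mk _ (algebraMap _ (FormalNhd p U Z) f) := fun f => Ideal.quotientMap_mk
    refine FormalChart.height_eq O Φ hΦ hΦt bB ι ?_ (fun c => ?_) ?_ _ ?_ ?_
    · intro f h
      obtain ⟨f, rfl⟩ := Ideal.Quotient.mk_surjective f
      obtain ⟨h, rfl⟩ := Ideal.Quotient.mk_surjective h
      rw [hbB, hιmk, hιmk, hιmk]
      exact (hbY _ _).trans (congrArg _ ((P.br U).completion_of I f h))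
    · exact hιmk _
    · intro a
      obtain ⟨f, hf⟩ := exists_sub_mk_algebraMap_mem 2 a
      exact ⟨Ideal.Quotient.mk J f, hf⟩
    · intro f
      obtain ⟨f, rfl⟩ := Ideal.Quotient.mk_surjective f
      rw [hmem, hιmk]
      exact (hev𝔪 f).symm
    · intro f hf
      obtain ⟨f, rfl⟩ := Ideal.Quotient.mk_surjective f
      rw [hιmk] at hf
      obtain ⟨j, hj, hfj⟩ := exists_mem_of_mk_algebraMap_mem hf
      rw [← Ideal.map_pow, Ideal.Quotient.eq.2 (by rwa [sub_sub_cancel] : f - (f - j) ∈ J)]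
      exact Ideal.mem_map_of_mem _ (Ideal.pow_right_mono hI𝔪 2 hfj)
  · obtain ⟨a, ha⟩ : ∃ a : Fun p U, (Φ.t : SubFormalNhd p U Z Y) -
        Ideal.Quotient.mk _ (algebraMap _ (FormalNhd p U Z) a) ∈ SubFormalNhd.ideal p U Z Y := by
      obtain ⟨a, ha⟩ := exists_sub_mk_algebraMap_mem (I := I) (J := J) 1
        (Φ.t : SubFormalNhd p U Z Y)
      exact ⟨a, Ideal.pow_le_self one_ne_zero ha⟩
    refine ⟨a, ?_, ?_⟩
    · rw [← hev𝔪, map_sub, map_sub, map_sub, map_one, map_one, map_one, sub_eq_zero]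
      have h1 := O.ev_of_mem ha
      rw [map_sub, hΦt, O.ev_t, sub_eq_zero] at h1
      exact h1.symm
    · rw [← neg_sub]
      exact neg_mem ha
  · have h𝔨 : FormalNhd.ideal p U Z ≠ ⊤ := fun h => O.ne_top (by
      rw [SubFormalNhd.ideal, h, Ideal.map_top])
    have g' : TopGrading (FormalNhd.ideal p U Z) (IsWeight G U Z) := hwt' ▸ g
    exact Φ.exists_slices g' hdk (fun i j f h hf hh =>
      (hwt _ _).1 (hb i j f h ((hwt _ _).2 hf) ((hwt _ _).2 hh))) hP hP𝔨
      (fun f h => hbY f h) (fun e a => Iff.rfl) hΦ h𝔨 hℓ
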